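/- Everything is over $\mathbb{Q}$. For a finite set $I$, the double even Orlik--Solomon algebra $OS_2^+(I)$ is the commutative associative unital algebra with generators $x_{ij}, y_{ij}$ ($i\ne j$ in $I$) and relations $x_{ij}+x_{ji}=y_{ij}+y_{ji}=0$, $x_{ij}^2=x_{ij}y_{ij}=y_{ij}^2=0$ and, for pairwise distinct $i,j,k$, $$x_{ij}x_{jk}+x_{jk}x_{ki}+x_{ki}x_{ij}=0,\qquad y_{ij}y_{jk}+y_{jk}y_{ki}+y_{ki}y_{ij}=0,$$ $$x_{ij}y_{jk}+x_{jk}y_{ki}+x_{ki}y_{ij}+y_{ij}x_{jk}+y_{jk}x_{ki}+y_{ki}x_{ij}=0.$$ A bi-Hamiltonian algebra is a vector space with a (not necessarily unital) commutative associative product $\star$ and two skew-symmetric brackets $\{\,,\}_1,\{\,,\}_2$, each satisfying the Jacobi identity, which are derivations of $\star$ in each argument and are compatible, i.e. $$\{a,\{b,c\}_1\}_2+\{b,\{c,a\}_1\}_2+\{c,\{a,b\}_1\}_2+\{a,\{b,c\}_2\}_1+\{b,\{c,a\}_2\}_1+\{c,\{a,b\}_2\}_1=0.$$ The component $\mathcal{P}_2(I)$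 of the bi-Hamiltonian operad is the space of multilinear elements (each generator occurs exactly once) of the free bi-Hamiltonian algebra on generators $a_i$, $i\in I$. The tensor product of two bi-Hamiltonian algebras is a bi-Hamiltonian algebra via $\Delta(\star)=\star\otimes\star$, $\Delta(\{\,,\}_s)=\{\,,\}_s\otimes\star+\star\otimes\{\,,\}_s$; the homomorphism from the free algebra to its tensor square with $a_i\mapsto a_i\otimes a_i$ restricts to a coassociative map $\Delta:\mathcal{P}_2(I)\to\mathcal{P}_2(I)\otimes\mathcal{P}_2(I)$, and $\mathcal{P}_2(I)^*$ is an algebra with product $fg=(f\otimes g)\circ\Delta$; its unit is the functional equal to $1$ on monomials without brackets and to $0$ on monomials containing a bracket. Let $A$ be a non-empty finite totally ordered set and $T$ a tree on the vertex set $A$ with edges labelled $x$ or $y$. Root $T$ at $r=\max A$ and orient its edges away from the root. Recursively, $T$ belongs to $\mathfrak{T}(A)$ if the following hold. - Each vertex has at most one outgoing $x$-edge and at most one outgoing $y$-edge (so from each vertex there starts exactly one maximal $x$-chain and exactly one maximal $y$-chain). - Let $j_0=r,j_1,\dots,j_k$ be the maximal $x$-chain starting at $r$, and for each $p$ let $i_{0,p}=j_p,i_{1,p},\dots,i_{k_p,p}$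 be the maximal $y$-chain starting at $j_p$. Delete all edges of these chains, and for $s\ge1$ let $T_{s,p}$, with vertex set $\pi_{s,p}$, be the connected component of $i_{s,p}$ in what remains. Then for all $p$ and all $1\le s\le k_p$ the maximal $x$-chain starting at $i_{s,p}$ ends at $\max\pi_{s,p}$, and $T_{s,p}\in\mathfrak{T}(\pi_{s,p})$. Let $\mathfrak{F}(n)$ be the set of forests on $[n]=\{1,\dots,n\}$ with edges labelled $x$ or $y$, each of whose connected components, with vertex set $\pi$, belongs to $\mathfrak{T}(\pi)$. For $F\in\mathfrak{F}(n)$ let $m_F\in OS_2^+(n)=OS_2^+([n])$ be the product of $x_{ij}$ over the $x$-edges and of $y_{ij}$ over the $y$-edges $\{i,j\}$ of $F$, $i<j$. **Theorem.** For every $n\ge1$: 1. the algebras $OS_2^+(n)$ and $\mathcal{P}_2(n)^*=\mathcal{P}_2([n])^*$ (with the product given by $\Delta$) are isomorphic; 2. $\dim OS_2^+(n)=(n+1)^{n-1}$; 3. the monomials $m_F$, indexed by $F\in\mathfrak{F}(n)$, form a basis of $OS_2^+(n)$. -/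

import Mathlib

open scoped TensorProduct

noncomputable section

/-! ### Bi-Hamiltonian algebras -/

/-- The three generating operations: the product and the two brackets `{ , }₁`, `{ , }₂`,
which are labelled by `0, 1 : Fin 2`. -/
inductive BiHamOp : Type
  | prod : BiHamOp
  | bracket : Fin 2 → BiHamOp

open BiHamOp

/-- A bi-Hamiltonian algebra over `ℚ`, that is, an algebra over the bi-Hamiltonian operad: a
(not necessarily unital) commutative associative product with two compatible Lie brackets, both of
which are derivations of the product. -/
class BiHamAlgebra (A : Type*) [AddCommGroup A] [Module ℚ A] where
  op : BiHamOp → A →ₗ[ℚ] A →ₗ[ℚ] A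
  prod_comm : ∀ a b : A, op prod a b = op prod b a
  prod_assoc : ∀ a b c : A, op prod (op prod a b) c = op prod a (op prod b c)
  skew : ∀ (i : Fin 2) (a b : A), op (bracket i) a b = -op (bracket i) b a
  jacobi : ∀ (i : Fin 2) (a b c : A),
    op (bracket i) a (op (bracket i) b c) + op (bracket i) b (op (bracket i) c a)
      + op (bracket i) c (op (bracket i) a b) = 0
  six_term : ∀ a b c : A,
    op (bracket 1) a (op (bracket 0) b c) + op (bracket 1) b (op (bracket 0) c a)
      + op (bracket 1) c (op (bracket 0) a b)
      + op (bracket 0) a (op (bracket 1) b c) + op (bracket 0) b (op (bracket 1) c a)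
      + op (bracket 0) c (op (bracket 1) a b) = 0
  leibniz : ∀ (i : Fin 2) (a b c : A),
    op (bracket i) a (op prod b c)
      = op prod (op (bracket i) a b) c + op prod b (op (bracket i) a c)

namespace BiHamAlgebra

/-- The ground field with its product and zero brackets. -/
instance instRat : BiHamAlgebra ℚ where
  op o := match o with
    | prod => LinearMap.mul ℚ ℚ
    | bracket _ => 0
  prod_comm a b := by simp [mul_comm]
  prod_assoc a b c := by simp [mul_assoc]
  skew := by simp
  jacobi := by simp
  six_term := by simp
  leibniz := by simp

section Tensor

variable {A B : Type*} [AddCommGroup A] [Module ℚ A] [AddCommGroup B] [Module ℚ B]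
  [BiHamAlgebra A] [BiHamAlgebra B]

/-- The operations on a tensor product of two bi-Hamiltonian algebras:
`(a ⊗ b) ⋆ (a' ⊗ b') = (a ⋆ a') ⊗ (b ⋆ b')` and
`{a ⊗ b, a' ⊗ b'} = {a, a'} ⊗ (b ⋆ b') + (a ⋆ a') ⊗ {b, b'}`. -/
def tensorOp (A B : Type*) [AddCommGroup A] [Module ℚ A] [AddCommGroup B] [Module ℚ B]
    [BiHamAlgebra A] [BiHamAlgebra B] : BiHamOp → (A ⊗[ℚ] B) →ₗ[ℚ] (A ⊗[ℚ] B) →ₗ[ℚ] (A ⊗[ℚ] B)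
  | prod => TensorProduct.map₂ (op prod) (op prod)
  | bracket i =>
      TensorProduct.map₂ (op (bracket i)) (op prod) + TensorProduct.map₂ (op prod) (op (bracket i))

theorem tensorOp_prod (a a' : A) (b b' : B) :
    tensorOp A B prod (a ⊗ₜ b) (a' ⊗ₜ b') = op prod a a' ⊗ₜ[ℚ] op prod b b' := rfl

theorem tensorOp_bracket (i : Fin 2) (a a' : A) (b b' : B) :
    tensorOp A B (bracket i) (a ⊗ₜ b) (a' ⊗ₜ b')
      = op (bracket i) a a' ⊗ₜ[ℚ] op prod b b' + op prod a a' ⊗ₜ[ℚ] op (bracket i) b b' := rfl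

theorem prod_left_comm (a b c : A) : op prod a (op prod b c) = op prod b (op prod a c) := by
  rw [← prod_assoc, prod_comm a b, prod_assoc]

/-- The cyclic sum of `{a, {b, c}ᵢ}ⱼ` on pure tensors. -/
theorem tensor_cyclic (i j : Fin 2) (a b c : A) (a' b' c' : B) :
    tensorOp A B (bracket j) (a ⊗ₜ a') (tensorOp A B (bracket i) (b ⊗ₜ b') (c ⊗ₜ c'))
      + tensorOp A B (bracket j) (b ⊗ₜ b') (tensorOp A B (bracket i) (c ⊗ₜ c') (a ⊗ₜ a'))
      + tensorOp A B (bracket j) (c ⊗ₜ c') (tensorOp A B (bracket i) (a ⊗ₜ a') (b ⊗ₜ b'))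
    = (op (bracket j) a (op (bracket i) b c) + op (bracket j) b (op (bracket i) c a)
        + op (bracket j) c (op (bracket i) a b)) ⊗ₜ[ℚ] op prod a' (op prod b' c')
      + op prod a (op prod b c) ⊗ₜ[ℚ] (op (bracket j) a' (op (bracket i) b' c')
        + op (bracket j) b' (op (bracket i) c' a') + op (bracket j) c' (op (bracket i) a' b'))
      + (op prod a (op (bracket i) b c) ⊗ₜ[ℚ] op prod c' (op (bracket j) a' b')
        - op prod a (op (bracket j) b c) ⊗ₜ[ℚ] op prod c' (op (bracket i) a' b')
        + op prod b (op (bracket i) c a) ⊗ₜ[ℚ] op prod a' (op (bracket j) b' c')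
        - op prod b (op (bracket j) c a) ⊗ₜ[ℚ] op prod a' (op (bracket i) b' c')
        + op prod c (op (bracket i) a b) ⊗ₜ[ℚ] op prod b' (op (bracket j) c' a')
        - op prod c (op (bracket j) a b) ⊗ₜ[ℚ] op prod b' (op (bracket i) c' a')
        - op prod a (op (bracket i) b c) ⊗ₜ[ℚ] op prod b' (op (bracket j) c' a')
        + op prod a (op (bracket j) b c) ⊗ₜ[ℚ] op prod b' (op (bracket i) c' a')
        - op prod b (op (bracket i) c a) ⊗ₜ[ℚ] op prod c' (op (bracket j) a' b')
        + op prod b (op (bracket j) c a) ⊗ₜ[ℚ] op prod c' (op (bracket i) a' b')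
        - op prod c (op (bracket i) a b) ⊗ₜ[ℚ] op prod a' (op (bracket j) b' c')
        + op prod c (op (bracket j) a b) ⊗ₜ[ℚ] op prod a' (op (bracket i) b' c')) := by
  have e1 : op prod b' (op prod c' a') = op prod a' (op prod b' c') := by
    rw [prod_comm c' a', prod_left_comm]
  have e2 : op prod c' (op prod a' b') = op prod a' (op prod b' c') := by
    rw [prod_left_comm, prod_comm c' b']
  have f1 : op prod b (op prod c a) = op prod a (op prod b c) := by
    rw [prod_comm c a, prod_left_comm]
  have f2 : op prod c (op prod a b) = op prod a (op prod b c) := by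
    rw [prod_left_comm, prod_comm c b]
  simp only [tensorOp_bracket, map_add, leibniz, e1, e2, f1, f2, TensorProduct.add_tmul,
    TensorProduct.tmul_add, prod_comm (op (bracket _) _ _)]
  simp only [skew _ a c, skew _ b a, skew _ c b, skew _ a' c', skew _ b' a', skew _ c' b', map_neg,
    TensorProduct.neg_tmul, TensorProduct.tmul_neg]
  abel

/-- The tensor product of two bi-Hamiltonian algebras is a bi-Hamiltonian algebra; this is the Hopf
structure `Δ(⋆) = ⋆ ⊗ ⋆`, `Δ({ , }ᵢ) = { , }ᵢ ⊗ ⋆ + ⋆ ⊗ { , }ᵢ` on the bi-Hamiltonian operad. -/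
instance instTensor : BiHamAlgebra (A ⊗[ℚ] B) where
  op := tensorOp A B
  prod_comm x y := by
    induction x with
    | zero => simp
    | add x₁ x₂ h₁ h₂ => simp [h₁, h₂]
    | tmul a a' =>
      induction y with
      | zero => simp
      | add y₁ y₂ h₁ h₂ => simp [h₁, h₂]
      | tmul b b' => rw [tensorOp_prod, tensorOp_prod, prod_comm a, prod_comm a']
  prod_assoc x y z := by
    induction x with
    | zero => simp
    | add x₁ x₂ h₁ h₂ => simp [h₁, h₂]
    | tmul a a' =>
      induction y with
      | zero => simp
      | add y₁ y₂ h₁ h₂ => simp [h₁, h₂]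
      | tmul b b' =>
        induction z with
        | zero => simp
        | add z₁ z₂ h₁ h₂ => simp [h₁, h₂]
        | tmul c c' => simp only [tensorOp_prod, prod_assoc]
  skew i x y := by
    induction x with
    | zero => simp
    | add x₁ x₂ h₁ h₂ => simp only [map_add, LinearMap.add_apply, h₁, h₂]; abel
    | tmul a a' =>
      induction y with
      | zero => simp
      | add y₁ y₂ h₁ h₂ => simp only [map_add, LinearMap.add_apply, h₁, h₂]; abel
      | tmul b b' =>
        rw [tensorOp_bracket, tensorOp_bracket, prod_comm a, prod_comm a', skew _ a, skew _ a',
          TensorProduct.neg_tmul, TensorProduct.tmul_neg]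
        abel
  jacobi i x y z := by
    induction x with
    | zero => simp
    | add x₁ x₂ h₁ h₂ =>
      simp only [map_add, LinearMap.add_apply]
      rw [← add_zero (0 : A ⊗[ℚ] B)]
      nth_rewrite 1 [← h₁]
      rw [← h₂]
      abel
    | tmul a a' =>
      induction y with
      | zero => simp
      | add y₁ y₂ h₁ h₂ =>
        simp only [map_add, LinearMap.add_apply]
        rw [← add_zero (0 : A ⊗[ℚ] B)]
        nth_rewrite 1 [← h₁]
        rw [← h₂]
        abel
      | tmul b b' =>
        induction z with
        | zero => simp
        | add z₁ z₂ h₁ h₂ =>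
          simp only [map_add, LinearMap.add_apply]
          rw [← add_zero (0 : A ⊗[ℚ] B)]
          nth_rewrite 1 [← h₁]
          rw [← h₂]
          abel
        | tmul c c' =>
          rw [tensor_cyclic, jacobi, jacobi, TensorProduct.zero_tmul, TensorProduct.tmul_zero]
          abel
  six_term x y z := by
    induction x with
    | zero => simp
    | add x₁ x₂ h₁ h₂ =>
      simp only [map_add, LinearMap.add_apply]
      rw [← add_zero (0 : A ⊗[ℚ] B)]
      nth_rewrite 1 [← h₁]
      rw [← h₂]
      abel
    | tmul a a' =>
      induction y with
      | zero => simp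
      | add y₁ y₂ h₁ h₂ =>
        simp only [map_add, LinearMap.add_apply]
        rw [← add_zero (0 : A ⊗[ℚ] B)]
        nth_rewrite 1 [← h₁]
        rw [← h₂]
        abel
      | tmul b b' =>
        induction z with
        | zero => simp
        | add z₁ z₂ h₁ h₂ =>
          simp only [map_add, LinearMap.add_apply]
          rw [← add_zero (0 : A ⊗[ℚ] B)]
          nth_rewrite 1 [← h₁]
          rw [← h₂]
          abel
        | tmul c c' =>
          have hA := six_term a b c
          have hB := six_term a' b' c'
          have h1 := tensor_cyclic 0 1 a b c a' b' c'
          have h2 := tensor_cyclic 1 0 a b c a' b' c'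
          have hA' := congrArg (fun u => u ⊗ₜ[ℚ] op prod a' (op prod b' c')) hA
          have hB' := congrArg (fun u => op prod a (op prod b c) ⊗ₜ[ℚ] u) hB
          simp only [TensorProduct.add_tmul, TensorProduct.tmul_add, TensorProduct.zero_tmul,
            TensorProduct.tmul_zero] at hA' hB' h1 h2
          rw [add_assoc, add_assoc, ← add_assoc (tensorOp A B (bracket 0) _ _), h1, h2,
            ← add_zero (0 : A ⊗[ℚ] B)]
          nth_rewrite 1 [← hA']
          rw [← hB']
          abel
  leibniz i x y z := by
    induction x with
    | zero => simp
    | add x₁ x₂ h₁ h₂ => simp only [map_add, LinearMap.add_apply, h₁, h₂]; abel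
    | tmul a a' =>
      induction y with
      | zero => simp
      | add y₁ y₂ h₁ h₂ => simp only [map_add, LinearMap.add_apply, h₁, h₂]; abel
      | tmul b b' =>
        induction z with
        | zero => simp
        | add z₁ z₂ h₁ h₂ => simp only [map_add, h₁, h₂]; abel
        | tmul c c' =>
          simp only [tensorOp_prod, tensorOp_bracket, leibniz, map_add, LinearMap.add_apply,
            TensorProduct.add_tmul, TensorProduct.tmul_add, prod_left_comm b a,
            prod_left_comm b' a', prod_assoc]
          abel

end Tensor

/-- A linear map that commutes with the three operations. -/
def IsHom {A B : Type*} [AddCommGroup A] [Module ℚ A] [AddCommGroup B] [Module ℚ B]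
    [BiHamAlgebra A] [BiHamAlgebra B] (f : A →ₗ[ℚ] B) : Prop :=
  ∀ (o : BiHamOp) (a b : A), f (op o a b) = op o (f a) (f b)

section Hom

variable {A B C D : Type*} [AddCommGroup A] [Module ℚ A] [AddCommGroup B] [Module ℚ B]
  [AddCommGroup C] [Module ℚ C] [AddCommGroup D] [Module ℚ D]
  [BiHamAlgebra A] [BiHamAlgebra B] [BiHamAlgebra C] [BiHamAlgebra D]

theorem IsHom.comp {g : B →ₗ[ℚ] C} {f : A →ₗ[ℚ] B} (hg : IsHom g) (hf : IsHom f) :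
    IsHom (g ∘ₗ f) := fun o a b => by
  rw [LinearMap.comp_apply, hf, hg]; rfl

theorem isHom_id : IsHom (LinearMap.id : A →ₗ[ℚ] A) := fun _ _ _ => rfl

theorem isHom_of_tmul {f : A ⊗[ℚ] B →ₗ[ℚ] C}
    (h : ∀ (o : BiHamOp) (a a' : A) (b b' : B),
      f (op o (a ⊗ₜ b) (a' ⊗ₜ b')) = op o (f (a ⊗ₜ b)) (f (a' ⊗ₜ b'))) : IsHom f := by
  intro o x y
  induction x with
  | zero => simp
  | add x₁ x₂ h₁ h₂ => simp only [map_add, LinearMap.add_apply, h₁, h₂]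
  | tmul a b =>
    induction y with
    | zero => simp
    | add y₁ y₂ h₁ h₂ => simp only [map_add, h₁, h₂]
    | tmul a' b' => exact h o a a' b b'

theorem op_tmul_prod (a a' : A) (b b' : B) :
    op prod (a ⊗ₜ[ℚ] b) (a' ⊗ₜ[ℚ] b') = op prod a a' ⊗ₜ[ℚ] op prod b b' := rfl

theorem op_tmul_bracket (i : Fin 2) (a a' : A) (b b' : B) :
    op (bracket i) (a ⊗ₜ[ℚ] b) (a' ⊗ₜ[ℚ] b')
      = op (bracket i) a a' ⊗ₜ[ℚ] op prod b b' + op prod a a' ⊗ₜ[ℚ] op (bracket i) b b' := rfl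

theorem IsHom.map {f : A →ₗ[ℚ] C} {g : B →ₗ[ℚ] D} (hf : IsHom f) (hg : IsHom g) :
    IsHom (TensorProduct.map f g) := by
  refine isHom_of_tmul fun o a a' b b' => ?_
  cases o with
  | prod => simp only [op_tmul_prod, TensorProduct.map_tmul, hf _ _ _, hg _ _ _]
  | bracket i => simp only [op_tmul_bracket, TensorProduct.map_tmul, hf _ _ _, hg _ _ _, map_add]

theorem isHom_mk_one : IsHom (TensorProduct.mk ℚ ℚ A 1) := by
  intro o a b
  cases o with
  | prod =>
    simp only [TensorProduct.mk_apply, op_tmul_prod]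
    congr 1
    exact (one_mul (1 : ℚ)).symm
  | bracket i =>
    simp only [TensorProduct.mk_apply, op_tmul_bracket]
    have h1 : op prod (1 : ℚ) (1 : ℚ) = 1 := one_mul (1 : ℚ)
    have h2 : op (bracket i) (1 : ℚ) (1 : ℚ) = 0 := rfl
    rw [h1, h2, TensorProduct.zero_tmul, zero_add]

theorem isHom_flip_mk_one : IsHom ((TensorProduct.mk ℚ A ℚ).flip 1) := by
  intro o a b
  cases o with
  | prod =>
    simp only [LinearMap.flip_apply, TensorProduct.mk_apply, op_tmul_prod]
    congr 1
    exact (one_mul (1 : ℚ)).symm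
  | bracket i =>
    simp only [LinearMap.flip_apply, TensorProduct.mk_apply, op_tmul_bracket]
    have h1 : op prod (1 : ℚ) (1 : ℚ) = 1 := one_mul (1 : ℚ)
    have h2 : op (bracket i) (1 : ℚ) (1 : ℚ) = 0 := rfl
    rw [h1, h2, TensorProduct.tmul_zero, add_zero]

theorem isHom_assoc : IsHom (TensorProduct.assoc ℚ A B C).toLinearMap := by
  intro o x y
  induction x with
  | zero => simp
  | add x₁ x₂ h₁ h₂ => simp only [map_add, LinearMap.add_apply, h₁, h₂]
  | tmul ab c =>
    induction ab with
    | zero => simp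
    | add x₁ x₂ h₁ h₂ => simp only [map_add, LinearMap.add_apply, h₁, h₂, TensorProduct.add_tmul]
    | tmul a b =>
      induction y with
      | zero => simp
      | add y₁ y₂ h₁ h₂ => simp only [map_add, h₁, h₂]
      | tmul ab' c' =>
        induction ab' with
        | zero => simp
        | add x₁ x₂ h₁ h₂ => simp only [map_add, h₁, h₂, TensorProduct.add_tmul]
        | tmul a' b' =>
          cases o with
          | prod => rfl
          | bracket i =>
            simp only [op_tmul_bracket, op_tmul_prod, TensorProduct.add_tmul, map_add,
              LinearEquiv.coe_coe, TensorProduct.assoc_tmul, TensorProduct.tmul_add]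
            abel

end Hom

end BiHamAlgebra

/-! ### Free bi-Hamiltonian algebras and the operad -/

/-- Bracketed monomials in the generators `I` built with the three operations. -/
inductive BiHamTerm (I : Type*) : Type _
  | leaf : I → BiHamTerm I
  | node : BiHamOp → BiHamTerm I → BiHamTerm I → BiHamTerm I

namespace BiHamTerm

/-- The multiset of generators that occur in a monomial. -/
def leaves {I : Type*} : BiHamTerm I → Multiset I
  | leaf i => {i}
  | node _ s t => leaves s + leaves t

/-- The value of a monomial in a bi-Hamiltonian algebra. -/
def eval {I A : Type*} [AddCommGroup A] [Module ℚ A] [BiHamAlgebra A] (v : I → A) :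
    BiHamTerm I → A
  | leaf i => v i
  | node o s t => BiHamAlgebra.op o (eval v s) (eval v t)

end BiHamTerm

/-- The free nonassociative algebra on `I` with three bilinear operations. -/
abbrev BiHamMagma (I : Type*) := BiHamTerm I →₀ ℚ

namespace BiHamMagma

variable {I : Type*}

/-- The three bilinear operations, given by `node` on monomials. -/
def op (o : BiHamOp) : BiHamMagma I →ₗ[ℚ] BiHamMagma I →ₗ[ℚ] BiHamMagma I :=
  Finsupp.lift (BiHamMagma I →ₗ[ℚ] BiHamMagma I) ℚ (BiHamTerm I)
    fun s => Finsupp.lmapDomain ℚ ℚ (BiHamTerm.node o s)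

/-- The defining relations of bi-Hamiltonian algebras and everything obtained from them by applying
operations. -/
inductive Rel : BiHamMagma I → Prop
  | prod_comm (a b) : Rel (op prod a b - op prod b a)
  | prod_assoc (a b c) : Rel (op prod (op prod a b) c - op prod a (op prod b c))
  | skew (i : Fin 2) (a b) : Rel (op (bracket i) a b + op (bracket i) b a)
  | jacobi (i : Fin 2) (a b c) :
      Rel (op (bracket i) a (op (bracket i) b c) + op (bracket i) b (op (bracket i) c a)
        + op (bracket i) c (op (bracket i) a b))
  | six_term (a b c) :
      Rel (op (bracket 1) a (op (bracket 0) b c) + op (bracket 1) b (op (bracket 0) c a)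
        + op (bracket 1) c (op (bracket 0) a b)
        + op (bracket 0) a (op (bracket 1) b c) + op (bracket 0) b (op (bracket 1) c a)
        + op (bracket 0) c (op (bracket 1) a b))
  | leibniz (i : Fin 2) (a b c) :
      Rel (op (bracket i) a (op prod b c)
        - (op prod (op (bracket i) a b) c + op prod b (op (bracket i) a c)))
  | op_left (o : BiHamOp) (r m) : Rel r → Rel (op o r m)
  | op_right (o : BiHamOp) (m r) : Rel r → Rel (op o m r)

/-- The ideal of relations. -/
def relIdeal (I : Type*) : Submodule ℚ (BiHamMagma I) := Submodule.span ℚ {r | Rel r}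

theorem op_single (o : BiHamOp) (s t : BiHamTerm I) :
    op o (Finsupp.single s 1) (Finsupp.single t 1) = Finsupp.single (BiHamTerm.node o s t) 1 := by
  simp [op]

theorem op_mem_left (o : BiHamOp) {r : BiHamMagma I} (hr : r ∈ relIdeal I) (m : BiHamMagma I) :
    op o r m ∈ relIdeal I := by
  induction hr using Submodule.span_induction with
  | mem x h => exact Submodule.subset_span (Rel.op_left o x m h)
  | zero => simp
  | add x y _ _ hx hy => simpa using add_mem hx hy
  | smul c x _ hx => simpa using Submodule.smul_mem _ c hx

theorem op_mem_right (o : BiHamOp) {r : BiHamMagma I} (hr : r ∈ relIdeal I) (m : BiHamMagma I) :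
    op o m r ∈ relIdeal I := by
  induction hr using Submodule.span_induction with
  | mem x h => exact Submodule.subset_span (Rel.op_right o m x h)
  | zero => simp
  | add x y _ _ hx hy => simpa using add_mem hx hy
  | smul c x _ hx => simpa using Submodule.smul_mem _ c hx

/-- The linear extension of the evaluation of monomials. -/
def eval {A : Type*} [AddCommGroup A] [Module ℚ A] [BiHamAlgebra A] (v : I → A) :
    BiHamMagma I →ₗ[ℚ] A :=
  Finsupp.lift A ℚ (BiHamTerm I) (BiHamTerm.eval v)

theorem eval_single {A : Type*} [AddCommGroup A] [Module ℚ A] [BiHamAlgebra A] (v : I → A)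
    (t : BiHamTerm I) : eval v (Finsupp.single t 1) = t.eval v := by
  simp [eval]

theorem eval_op {A : Type*} [AddCommGroup A] [Module ℚ A] [BiHamAlgebra A] (v : I → A)
    (o : BiHamOp) (a b : BiHamMagma I) :
    eval v (op o a b) = BiHamAlgebra.op o (eval v a) (eval v b) := by
  have h : (op o).compr₂ (eval v) = (BiHamAlgebra.op o).compl₁₂ (eval v) (eval v) := by
    ext s t
    simp [op_single, eval_single, BiHamTerm.eval]
  exact LinearMap.congr_fun₂ h a b

theorem relIdeal_le_ker {A : Type*} [AddCommGroup A] [Module ℚ A] [BiHamAlgebra A] (v : I → A) :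
    relIdeal I ≤ LinearMap.ker (eval v) := by
  refine Submodule.span_le.2 fun r hr => ?_
  rw [SetLike.mem_coe, LinearMap.mem_ker]
  induction hr with
  | prod_comm a b => rw [map_sub, eval_op, eval_op, BiHamAlgebra.prod_comm, sub_self]
  | prod_assoc a b c =>
    simp only [map_sub, eval_op, BiHamAlgebra.prod_assoc, sub_self]
  | skew i a b => rw [map_add, eval_op, eval_op, BiHamAlgebra.skew, neg_add_cancel]
  | jacobi i a b c => simp only [map_add, eval_op, BiHamAlgebra.jacobi]
  | six_term a b c => simp only [map_add, eval_op, BiHamAlgebra.six_term]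
  | leibniz i a b c =>
    simp only [map_sub, map_add, eval_op, BiHamAlgebra.leibniz, sub_self]
  | op_left o r m _ ih => rw [eval_op, ih]; simp
  | op_right o m r _ ih => rw [eval_op, ih]; simp

end BiHamMagma

/-- The free bi-Hamiltonian algebra on `I`. -/
def FreeBiHam (I : Type*) : Type _ := BiHamMagma I ⧸ BiHamMagma.relIdeal I

namespace FreeBiHam

variable {I : Type*}

instance instAddCommGroup : AddCommGroup (FreeBiHam I) :=
  inferInstanceAs (AddCommGroup (BiHamMagma I ⧸ BiHamMagma.relIdeal I))

instance instModule : Module ℚ (FreeBiHam I) :=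
  inferInstanceAs (Module ℚ (BiHamMagma I ⧸ BiHamMagma.relIdeal I))

/-- The projection from the free nonassociative algebra. -/
def proj (I : Type*) : BiHamMagma I →ₗ[ℚ] FreeBiHam I := (BiHamMagma.relIdeal I).mkQ

theorem proj_surjective : Function.Surjective (proj I) := Submodule.mkQ_surjective _

theorem proj_eq_zero {r : BiHamMagma I} (h : r ∈ BiHamMagma.relIdeal I) : proj I r = 0 :=
  (Submodule.Quotient.mk_eq_zero _).2 h

/-- The class of a monomial. -/
def mono (t : BiHamTerm I) : FreeBiHam I := proj I (Finsupp.single t 1)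

/-- The map on the free bi-Hamiltonian algebra induced by a linear map that kills the relations. -/
def descend {A : Type*} [AddCommGroup A] [Module ℚ A] (f : BiHamMagma I →ₗ[ℚ] A)
    (h : ∀ r ∈ BiHamMagma.relIdeal I, f r = 0) : FreeBiHam I →ₗ[ℚ] A :=
  Submodule.liftQ _ f h

theorem descend_proj {A : Type*} [AddCommGroup A] [Module ℚ A] (f : BiHamMagma I →ₗ[ℚ] A)
    (h : ∀ r ∈ BiHamMagma.relIdeal I, f r = 0) (m : BiHamMagma I) :
    descend f h (proj I m) = f m := rfl

/-- The operation with left argument in the free nonassociative algebra. -/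
def opAux (o : BiHamOp) (a : BiHamMagma I) : FreeBiHam I →ₗ[ℚ] FreeBiHam I :=
  descend (proj I ∘ₗ BiHamMagma.op o a) fun _ hr => proj_eq_zero (BiHamMagma.op_mem_right o hr a)

theorem opAux_proj (o : BiHamOp) (a b : BiHamMagma I) :
    opAux o a (proj I b) = proj I (BiHamMagma.op o a b) := rfl

/-- The operations, induced from those of the free nonassociative algebra. -/
def op (o : BiHamOp) : FreeBiHam I →ₗ[ℚ] FreeBiHam I →ₗ[ℚ] FreeBiHam I :=
  descend
    { toFun := opAux o
      map_add' := fun a a' => LinearMap.ext fun x => by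
        obtain ⟨m, rfl⟩ := proj_surjective x
        simp only [opAux_proj, map_add, LinearMap.add_apply]
      map_smul' := fun c a => LinearMap.ext fun x => by
        obtain ⟨m, rfl⟩ := proj_surjective x
        simp only [opAux_proj, map_smul, LinearMap.smul_apply, RingHom.id_apply] }
    fun r hr => LinearMap.ext fun x => by
      obtain ⟨m, rfl⟩ := proj_surjective x
      exact proj_eq_zero (BiHamMagma.op_mem_left o hr m)

theorem op_proj (o : BiHamOp) (a b : BiHamMagma I) :
    op o (proj I a) (proj I b) = proj I (BiHamMagma.op o a b) := rfl

theorem proj_rel {r : BiHamMagma I} (h : BiHamMagma.Rel r) : proj I r = 0 :=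
  proj_eq_zero (Submodule.subset_span h)

instance instBiHamAlgebra : BiHamAlgebra (FreeBiHam I) where
  op := op
  prod_comm a b := by
    obtain ⟨a, rfl⟩ := proj_surjective a
    obtain ⟨b, rfl⟩ := proj_surjective b
    have h := proj_rel (BiHamMagma.Rel.prod_comm a b)
    rw [map_sub] at h
    exact sub_eq_zero.1 h
  prod_assoc a b c := by
    obtain ⟨a, rfl⟩ := proj_surjective a
    obtain ⟨b, rfl⟩ := proj_surjective b
    obtain ⟨c, rfl⟩ := proj_surjective c
    have h := proj_rel (BiHamMagma.Rel.prod_assoc a b c)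
    rw [map_sub] at h
    exact sub_eq_zero.1 h
  skew i a b := by
    obtain ⟨a, rfl⟩ := proj_surjective a
    obtain ⟨b, rfl⟩ := proj_surjective b
    have h := proj_rel (BiHamMagma.Rel.skew i a b)
    rw [map_add] at h
    exact eq_neg_of_add_eq_zero_left h
  jacobi i a b c := by
    obtain ⟨a, rfl⟩ := proj_surjective a
    obtain ⟨b, rfl⟩ := proj_surjective b
    obtain ⟨c, rfl⟩ := proj_surjective c
    exact proj_rel (BiHamMagma.Rel.jacobi i a b c)
  six_term a b c := by
    obtain ⟨a, rfl⟩ := proj_surjective a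
    obtain ⟨b, rfl⟩ := proj_surjective b
    obtain ⟨c, rfl⟩ := proj_surjective c
    exact proj_rel (BiHamMagma.Rel.six_term a b c)
  leibniz i a b c := by
    obtain ⟨a, rfl⟩ := proj_surjective a
    obtain ⟨b, rfl⟩ := proj_surjective b
    obtain ⟨c, rfl⟩ := proj_surjective c
    have h := proj_rel (BiHamMagma.Rel.leibniz i a b c)
    rw [map_sub] at h
    exact sub_eq_zero.1 h

theorem mono_node (o : BiHamOp) (s t : BiHamTerm I) :
    mono (BiHamTerm.node o s t) = BiHamAlgebra.op o (mono s) (mono t) := by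
  rw [mono, ← BiHamMagma.op_single]
  rfl

/-- The homomorphism of bi-Hamiltonian algebras with prescribed values on the generators. -/
def lift {A : Type*} [AddCommGroup A] [Module ℚ A] [BiHamAlgebra A] (v : I → A) :
    FreeBiHam I →ₗ[ℚ] A :=
  descend (BiHamMagma.eval v) fun _ hr => BiHamMagma.relIdeal_le_ker v hr

theorem lift_mono {A : Type*} [AddCommGroup A] [Module ℚ A] [BiHamAlgebra A] (v : I → A)
    (t : BiHamTerm I) : lift v (mono t) = t.eval v :=
  BiHamMagma.eval_single v t

theorem isHom_lift {A : Type*} [AddCommGroup A] [Module ℚ A] [BiHamAlgebra A] (v : I → A) :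
    BiHamAlgebra.IsHom (lift v) := by
  intro o a b
  obtain ⟨a, rfl⟩ := proj_surjective a
  obtain ⟨b, rfl⟩ := proj_surjective b
  exact BiHamMagma.eval_op v o a b

theorem hom_ext {A : Type*} [AddCommGroup A] [Module ℚ A] [BiHamAlgebra A]
    {f g : FreeBiHam I →ₗ[ℚ] A} (hf : BiHamAlgebra.IsHom f) (hg : BiHamAlgebra.IsHom g)
    (h : ∀ i, f (mono (.leaf i)) = g (mono (.leaf i))) : f = g := by
  have key : ∀ t : BiHamTerm I, f (mono t) = g (mono t) := by
    intro t
    induction t with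
    | leaf i => exact h i
    | node o s t hs ht => rw [mono_node, hf, hg, hs, ht]
  have h2 : f ∘ₗ proj I = g ∘ₗ proj I := by
    ext t
    exact key t
  ext x
  obtain ⟨m, rfl⟩ := proj_surjective x
  exact LinearMap.congr_fun h2 m

/-- The free bi-Hamiltonian algebra is a coalgebra: the comultiplication is the homomorphism of
bi-Hamiltonian algebras with `aᵢ ↦ aᵢ ⊗ aᵢ`, and the counit is the homomorphism to `ℚ` (with zero
brackets) with `aᵢ ↦ 1`. -/
instance instCoalgebra : Coalgebra ℚ (FreeBiHam I) where
  comul := lift fun i => mono (.leaf i) ⊗ₜ[ℚ] mono (.leaf i)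
  counit := lift fun _ => (1 : ℚ)
  coassoc := by
    refine hom_ext (BiHamAlgebra.isHom_assoc.comp
      (((isHom_lift _).map BiHamAlgebra.isHom_id).comp (isHom_lift _)))
      ((BiHamAlgebra.isHom_id.map (isHom_lift _)).comp (isHom_lift _)) fun i => ?_
    simp [lift_mono, BiHamTerm.eval]
  rTensor_counit_comp_comul := by
    refine hom_ext (((isHom_lift _).map BiHamAlgebra.isHom_id).comp (isHom_lift _))
      BiHamAlgebra.isHom_mk_one fun i => ?_
    simp [lift_mono, BiHamTerm.eval]
  lTensor_counit_comp_comul := by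
    refine hom_ext ((BiHamAlgebra.isHom_id.map (isHom_lift _)).comp (isHom_lift _))
      BiHamAlgebra.isHom_flip_mk_one fun i => ?_
    simp [lift_mono, BiHamTerm.eval]

theorem comul_leaf (i : I) :
    Coalgebra.comul (R := ℚ) (mono (.leaf i)) = mono (.leaf i) ⊗ₜ[ℚ] mono (.leaf i) :=
  lift_mono _ _

theorem comul_op (o : BiHamOp) (a b : FreeBiHam I) :
    Coalgebra.comul (R := ℚ) (BiHamAlgebra.op o a b)
      = BiHamAlgebra.op o (Coalgebra.comul (R := ℚ) a) (Coalgebra.comul (R := ℚ) b) :=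
  isHom_lift _ o a b

/-- The component of multidegree `d` of the free algebra. -/
def component (d : Multiset I) : Submodule ℚ (FreeBiHam I) :=
  Submodule.span ℚ {x | ∃ t : BiHamTerm I, t.leaves = d ∧ mono t = x}

theorem op_mem_component (o : BiHamOp) {d e : Multiset I} {a b : FreeBiHam I}
    (ha : a ∈ component d) (hb : b ∈ component e) :
    BiHamAlgebra.op o a b ∈ component (d + e) := by
  induction ha using Submodule.span_induction with
  | zero => simp
  | add x y _ _ hx hy => simpa using add_mem hx hy
  | smul c x _ hx => simpa using Submodule.smul_mem _ c hx
  | mem x hx =>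
    obtain ⟨s, hs, rfl⟩ := hx
    induction hb using Submodule.span_induction with
    | zero => simp
    | add x y _ _ hx hy => simpa using add_mem hx hy
    | smul c x _ hx => simpa using Submodule.smul_mem _ c hx
    | mem y hy =>
      obtain ⟨t, ht, rfl⟩ := hy
      exact Submodule.subset_span ⟨.node o s t, by simp [BiHamTerm.leaves, hs, ht], mono_node o s t⟩

/-- `component d ⊗ component d`, as a subspace of the tensor square of the free algebra. -/
def component2 (d : Multiset I) : Submodule ℚ (FreeBiHam I ⊗[ℚ] FreeBiHam I) :=
  Submodule.span ℚ {x | ∃ a ∈ component d, ∃ b ∈ component d, a ⊗ₜ[ℚ] b = x}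

theorem op_mem_component2 (o : BiHamOp) {d e : Multiset I} {x y : FreeBiHam I ⊗[ℚ] FreeBiHam I}
    (hx : x ∈ component2 d) (hy : y ∈ component2 e) :
    BiHamAlgebra.op o x y ∈ component2 (d + e) := by
  induction hx using Submodule.span_induction with
  | zero => simp
  | add x y _ _ hx hy => simpa using add_mem hx hy
  | smul c x _ hx => simpa using Submodule.smul_mem _ c hx
  | mem x hx =>
    obtain ⟨a, ha, b, hb, rfl⟩ := hx
    induction hy using Submodule.span_induction with
    | zero => simp
    | add x y _ _ hx hy => simpa using add_mem hx hy
    | smul c x _ hx => simpa using Submodule.smul_mem _ c hx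
    | mem y hy =>
      obtain ⟨a', ha', b', hb', rfl⟩ := hy
      have key : ∀ o o' : BiHamOp, BiHamAlgebra.op o a a' ⊗ₜ[ℚ] BiHamAlgebra.op o' b b'
          ∈ component2 (d + e) := fun o o' => Submodule.subset_span
        ⟨_, op_mem_component o ha ha', _, op_mem_component o' hb hb', rfl⟩
      cases o with
      | prod => exact key prod prod
      | bracket i => exact add_mem (key (bracket i) prod) (key prod (bracket i))

theorem comul_mono_mem (t : BiHamTerm I) :
    Coalgebra.comul (R := ℚ) (mono t) ∈ component2 t.leaves := by
  induction t with
  | leaf i =>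
    have h : mono (.leaf i) ∈ component ({i} : Multiset I) :=
      Submodule.subset_span ⟨_, rfl, rfl⟩
    rw [comul_leaf]
    exact Submodule.subset_span ⟨_, h, _, h, rfl⟩
  | node o s t hs ht =>
    rw [mono_node, comul_op]
    exact op_mem_component2 o hs ht

theorem comul_mem {d : Multiset I} {x : FreeBiHam I} (hx : x ∈ component d) :
    Coalgebra.comul (R := ℚ) x ∈ component2 d := by
  induction hx using Submodule.span_induction with
  | zero => simp
  | add x y _ _ hx hy => simpa using add_mem hx hy
  | smul c x _ hx => simpa using Submodule.smul_mem _ c hx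
  | mem x hx =>
    obtain ⟨t, rfl, rfl⟩ := hx
    exact comul_mono_mem t

end FreeBiHam

/-- The component `P₂(I)` of the bi-Hamiltonian operad: the multilinear elements of the free
bi-Hamiltonian algebra on `I`, spanned by the monomials that contain each generator exactly once. -/
def BiHamOperad (I : Type*) [Fintype I] : Type _ :=
  FreeBiHam.component (Finset.univ.val : Multiset I)

namespace BiHamOperad

variable (I : Type*) [Fintype I]

instance instAddCommGroup : AddCommGroup (BiHamOperad I) :=
  inferInstanceAs (AddCommGroup (FreeBiHam.component (Finset.univ.val : Multiset I)))

instance instModule : Module ℚ (BiHamOperad I) :=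
  inferInstanceAs (Module ℚ (FreeBiHam.component (Finset.univ.val : Multiset I)))

/-- The inclusion into the free algebra. -/
def incl : BiHamOperad I →ₗ[ℚ] FreeBiHam I :=
  (FreeBiHam.component (Finset.univ.val : Multiset I)).subtype

theorem incl_injective : Function.Injective (incl I) := Subtype.val_injective

/-- The inclusion of the tensor square. -/
def incl2 : BiHamOperad I ⊗[ℚ] BiHamOperad I →ₗ[ℚ] FreeBiHam I ⊗[ℚ] FreeBiHam I :=
  TensorProduct.map (incl I) (incl I)

theorem incl2_injective : Function.Injective (incl2 I) :=
  TensorProduct.map_injective_of_flat_flat _ _ (incl_injective I) (incl_injective I)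

theorem comul_incl_mem (x : BiHamOperad I) :
    Coalgebra.comul (R := ℚ) (incl I x) ∈ LinearMap.range (incl2 I) := by
  have h := FreeBiHam.comul_mem x.2
  refine Submodule.span_le.2 ?_ h
  rintro _ ⟨a, ha, b, hb, rfl⟩
  exact ⟨(⟨a, ha⟩ : BiHamOperad I) ⊗ₜ (⟨b, hb⟩ : BiHamOperad I), rfl⟩

/-- The map `Δ : P₂(I) → P₂(I) ⊗ P₂(I)`, the restriction of the comultiplication of the free
bi-Hamiltonian algebra. -/
def Δ : BiHamOperad I →ₗ[ℚ] BiHamOperad I ⊗[ℚ] BiHamOperad I :=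
  (LinearEquiv.ofInjective (incl2 I) (incl2_injective I)).symm.toLinearMap ∘ₗ
    LinearMap.codRestrict (LinearMap.range (incl2 I)) (Coalgebra.comul ∘ₗ incl I)
      (comul_incl_mem I)

theorem incl2_Δ (x : BiHamOperad I) :
    TensorProduct.map (incl I) (incl I) (Δ I x) = Coalgebra.comul (R := ℚ) (incl I x) := by
  have h := LinearEquiv.apply_symm_apply (LinearEquiv.ofInjective (incl2 I) (incl2_injective I))
    (LinearMap.codRestrict (LinearMap.range (incl2 I)) (Coalgebra.comul ∘ₗ incl I)
      (comul_incl_mem I) x)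
  exact congrArg Subtype.val h

theorem incl2_comp_Δ :
    TensorProduct.map (incl I) (incl I) ∘ₗ Δ I = Coalgebra.comul ∘ₗ incl I :=
  LinearMap.ext (incl2_Δ I)

instance instCoalgebra : Coalgebra ℚ (BiHamOperad I) where
  comul := Δ I
  counit := Coalgebra.counit ∘ₗ incl I
  coassoc := by
    have inj : Function.Injective (TensorProduct.map (incl I) (incl2 I)) :=
      TensorProduct.map_injective_of_flat_flat _ _ (incl_injective I) (incl2_injective I)
    refine LinearMap.ext fun x => inj ?_
    have h1 : TensorProduct.map (incl I) (incl2 I) ∘ₗ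
        (TensorProduct.assoc ℚ (BiHamOperad I) (BiHamOperad I) (BiHamOperad I)).toLinearMap
        = (TensorProduct.assoc ℚ (FreeBiHam I) (FreeBiHam I) (FreeBiHam I)).toLinearMap ∘ₗ
          TensorProduct.map (incl2 I) (incl I) := by
      refine TensorProduct.ext_threefold fun a b c => rfl
    have h2 : TensorProduct.map (incl2 I) (incl I) ∘ₗ LinearMap.rTensor (BiHamOperad I) (Δ I)
        = LinearMap.rTensor (FreeBiHam I) Coalgebra.comul ∘ₗ
          TensorProduct.map (incl I) (incl I) := by
      refine TensorProduct.ext' fun a b => ?_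
      simp [incl2, incl2_Δ]
    have h3 : TensorProduct.map (incl I) (incl2 I) ∘ₗ LinearMap.lTensor (BiHamOperad I) (Δ I)
        = LinearMap.lTensor (FreeBiHam I) Coalgebra.comul ∘ₗ
          TensorProduct.map (incl I) (incl I) := by
      refine TensorProduct.ext' fun a b => ?_
      simp [incl2, incl2_Δ]
    have e1 := LinearMap.congr_fun h1 (LinearMap.rTensor (BiHamOperad I) (Δ I) (Δ I x))
    have e2 := LinearMap.congr_fun h2 (Δ I x)
    have e3 := LinearMap.congr_fun h3 (Δ I x)
    simp only [LinearMap.comp_apply, LinearEquiv.coe_coe, incl2_Δ] at e1 e2 e3 ⊢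
    rw [e1, e2, e3]
    exact Coalgebra.coassoc_apply _
  rTensor_counit_comp_comul := by
    have inj : Function.Injective (LinearMap.lTensor ℚ (incl I)) :=
      Module.Flat.lTensor_preserves_injective_linearMap _ (incl_injective I)
    refine LinearMap.ext fun x => inj ?_
    have h : LinearMap.lTensor ℚ (incl I) ∘ₗ
        LinearMap.rTensor (BiHamOperad I) (Coalgebra.counit (R := ℚ) ∘ₗ incl I)
        = LinearMap.rTensor (FreeBiHam I) (Coalgebra.counit (R := ℚ)) ∘ₗ
          TensorProduct.map (incl I) (incl I) := TensorProduct.ext' fun a b => rfl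
    have e := LinearMap.congr_fun h (Δ I x)
    simp only [LinearMap.comp_apply, incl2_Δ] at e ⊢
    rw [e, Coalgebra.rTensor_counit_comul]
    rfl
  lTensor_counit_comp_comul := by
    have inj : Function.Injective (LinearMap.rTensor ℚ (incl I)) :=
      Module.Flat.rTensor_preserves_injective_linearMap _ (incl_injective I)
    refine LinearMap.ext fun x => inj ?_
    have h : LinearMap.rTensor ℚ (incl I) ∘ₗ
        LinearMap.lTensor (BiHamOperad I) (Coalgebra.counit (R := ℚ) ∘ₗ incl I)
        = LinearMap.lTensor (FreeBiHam I) (Coalgebra.counit (R := ℚ)) ∘ₗ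
          TensorProduct.map (incl I) (incl I) := TensorProduct.ext' fun a b => rfl
    have e := LinearMap.congr_fun h (Δ I x)
    simp only [LinearMap.comp_apply, incl2_Δ] at e ⊢
    rw [e, Coalgebra.lTensor_counit_comul]
    rfl

/-- The dual space `P₂(I)*` as an algebra: the product of `f` and `g` is `(f ⊗ g) ∘ Δ`. -/
abbrev DualAlgebra : Type _ := WithConv (BiHamOperad I →ₗ[ℚ] ℚ)

end BiHamOperad

/-! ### The double even Orlik–Solomon algebra -/

namespace DoubleOS

/-- The index set of the generators `x i j` (label `0`) and `y i j` (label `1`), for `i ≠ j`. -/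
abbrev Gen (I : Type*) : Type _ := Fin 2 × {p : I × I // p.1 ≠ p.2}

/-- The polynomial variable with label `c` and indices `i ≠ j`. -/
def var {I : Type*} (c : Fin 2) (i j : I) (h : i ≠ j) : MvPolynomial (Gen I) ℚ :=
  MvPolynomial.X (c, ⟨(i, j), h⟩)

/-- The defining relations. -/
inductive Rel (I : Type*) : MvPolynomial (Gen I) ℚ → Prop
  | skew (c : Fin 2) (i j : I) (h : i ≠ j) : Rel I (var c i j h + var c j i h.symm)
  | square (c c' : Fin 2) (i j : I) (h : i ≠ j) : Rel I (var c i j h * var c' i j h)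
  | three_term (c : Fin 2) (i j k : I) (hij : i ≠ j) (hjk : j ≠ k) (hki : k ≠ i) :
      Rel I (var c i j hij * var c j k hjk + var c j k hjk * var c k i hki
        + var c k i hki * var c i j hij)
  | six_term (i j k : I) (hij : i ≠ j) (hjk : j ≠ k) (hki : k ≠ i) :
      Rel I (var 0 i j hij * var 1 j k hjk + var 0 j k hjk * var 1 k i hki
        + var 0 k i hki * var 1 i j hij
        + var 1 i j hij * var 0 j k hjk + var 1 j k hjk * var 0 k i hki
        + var 1 k i hki * var 0 i j hij)

end DoubleOS

/-- The double even Orlik–Solomon algebra with index set `I`. -/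
abbrev DoubleOS (I : Type*) : Type _ :=
  MvPolynomial (DoubleOS.Gen I) ℚ ⧸ Ideal.span {r | DoubleOS.Rel I r}

/-! ### Labelled graphs and forests -/

/-- A graph on `I` with edges labelled `x` (label `0`) or `y` (label `1`), given by the graph of
`x`-edges and the graph of `y`-edges. -/
abbrev LabelledGraph (I : Type*) : Type _ := Fin 2 → SimpleGraph I

namespace LabelledGraph

variable {I : Type*}

/-- The graph obtained by forgetting the labels. -/
def total (T : LabelledGraph I) : SimpleGraph I := T 0 ⊔ T 1

/-- The part of `T` on the vertex set `S`. -/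
def restrict (T : LabelledGraph I) (S : Set I) : LabelledGraph I := fun c =>
  { Adj := fun u v => (T c).Adj u v ∧ u ∈ S ∧ v ∈ S
    symm := ⟨fun _ _ h => ⟨h.1.symm, h.2.2, h.2.1⟩⟩
    loopless := ⟨fun u h => (T c).loopless.irrefl u h.1⟩ }

/-- `T` is a forest: no edge carries two labels and there are no cycles. -/
def IsForest (T : LabelledGraph I) : Prop :=
  Disjoint (T 0) (T 1) ∧ T.total.IsAcyclic

/-- `T` is a tree with vertex set `A`. -/
def IsTreeOn (T : LabelledGraph I) (A : Set I) : Prop :=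
  T.IsForest ∧ (∀ u v, T.total.Adj u v → u ∈ A ∧ v ∈ A) ∧ A.Nonempty ∧
    ∀ u ∈ A, ∀ v ∈ A, T.total.Reachable u v

/-- In a tree `T` with root `r`: there is an edge with label `c` which is oriented (away from the
root) from `u` to `v`. -/
def Out (T : LabelledGraph I) (r : I) (c : Fin 2) (u v : I) : Prop :=
  (T c).Adj u v ∧ T.total.dist r v = T.total.dist r u + 1

/-- Each vertex has at most one outgoing edge with each label. -/
def Star (T : LabelledGraph I) (r : I) : Prop :=
  ∀ (c : Fin 2) (u v w : I), T.Out r c u v → T.Out r c u w → v = w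

/-- The set of vertices of the maximal chain with label `c` that starts at `v`. -/
def chain (T : LabelledGraph I) (r : I) (c : Fin 2) (v : I) : Set I :=
  {w | Relation.ReflTransGen (T.Out r c) v w}

/-- `w` is the end of the maximal chain with label `c` that starts at `v`. -/
def IsChainEnd (T : LabelledGraph I) (r : I) (c : Fin 2) (v w : I) : Prop :=
  w ∈ T.chain r c v ∧ ∀ u, ¬ T.Out r c w u

/-- The vertices `i_{s,p}`, `s ≥ 1`, that is, the vertices other than the starting point on the
maximal `y`-chains that start at the vertices `j_p` of the maximal `x`-chain of the root. -/
def IsSpine (T : LabelledGraph I) (r v : I) : Prop :=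
  ∃ j ∈ T.chain r 0 r, Relation.TransGen (T.Out r 1) j v

/-- What is left of `T` after the deletion of the edges of the maximal `x`-chain starting at the
root `r` and of the edges of the maximal `y`-chains starting at the vertices of that `x`-chain. -/
def remainder (T : LabelledGraph I) (r : I) : LabelledGraph I := fun c =>
  (T c).deleteEdges {e | ∃ u v, e = s(u, v) ∧ T.Out r c u v ∧
    ((c = 0 ∧ u ∈ T.chain r 0 r) ∨ (c = 1 ∧ ∃ j ∈ T.chain r 0 r, u ∈ T.chain r 1 j))}

/-- The vertex set of the connected component of `v` in the remainder. -/
def part (T : LabelledGraph I) (r v : I) : Set I := {w | (T.remainder r).total.Reachable v w}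

/-- `IsBasisTree A T` says that the tree `T` on the vertex set `A` belongs to the recursively
defined set `𝔗(A)`; the root of `T` is the maximal element of `A`. -/
inductive IsBasisTree [LinearOrder I] : Set I → LabelledGraph I → Prop
  | intro (A : Set I) (T : LabelledGraph I) (r : I)
      (tree : T.IsTreeOn A)
      (root : IsGreatest A r)
      (star : T.Star r)
      (maximal : ∀ v, T.IsSpine r v → ∀ w, T.IsChainEnd r 0 v w → IsGreatest (T.part r v) w)
      (recursive : ∀ v, T.IsSpine r v →
        IsBasisTree (T.part r v) ((T.remainder r).restrict (T.part r v))) :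
      IsBasisTree A T

/-- The set `𝔉(I)` of forests on `I`, all of whose connected components `C` belong to `𝔗(C)`. -/
def basisForests (I : Type*) [LinearOrder I] : Set (LabelledGraph I) :=
  {F | F.IsForest ∧ ∀ C : F.total.ConnectedComponent, IsBasisTree C.supp (F.restrict C.supp)}

open Classical in
/-- The monomial of a labelled graph: the product of the generators `x i j` (or `y i j`) over all
edges with label `x` (or `y`) and with ends `i < j`. -/
def monomial [LinearOrder I] [Fintype I] (F : LabelledGraph I) : DoubleOS I :=
  ∏ g : DoubleOS.Gen I with g.2.1.1 < g.2.1.2 ∧ (F g.1).Adj g.2.1.1 g.2.1.2,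
    Ideal.Quotient.mk _ (MvPolynomial.X g)

end LabelledGraph

end

/-!
The duality between the Orlik–Solomon algebra and the operad comes from explicit functionals. A pair
`ω` of antisymmetric matrices (a `SkewForm`) defines two log-canonical brackets
`{x^d, x^e}_c = ω_c(d, e) x^(d + e)` on polynomials in commuting variables. They are compatible, since
they are linear in `ω`. Evaluation in this algebra, followed by `x^d ↦ 1`, gives a functional
`valConv ω` on the multilinear part `P₂(I)`, and these functionals are exponential in `ω`: the
convolution product of those for `ω` and `ω'` is the one for `ω + ω'` (`valLin_add`). The functionals
with a single entry `c, i, j` are of first order, and their first-order parts satisfy the relations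
of the double Orlik–Solomon algebra; this is the homomorphism `ofDoubleOS` to the dual of `P₂(I)`.
As `ω` is a sum of forms with a single entry, all `valConv ω` lie in its range
(`valConv_mem_range`).

The dimension is bounded from both sides by the same combinatorial set, that of the normal monomials.
A normal tree is built from a letter by `{j, ·}₁`, with a letter `j`, and by `{·, b}₂`, where `b` is a
block, that is, a single letter or a tree `{j, t}₁`. The head of a tree is the letter at which the
construction begins, and the heads of the tree and of its blocks are maximal among their letters.
Normal monomials are products of normal trees.

* On the side of the operad, normal monomials span `P₂(I)`: the Jacobi identities and the
  compatibility of the brackets rewrite brackets of normal trees (`eval_mem_span_forest`). They are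
  linearly independent as well, and the functionals `valConv ω` suffice to see this
  (`indep_forest`). For this purpose, normal trees are compared through their skeletons: a form
  `Adapted` to a tree `t` annihilates all trees with at least as many outer brackets `{ , }₂` as `t`
  but another skeleton (`Adapted.joins_le`), and trees with the same skeleton are separated by
  induction. Hence the `valConv ω` span the dual, and `ofDoubleOS` is surjective.

* On the side of the Orlik–Solomon algebra, a product of generators over a closed walk vanishes
  (`closed_walk`), so the algebra is spanned by products over the edges of forests. The relations
  rewrite these as products over the forests that belong to normal monomials
  (`forestSpan_eq_top`): several `x`-edges, or `y`-edges, at the root are replaced by one, and a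
  `y`-branch can be attached at its top (`y_branch_mem`, `mem_rootedSpan`). The dimension is
  therefore at most the number of normal monomials, which is the dimension of `P₂(I)`, so
  `ofDoubleOS` is an isomorphism.

The number of normal monomials is `(n + 1)^(n - 1)` by Abel's identity (`exists_normalForests`). In
the forest of a normal monomial, `{j, t}₁` is an `x`-edge from the top of `t` to `j`, and `{t, b}₂` is a
`y`-edge from the last vertex of `t` to the top of `b`. These are exactly the forests in `𝔉(n)`
(`graph_mem_basisForests`, `exists_of_mem_basisForests`), and their monomials agree up to sign with
those that span the algebra (`monomial_graph`); they form a spanning family of the right size, and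
hence a basis.
-/

noncomputable section

open BiHamOp

/-! ### Log-canonical brackets -/

/-- Pairs of antisymmetric matrices with rows and columns indexed by `I`. -/
@[ext]
structure SkewForm (I : Type*) where
  /-- The entries. -/
  form : Fin 2 → I → I → ℚ
  skew : ∀ c i j, form c i j = -form c j i

namespace SkewForm

variable {I : Type*}

instance instZero : Zero (SkewForm I) where
  zero := ⟨0, by simp⟩

instance instAdd : Add (SkewForm I) where
  add a b := ⟨a.form + b.form, fun c i j => by
    simp only [Pi.add_apply]
    rw [a.skew c i j, b.skew c i j]; ring⟩

@[simp] theorem zero_form (c : Fin 2) (i j : I) : (0 : SkewForm I).form c i j = 0 := rfl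

@[simp] theorem add_form (a b : SkewForm I) (c : Fin 2) (i j : I) :
    (a + b).form c i j = a.form c i j + b.form c i j := rfl

/-- The value of the form with label `c` on two multisets, regarded as sums of basis vectors. -/
def pair (ω : SkewForm I) (c : Fin 2) (d e : Multiset I) : ℚ :=
  (d.map fun i => (e.map fun j => ω.form c i j).sum).sum

variable (ω ω' : SkewForm I) (c : Fin 2)

@[simp] theorem pair_zero_left (e : Multiset I) : ω.pair c 0 e = 0 := by simp [pair]

@[simp] theorem pair_zero_right (d : Multiset I) : ω.pair c d 0 = 0 := by simp [pair]

theorem pair_add_left (d d' e : Multiset I) :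
    ω.pair c (d + d') e = ω.pair c d e + ω.pair c d' e := by simp [pair]

theorem pair_add_right (d e e' : Multiset I) :
    ω.pair c d (e + e') = ω.pair c d e + ω.pair c d e' := by
  simp [pair, Multiset.sum_map_add]

@[simp] theorem pair_singleton_left (i : I) (e : Multiset I) :
    ω.pair c {i} e = (e.map fun j => ω.form c i j).sum := by simp [pair]

theorem pair_singleton (i j : I) : ω.pair c {i} {j} = ω.form c i j := by simp

theorem pair_skew (d e : Multiset I) : ω.pair c d e = -ω.pair c e d := by
  induction d using Multiset.induction with
  | empty => simp
  | cons i d ih =>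
    rw [← Multiset.singleton_add, pair_add_left, pair_add_right, ih, neg_add]
    congr 1
    clear ih
    induction e using Multiset.induction with
    | empty => simp
    | cons j e ih' =>
      rw [← Multiset.singleton_add, pair_add_left, pair_add_right, ih', pair_singleton,
        pair_singleton, ω.skew c i j]
      ring

theorem pair_self (d : Multiset I) : ω.pair c d d = 0 := by
  have := ω.pair_skew c d d
  linarith

theorem pair_zero_form (d e : Multiset I) : (0 : SkewForm I).pair c d e = 0 := by simp [pair]

theorem pair_add_form (d e : Multiset I) : (ω + ω').pair c d e = ω.pair c d e + ω'.pair c d e := by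
  simp [pair, Multiset.sum_map_add]

/-- The form that vanishes between `d` and `e` pairs them to zero. -/
theorem pair_eq_zero {d e : Multiset I} (h : ∀ i ∈ d, ∀ j ∈ e, ω.form c i j = 0) :
    ω.pair c d e = 0 := by
  unfold pair
  refine Multiset.sum_eq_zero fun x hx => ?_
  obtain ⟨i, hi, rfl⟩ := Multiset.mem_map.1 hx
  refine Multiset.sum_eq_zero fun y hy => ?_
  obtain ⟨j, hj, rfl⟩ := Multiset.mem_map.1 hy
  exact h i hi j hj

theorem pair_congr {ω ω' : SkewForm I} {d e : Multiset I}
    (h : ∀ i ∈ d, ∀ j ∈ e, ω.form c i j = ω'.form c i j) : ω.pair c d e = ω'.pair c d e := by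
  unfold pair
  refine congrArg _ (Multiset.map_congr rfl fun i hi => congrArg _ (Multiset.map_congr rfl
    fun j hj => h i hi j hj))

end SkewForm

/-- The monoid algebra of the free commutative monoid on `I`, to be equipped with the log-canonical
brackets `{t^d, t^e}_c = ω_c(d, e) t^(d + e)`. -/
def LogCanonical {I : Type*} (_ω : SkewForm I) : Type _ := Multiset I →₀ ℚ

namespace LogCanonical

variable {I : Type*} (ω : SkewForm I)

instance instAddCommGroup : AddCommGroup (LogCanonical ω) :=
  inferInstanceAs (AddCommGroup (Multiset I →₀ ℚ))

instance instModule : Module ℚ (LogCanonical ω) :=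
  inferInstanceAs (Module ℚ (Multiset I →₀ ℚ))

/-- The monomial `t^d`. -/
def mon (d : Multiset I) : LogCanonical ω := Finsupp.single d (1 : ℚ)

theorem induction {p : LogCanonical ω → Prop} (x : LogCanonical ω) (zero : p 0)
    (add : ∀ x y, p x → p y → p (x + y)) (mon : ∀ (r : ℚ) d, p (r • mon ω d)) : p x :=
  Finsupp.induction_linear x zero add fun d r => by
    have h := mon r d
    have e : r • LogCanonical.mon ω d = (Finsupp.single d r : Multiset I →₀ ℚ) := by
      change r • (Finsupp.single d (1 : ℚ)) = _
      simp
    rwa [e] at h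

/-- The structure constants of the three operations. -/
def coeff (ω : SkewForm I) : BiHamOp → Multiset I → Multiset I → ℚ
  | prod, _, _ => 1
  | bracket c, d, e => ω.pair c d e

/-- The linear map with prescribed values on monomials. -/
def lin {V : Type*} [AddCommGroup V] [Module ℚ V] (f : Multiset I → V) : LogCanonical ω →ₗ[ℚ] V :=
  Finsupp.lift V ℚ (Multiset I) f

theorem lin_mon {V : Type*} [AddCommGroup V] [Module ℚ V] (f : Multiset I → V) (d : Multiset I) :
    lin ω f (mon ω d) = f d := by
  unfold lin mon; exact (Finsupp.lift_apply ..).trans (by simp)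

theorem lin_ext {V : Type*} [AddCommGroup V] [Module ℚ V] {f g : LogCanonical ω →ₗ[ℚ] V}
    (h : ∀ d, f (mon ω d) = g (mon ω d)) : f = g := by
  ext x
  induction x using induction with
  | zero => simp
  | add x y hx hy => simp [hx, hy]
  | mon r d => simp [h]

/-- The operations of the log-canonical algebra: `x^d * x^e` is a multiple of `x^(d + e)`. -/
def opLin (o : BiHamOp) : LogCanonical ω →ₗ[ℚ] LogCanonical ω →ₗ[ℚ] LogCanonical ω :=
  lin ω fun d => lin ω fun e => coeff ω o d e • mon ω (d + e)

theorem opLin_mon (o : BiHamOp) (d e : Multiset I) :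
    opLin ω o (mon ω d) (mon ω e) = coeff ω o d e • mon ω (d + e) := by
  rw [opLin, lin_mon, lin_mon]

theorem eq_on_mon₂ {V : Type*} [AddCommGroup V] [Module ℚ V]
    {f g : LogCanonical ω →ₗ[ℚ] LogCanonical ω →ₗ[ℚ] V}
    (h : ∀ d e, f (mon ω d) (mon ω e) = g (mon ω d) (mon ω e)) (x y) : f x y = g x y := by
  have : f = g := lin_ext ω fun d => lin_ext ω fun e => h d e
  rw [this]

/-- A trilinear expression vanishes if it vanishes on monomials. -/
theorem trilinear_induction {p : LogCanonical ω → LogCanonical ω → LogCanonical ω → LogCanonical ω}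
    (add₁ : ∀ x x' y z, p (x + x') y z = p x y z + p x' y z)
    (add₂ : ∀ x y y' z, p x (y + y') z = p x y z + p x y' z)
    (add₃ : ∀ x y z z', p x y (z + z') = p x y z + p x y z')
    (smul : ∀ (r s t : ℚ) x y z, p (r • x) (s • y) (t • z) = (r * s * t) • p x y z)
    (mon : ∀ d e f, p (mon ω d) (mon ω e) (mon ω f) = 0) (x y z) : p x y z = 0 := by
  induction x using induction with
  | zero => have := add₁ 0 0 y z; simpa using this
  | add x x' hx hx' => rw [add₁, hx, hx', add_zero]
  | mon r d =>
    induction y using induction with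
    | zero => have := add₂ (r • LogCanonical.mon ω d) 0 0 z; simpa using this
    | add y y' hy hy' => rw [add₂, hy, hy', add_zero]
    | mon s e =>
      induction z using induction with
      | zero =>
        have := add₃ (r • LogCanonical.mon ω d) (s • LogCanonical.mon ω e) 0 0; simpa using this
      | add z z' hz hz' => rw [add₃, hz, hz', add_zero]
      | mon t f => rw [smul, mon, smul_zero]

/-- Log-canonical brackets are compatible Poisson brackets. -/
instance instBiHamAlgebra : BiHamAlgebra (LogCanonical ω) where
  op := opLin ω
  prod_comm a b := by
    refine eq_on_mon₂ ω (f := opLin ω prod) (g := (opLin ω prod).flip) (fun d e => ?_) a b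
    simp only [LinearMap.flip_apply, opLin_mon, coeff, add_comm d e]
  prod_assoc a b c := by
    rw [← sub_eq_zero]
    refine trilinear_induction ω (p := fun a b c => opLin ω prod (opLin ω prod a b) c -
      opLin ω prod a (opLin ω prod b c)) ?_ ?_ ?_ ?_ ?_ a b c
    · intros; simp only [map_add, LinearMap.add_apply]; abel
    · intros; simp only [map_add, LinearMap.add_apply]; abel
    · intros; simp only [map_add]; abel
    · intros; simp only [map_smul, LinearMap.smul_apply, smul_smul, smul_sub]; congr 2 <;> ring
    · intro d e f
      simp only [opLin_mon, coeff, one_smul, add_assoc, sub_self]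
  skew i a b := by
    refine eq_on_mon₂ ω (f := opLin ω (bracket i)) (g := -(opLin ω (bracket i)).flip)
      (fun d e => ?_) a b
    simp only [LinearMap.neg_apply, LinearMap.flip_apply, opLin_mon, coeff, add_comm e d]
    rw [ω.pair_skew i d e, neg_smul]
  jacobi i a b c := by
    refine trilinear_induction ω (p := fun a b c =>
      opLin ω (bracket i) a (opLin ω (bracket i) b c) +
      opLin ω (bracket i) b (opLin ω (bracket i) c a) +
      opLin ω (bracket i) c (opLin ω (bracket i) a b)) ?_ ?_ ?_ ?_ ?_ a b c
    · intros; simp only [map_add, LinearMap.add_apply]; abel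
    · intros; simp only [map_add, LinearMap.add_apply]; abel
    · intros; simp only [map_add, LinearMap.add_apply]; abel
    · intros; simp only [map_smul, LinearMap.smul_apply, smul_smul, smul_add]
      congr 2
      · congr 1; ring
      · congr 1; ring
      · ring
    · intro d e f
      simp only [opLin_mon, coeff, map_smul, smul_smul, ω.pair_add_right]
      rw [show e + (f + d) = d + (e + f) by abel, show f + (d + e) = d + (e + f) by abel,
        ← add_smul, ← add_smul, ω.pair_skew i e d, ω.pair_skew i f d, ω.pair_skew i f e]
      convert zero_smul ℚ _
      ring
  six_term a b c := by
    refine trilinear_induction ω (p := fun a b c =>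
      opLin ω (bracket 1) a (opLin ω (bracket 0) b c) +
      opLin ω (bracket 1) b (opLin ω (bracket 0) c a) +
      opLin ω (bracket 1) c (opLin ω (bracket 0) a b) +
      opLin ω (bracket 0) a (opLin ω (bracket 1) b c) +
      opLin ω (bracket 0) b (opLin ω (bracket 1) c a) +
      opLin ω (bracket 0) c (opLin ω (bracket 1) a b)) ?_ ?_ ?_ ?_ ?_ a b c
    · intros; simp only [map_add, LinearMap.add_apply]; abel
    · intros; simp only [map_add, LinearMap.add_apply]; abel
    · intros; simp only [map_add, LinearMap.add_apply]; abel
    · intro r s t x y z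
      simp only [map_smul, LinearMap.smul_apply, smul_smul, smul_add, mul_comm, mul_left_comm]
    · intro d e f
      simp only [opLin_mon, coeff, map_smul, smul_smul, ω.pair_add_right]
      rw [show e + (f + d) = d + (e + f) by abel, show f + (d + e) = d + (e + f) by abel]
      simp only [← add_smul]
      rw [ω.pair_skew 0 e d, ω.pair_skew 0 f d, ω.pair_skew 0 f e,
        ω.pair_skew 1 e d, ω.pair_skew 1 f d, ω.pair_skew 1 f e]
      convert zero_smul ℚ _
      ring
  leibniz i a b c := by
    rw [← sub_eq_zero]
    refine trilinear_induction ω (p := fun a b c => opLin ω (bracket i) a (opLin ω prod b c) -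
      (opLin ω prod (opLin ω (bracket i) a b) c + opLin ω prod b (opLin ω (bracket i) a c)))
      ?_ ?_ ?_ ?_ ?_ a b c
    · intros; simp only [map_add, LinearMap.add_apply]; abel
    · intros; simp only [map_add, LinearMap.add_apply]; abel
    · intros; simp only [map_add]; abel
    · intro r s t x y z
      simp only [map_smul, LinearMap.smul_apply, smul_smul, smul_sub, smul_add, mul_comm,
        mul_left_comm]
    · intro d e f
      simp only [opLin_mon, coeff, map_smul, LinearMap.smul_apply, one_smul,
        ω.pair_add_right]
      rw [show d + e + f = d + (e + f) by abel, show e + (d + f) = d + (e + f) by abel,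
        ← add_smul, sub_self]

theorem op_mon (o : BiHamOp) (d e : Multiset I) :
    BiHamAlgebra.op o (mon ω d) (mon ω e) = coeff ω o d e • mon ω (d + e) := opLin_mon ω o d e

/-- The sum of the coefficients. -/
def aug : LogCanonical ω →ₗ[ℚ] ℚ := lin ω fun _ => 1

theorem aug_mon (d : Multiset I) : aug ω (mon ω d) = 1 := lin_mon ω _ d

/-- A linear map from a log-canonical algebra is a homomorphism if it is one on monomials. -/
theorem isHom_of_mon {A : Type*} [AddCommGroup A] [Module ℚ A] [BiHamAlgebra A]
    {f : LogCanonical ω →ₗ[ℚ] A}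
    (h : ∀ o d e, coeff ω o d e • f (mon ω (d + e)) =
      BiHamAlgebra.op o (f (mon ω d)) (f (mon ω e))) : BiHamAlgebra.IsHom f := by
  intro o x y
  refine eq_on_mon₂ ω (f := (opLin ω o).compr₂ f)
    (g := (BiHamAlgebra.op o).compl₁₂ f f) (fun d e => ?_) x y
  simp only [LinearMap.compr₂_apply, LinearMap.compl₁₂_apply, opLin_mon, map_smul]
  exact h o d e

end LogCanonical

namespace BiHamTerm

variable {I : Type*}

/-- The coefficient of a monomial when it is evaluated in the log-canonical algebra of `ω`: each
bracket contributes the value of `ω` on the leaves of its two arguments. -/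
def val (ω : SkewForm I) : BiHamTerm I → ℚ
  | leaf _ => 1
  | node o s t => LogCanonical.coeff ω o s.leaves t.leaves * (val ω s * val ω t)

@[simp] theorem val_leaf (ω : SkewForm I) (i : I) : val ω (leaf i) = 1 := rfl

@[simp] theorem val_prod (ω : SkewForm I) (s t : BiHamTerm I) :
    val ω (node prod s t) = val ω s * val ω t := by simp [val, LogCanonical.coeff]

@[simp] theorem val_bracket (ω : SkewForm I) (c : Fin 2) (s t : BiHamTerm I) :
    val ω (node (bracket c) s t) = ω.pair c s.leaves t.leaves * (val ω s * val ω t) := rfl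

theorem eval_mon (ω : SkewForm I) (t : BiHamTerm I) :
    t.eval (fun i => LogCanonical.mon ω {i}) = val ω t • LogCanonical.mon ω t.leaves := by
  induction t with
  | leaf i => simp [eval, leaves]
  | node o s t hs ht =>
    simp only [eval, hs, ht, map_smul, LinearMap.smul_apply, LogCanonical.op_mon, smul_smul, val,
      leaves]
    congr 1; ring

end BiHamTerm

namespace FreeBiHam

variable {I : Type*}

/-- The linear functional on the free bi-Hamiltonian algebra that extends `BiHamTerm.val`. -/
def valLin (ω : SkewForm I) : FreeBiHam I →ₗ[ℚ] ℚ :=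
  LogCanonical.aug ω ∘ₗ lift fun i => LogCanonical.mon ω {i}

theorem valLin_mono (ω : SkewForm I) (t : BiHamTerm I) : valLin ω (mono t) = t.val ω := by
  simp [valLin, lift_mono, BiHamTerm.eval_mon, LogCanonical.aug_mon]

theorem valLin_zero : valLin (0 : SkewForm I) = Coalgebra.counit := by
  have h : BiHamAlgebra.IsHom (LogCanonical.aug (0 : SkewForm I)) := by
    refine LogCanonical.isHom_of_mon _ fun o d e => ?_
    simp only [LogCanonical.aug_mon]
    cases o with
    | prod => simp only [LogCanonical.coeff]; rfl
    | bracket c => simp only [LogCanonical.coeff, SkewForm.pair_zero_form]; exact zero_smul _ _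
  refine hom_ext (h.comp (isHom_lift _)) (isHom_lift _) fun i => ?_
  change LogCanonical.aug 0 (lift _ (mono _)) = lift _ (mono _)
  simp [lift_mono, BiHamTerm.eval, LogCanonical.aug_mon]

/-- The functionals `valLin ω` behave like exponentials: adding forms amounts to convolution. -/
theorem valLin_add (ω ω' : SkewForm I) :
    valLin (ω + ω') = LinearMap.mul' ℚ ℚ ∘ₗ TensorProduct.map (valLin ω) (valLin ω') ∘ₗ
      Coalgebra.comul := by
  let δ : LogCanonical (ω + ω') →ₗ[ℚ] LogCanonical ω ⊗[ℚ] LogCanonical ω' :=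
    LogCanonical.lin _ fun d => LogCanonical.mon ω d ⊗ₜ LogCanonical.mon ω' d
  have hδ : BiHamAlgebra.IsHom δ := by
    refine LogCanonical.isHom_of_mon _ fun o d e => ?_
    simp only [δ, LogCanonical.lin_mon]
    cases o with
    | prod => simp [LogCanonical.coeff, BiHamAlgebra.op_tmul_prod, LogCanonical.op_mon]
    | bracket c =>
      simp [LogCanonical.coeff, BiHamAlgebra.op_tmul_bracket, LogCanonical.op_mon,
        SkewForm.pair_add_form, add_smul, TensorProduct.smul_tmul']
  have h1 : TensorProduct.map (lift fun i => LogCanonical.mon ω {i})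
      (lift fun i => LogCanonical.mon ω' {i}) ∘ₗ Coalgebra.comul
      = δ ∘ₗ lift fun i => LogCanonical.mon (ω + ω') {i} := by
    refine hom_ext (((isHom_lift _).map (isHom_lift _)).comp (isHom_lift _))
      (hδ.comp (isHom_lift _)) fun i => ?_
    simp only [LinearMap.comp_apply, comul_leaf, lift_mono, BiHamTerm.eval, δ,
      LogCanonical.lin_mon, TensorProduct.map_tmul]
  have h2 : LogCanonical.aug (ω + ω') = LinearMap.mul' ℚ ℚ ∘ₗ
      TensorProduct.map (LogCanonical.aug ω) (LogCanonical.aug ω') ∘ₗ δ := by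
    refine LogCanonical.lin_ext _ fun d => ?_
    simp [δ, LogCanonical.lin_mon, LogCanonical.aug_mon]
  have h3 : TensorProduct.map (valLin ω) (valLin ω') =
      TensorProduct.map (LogCanonical.aug ω) (LogCanonical.aug ω') ∘ₗ
      TensorProduct.map (lift fun i => LogCanonical.mon ω {i})
      (lift fun i => LogCanonical.mon ω' {i}) := by
    rw [← TensorProduct.map_comp]; rfl
  rw [h3, LinearMap.comp_assoc, h1, valLin, h2]
  rfl

theorem isHom_comm {A B : Type*} [AddCommGroup A] [Module ℚ A] [AddCommGroup B] [Module ℚ B]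
    [BiHamAlgebra A] [BiHamAlgebra B] :
    BiHamAlgebra.IsHom (TensorProduct.comm ℚ A B).toLinearMap := by
  refine BiHamAlgebra.isHom_of_tmul fun o a a' b b' => ?_
  cases o with
  | prod => rfl
  | bracket i =>
    simp only [BiHamAlgebra.op_tmul_bracket, map_add, LinearEquiv.coe_coe,
      TensorProduct.comm_tmul]
    abel

theorem comm_comp_comul :
    (TensorProduct.comm ℚ (FreeBiHam I) (FreeBiHam I)).toLinearMap ∘ₗ Coalgebra.comul
      = Coalgebra.comul := by
  refine hom_ext (isHom_comm.comp (isHom_lift _)) (isHom_lift _) fun i => ?_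
  simp only [LinearMap.comp_apply, comul_leaf, LinearEquiv.coe_coe, TensorProduct.comm_tmul]

end FreeBiHam

namespace BiHamOperad

variable {I : Type*} [Fintype I]

instance instIsCocomm : Coalgebra.IsCocomm ℚ (BiHamOperad I) where
  comm_comp_comul := by
    refine LinearMap.ext fun x => incl2_injective I ?_
    have h : incl2 I ∘ₗ (TensorProduct.comm ℚ (BiHamOperad I) (BiHamOperad I)).toLinearMap
        = (TensorProduct.comm ℚ (FreeBiHam I) (FreeBiHam I)).toLinearMap ∘ₗ incl2 I :=
      TensorProduct.ext' fun a b => rfl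
    have e := LinearMap.congr_fun h (Δ I x)
    have e2 := LinearMap.congr_fun (FreeBiHam.comm_comp_comul (I := I)) (incl I x)
    simp only [LinearMap.comp_apply] at e e2
    change incl2 I (TensorProduct.comm ℚ _ _ (Δ I x)) = incl2 I (Δ I x)
    refine e.trans ?_
    rw [show incl2 I (Δ I x) = _ from incl2_Δ I x]
    exact e2

/-- The functional `valLin ω` on multilinear elements. -/
def valConv (ω : SkewForm I) : DualAlgebra I := WithConv.toConv (FreeBiHam.valLin ω ∘ₗ incl I)

theorem valConv_apply (ω : SkewForm I) (x : BiHamOperad I) :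
    (valConv ω).ofConv x = FreeBiHam.valLin ω (incl I x) := rfl

theorem valConv_zero : valConv (0 : SkewForm I) = 1 := by
  rw [valConv, FreeBiHam.valLin_zero]
  rfl

theorem valConv_add (ω ω' : SkewForm I) : valConv (ω + ω') = valConv ω * valConv ω' := by
  refine WithConv.ofConv_injective (LinearMap.ext fun x => ?_)
  rw [valConv_apply, FreeBiHam.valLin_add, LinearMap.comp_apply, LinearMap.comp_apply,
    ← incl2_Δ, LinearMap.convMul_def]
  change _ = LinearMap.mul' ℚ ℚ (TensorProduct.map _ _ (Δ I x))
  congr 1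
  generalize Δ I x = y
  have h : TensorProduct.map (FreeBiHam.valLin ω) (FreeBiHam.valLin ω') ∘ₗ
      TensorProduct.map (incl I) (incl I) = TensorProduct.map (valConv ω).ofConv
        (valConv ω').ofConv := by
    rw [← TensorProduct.map_comp]; rfl
  exact LinearMap.congr_fun h y

end BiHamOperad

/-! ### The homomorphism from the double Orlik–Solomon algebra -/

namespace SkewForm

variable {I : Type*} [DecidableEq I]

/-- The elementary form with entries `r` at `(i, j)` and `-r` at `(j, i)` in the matrix with
label `c` (and the zero form for `i = j`). -/
def single (r : ℚ) (c : Fin 2) (i j : I) : SkewForm I where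
  form c' u v := if c' = c then
    r * ((if u = i ∧ v = j then 1 else 0) - (if u = j ∧ v = i then 1 else 0)) else 0
  skew c' u v := by
    by_cases h : c' = c
    · simp only [h, if_true, and_comm (a := v = i), and_comm (a := v = j)]; ring
    · simp [h]

theorem single_form (r : ℚ) (c : Fin 2) (i j : I) (c' : Fin 2) (u v : I) :
    (single r c i j).form c' u v = if c' = c then
    r * ((if u = i ∧ v = j then 1 else 0) - (if u = j ∧ v = i then 1 else 0)) else 0 := rfl

theorem single_self (r : ℚ) (c : Fin 2) (i : I) : single r c i i = 0 := by
  ext c' u v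
  simp [single_form]

theorem single_swap (r : ℚ) (c : Fin 2) (i j : I) : single r c j i = single (-r) c i j := by
  ext c' u v
  simp only [single_form]
  split_ifs <;> ring

theorem sum_ind (e : Multiset I) (p : Prop) [Decidable p] (j : I) :
    (e.map fun v => if p ∧ v = j then (1 : ℚ) else 0).sum = if p then (e.count j : ℚ) else 0 := by
  by_cases hp : p
  · simp only [hp, true_and, if_true]
    induction e using Multiset.induction with
    | empty => simp
    | cons a e ih =>
      rw [Multiset.map_cons, Multiset.sum_cons, ih, Multiset.count_cons]
      by_cases h : a = j
      · simp [h, add_comm]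
      · simp [h, Ne.symm h]
  · simp [hp]

theorem pair_single (r : ℚ) (c : Fin 2) (i j : I) (c' : Fin 2) (d e : Multiset I) :
    (single r c i j).pair c' d e = if c' = c then
      r * ((d.count i : ℚ) * e.count j - d.count j * e.count i) else 0 := by
  unfold pair
  by_cases h : c' = c
  · have h1 : ∀ (d : Multiset I) (a : I) (x : ℚ),
        (d.map fun u => if u = a then x else 0).sum = d.count a * x := by
      intro d a x
      induction d using Multiset.induction with
      | empty => simp
      | cons b d ih =>
        rw [Multiset.map_cons, Multiset.sum_cons, ih, Multiset.count_cons]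
        by_cases h : b = a
        · simp [h]; ring
        · simp [h, Ne.symm h]
    simp only [single_form, h, if_true, Multiset.sum_map_mul_left, Multiset.sum_map_sub, sum_ind,
      h1]
  · simp [single_form, h]

end SkewForm

namespace BiHamTerm

variable {I : Type*}

theorem val_congr {ω ω' : SkewForm I} {t : BiHamTerm I}
    (h : ∀ c, ∀ i ∈ t.leaves, ∀ j ∈ t.leaves, ω.form c i j = ω'.form c i j) :
    t.val ω = t.val ω' := by
  induction t with
  | leaf i => rfl
  | node o s t hs ht =>
    have hs' := hs fun c i hi j hj => h c i (by simp [leaves, hi]) j (by simp [leaves, hj])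
    have ht' := ht fun c i hi j hj => h c i (by simp [leaves, hi]) j (by simp [leaves, hj])
    cases o with
    | prod => rw [val_prod, val_prod, hs', ht']
    | bracket c =>
      rw [val_bracket, val_bracket, hs', ht', SkewForm.pair_congr c fun i hi j hj =>
        h c i (by simp [leaves, hi]) j (by simp [leaves, hj])]

theorem zero_add_form (ω : SkewForm I) : 0 + ω = ω := by ext; simp

theorem add_comm_form (ω ω' : SkewForm I) : ω + ω' = ω' + ω := by ext; simp [add_comm]

theorem val_bracket_zero (c : Fin 2) (s t : BiHamTerm I) :
    (node (bracket c) s t).val 0 = 0 := by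
  simp [SkewForm.pair_zero_form]

theorem val_swap (o : BiHamOp) :
    ∃ ε : ℚ, ∀ (s t : BiHamTerm I) (ω : SkewForm I),
      (node o s t).val ω = ε * (node o t s).val ω := by
  cases o with
  | prod => exact ⟨1, fun s t ω => by simp [mul_comm]⟩
  | bracket c => exact ⟨-1, fun s t ω => by
      simp only [val_bracket]; rw [ω.pair_skew c s.leaves t.leaves]; ring⟩

/-- The second difference of `val` at `0` in the directions `ω` and `ω'`. -/
def val₂ (ω ω' : SkewForm I) (t : BiHamTerm I) : ℚ :=
  t.val (ω + ω') - t.val ω - t.val ω' + t.val 0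

variable [DecidableEq I]

/-- Elementary forms at pairs that are not both leaves do not matter. -/
theorem val_add_single {ω : SkewForm I} {t : BiHamTerm I} {r : ℚ} {c : Fin 2} {i j : I}
    (h : ¬ (i ∈ t.leaves ∧ j ∈ t.leaves)) : t.val (ω + SkewForm.single r c i j) = t.val ω := by
  refine val_congr fun c' u hu v hv => ?_
  have h1 : ¬ (u = i ∧ v = j) := by rintro ⟨rfl, rfl⟩; exact h ⟨hu, hv⟩
  have h2 : ¬ (u = j ∧ v = i) := by rintro ⟨rfl, rfl⟩; exact h ⟨hv, hu⟩
  simp [SkewForm.single_form, h1, h2]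

theorem val_single_add {ω : SkewForm I} {t : BiHamTerm I} {r : ℚ} {c : Fin 2} {i j : I}
    (h : ¬ (i ∈ t.leaves ∧ j ∈ t.leaves)) : t.val (SkewForm.single r c i j + ω) = t.val ω := by
  rw [add_comm_form, val_add_single h]

theorem val_single {t : BiHamTerm I} {r : ℚ} {c : Fin 2} {i j : I}
    (h : ¬ (i ∈ t.leaves ∧ j ∈ t.leaves)) : t.val (SkewForm.single r c i j) = t.val 0 := by
  rw [← zero_add_form (SkewForm.single r c i j), val_add_single h]

theorem val₂_single_eq_zero_left {ω : SkewForm I} {t : BiHamTerm I} {r : ℚ} {c : Fin 2} {i j : I}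
    (h : ¬ (i ∈ t.leaves ∧ j ∈ t.leaves)) : t.val₂ (SkewForm.single r c i j) ω = 0 := by
  rw [val₂, val_single h, val_single_add h]; ring

theorem val₂_single_eq_zero_right {ω : SkewForm I} {t : BiHamTerm I} {r : ℚ} {c : Fin 2} {i j : I}
    (h : ¬ (i ∈ t.leaves ∧ j ∈ t.leaves)) : t.val₂ ω (SkewForm.single r c i j) = 0 := by
  rw [val₂, val_single h, val_add_single h]; ring

/-- On multilinear monomials, `val` is affine in the direction of an elementary form. -/
theorem val_single_smul {t : BiHamTerm I} (ht : t.leaves.Nodup) (r : ℚ) (c : Fin 2) (i j : I) :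
    t.val (SkewForm.single r c i j) - t.val 0
      = r * (t.val (SkewForm.single 1 c i j) - t.val 0) := by
  induction t with
  | leaf i => simp
  | node o s t hs ht' =>
    have hn := Multiset.nodup_add.1 ht
    have hs := hs hn.1
    have ht' := ht' hn.2.1
    have key : t.val (SkewForm.single r c i j) = t.val 0 ∧ t.val (SkewForm.single 1 c i j) = t.val 0
        ∨ s.val (SkewForm.single r c i j) = s.val 0 ∧
          s.val (SkewForm.single 1 c i j) = s.val 0 := by
      by_cases h : i ∈ s.leaves
      · have : i ∉ t.leaves := fun h' => Multiset.disjoint_left.1 hn.2.2 h h'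
        exact Or.inl ⟨val_single (by tauto), val_single (by tauto)⟩
      · exact Or.inr ⟨val_single (by tauto), val_single (by tauto)⟩
    cases o with
    | prod =>
      simp only [val_prod]
      rcases key with ⟨h1, h2⟩ | ⟨h1, h2⟩
      · rw [h1, h2]; linear_combination t.val 0 * hs
      · rw [h1, h2]; linear_combination s.val 0 * ht'
    | bracket c' =>
      rw [val_bracket_zero, val_bracket, val_bracket, SkewForm.pair_single, SkewForm.pair_single]
      by_cases hij : i ∈ s.leaves ∧ j ∈ s.leaves ∨ ¬ (i ∈ s.leaves ∧ j ∈ s.leaves) ∧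
          (i ∈ t.leaves ∧ j ∈ t.leaves)
      · have h0 : (s.leaves.count i : ℚ) * t.leaves.count j
            - s.leaves.count j * t.leaves.count i = 0 := by
          rcases hij with ⟨h1, h2⟩ | ⟨-, h1, h2⟩
          · have e1 : i ∉ t.leaves := fun h' => Multiset.disjoint_left.1 hn.2.2 h1 h'
            have e2 : j ∉ t.leaves := fun h' => Multiset.disjoint_left.1 hn.2.2 h2 h'
            simp [e1, e2]
          · have e1 : i ∉ s.leaves := fun h' => Multiset.disjoint_left.1 hn.2.2 h' h1
            have e2 : j ∉ s.leaves := fun h' => Multiset.disjoint_left.1 hn.2.2 h' h2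
            simp [e1, e2]
        rw [h0]; simp
      · have e1 : ¬ (i ∈ s.leaves ∧ j ∈ s.leaves) := fun h => hij (Or.inl h)
        have e2 : ¬ (i ∈ t.leaves ∧ j ∈ t.leaves) := fun h => hij (Or.inr ⟨e1, h⟩)
        rw [val_single e1, val_single e1, val_single e2, val_single e2]
        split_ifs <;> ring

theorem val₂_square {t : BiHamTerm I} (ht : t.leaves.Nodup) (a b : Fin 2) (i j : I) :
    t.val₂ (SkewForm.single 1 a i j) (SkewForm.single 1 b i j) = 0 := by
  induction t with
  | leaf i => simp [val₂]
  | node o s t hs ht' =>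
    have hn := Multiset.nodup_add.1 ht
    have hs := hs hn.1
    have ht' := ht' hn.2.1
    unfold val₂ at hs ht' ⊢
    have D : ∀ x ∈ s.leaves, x ∉ t.leaves := fun x hx => Multiset.disjoint_left.1 hn.2.2 hx
    by_cases h1 : i ∈ s.leaves ∧ j ∈ s.leaves
    · have e1 : i ∉ t.leaves := D _ h1.1
      have e2 : j ∉ t.leaves := D _ h1.2
      cases o with
      | prod =>
        simp only [val_prod]
        rw [val_single_add (t := t) (by tauto), val_single (t := t) (by tauto),
          val_single (t := t) (by tauto)]
        linear_combination t.val 0 * hs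
      | bracket c =>
        simp only [val_bracket, SkewForm.pair_add_form, SkewForm.pair_single,
          SkewForm.pair_zero_form]
        simp [e1, e2]
    · by_cases h2 : i ∈ t.leaves ∧ j ∈ t.leaves
      · have e1 : i ∉ s.leaves := fun h => D _ h h2.1
        have e2 : j ∉ s.leaves := fun h => D _ h h2.2
        cases o with
        | prod =>
          simp only [val_prod]
          rw [val_single_add (t := s) (by tauto), val_single (t := s) (by tauto),
            val_single (t := s) (by tauto)]
          linear_combination s.val 0 * ht'
        | bracket c =>
          simp only [val_bracket, SkewForm.pair_add_form, SkewForm.pair_single,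
            SkewForm.pair_zero_form]
          simp [e1, e2]
      · cases o with
        | prod =>
          simp only [val_prod]
          rw [val_single_add h1, val_single h1, val_single h1, val_single_add h2, val_single h2,
            val_single h2]
          ring
        | bracket c =>
          simp only [val_bracket, SkewForm.pair_add_form, SkewForm.pair_zero_form]
          rw [val_single_add h1, val_single h1, val_single h1, val_single_add h2, val_single h2,
            val_single h2]
          ring

/-- The functional of the polarised three-term relation. -/
def arnold (a b : Fin 2) (i j k : I) (t : BiHamTerm I) : ℚ :=
  t.val₂ (.single 1 a i j) (.single 1 b j k) + t.val₂ (.single 1 a j k) (.single 1 b k i)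
    + t.val₂ (.single 1 a k i) (.single 1 b i j)
    + (t.val₂ (.single 1 b i j) (.single 1 a j k) + t.val₂ (.single 1 b j k) (.single 1 a k i)
    + t.val₂ (.single 1 b k i) (.single 1 a i j))

theorem arnold_cyclic (a b : Fin 2) (i j k : I) (t : BiHamTerm I) :
    arnold a b j k i t = arnold a b i j k t := by
  unfold arnold; ring

/-- The case in which two of the three leaves are on the left. -/
theorem arnold_split (a b : Fin 2) {i j k : I} {o : BiHamOp} {s t : BiHamTerm I}
    (hn : (s.leaves + t.leaves).Nodup) (hi : i ∈ s.leaves) (hj : j ∈ s.leaves)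
    (hk : k ∈ t.leaves) : arnold a b i j k (node o s t) = 0 := by
  have hn := Multiset.nodup_add.1 hn
  have D : ∀ x ∈ s.leaves, x ∉ t.leaves := fun x hx => Multiset.disjoint_left.1 hn.2.2 hx
  have i' := D _ hi
  have j' := D _ hj
  have k' : k ∉ s.leaves := fun h => D _ h hk
  have ci := Multiset.count_eq_one_of_mem hn.1 hi
  have cj := Multiset.count_eq_one_of_mem hn.1 hj
  have ck := Multiset.count_eq_one_of_mem hn.2.1 hk
  have v1 : ∀ (c : Fin 2), s.val (.single 1 c j k) = s.val 0 := fun c => val_single (by tauto)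
  have v2 : ∀ (c : Fin 2), s.val (.single 1 c k i) = s.val 0 := fun c => val_single (by tauto)
  have v3 : ∀ (c : Fin 2) ω, s.val (.single 1 c j k + ω) = s.val ω :=
    fun c ω => val_single_add (by tauto)
  have v4 : ∀ (c : Fin 2) ω, s.val (.single 1 c k i + ω) = s.val ω :=
    fun c ω => val_single_add (by tauto)
  have v5 : ∀ (c : Fin 2) ω, s.val (ω + .single 1 c j k) = s.val ω :=
    fun c ω => val_add_single (by tauto)
  have w1 : ∀ (c : Fin 2), t.val (.single 1 c j k) = t.val 0 := fun c => val_single (by tauto)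
  have w2 : ∀ (c : Fin 2), t.val (.single 1 c k i) = t.val 0 := fun c => val_single (by tauto)
  have w3 : ∀ (c : Fin 2) ω, t.val (.single 1 c j k + ω) = t.val ω :=
    fun c ω => val_single_add (by tauto)
  have w4 : ∀ (c : Fin 2) ω, t.val (.single 1 c k i + ω) = t.val ω :=
    fun c ω => val_single_add (by tauto)
  have w5 : ∀ (c : Fin 2) ω, t.val (.single 1 c i j + ω) = t.val ω :=
    fun c ω => val_single_add (by tauto)
  have w6 : ∀ (c : Fin 2), t.val (.single 1 c i j) = t.val 0 := fun c => val_single (by tauto)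
  unfold arnold val₂
  cases o with
  | prod =>
    simp only [val_prod, v1, v2, v3, v4, v5, w1, w2, w3, w4, w5, w6]
    ring
  | bracket c =>
    simp only [val_bracket, v1, v2, v3, v4, v5, w1, w2, w3, w4, w5, w6, SkewForm.pair_add_form,
      SkewForm.pair_single, SkewForm.pair_zero_form, ci, cj, ck,
      Multiset.count_eq_zero_of_notMem i', Multiset.count_eq_zero_of_notMem j',
      Multiset.count_eq_zero_of_notMem k']
    split_ifs <;> push_cast <;> ring

theorem arnold_swap (a b : Fin 2) {i j k : I} {o : BiHamOp} {s t : BiHamTerm I}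
    (h : arnold a b i j k (node o t s) = 0) : arnold a b i j k (node o s t) = 0 := by
  obtain ⟨ε, hε⟩ := val_swap (I := I) o
  unfold arnold val₂ at h ⊢
  simp only [hε s t]
  linear_combination ε * h

/-- If all three leaves are on the left, the relation reduces to the left argument. -/
theorem arnold_left (a b : Fin 2) {i j k : I} {o : BiHamOp} {s t : BiHamTerm I}
    (hn : (s.leaves + t.leaves).Nodup) (hi : i ∈ s.leaves) (hj : j ∈ s.leaves)
    (hk : k ∈ s.leaves) (h : arnold a b i j k s = 0) : arnold a b i j k (node o s t) = 0 := by
  have hn := Multiset.nodup_add.1 hn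
  have D : ∀ x ∈ s.leaves, x ∉ t.leaves := fun x hx => Multiset.disjoint_left.1 hn.2.2 hx
  have i' := D _ hi
  have j' := D _ hj
  have k' := D _ hk
  have w1 : ∀ (c : Fin 2), t.val (.single 1 c j k) = t.val 0 := fun c => val_single (by tauto)
  have w2 : ∀ (c : Fin 2), t.val (.single 1 c k i) = t.val 0 := fun c => val_single (by tauto)
  have w3 : ∀ (c : Fin 2) ω, t.val (.single 1 c j k + ω) = t.val ω :=
    fun c ω => val_single_add (by tauto)
  have w4 : ∀ (c : Fin 2) ω, t.val (.single 1 c k i + ω) = t.val ω :=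
    fun c ω => val_single_add (by tauto)
  have w5 : ∀ (c : Fin 2) ω, t.val (.single 1 c i j + ω) = t.val ω :=
    fun c ω => val_single_add (by tauto)
  have w6 : ∀ (c : Fin 2), t.val (.single 1 c i j) = t.val 0 := fun c => val_single (by tauto)
  unfold arnold val₂ at h ⊢
  cases o with
  | prod =>
    simp only [val_prod, w1, w2, w3, w4, w5, w6]
    linear_combination t.val 0 * h
  | bracket c =>
    simp only [val_bracket, SkewForm.pair_add_form,
      SkewForm.pair_single, SkewForm.pair_zero_form,
      Multiset.count_eq_zero_of_notMem i', Multiset.count_eq_zero_of_notMem j',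
      Multiset.count_eq_zero_of_notMem k']
    simp

theorem arnold_eq_zero {t : BiHamTerm I} (ht : t.leaves.Nodup) (a b : Fin 2) {i j k : I}
    (hij : i ≠ j) : arnold a b i j k t = 0 := by
  have outside : ∀ t : BiHamTerm I, ¬ (i ∈ t.leaves ∧ j ∈ t.leaves ∧ k ∈ t.leaves) →
      arnold a b i j k t = 0 := by
    intro t h
    unfold arnold
    have h2 : ∀ c c' : Fin 2, t.val₂ (.single 1 c i j) (.single 1 c' j k) = 0 := by
      intro c c'
      by_cases h' : i ∈ t.leaves ∧ j ∈ t.leaves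
      · exact val₂_single_eq_zero_right (by tauto)
      · exact val₂_single_eq_zero_left h'
    have h3 : ∀ c c' : Fin 2, t.val₂ (.single 1 c j k) (.single 1 c' k i) = 0 := by
      intro c c'
      by_cases h' : j ∈ t.leaves ∧ k ∈ t.leaves
      · exact val₂_single_eq_zero_right (by tauto)
      · exact val₂_single_eq_zero_left h'
    have h4 : ∀ c c' : Fin 2, t.val₂ (.single 1 c k i) (.single 1 c' i j) = 0 := by
      intro c c'
      by_cases h' : k ∈ t.leaves ∧ i ∈ t.leaves
      · exact val₂_single_eq_zero_right (by tauto)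
      · exact val₂_single_eq_zero_left h'
    simp [h2, h3, h4]
  induction t with
  | leaf u =>
    refine outside _ ?_
    simp only [leaves, Multiset.mem_singleton]
    rintro ⟨rfl, rfl, -⟩
    exact hij rfl
  | node o s t hs ht' =>
    by_cases h : i ∈ (node o s t).leaves ∧ j ∈ (node o s t).leaves ∧ k ∈ (node o s t).leaves
    · simp only [leaves, Multiset.mem_add] at h
      have hn : (s.leaves + t.leaves).Nodup := ht
      have hn' : (t.leaves + s.leaves).Nodup := by rwa [add_comm]
      have hs := hs (Multiset.nodup_add.1 hn).1
      have ht' := ht' (Multiset.nodup_add.1 hn).2.1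
      obtain ⟨hi | hi, hj | hj, hk | hk⟩ := h
      · exact arnold_left a b hn hi hj hk hs
      · exact arnold_split a b hn hi hj hk
      · rw [← arnold_cyclic, ← arnold_cyclic]
        exact arnold_split a b hn hk hi hj
      · rw [← arnold_cyclic]
        exact arnold_swap a b (arnold_split a b hn' hj hk hi)
      · rw [← arnold_cyclic]
        exact arnold_split a b hn hj hk hi
      · rw [← arnold_cyclic, ← arnold_cyclic]
        exact arnold_swap a b (arnold_split a b hn' hk hi hj)
      · exact arnold_swap a b (arnold_split a b hn' hi hj hk)
      · exact arnold_swap a b (arnold_left a b hn' hi hj hk ht')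
    · exact outside _ h

end BiHamTerm

namespace BiHamOperad

variable {I : Type*} [Fintype I]

/-- The class of a monomial that contains each generator exactly once. -/
def mono (t : BiHamTerm I) (h : t.leaves = Finset.univ.val) : BiHamOperad I :=
  ⟨FreeBiHam.mono t, Submodule.subset_span ⟨t, h, rfl⟩⟩

theorem incl_mono (t : BiHamTerm I) (h : t.leaves = Finset.univ.val) :
    incl I (mono t h) = FreeBiHam.mono t := rfl

theorem span_mono : Submodule.span ℚ {x : BiHamOperad I | ∃ t h, mono t h = x} = ⊤ := by
  rw [eq_top_iff]
  rintro ⟨x, hx⟩ -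
  have : ∀ y (hy : y ∈ FreeBiHam.component (Finset.univ.val : Multiset I)),
      (⟨y, hy⟩ : BiHamOperad I) ∈ Submodule.span ℚ {x : BiHamOperad I | ∃ t h, mono t h = x} := by
    intro y hy
    induction hy using Submodule.span_induction with
    | zero => exact Submodule.zero_mem _
    | add x y hx hy hx' hy' => exact Submodule.add_mem _ hx' hy'
    | smul c x hx hx' => exact Submodule.smul_mem _ c hx'
    | mem x hx =>
      obtain ⟨t, ht, rfl⟩ := hx
      exact Submodule.subset_span ⟨t, ht, rfl⟩
  exact this x hx

theorem nodup_of_leaves {t : BiHamTerm I} (h : t.leaves = Finset.univ.val) : t.leaves.Nodup := by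
  rw [h]; exact Finset.univ.nodup

theorem dual_ext {f g : DualAlgebra I} (h : ∀ t ht, f.ofConv (mono t ht) = g.ofConv (mono t ht)) :
    f = g := by
  refine WithConv.ofConv_injective (LinearMap.ext_on_range (v := fun p :
    {t : BiHamTerm I // t.leaves = Finset.univ.val} => mono p.1 p.2) ?_ fun p => h p.1 p.2)
  rw [← span_mono (I := I)]
  congr 1
  ext x
  simp

theorem valConv_mono (ω : SkewForm I) (t : BiHamTerm I) (h : t.leaves = Finset.univ.val) :
    (valConv ω).ofConv (mono t h) = t.val ω := by
  rw [valConv_apply, incl_mono, FreeBiHam.valLin_mono]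

theorem one_mono (t : BiHamTerm I) (h : t.leaves = Finset.univ.val) :
    (1 : DualAlgebra I).ofConv (mono t h) = t.val 0 := by
  rw [← valConv_zero, valConv_mono]

variable [DecidableEq I]

/-- The image of a generator of the double Orlik–Solomon algebra: the derivative of `valConv` at
`0` in an elementary direction. It takes the value `1` on the monomials whose only bracket is
`{aᵢ, aⱼ}_c`. -/
def gen (c : Fin 2) (i j : I) : DualAlgebra I := valConv (.single 1 c i j) - 1

theorem gen_mono (c : Fin 2) (i j : I) (t : BiHamTerm I) (h : t.leaves = Finset.univ.val) :
    (gen c i j).ofConv (mono t h) = t.val (.single 1 c i j) - t.val 0 := by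
  rw [gen, ← valConv_mono _ t h, ← one_mono t h]
  rfl

theorem gen_mul_mono (c c' : Fin 2) (i j i' j' : I) (t : BiHamTerm I)
    (h : t.leaves = Finset.univ.val) :
    (gen c i j * gen c' i' j').ofConv (mono t h)
      = t.val₂ (.single 1 c i j) (.single 1 c' i' j') := by
  have e : gen c i j * gen c' i' j' = valConv (.single 1 c i j + .single 1 c' i' j')
      - valConv (.single 1 c i j) - valConv (.single 1 c' i' j') + 1 := by
    rw [valConv_add, gen, gen]; ring
  rw [e, BiHamTerm.val₂, ← valConv_mono _ t h, ← one_mono t h, ← valConv_mono _ t h,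
    ← valConv_mono _ t h]
  rfl

theorem valConv_single (r : ℚ) (c : Fin 2) (i j : I) :
    valConv (.single r c i j) = 1 + r • gen c i j := by
  refine dual_ext fun t ht => ?_
  have e : (1 + r • gen c i j).ofConv (mono t ht)
    = (1 : DualAlgebra I).ofConv (mono t ht) + r * (gen c i j).ofConv (mono t ht) := rfl
  rw [e, valConv_mono, one_mono, gen_mono,
    ← BiHamTerm.val_single_smul (nodup_of_leaves ht)]
  ring

theorem gen_swap (c : Fin 2) (i j : I) : gen c i j + gen c j i = 0 := by
  rw [show gen c j i = valConv (.single 1 c j i) - 1 from rfl, SkewForm.single_swap,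
    valConv_single]
  simp

theorem gen_square (c c' : Fin 2) (i j : I) : gen c i j * gen c' i j = 0 := by
  refine dual_ext fun t ht => ?_
  rw [gen_mul_mono, BiHamTerm.val₂_square (nodup_of_leaves ht)]
  rfl

theorem gen_arnold (a b : Fin 2) {i j k : I} (hij : i ≠ j) :
    gen a i j * gen b j k + gen a j k * gen b k i + gen a k i * gen b i j +
    (gen b i j * gen a j k + gen b j k * gen a k i + gen b k i * gen a i j) = 0 := by
  refine dual_ext fun t ht => ?_
  have h := BiHamTerm.arnold_eq_zero (nodup_of_leaves ht) a b (k := k) hij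
  unfold BiHamTerm.arnold at h
  simp only [← gen_mul_mono _ _ _ _ _ _ t ht] at h
  exact h

/-- The homomorphism from the double Orlik–Solomon algebra to the dual of the component of the
bi-Hamiltonian operad. -/
def ofDoubleOS (I : Type*) [Fintype I] [DecidableEq I] : DoubleOS I →ₐ[ℚ] DualAlgebra I :=
  Ideal.Quotient.liftₐ _
    (MvPolynomial.aeval fun g : DoubleOS.Gen I => gen g.1 g.2.1.1 g.2.1.2) (by
    intro a ha
    have : Ideal.span {r | DoubleOS.Rel I r} ≤ RingHom.ker (MvPolynomial.aeval (R := ℚ)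
        fun g : DoubleOS.Gen I => gen g.1 g.2.1.1 g.2.1.2) := by
      rw [Ideal.span_le]
      intro r hr
      rw [SetLike.mem_coe, RingHom.mem_ker]
      cases hr with
      | skew c i j h => simpa [DoubleOS.var] using gen_swap c i j
      | square c c' i j h => simpa [DoubleOS.var] using gen_square c c' i j
      | three_term c i j k hij hjk hki =>
        have := gen_arnold c c hij (k := k)
        simp only [DoubleOS.var, map_add, map_mul, MvPolynomial.aeval_X]
        rw [← two_smul ℚ, smul_eq_zero] at this
        exact this.resolve_left two_ne_zero
      | six_term i j k hij hjk hki =>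
        have := gen_arnold 0 1 hij (k := k)
        simp only [DoubleOS.var, map_add, map_mul, MvPolynomial.aeval_X]
        rw [← this]; ring
    exact this ha)

theorem ofDoubleOS_gen (g : DoubleOS.Gen I) :
    ofDoubleOS I (Ideal.Quotient.mk _ (MvPolynomial.X g)) = gen g.1 g.2.1.1 g.2.1.2 := by
  refine (Ideal.Quotient.lift_mk _ _ _).trans ?_
  exact MvPolynomial.aeval_X _ g

/-- The functionals `valConv ω` are in the image of the double Orlik–Solomon algebra: they are the
images of the exponentials `∏ (1 + ω_c(i, j) z_c(i, j))`. -/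
theorem valConv_mem_range (ω : SkewForm I) : valConv ω ∈ (ofDoubleOS I).range := by
  have hgen : ∀ c (i j : I), gen c i j ∈ (ofDoubleOS I).range := by
    intro c i j
    by_cases h : i = j
    · subst h
      rw [gen, SkewForm.single_self, valConv_zero, sub_self]
      exact zero_mem _
    · exact ⟨_, ofDoubleOS_gen (c, ⟨(i, j), h⟩)⟩
  let sum : List (Fin 2 × I × I) → SkewForm I := fun L =>
    L.foldr (fun g η => .single (ω.form g.1 g.2.1 g.2.2 / 2) g.1 g.2.1 g.2.2 + η) 0
  have h1 : ∀ L, valConv (sum L) ∈ (ofDoubleOS I).range := by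
    intro L
    induction L with
    | nil => rw [show sum [] = 0 from rfl, valConv_zero]; exact one_mem _
    | cons g L ih =>
      rw [show sum (g :: L) = _ + sum L from rfl, valConv_add, valConv_single]
      exact mul_mem (add_mem (one_mem _) (Subalgebra.smul_mem _ (hgen _ _ _) _)) ih
  have h2 : ∀ L c u v, (sum L).form c u v = (L.map fun g =>
      (SkewForm.single (ω.form g.1 g.2.1 g.2.2 / 2) g.1 g.2.1 g.2.2).form c u v).sum := by
    intro L c u v
    induction L with
    | nil => rfl
    | cons g L ih => rw [List.map_cons, List.sum_cons, ← ih]; rfl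
  have h3 : sum Finset.univ.toList = ω := by
    ext c u v
    rw [h2, Finset.sum_map_toList, Fintype.sum_prod_type]
    simp only [SkewForm.single_form, Fintype.sum_prod_type, Finset.sum_ite_irrel]
    simp only [Finset.sum_const_zero, Finset.sum_ite_eq, Finset.mem_univ, if_true, mul_sub,
      Finset.sum_sub_distrib, ite_and, mul_ite, mul_one, mul_zero, Finset.sum_ite_irrel]
    rw [ω.skew c v u]
    ring
  rw [← h3]
  exact h1 _

end BiHamOperad

/-! ### Normal monomials -/

namespace BiHamTerm

variable {I : Type*}

/-- The monomial `{j, t}₁` (with the bracket labelled `0`). -/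
abbrev ext (j : I) (t : BiHamTerm I) : BiHamTerm I := node (bracket 0) (leaf j) t

/-- The monomial `{t, b}₂` (with the bracket labelled `1`). -/
abbrev join (t b : BiHamTerm I) : BiHamTerm I := node (bracket 1) t b

/-- The head of a normal monomial: the innermost leaf, from which `t` is obtained by the operations
`{j, · }₁`, `{ · , b}₂` and ` · ⋆ f`. -/
def hd : BiHamTerm I → I
  | leaf i => i
  | node prod s _ => hd s
  | node (bracket c) s t => if c = 0 then hd t else hd s

/-- The leftmost leaf. In the tree of a normal monomial, this is the end of the maximal `x`-chain
that starts at the head. -/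
def top : BiHamTerm I → I
  | leaf i => i
  | node _ s _ => top s

/-- The end of the maximal `y`-chain that starts at `top t`, for normal monomials `t`. -/
def last : BiHamTerm I → I
  | leaf i => i
  | node prod s _ => top s
  | node (bracket c) s t => if c = 0 then top s else top t

@[simp] theorem hd_leaf (i : I) : hd (leaf i) = i := rfl
@[simp] theorem hd_ext (j : I) (t : BiHamTerm I) : hd (ext j t) = hd t := rfl
@[simp] theorem hd_join (t b : BiHamTerm I) : hd (join t b) = hd t := rfl
@[simp] theorem hd_prod (t f : BiHamTerm I) : hd (node prod t f) = hd t := rfl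
@[simp] theorem top_leaf (i : I) : top (leaf i) = i := rfl
@[simp] theorem top_node (o : BiHamOp) (s t : BiHamTerm I) : top (node o s t) = top s := rfl
@[simp] theorem last_leaf (i : I) : last (leaf i) = i := rfl
@[simp] theorem last_ext (j : I) (t : BiHamTerm I) : last (ext j t) = j := rfl
@[simp] theorem last_join (t b : BiHamTerm I) : last (join t b) = top b := rfl
@[simp] theorem leaves_leaf (i : I) : leaves (leaf i) = {i} := rfl
@[simp] theorem leaves_node (o : BiHamOp) (s t : BiHamTerm I) :
    leaves (node o s t) = s.leaves + t.leaves := rfl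

theorem hd_mem (t : BiHamTerm I) : t.hd ∈ t.leaves := by
  induction t with
  | leaf i => simp
  | node o s t hs ht =>
    rcases o with _ | c
    · simp [hs]
    · by_cases h : c = 0 <;> simp [hd, h, hs, ht]

theorem top_mem (t : BiHamTerm I) : t.top ∈ t.leaves := by
  induction t with
  | leaf i => simp
  | node o s t hs ht => simp [hs]

theorem last_mem (t : BiHamTerm I) : t.last ∈ t.leaves := by
  cases t with
  | leaf i => simp
  | node o s t =>
    rcases o with _ | c
    · simp [last, top_mem]
    · by_cases h : c = 0 <;> simp [last, h, top_mem]

theorem leaves_ne_zero (t : BiHamTerm I) : t.leaves ≠ 0 := fun h => by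
  have := hd_mem t
  simp [h] at this

theorem card_leaves_pos (t : BiHamTerm I) : 0 < t.leaves.card :=
  Multiset.card_pos.2 t.leaves_ne_zero

/-- Single letters and the monomials `{j, t}₁`. -/
inductive IsBlock : BiHamTerm I → Prop
  | leaf (i : I) : IsBlock (leaf i)
  | ext (j : I) (t : BiHamTerm I) : IsBlock (ext j t)

variable [LinearOrder I]

/-- The head is the largest leaf. -/
def HdMax (t : BiHamTerm I) : Prop := ∀ x ∈ t.leaves, x ≤ t.hd

/-- Monomials obtained from their head by the operations `{j, · }₁` and `{ · , b}₂`, where the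
`b` are blocks of the same kind whose head is their largest leaf. -/
inductive IsTree : BiHamTerm I → Prop
  | leaf (i : I) : IsTree (leaf i)
  | ext (j : I) (t : BiHamTerm I) : IsTree t → IsTree (ext j t)
  | join (t b : BiHamTerm I) : IsTree t → IsBlock b → IsTree b → HdMax b → IsTree (join t b)

/-- Normal monomials without products. -/
def IsNormalTree (t : BiHamTerm I) : Prop := IsTree t ∧ HdMax t

/-- Normal monomials: products of normal trees, with decreasing heads. -/
inductive IsForest : BiHamTerm I → Prop
  | tree (t : BiHamTerm I) : IsNormalTree t → IsForest t
  | prod (t f : BiHamTerm I) : IsNormalTree t → IsForest f → (∀ x ∈ f.leaves, x ≤ t.hd) →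
      IsForest (node prod t f)

theorem HdMax.of_ext {j : I} {t : BiHamTerm I} (h : HdMax (ext j t)) : HdMax t ∧ j ≤ t.hd :=
  ⟨fun x hx => h x (by simp [hx]), h j (by simp)⟩

theorem HdMax.of_join {t b : BiHamTerm I} (h : HdMax (join t b)) :
    HdMax t ∧ ∀ x ∈ b.leaves, x ≤ t.hd :=
  ⟨fun x hx => h x (by simp [hx]), fun x hx => h x (by simp [hx])⟩

theorem IsForest.hdMax {f : BiHamTerm I} (h : IsForest f) : HdMax f := by
  cases h with
  | tree t h => exact h.2
  | prod t f ht hf hle =>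
    intro x hx
    rcases Multiset.mem_add.1 hx with hx | hx
    · exact ht.2 x hx
    · exact hle x hx

/-- The head of a normal monomial depends on its leaves only. -/
theorem HdMax.hd_eq {s t : BiHamTerm I} (hs : HdMax s) (ht : HdMax t) (h : s.leaves = t.leaves) :
    s.hd = t.hd :=
  le_antisymm (ht _ (h ▸ s.hd_mem)) (hs _ (h ▸ t.hd_mem))

end BiHamTerm

/-! ### Normal monomials span the operad -/

theorem bilin_mem_of_span {U V W : Type*} [AddCommGroup U] [AddCommGroup V] [AddCommGroup W]
    [Module ℚ U] [Module ℚ V] [Module ℚ W] (f : U →ₗ[ℚ] V →ₗ[ℚ] W) {S : Set U} {T : Set V}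
    {P : Submodule ℚ W} (h : ∀ s ∈ S, ∀ t ∈ T, f s t ∈ P) {x : U} {y : V}
    (hx : x ∈ Submodule.span ℚ S) (hy : y ∈ Submodule.span ℚ T) : f x y ∈ P := by
  have h1 : Submodule.map₂ f (Submodule.span ℚ S) (Submodule.span ℚ T) ≤ P := by
    rw [Submodule.map₂_span_span, Submodule.span_le]
    rintro _ ⟨s, hs, t, ht, rfl⟩
    exact h s hs t ht
  exact h1 (Submodule.apply_mem_map₂ f hx hy)

namespace BiHamAlgebra

open BiHamTerm

variable {I : Type*} {A : Type*} [AddCommGroup A] [Module ℚ A] [BiHamAlgebra A] (a : I → A)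

theorem eval_node (o : BiHamOp) (s t : BiHamTerm I) :
    eval a (node o s t) = op o (eval a s) (eval a t) := rfl

variable [LinearOrder I]

/-- The span of the normal trees with leaves `d`. -/
def treeSpan (d : Multiset I) : Submodule ℚ A :=
  Submodule.span ℚ {x | ∃ t, IsNormalTree t ∧ t.leaves = d ∧ eval a t = x}

/-- The span of the normal monomials with leaves `d`. -/
def forestSpan (d : Multiset I) : Submodule ℚ A :=
  Submodule.span ℚ {x | ∃ t, IsForest t ∧ t.leaves = d ∧ eval a t = x}

theorem eval_mem_treeSpan {t : BiHamTerm I} (h : IsNormalTree t) {d : Multiset I}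
    (hd : t.leaves = d) : eval a t ∈ treeSpan a d :=
  Submodule.subset_span ⟨t, h, hd, rfl⟩

theorem eval_mem_forestSpan {t : BiHamTerm I} (h : IsForest t) {d : Multiset I}
    (hd : t.leaves = d) : eval a t ∈ forestSpan a d :=
  Submodule.subset_span ⟨t, h, hd, rfl⟩

theorem treeSpan_le (d : Multiset I) : treeSpan a d ≤ forestSpan a d := by
  refine Submodule.span_mono ?_
  rintro _ ⟨t, ht, h, rfl⟩
  exact ⟨t, .tree t ht, h, rfl⟩

/-- The brackets of normal trees `u` and `s` are combinations of normal trees. The largest letter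
occurs in `s`; the proof is by induction on the size of `u`. If `{s, u}₂` or `{u, s}₁` is not itself
normal, then `u` is a bracket, and the Jacobi identities and the compatibility of the two brackets
move its two arguments to `s` one after the other. -/
theorem bracket_mem_treeSpan_of_lt (n : ℕ) : ∀ (d e : Multiset I), d.card ≤ n → (d + e).Nodup →
    (∀ x ∈ d, ∃ y ∈ e, x < y) → ∀ (c : Fin 2), ∀ x ∈ treeSpan a d, ∀ y ∈ treeSpan a e,
      op (bracket c) x y ∈ treeSpan a (d + e) := by
  induction n with
  | zero =>
    intro d e hd hn hlt c x hx
    have h0 : d = 0 := Multiset.card_eq_zero.1 (by omega)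
    have : treeSpan a d = (⊥ : Submodule ℚ A) := by
      refine Submodule.span_eq_bot.2 ?_
      rintro _ ⟨t, -, ht, rfl⟩
      exact absurd (ht.trans h0) t.leaves_ne_zero
    rw [this, Submodule.mem_bot] at hx
    simp [hx]
  | succ n ih =>
    -- membership in nested brackets with two smaller left arguments
    have nest : ∀ (d d' e : Multiset I) (c c' : Fin 2) (x y z : A), d.card ≤ n →
        d'.card ≤ n → (d + d' + e).Nodup → (∀ x ∈ d, ∃ y ∈ e, x < y) →
        (∀ x ∈ d', ∃ y ∈ e, x < y) → x ∈ treeSpan a d → y ∈ treeSpan a d' → z ∈ treeSpan a e →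
        op (bracket c) x (op (bracket c') y z) ∈ treeSpan a (d + d' + e) := by
      intro d d' e c c' x y z hd hd' hn hlt hlt' hx hy hz
      rw [add_assoc] at hn ⊢
      refine ih d (d' + e) hd hn (fun x hx => ?_) c x hx _
        (ih d' e hd' (Multiset.nodup_add.1 hn).2.1 hlt' c' y hy z hz)
      obtain ⟨y, hy, h⟩ := hlt x hx
      exact ⟨y, by simp [hy], h⟩
    have flip : ∀ (c : Fin 2) (x y : A) (P : Submodule ℚ A),
        op (bracket c) y x ∈ P → op (bracket c) x y ∈ P := by
      intro c x y P h
      rw [BiHamAlgebra.skew]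
      exact P.neg_mem h
    -- the second bracket
    have h1 : ∀ u s : BiHamTerm I, u.leaves.card ≤ n + 1 → (u.leaves + s.leaves).Nodup →
        (∀ x ∈ u.leaves, ∃ y ∈ s.leaves, x < y) → IsNormalTree u → IsNormalTree s →
        op (bracket 1) (eval a u) (eval a s) ∈ treeSpan a (u.leaves + s.leaves) := by
      intro u s hc hn hlt hu hs
      have block : IsBlock u →
          op (bracket 1) (eval a u) (eval a s) ∈ treeSpan a (u.leaves + s.leaves) := by
        intro hb
        refine flip _ _ _ _ ?_
        rw [← eval_node, add_comm]
        refine eval_mem_treeSpan a ⟨.join s u hs.1 hb hu.1 hu.2, fun x hx => ?_⟩ rfl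
        rcases Multiset.mem_add.1 hx with hx | hx
        · exact hs.2 x hx
        · obtain ⟨y, hy, h⟩ := hlt x hx
          exact h.le.trans (hs.2 y hy)
      obtain ⟨hu1, hu2⟩ := hu
      cases hu1 with
      | leaf j => exact block (.leaf j)
      | ext j t ht => exact block (.ext j t)
      | join t b ht hb hbt hbm =>
        have htm := hu2.of_join.1
        simp only [leaves_node, Multiset.card_add] at hc hlt
        have p1 := t.card_leaves_pos
        have p2 := b.card_leaves_pos
        have hn' : (t.leaves + b.leaves + s.leaves).Nodup := hn
        have e1 := nest t.leaves b.leaves s.leaves 1 1 (eval a t) (eval a b) (eval a s) (by omega)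
          (by omega) hn' (fun x hx => hlt x (by simp [hx])) (fun x hx => hlt x (by simp [hx]))
          (eval_mem_treeSpan a ⟨ht, htm⟩ rfl) (eval_mem_treeSpan a ⟨hbt, hbm⟩ rfl)
          (eval_mem_treeSpan a hs rfl)
        have e2 := nest b.leaves t.leaves s.leaves 1 1 (eval a b) (eval a t) (eval a s) (by omega)
          (by omega) (by rwa [add_comm b.leaves]) (fun x hx => hlt x (by simp [hx]))
          (fun x hx => hlt x (by simp [hx]))
          (eval_mem_treeSpan a ⟨hbt, hbm⟩ rfl) (eval_mem_treeSpan a ⟨ht, htm⟩ rfl)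
          (eval_mem_treeSpan a hs rfl)
        rw [add_comm b.leaves] at e2
        have hj := BiHamAlgebra.jacobi 1 (eval a t) (eval a b) (eval a s)
        have : op (bracket 1) (eval a (join t b)) (eval a s)
            = op (bracket 1) (eval a t) (op (bracket 1) (eval a b) (eval a s))
              - op (bracket 1) (eval a b) (op (bracket 1) (eval a t) (eval a s)) := by
          rw [eval_node, BiHamAlgebra.skew 1 _ (eval a s),
            BiHamAlgebra.skew 1 (eval a t) (eval a s),
            map_neg, sub_neg_eq_add, eq_comm, ← sub_eq_zero, sub_neg_eq_add]
          exact hj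
        rw [this]
        exact Submodule.sub_mem _ e1 e2
    have h1' : ∀ (d e : Multiset I), d.card ≤ n + 1 → (d + e).Nodup →
        (∀ x ∈ d, ∃ y ∈ e, x < y) → ∀ x ∈ treeSpan a d, ∀ y ∈ treeSpan a e,
        op (bracket 1) x y ∈ treeSpan a (d + e) := by
      intro d e hd hn hlt x hx y hy
      refine bilin_mem_of_span (op (bracket 1)) ?_ hx hy
      rintro _ ⟨u, hu, rfl, rfl⟩ _ ⟨s, hs, rfl, rfl⟩
      exact h1 u s hd hn hlt hu hs
    -- the first bracket
    have h0 : ∀ u s : BiHamTerm I, u.leaves.card ≤ n + 1 → (u.leaves + s.leaves).Nodup →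
        (∀ x ∈ u.leaves, ∃ y ∈ s.leaves, x < y) → IsNormalTree u → IsNormalTree s →
        op (bracket 0) (eval a u) (eval a s) ∈ treeSpan a (u.leaves + s.leaves) := by
      intro u s hc hn hlt hu hs
      obtain ⟨hu1, hu2⟩ := hu
      cases hu1 with
      | leaf j =>
        rw [← eval_node]
        refine eval_mem_treeSpan a ⟨.ext j s hs.1, fun x hx => ?_⟩ rfl
        rcases Multiset.mem_add.1 hx with hx | hx
        · obtain ⟨y, hy, h⟩ := hlt x hx
          exact h.le.trans (hs.2 y hy)
        · exact hs.2 x hx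
      | ext j t ht =>
        have htm := hu2.of_ext.1
        simp only [leaves_node, Multiset.card_add, leaves_leaf, Multiset.card_singleton] at hc hlt
        have p1 := t.card_leaves_pos
        have hn' : ({j} + t.leaves + s.leaves).Nodup := hn
        have hj' : eval a (leaf j) ∈ treeSpan a ({j} : Multiset I) :=
          eval_mem_treeSpan a
            ⟨.leaf j, fun x hx => by simpa using (Multiset.mem_singleton.1 hx).le⟩ rfl
        have e1 := nest {j} t.leaves s.leaves 0 0 (eval a (leaf j)) (eval a t) (eval a s)
          (by simp; omega)
          (by omega) hn' (fun x hx => hlt x (Multiset.mem_add.2 (.inl hx)))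
          (fun x hx => hlt x (Multiset.mem_add.2 (.inr hx)))
          hj' (eval_mem_treeSpan a ⟨ht, htm⟩ rfl) (eval_mem_treeSpan a hs rfl)
        have e2 := nest t.leaves {j} s.leaves 0 0 (eval a t) (eval a (leaf j)) (eval a s) (by omega)
          (by simp; omega) (by rwa [add_comm t.leaves])
          (fun x hx => hlt x (Multiset.mem_add.2 (.inr hx)))
          (fun x hx => hlt x (Multiset.mem_add.2 (.inl hx)))
          (eval_mem_treeSpan a ⟨ht, htm⟩ rfl) hj' (eval_mem_treeSpan a hs rfl)
        rw [add_comm t.leaves] at e2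
        have hj := BiHamAlgebra.jacobi 0 (eval a (leaf j)) (eval a t) (eval a s)
        have : op (bracket 0) (eval a (ext j t)) (eval a s)
            = op (bracket 0) (eval a (leaf j)) (op (bracket 0) (eval a t) (eval a s))
              - op (bracket 0) (eval a t) (op (bracket 0) (eval a (leaf j)) (eval a s)) := by
          rw [eval_node, BiHamAlgebra.skew 0 _ (eval a s),
            BiHamAlgebra.skew 0 (eval a (leaf j)) (eval a s),
            map_neg, sub_neg_eq_add, eq_comm, ← sub_eq_zero, sub_neg_eq_add]
          exact hj
        rw [this]
        exact Submodule.sub_mem _ e1 e2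
      | join t b ht hb hbt hbm =>
        have htm := hu2.of_join.1
        simp only [leaves_node, Multiset.card_add] at hc hlt
        have p1 := t.card_leaves_pos
        have p2 := b.card_leaves_pos
        have hn' : (t.leaves + b.leaves + s.leaves).Nodup := hn
        have e1 : ∀ c c' : Fin 2, op (bracket c) (eval a t)
            (op (bracket c') (eval a b) (eval a s)) ∈ treeSpan a (t.leaves + b.leaves + s.leaves) :=
          fun c c' => nest t.leaves b.leaves s.leaves c c' (eval a t) (eval a b)
          (eval a s) (by omega)
          (by omega) hn' (fun x hx => hlt x (by simp [hx])) (fun x hx => hlt x (by simp [hx]))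
          (eval_mem_treeSpan a ⟨ht, htm⟩ rfl) (eval_mem_treeSpan a ⟨hbt, hbm⟩ rfl)
          (eval_mem_treeSpan a hs rfl)
        have e2 : ∀ c c' : Fin 2, op (bracket c) (eval a b)
            (op (bracket c') (eval a t) (eval a s)) ∈ treeSpan a (b.leaves + t.leaves + s.leaves) :=
          fun c c' => nest b.leaves t.leaves s.leaves c c' (eval a b) (eval a t)
          (eval a s) (by omega)
          (by omega) (by rwa [add_comm b.leaves]) (fun x hx => hlt x (by simp [hx]))
          (fun x hx => hlt x (by simp [hx]))
          (eval_mem_treeSpan a ⟨hbt, hbm⟩ rfl) (eval_mem_treeSpan a ⟨ht, htm⟩ rfl)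
          (eval_mem_treeSpan a hs rfl)
        simp only [add_comm b.leaves] at e2
        -- `{t, b}₁` is a combination of normal trees with the same leaves as `u = {t, b}₂`
        have e3 : op (bracket 0) (eval a t) (eval a b) ∈ treeSpan a (t.leaves + b.leaves) := by
          refine flip _ _ _ _ ?_
          rw [add_comm]
          have hbt' := Multiset.nodup_add.1 (Multiset.nodup_add.1 hn').1
          refine ih _ _ (by omega) (by rw [add_comm]; exact (Multiset.nodup_add.1 hn').1)
            (fun x hx => ⟨t.hd, t.hd_mem, lt_of_le_of_ne (hu2.of_join.2 x hx) ?_⟩) 0 _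
            (eval_mem_treeSpan a ⟨hbt, hbm⟩ rfl) _ (eval_mem_treeSpan a ⟨ht, htm⟩ rfl)
          rintro rfl
          exact Multiset.disjoint_left.1 hbt'.2.2 t.hd_mem hx
        have e4 := h1' (t.leaves + b.leaves) s.leaves (by simpa using hc) hn'
          hlt _ e3 _ (eval_mem_treeSpan a hs rfl)
        have hs6 := BiHamAlgebra.six_term (eval a t) (eval a b) (eval a s)
        have : op (bracket 0) (eval a (join t b)) (eval a s)
            = op (bracket 1) (eval a t) (op (bracket 0) (eval a b) (eval a s))
              - op (bracket 1) (eval a b) (op (bracket 0) (eval a t) (eval a s))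
              + (op (bracket 0) (eval a t) (op (bracket 1) (eval a b) (eval a s))
              - op (bracket 0) (eval a b) (op (bracket 1) (eval a t) (eval a s)))
              - op (bracket 1) (op (bracket 0) (eval a t) (eval a b)) (eval a s) := by
          rw [eval_node, BiHamAlgebra.skew 0 (op (bracket 1) (eval a t) (eval a b)),
            BiHamAlgebra.skew 1 (op (bracket 0) (eval a t) (eval a b)),
            BiHamAlgebra.skew 0 (eval a t) (eval a s), BiHamAlgebra.skew 1 (eval a t) (eval a s),
            map_neg, map_neg, eq_comm, ← sub_eq_zero, ← hs6]
          abel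
        rw [this]
        exact Submodule.sub_mem _ (Submodule.add_mem _ (Submodule.sub_mem _ (e1 1 0) (e2 1 0))
          (Submodule.sub_mem _ (e1 0 1) (e2 0 1))) e4
    intro d e hd hn hlt c x hx y hy
    refine bilin_mem_of_span (op (bracket c)) ?_ hx hy
    rintro _ ⟨u, hu, rfl, rfl⟩ _ ⟨s, hs, rfl, rfl⟩
    fin_cases c
    · exact h0 u s hd hn hlt hu hs
    · exact h1 u s hd hn hlt hu hs

theorem bracket_mem_treeSpan {u s : BiHamTerm I} (hn : (u.leaves + s.leaves).Nodup)
    (hu : IsNormalTree u) (hs : IsNormalTree s) (c : Fin 2) :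
    op (bracket c) (eval a u) (eval a s) ∈ treeSpan a (u.leaves + s.leaves) := by
  have hne : u.hd ≠ s.hd := fun h =>
    Multiset.disjoint_left.1 (Multiset.nodup_add.1 hn).2.2 u.hd_mem (h ▸ s.hd_mem)
  rcases lt_or_gt_of_ne hne with h | h
  · exact bracket_mem_treeSpan_of_lt a _ _ _ le_rfl hn
      (fun x hx => ⟨s.hd, s.hd_mem, (hu.2 x hx).trans_lt h⟩) c _ (eval_mem_treeSpan a hu rfl) _
      (eval_mem_treeSpan a hs rfl)
  · rw [BiHamAlgebra.skew, add_comm]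
    exact Submodule.neg_mem _ (bracket_mem_treeSpan_of_lt a _ _ _ le_rfl (by rwa [add_comm])
      (fun x hx => ⟨u.hd, u.hd_mem, (hs.2 x hx).trans_lt h⟩) c _ (eval_mem_treeSpan a hs rfl) _
      (eval_mem_treeSpan a hu rfl))

theorem tree_prod_mem {t f : BiHamTerm I} (ht : IsNormalTree t) (hf : IsForest f) :
    op prod (eval a t) (eval a f) ∈ forestSpan a (t.leaves + f.leaves) := by
  induction hf with
  | tree f hf =>
    rcases le_total f.hd t.hd with h | h
    · rw [← eval_node]
      exact eval_mem_forestSpan a (.prod t f ht (.tree f hf) fun x hx => (hf.2 x hx).trans h) rfl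
    · rw [BiHamAlgebra.prod_comm, ← eval_node, add_comm]
      exact eval_mem_forestSpan a (.prod f t hf (.tree t ht) fun x hx => (ht.2 x hx).trans h) rfl
  | prod t' f ht' hf hle ih =>
    rcases le_total t'.hd t.hd with h | h
    · rw [← eval_node]
      exact eval_mem_forestSpan a (.prod t _ ht (.prod t' f ht' hf hle)
        fun x hx => ((IsForest.prod t' f ht' hf hle).hdMax x hx).trans h) rfl
    · rw [eval_node, BiHamAlgebra.prod_left_comm, leaves_node, add_left_comm]
      refine bilin_mem_of_span (op prod) (S := {eval a t'}) ?_ (Submodule.mem_span_singleton_self _)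
        ih
      rintro _ rfl _ ⟨g, hg, hl, rfl⟩
      rw [← eval_node, ← hl]
      refine eval_mem_forestSpan a (.prod t' g ht' hg fun x hx => ?_) rfl
      rw [hl] at hx
      rcases Multiset.mem_add.1 hx with hx | hx
      · exact (ht.2 x hx).trans h
      · exact hle x hx

theorem prod_mem_forestSpan {d e : Multiset I} {x y : A} (hx : x ∈ forestSpan a d)
    (hy : y ∈ forestSpan a e) : op prod x y ∈ forestSpan a (d + e) := by
  refine bilin_mem_of_span (op prod) ?_ hx hy
  rintro _ ⟨f, hf, rfl, rfl⟩ _ ⟨g, hg, rfl, rfl⟩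
  clear hx hy
  induction hf with
  | tree t ht => exact tree_prod_mem a ht hg
  | prod t f ht hf hle ih =>
    rw [eval_node, BiHamAlgebra.prod_assoc, leaves_node, add_assoc]
    refine bilin_mem_of_span (op prod) (S := {eval a t}) ?_ (Submodule.mem_span_singleton_self _)
      ih
    rintro _ rfl _ ⟨g, hg, hl, rfl⟩
    rw [← hl]
    exact tree_prod_mem a ht hg

theorem tree_bracket_mem {t g : BiHamTerm I} (hn : (t.leaves + g.leaves).Nodup)
    (ht : IsNormalTree t) (hg : IsForest g) (c : Fin 2) :
    op (bracket c) (eval a t) (eval a g) ∈ forestSpan a (t.leaves + g.leaves) := by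
  induction hg with
  | tree g hg => exact treeSpan_le a _ (bracket_mem_treeSpan a hn ht hg c)
  | prod s g hs hg hle ih =>
    rw [leaves_node] at hn ⊢
    have n1 : (t.leaves + s.leaves).Nodup := by
      rw [← add_assoc] at hn; exact (Multiset.nodup_add.1 hn).1
    have n2 : (t.leaves + g.leaves).Nodup := by
      rw [add_left_comm] at hn; exact (Multiset.nodup_add.1 hn).2.1
    rw [eval_node, BiHamAlgebra.leibniz]
    refine Submodule.add_mem _ ?_ ?_
    · rw [← add_assoc]
      exact prod_mem_forestSpan a (treeSpan_le a _ (bracket_mem_treeSpan a n1 ht hs c))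
        (eval_mem_forestSpan a hg rfl)
    · rw [add_left_comm]
      exact prod_mem_forestSpan a (eval_mem_forestSpan a (.tree s hs) rfl) (ih n2)

theorem bracket_mem_forestSpan {d e : Multiset I} {x y : A} (hn : (d + e).Nodup)
    (hx : x ∈ forestSpan a d) (hy : y ∈ forestSpan a e) (c : Fin 2) :
    op (bracket c) x y ∈ forestSpan a (d + e) := by
  refine bilin_mem_of_span (op (bracket c)) ?_ hx hy
  rintro _ ⟨f, hf, rfl, rfl⟩ _ ⟨g, hg, rfl, rfl⟩
  clear hx hy
  induction hf with
  | tree t ht => exact tree_bracket_mem a hn ht hg c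
  | prod t f ht hf hle ih =>
    rw [leaves_node] at hn ⊢
    have n1 : (t.leaves + g.leaves).Nodup := by
      rw [add_right_comm] at hn; exact (Multiset.nodup_add.1 hn).1
    have n2 : (f.leaves + g.leaves).Nodup := by
      rw [add_assoc] at hn; exact (Multiset.nodup_add.1 hn).2.1
    rw [eval_node, BiHamAlgebra.skew, BiHamAlgebra.leibniz, BiHamAlgebra.skew c _ (eval a t),
      BiHamAlgebra.skew c _ (eval a f)]
    refine Submodule.neg_mem _ (Submodule.add_mem _ ?_ ?_)
    · rw [add_right_comm]
      exact prod_mem_forestSpan a (Submodule.neg_mem _ (tree_bracket_mem a n1 ht hg c))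
        (eval_mem_forestSpan a hf rfl)
    · rw [add_assoc]
      exact prod_mem_forestSpan a (eval_mem_forestSpan a (.tree t ht) rfl)
        (Submodule.neg_mem _ (ih n2))

/-- Every multilinear monomial is a combination of normal monomials with the same leaves. -/
theorem eval_mem_span_forest {t : BiHamTerm I} (hn : t.leaves.Nodup) :
    eval a t ∈ forestSpan a t.leaves := by
  induction t with
  | leaf i =>
    exact eval_mem_forestSpan a
      (.tree _ ⟨.leaf i, fun x hx => (Multiset.mem_singleton.1 hx).le⟩) rfl
  | node o s t hs ht =>
    rw [leaves_node] at hn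
    have hs := hs (Multiset.nodup_add.1 hn).1
    have ht := ht (Multiset.nodup_add.1 hn).2.1
    rw [eval_node]
    cases o with
    | prod => exact prod_mem_forestSpan a hs ht
    | bracket c => exact bracket_mem_forestSpan a hn hs ht c

end BiHamAlgebra

/-! ### Forms adapted to a normal tree -/

namespace SkewForm

variable {I : Type*} {ω : SkewForm I} {c : Fin 2}

theorem pair_eq_zero_of_row {C : Multiset I} (h : ∀ i ∈ C, ω.pair c {i} C = 0) {U V : Multiset I}
    (hC : C = U + V) : ω.pair c U V = 0 := by
  have key : ∀ U' : Multiset I, (∀ i ∈ U', i ∈ C) → ω.pair c U' C = 0 := by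
    intro U' hU
    induction U' using Multiset.induction with
    | empty => simp
    | cons i U' ih =>
      rw [← Multiset.singleton_add, pair_add_left, h i (hU i (by simp)),
        ih fun k hk => hU k (by simp [hk]), add_zero]
  have h1 := key U fun i hi => by simp [hC, hi]
  rwa [hC, pair_add_right, pair_self, zero_add] at h1

theorem form_eq_zero_symm {i j : I} (h : ω.form c i j = 0) : ω.form c j i = 0 := by
  rw [ω.skew, h, neg_zero]

end SkewForm

namespace BiHamTerm

variable {I : Type*} {ω : SkewForm I}

theorem notMem_of_nodup_add {d e : Multiset I} (h : (d + e).Nodup) ⦃i : I⦄ (hi : i ∈ d) : i ∉ e :=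
  Multiset.disjoint_left.1 (Multiset.nodup_add.1 h).2.2 hi

theorem exists_add_of_subset {C b : Multiset I} (hb : b.Nodup) (h : ∀ i ∈ b, i ∈ C) :
    ∃ U, C = U + b := by
  obtain ⟨U, hU⟩ := Multiset.le_iff_exists_add.1 ((Multiset.le_iff_subset hb).2 h)
  exact ⟨U, by rw [hU, add_comm]⟩

theorem mem_right_of_nodup {d e d' e' : Multiset I} (h : d + e = d' + e') {i : I}
    (hi : i ∈ d') (h' : i ∉ d) : i ∈ e := by
  have : i ∈ d + e := by rw [h]; simp [hi]
  exact (Multiset.mem_add.1 this).resolve_left h'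

theorem val_node_ne_zero {c : Fin 2} {s t : BiHamTerm I} (h : val ω (node (bracket c) s t) ≠ 0) :
    ω.pair c s.leaves t.leaves ≠ 0 ∧ val ω s ≠ 0 ∧ val ω t ≠ 0 := by
  rw [val_bracket] at h
  exact ⟨left_ne_zero_of_mul h, left_ne_zero_of_mul (right_ne_zero_of_mul h),
    right_ne_zero_of_mul (right_ne_zero_of_mul h)⟩

/-- The number of outer brackets `{ , }₂` of a tree: it is composed of this number plus one of
blocks. -/
def joins : BiHamTerm I → ℕ
  | leaf _ => 0
  | node prod _ _ => 0
  | node (bracket c) s _ => if c = 0 then 0 else joins s + 1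

@[simp] theorem joins_leaf (i : I) : joins (leaf i) = 0 := rfl
@[simp] theorem joins_ext (j : I) (t : BiHamTerm I) : joins (ext j t) = 0 := rfl
@[simp] theorem joins_join (t b : BiHamTerm I) : joins (join t b) = joins t + 1 := rfl

/-- The two trees are built in the same way from blocks, and corresponding blocks have the same
leaves and the same first letter. -/
inductive SameSkel : BiHamTerm I → BiHamTerm I → Prop
  | leaf (i : I) : SameSkel (leaf i) (leaf i)
  | ext (j : I) (s t : BiHamTerm I) : s.leaves = t.leaves → SameSkel (ext j s) (ext j t)
  | join (s t b b' : BiHamTerm I) : SameSkel s t → SameSkel b b' →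
      SameSkel (join s b) (join t b')

theorem SameSkel.leaves_eq {s t : BiHamTerm I} (h : SameSkel s t) : s.leaves = t.leaves := by
  induction h with
  | leaf i => rfl
  | ext j s t h => simp [h]
  | join s t b b' h h' ih ih' => simp [ih, ih']

theorem IsBlock.joins_eq {b : BiHamTerm I} (h : IsBlock b) : joins b = 0 := by cases h <;> rfl

variable [LinearOrder I]

/-- If `val ω s` is not zero, then the leaves of `s` are connected by non-zero entries of `ω`. -/
theorem IsTree.connected {s : BiHamTerm I} (hs : IsTree s) (p : I → Prop)
    (h : ∀ c, ∀ i ∈ s.leaves, ∀ j ∈ s.leaves, p i → ¬ p j → ω.form c i j = 0)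
    (hv : val ω s ≠ 0) : (∀ i ∈ s.leaves, p i) ∨ ∀ i ∈ s.leaves, ¬ p i := by
  have node : ∀ (c : Fin 2) (u v : BiHamTerm I),
      (∀ c', ∀ i ∈ (node (bracket c) u v).leaves, ∀ j ∈ (node (bracket c) u v).leaves,
        p i → ¬ p j → ω.form c' i j = 0) → val ω (node (bracket c) u v) ≠ 0 →
      ((∀ i ∈ u.leaves, p i) ∨ ∀ i ∈ u.leaves, ¬ p i) →
      ((∀ i ∈ v.leaves, p i) ∨ ∀ i ∈ v.leaves, ¬ p i) →
      ((∀ i ∈ (node (bracket c) u v).leaves, p i) ∨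
        ∀ i ∈ (node (bracket c) u v).leaves, ¬ p i) := by
    intro c u v h hv hu hv'
    simp only [leaves_node, Multiset.mem_add] at h ⊢
    rcases hu with hu | hu <;> rcases hv' with hv' | hv'
    · exact .inl fun i hi => hi.elim (hu i) (hv' i)
    · exact absurd (SkewForm.pair_eq_zero ω c fun i hi j hj =>
        h c i (.inl hi) j (.inr hj) (hu i hi) (hv' j hj)) (val_node_ne_zero hv).1
    · exact absurd (SkewForm.pair_eq_zero ω c fun i hi j hj => SkewForm.form_eq_zero_symm
        (h c j (.inr hj) i (.inl hi) (hv' j hj) (hu i hi))) (val_node_ne_zero hv).1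
    · exact .inr fun i hi => hi.elim (hu i) (hv' i)
  induction hs with
  | leaf i => by_cases hp : p i <;> simp [hp]
  | ext j t ht iht =>
    refine node _ _ _ h hv (by by_cases hp : p j <;> simp [hp]) (iht ?_ (val_node_ne_zero hv).2.2)
    exact fun c i hi k hk => h c i (by simp [hi]) k (by simp [hk])
  | join t b ht hb hbt hbm iht ihb =>
    refine node _ _ _ h hv (iht ?_ (val_node_ne_zero hv).2.1) (ihb ?_ (val_node_ne_zero hv).2.2)
    · exact fun c i hi k hk => h c i (by simp [hi]) k (by simp [hk])
    · exact fun c i hi k hk => h c i (by simp [hi]) k (by simp [hk])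

/-- The forms by which the normal trees with the same skeleton as `t` are told apart from the
trees with at least as many outer brackets `{ , }₂`. On the leaves of a block `{j, t}₁`, the rows of
the second matrix sum to zero, and so do the rows of the first matrix except for `j` and the head. A
block `b` is linked to the preceding ones by a single entry of the second matrix. -/
inductive Adapted (ω : SkewForm I) : BiHamTerm I → Prop
  | leaf (i : I) : Adapted ω (leaf i)
  | ext (j : I) (t : BiHamTerm I)
      (row₁ : ∀ i ∈ (BiHamTerm.ext j t).leaves, ω.pair 1 {i} (BiHamTerm.ext j t).leaves = 0)
      (row₀ : ∀ i ∈ t.leaves, i ≠ t.hd → ω.pair 0 {i} (BiHamTerm.ext j t).leaves = 0)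
      (val : ω.pair 0 {j} t.leaves = 1) : Adapted ω (ext j t)
  | join (t b : BiHamTerm I) (left : Adapted ω t) (right : Adapted ω b)
      (cross : ∀ c, ∀ i ∈ t.leaves, ∀ k ∈ b.leaves,
        ω.form c i k = if c = 1 ∧ i = t.last ∧ k = b.top then 1 else 0) : Adapted ω (join t b)

theorem SameSkel.refl {t : BiHamTerm I} (h : IsTree t) : SameSkel t t := by
  induction h with
  | leaf i => exact .leaf i
  | ext j t => exact .ext j t t rfl
  | join t b ht hb hbt hbm iht ihb => exact .join t t b b iht ihb

theorem Adapted.row {b : BiHamTerm I} (h : Adapted ω b) (hb : IsBlock b) :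
    ∀ i ∈ b.leaves, ω.pair 1 {i} b.leaves = 0 := by
  cases hb with
  | leaf i =>
    intro k hk
    rw [leaves_leaf, Multiset.mem_singleton] at hk
    rw [hk, leaves_leaf, SkewForm.pair_self]
  | ext j t => cases h with | ext _ _ row₁ row₀ val => exact row₁

/-- Let letters `X` be attached to `t` by entries in the column of `last t` only, and let the
letters of `t` and `X` be distributed on `s` and `b` such that `s` contains `X` and the head of
`t`. Then `{s, b}₂` is annihilated. -/
theorem Adapted.pair_eq_zero {t : BiHamTerm I} (ht : IsTree t) (hA : Adapted ω t) :
    ∀ (X : Multiset I) (s b : BiHamTerm I), IsTree s → IsTree b → (t.leaves + X).Nodup →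
      s.leaves + b.leaves = t.leaves + X → X ≠ 0 → (∀ x ∈ X, x ∈ s.leaves) → t.hd ∈ s.leaves →
      (∀ c, ∀ x ∈ X, ∀ i ∈ t.leaves, i ≠ t.last → ω.form c x i = 0) →
      val ω s ≠ 0 → val ω b ≠ 0 → ω.pair 1 s.leaves b.leaves = 0 := by
  induction ht with
  | leaf i =>
    intro X s b hs hb hn he hX hXs hi att hvs hvb
    exfalso
    have hn' := hn
    rw [← he] at hn'
    have hm : b.hd ∈ ({i} : Multiset I) + X := by
      rw [leaves_leaf] at he; rw [← he]; simp [hd_mem]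
    have hd := notMem_of_nodup_add hn'
    rcases Multiset.mem_add.1 hm with h | h
    · exact hd hi (by rw [Multiset.mem_singleton] at h; rw [hd_leaf, ← h]; exact hd_mem b)
    · exact hd (hXs _ h) (hd_mem b)
  | ext j t ht _ =>
    intro X s b hs hb hn he hX hXs hi att hvs hvb
    cases hA with | ext _ _ row₁ row₀ val =>
    set C := (BiHamTerm.ext j t).leaves with hC
    have hn' := hn
    rw [← he] at hn'
    have dS := notMem_of_nodup_add hn'
    have dX := notMem_of_nodup_add hn
    have ms : ∀ k ∈ s.leaves, k ∈ C ∨ k ∈ X := fun k hk => by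
      rw [← Multiset.mem_add, ← he]; simp [hk]
    have mb : ∀ k ∈ b.leaves, k ∈ C ∨ k ∈ X := fun k hk => by
      rw [← Multiset.mem_add, ← he]; simp [hk]
    obtain ⟨x, hx⟩ := Multiset.exists_mem_of_ne_zero hX
    -- otherwise no entry connects `X` with the other letters of `s`
    have hj : j ∈ s.leaves := by
      by_contra hj
      rcases hs.connected (fun k => k ∈ X) (fun c k hk l hl hkX hlX =>
        att c k hkX l ((ms l hl).resolve_right hlX) (by rintro rfl; exact hj hl)) hvs with h | h
      · exact dX (by simp [hC, hd_mem]) (h _ hi)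
      · exact h x (hXs x hx) hx
    -- `b` lies in the block and avoids `j`, so its entries with `X` vanish and its entries with the
    -- rest of the block sum to zero
    have hbC : ∀ k ∈ b.leaves, k ∈ C := fun k hk =>
      (mb k hk).resolve_right fun h => dS (hXs k h) hk
    obtain ⟨U, hU⟩ := exists_add_of_subset (Multiset.nodup_add.1 hn').2.1 hbC
    have hsU : s.leaves = U + X := by
      have : s.leaves + b.leaves = U + X + b.leaves := by rw [he, hU]; abel
      exact add_right_cancel this
    rw [hsU, SkewForm.pair_add_left, SkewForm.pair_eq_zero_of_row row₁ hU, zero_add]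
    exact SkewForm.pair_eq_zero _ _ fun k hk l hl => att 1 k hk l (hbC l hl) (by
      rintro rfl; exact dS hj hl)
  | join t b' ht hb' hbt' hbm' iht _ =>
    intro X s b hs hb hn he hX hXs hi att hvs hvb
    cases hA with | join _ _ left right cross =>
    rw [leaves_node] at he hn att
    have hn' := hn
    rw [← he] at hn'
    have dS := notMem_of_nodup_add hn'
    have dX := notMem_of_nodup_add hn
    have dT := notMem_of_nodup_add (Multiset.nodup_add.1 hn).1
    have ms : ∀ k ∈ s.leaves, (k ∈ t.leaves ∨ k ∈ b'.leaves) ∨ k ∈ X := fun k hk => by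
      rw [← Multiset.mem_add, ← Multiset.mem_add, ← he]; simp [hk]
    have mb : ∀ k ∈ b.leaves, k ∈ t.leaves ∨ k ∈ b'.leaves := fun k hk => by
      have : (k ∈ t.leaves ∨ k ∈ b'.leaves) ∨ k ∈ X := by
        rw [← Multiset.mem_add, ← Multiset.mem_add, ← he]; simp [hk]
      exact this.resolve_right fun h => dS (hXs k h) hk
    obtain ⟨x, hx⟩ := Multiset.exists_mem_of_ne_zero hX
    have hdt : t.hd ∈ s.leaves := hi
    -- the letters of `s` are connected, so `s` contains `top b'`, to which `X` is attached, and
    -- `last t`, to which `b'` is attached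
    have htop : b'.top ∈ s.leaves := by
      by_contra hj
      rcases hs.connected (fun k => k ∈ X) (fun c k hk l hl hkX hlX =>
        att c k hkX l (Multiset.mem_add.2 ((ms l hl).resolve_right hlX))
          (by rintro rfl; exact hj hl)) hvs with h | h
      · exact dX (by simp [hd_mem]) (h _ hdt)
      · exact h x (hXs x hx) hx
    have hlast : t.last ∈ s.leaves := by
      by_contra hj
      rcases hs.connected (fun k => k ∈ t.leaves) (fun c k hk l hl hkt hlt => by
        have hkl : k ≠ t.last := by rintro rfl; exact hj hk
        rcases (ms l hl) with (h | h) | h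
        · exact absurd h hlt
        · rw [cross c k hkt l h, if_neg (by simp [hkl])]
        · exact SkewForm.form_eq_zero_symm (att c l h k (by simp [hkt])
            (by rintro rfl; exact dT hkt (top_mem _)))) hvs with h | h
      · exact dX (Multiset.mem_add.2 (.inl (h x (hXs x hx)))) hx
      · exact h _ hdt (hd_mem t)
    -- hence the letters of `b` lie in `t` or in `b'`
    rcases hb.connected (fun k => k ∈ t.leaves) (fun c k hk l hl hkt hlt => by
        rw [cross c k hkt l ((mb l hl).resolve_left hlt), if_neg]
        rintro ⟨-, rfl, -⟩
        exact dS hlast hk) hvb with h | h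
    · -- `b'` and `X` together are attached to `last t`
      refine iht left (b'.leaves + X) s b hs hb (by rwa [← add_assoc]) (by rw [he, add_assoc])
        (fun h0 => hX (add_eq_zero.1 h0).2) (fun y hy => ?_) hdt (fun c y hy i hi hil => ?_)
        hvs hvb
      · rcases Multiset.mem_add.1 hy with hy | hy
        · by_contra hys
          have : y ∈ b.leaves := mem_right_of_nodup (d' := b'.leaves) (e' := t.leaves + X)
            (by rw [he]; abel) hy hys
          exact dT (h y this) hy
        · exact hXs y hy
      · rcases Multiset.mem_add.1 hy with hy | hy
        · exact SkewForm.form_eq_zero_symm (by rw [cross c i hi y hy, if_neg (by simp [hil])])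
        · exact att c y hy i (by simp [hi]) (by rintro rfl; exact dT hi (top_mem _))
    · -- `b` lies in `b'` and avoids its top: as in the case of a block
      have hbB : ∀ k ∈ b.leaves, k ∈ b'.leaves := fun k hk => (mb k hk).resolve_left (h k hk)
      obtain ⟨U, hU⟩ := exists_add_of_subset (Multiset.nodup_add.1 hn').2.1 hbB
      have hsU : s.leaves = t.leaves + U + X := by
        have : s.leaves + b.leaves = t.leaves + U + X + b.leaves := by rw [he, hU]; abel
        exact add_right_cancel this
      have htb : ∀ k ∈ b.leaves, k ≠ b'.top := by rintro k hk rfl; exact dS htop hk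
      rw [hsU, SkewForm.pair_add_left, SkewForm.pair_add_left,
        SkewForm.pair_eq_zero_of_row (right.row hb') hU,
        SkewForm.pair_eq_zero _ _ fun k hk l hl => by
          rw [cross 1 k hk l (hbB l hl), if_neg (by simp [htb l hl])],
        SkewForm.pair_eq_zero _ _ fun k hk l hl =>
          att 1 k hk l (Multiset.mem_add.2 (.inr (hbB l hl))) (htb l hl)]
      simp

/-- The main property of the forms adapted to `t`: trees with the same leaves that are not
annihilated have fewer outer brackets `{ , }₂` than `t` or the same skeleton (second part). The
first part is used in the induction; letters `X` are attached to `last t` and contained in `b`. -/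
theorem Adapted.joins_le {t : BiHamTerm I} (ht : IsTree t) (hA : Adapted ω t) (hm : HdMax t) :
    (∀ (X : Multiset I) (s b : BiHamTerm I), IsTree s → HdMax s → IsTree b →
      (t.leaves + X).Nodup → s.leaves + b.leaves = t.leaves + X → (∀ x ∈ X, x ∈ b.leaves) →
      X ≠ 0 → (∃ i ∈ t.leaves, i ∈ b.leaves) → t.hd ∈ s.leaves →
      (∀ c, ∀ x ∈ X, ∀ i ∈ t.leaves, i ≠ t.last → ω.form c x i = 0) →
      val ω s ≠ 0 → val ω b ≠ 0 → ω.pair 1 s.leaves b.leaves ≠ 0 → joins s < joins t) ∧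
    (∀ s : BiHamTerm I, IsTree s → HdMax s → s.leaves = t.leaves → t.leaves.Nodup →
      val ω s ≠ 0 → joins s ≤ joins t ∧ (joins s = joins t → SameSkel s t)) := by
  induction ht with
  | leaf i =>
    refine ⟨?_, ?_⟩
    · rintro X s b hs hsm hb hn he hXb hX ⟨k, hk, hkb⟩ hi att hvs hvb hp
      rw [leaves_leaf, Multiset.mem_singleton] at hk
      rw [← he] at hn
      exact absurd (hk ▸ hkb) (notMem_of_nodup_add hn hi)
    · intro s hs hsm he hn hv
      have hc := congrArg Multiset.card he
      cases hs with
      | leaf k =>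
        rw [leaves_leaf, leaves_leaf, Multiset.singleton_inj] at he
        exact ⟨le_rfl, fun _ => he ▸ .leaf k⟩
      | ext k s hs =>
        have := s.card_leaves_pos
        simp only [leaves_node, Multiset.card_add, leaves_leaf, Multiset.card_singleton] at hc
        omega
      | join s b hs hb hbt hbm =>
        have := s.card_leaves_pos
        have := b.card_leaves_pos
        simp only [leaves_node, Multiset.card_add, leaves_leaf, Multiset.card_singleton] at hc
        omega
  | ext j t ht _ =>
    cases hA with | ext _ _ row₁ row₀ val =>
    refine ⟨?_, ?_⟩
    · rintro X s b hs hsm hb hn he hXb hX ⟨k, hk, hkb⟩ hi att hvs hvb hp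
      exfalso
      set C := (BiHamTerm.ext j t).leaves with hC
      have hn' := hn
      rw [← he] at hn'
      have dS := notMem_of_nodup_add hn'
      have dX := notMem_of_nodup_add hn
      have ms : ∀ k ∈ s.leaves, k ∈ C := fun k hk => by
        have : k ∈ C ∨ k ∈ X := by rw [← Multiset.mem_add, ← he]; simp [hk]
        exact this.resolve_right fun h => dS hk (hXb k h)
      have mb : ∀ k ∈ b.leaves, k ∈ C ∨ k ∈ X := fun k hk => by
        rw [← Multiset.mem_add, ← he]; simp [hk]
      obtain ⟨x, hx⟩ := Multiset.exists_mem_of_ne_zero hX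
      -- `b` contains letters of the block and of `X`, and these are attached to `j` only; then `s`
      -- lies in the block and avoids `j`, and its pairing with `b` is a sum over full rows
      have hj : j ∈ b.leaves := by
        by_contra hj
        rcases hb.connected (fun k => k ∈ X) (fun c k hk l hl hkX hlX =>
          att c k hkX l ((mb l hl).resolve_right hlX) (by rintro rfl; exact hj hl)) hvb with h | h
        · exact dX hk (h _ hkb)
        · exact h x (hXb x hx) hx
      obtain ⟨U, hU⟩ := exists_add_of_subset (Multiset.nodup_add.1 hn').1 ms
      have hbU : b.leaves = U + X := by
        have : s.leaves + b.leaves = s.leaves + (U + X) := by rw [he, hU]; abel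
        exact add_left_cancel this
      rw [add_comm] at hU
      rw [hbU, SkewForm.pair_add_right, SkewForm.pair_eq_zero_of_row row₁ hU, zero_add] at hp
      refine hp (SkewForm.pair_eq_zero _ _ fun k hk l hl => SkewForm.form_eq_zero_symm ?_)
      exact att 1 l hl k (ms k hk) fun h => dS hk (h ▸ hj)
    · intro s hs hsm he hn hv
      have hc := congrArg Multiset.card he
      cases hs with
      | leaf k =>
        simp only [leaves_node, Multiset.card_add, leaves_leaf, Multiset.card_singleton] at hc
        have := t.card_leaves_pos
        omega
      | ext k s hs =>
        obtain ⟨h1, h2, h3⟩ := val_node_ne_zero hv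
        have hnk : k ∉ s.leaves := by
          rw [← he] at hn
          exact fun h => notMem_of_nodup_add hn
            (Multiset.mem_singleton_self k) h
        have hkt : k ≠ t.hd := by
          rintro rfl
          have := hsm.hd_eq hm he
          rw [hd_ext, hd_ext] at this
          exact hnk (this ▸ s.hd_mem)
        -- only the rows of `j` and of the head have a sum different from zero
        have hr : ω.pair 0 {k} (BiHamTerm.ext j t).leaves ≠ 0 := by
          rw [← he, leaves_node, SkewForm.pair_add_right, leaves_leaf, SkewForm.pair_self, zero_add]
          exact h1
        have hkj : k = j := by
          have hk : k ∈ (BiHamTerm.ext j t).leaves := by rw [← he]; simp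
          rw [leaves_node, leaves_leaf, Multiset.mem_add, Multiset.mem_singleton] at hk
          exact hk.resolve_right fun h => hr (row₀ k h hkt)
        subst hkj
        rw [leaves_node, leaves_node] at he
        exact ⟨le_rfl, fun _ => .ext k s t (add_left_cancel he)⟩
      | join s b hs hb hbt hbm =>
        -- the leaves of `s` and `b` are those of a block, on which the rows sum to zero
        exact absurd (SkewForm.pair_eq_zero_of_row row₁ he.symm) (val_node_ne_zero hv).1
  | join t b' ht hb' hbt' hbm' iht ihb =>
    cases hA with | join _ _ left right cross =>
    obtain ⟨L, M⟩ := iht left hm.of_join.1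
    have Mb := (ihb right hbm').2
    have crossT : ∀ c, ∀ y ∈ b'.leaves, ∀ i ∈ t.leaves, i ≠ t.last → ω.form c y i = 0 :=
      fun c y hy i hi hil => SkewForm.form_eq_zero_symm (by
        rw [cross c i hi y hy, if_neg (by simp [hil])])
    refine ⟨?_, ?_⟩
    · rintro X s b hs hsm hb hn he hXb hX ⟨k, hk, hkb⟩ hi att hvs hvb hp
      rw [joins_join]
      rw [leaves_node] at he hn att hk
      have hn' := hn
      rw [← he] at hn'
      have dS := notMem_of_nodup_add hn'
      have dX := notMem_of_nodup_add hn
      have nT := (Multiset.nodup_add.1 hn).1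
      have dT := notMem_of_nodup_add nT
      have ms : ∀ k ∈ s.leaves, k ∈ t.leaves ∨ k ∈ b'.leaves := fun k hk => by
        have : (k ∈ t.leaves ∨ k ∈ b'.leaves) ∨ k ∈ X := by
          rw [← Multiset.mem_add, ← Multiset.mem_add, ← he]; simp [hk]
        exact this.resolve_right fun h => dS hk (hXb k h)
      have mb : ∀ k ∈ b.leaves, (k ∈ t.leaves ∨ k ∈ b'.leaves) ∨ k ∈ X := fun k hk => by
        rw [← Multiset.mem_add, ← Multiset.mem_add, ← he]; simp [hk]
      obtain ⟨x, hx⟩ := Multiset.exists_mem_of_ne_zero hX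
      have hdt : t.hd ∈ s.leaves := hi
      -- `b` is connected and contains letters of `X`, hence contains `top b'`; the entry that links
      -- `b'` with `t` is thus not available in `s`, so `b` contains all of `b'`
      have htop : b'.top ∈ b.leaves := by
        by_contra hj
        rcases hb.connected (fun k => k ∈ X) (fun c k hk l hl hkX hlX =>
          att c k hkX l (Multiset.mem_add.2 ((mb l hl).resolve_right hlX))
            (by rintro rfl; exact hj hl)) hvb with h | h
        · exact dX hk (h _ hkb)
        · exact h x (hXb x hx) hx
      have hB : ∀ l ∈ b'.leaves, l ∈ b.leaves := by
        intro l hl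
        by_contra hlb
        have hls : l ∈ s.leaves := mem_right_of_nodup (d' := b'.leaves) (e' := t.leaves + X)
            (by rw [add_comm, he]; abel) hl hlb
        rcases hs.connected (fun k => k ∈ t.leaves) (fun c k hk l hl hkt hlt => by
            rw [cross c k hkt l ((ms l hl).resolve_left hlt), if_neg]
            rintro ⟨-, -, rfl⟩
            exact dS hl htop) hvs with h | h
        · exact dT (h l hls) hl
        · exact h _ hdt (hd_mem t)
      have hBX : ∀ y ∈ b'.leaves + X, y ∈ b.leaves := fun y hy =>
        (Multiset.mem_add.1 hy).elim (hB y) (hXb y)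
      -- either `b` contains letters of `t`, and `b'` and `X` together are attached to `last t`, or
      -- `s` and `t` have the same letters
      by_cases hT : ∃ i ∈ t.leaves, i ∈ b.leaves
      · refine (L (b'.leaves + X) s b hs hsm hb (by rwa [← add_assoc]) (by rw [he, add_assoc])
          hBX (fun h0 => hX (add_eq_zero.1 h0).2) hT hdt (fun c y hy i hi hil => ?_)
          hvs hvb hp).trans (Nat.lt_succ_self _)
        rcases Multiset.mem_add.1 hy with hy | hy
        · exact crossT c y hy i hi hil
        · exact att c y hy i (by simp [hi]) (by rintro rfl; exact dT hi (top_mem _))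
      · push Not at hT
        have hst : s.leaves = t.leaves := by
          refine ((Multiset.nodup_add.1 hn').1.ext (Multiset.nodup_add.1 nT).1).2 fun i => ⟨fun h =>
            (ms i h).resolve_right fun h' => dS h (hB i h'), fun h => ?_⟩
          exact mem_right_of_nodup (d' := t.leaves) (e' := b'.leaves + X)
            (by rw [add_comm, he]; abel) h (hT i h)
        exact Nat.lt_succ_of_le (M s hs hsm hst (Multiset.nodup_add.1 nT).1 hvs).1
    · intro s hs hsm he hn hv
      cases hs with
      | leaf k => simp
      | ext k s hs => simp
      | join s b hs hb hbt hbm =>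
        obtain ⟨hp, hvs, hvb⟩ := val_node_ne_zero hv
        have hdt : t.hd ∈ s.leaves := by
          have := hsm.hd_eq hm he
          rw [hd_join, hd_join] at this
          exact this ▸ hd_mem s
        rw [leaves_node, leaves_node] at he
        rw [leaves_node] at hn
        have hn' := hn
        rw [← he] at hn'
        have dS := notMem_of_nodup_add hn'
        have dT := notMem_of_nodup_add hn
        have ms : ∀ k ∈ s.leaves, k ∈ t.leaves ∨ k ∈ b'.leaves := fun k hk => by
          rw [← Multiset.mem_add, ← he]; simp [hk]
        have mb : ∀ k ∈ b.leaves, k ∈ t.leaves ∨ k ∈ b'.leaves := fun k hk => by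
          rw [← Multiset.mem_add, ← he]; simp [hk]
        simp only [joins_join, Nat.add_le_add_iff_right, Nat.add_right_cancel_iff]
        -- the block `b'` is contained in `s`, contained in `b`, or split
        by_cases hB1 : ∀ l ∈ b'.leaves, l ∈ s.leaves
        · exact absurd (left.pair_eq_zero ht b'.leaves s b hs hbt hn he b'.leaves_ne_zero hB1 hdt
            crossT hvs hvb) hp
        by_cases hB2 : ∀ l ∈ b'.leaves, l ∈ b.leaves
        · by_cases hT : ∃ i ∈ t.leaves, i ∈ b.leaves
          · have := L b'.leaves s b hs hsm.of_join.1 hbt hn he hB2 b'.leaves_ne_zero hT hdt crossT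
              hvs hvb hp
            exact ⟨this.le, fun h => absurd h this.ne⟩
          · push Not at hT
            have hst : s.leaves = t.leaves := by
              refine ((Multiset.nodup_add.1 hn').1.ext (Multiset.nodup_add.1 hn).1).2 fun i =>
                ⟨fun h => (ms i h).resolve_right fun h' => dS h (hB2 i h'), fun h => ?_⟩
              exact mem_right_of_nodup (d' := t.leaves) (e' := b'.leaves)
                (by rw [add_comm, he]) h (hT i h)
            have hbb : b.leaves = b'.leaves := by
              rw [hst] at he
              exact add_left_cancel he
            have h1 := M s hs hsm.of_join.1 hst (Multiset.nodup_add.1 hn).1 hvs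
            have h2 := Mb b hbt hbm hbb (Multiset.nodup_add.1 hn).2.1 hvb
            exact ⟨h1.1, fun h => .join _ _ _ _ (h1.2 h) (h2.2 (by rw [hb.joins_eq, hb'.joins_eq]))⟩
        · -- if `b'` is split, then `s` contains both ends of the entry that links `b'` with `t`, so
          -- `b` is a part of `b'` without the top, and its pairing with `s` is a sum over full rows
          exfalso
          push Not at hB1 hB2
          obtain ⟨k, hk, hks⟩ := hB1
          obtain ⟨l, hl, hlb⟩ := hB2
          have hkb : k ∈ b.leaves := mem_right_of_nodup (d' := b'.leaves) (e' := t.leaves)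
            (by rw [he]; abel) hk hks
          have hls : l ∈ s.leaves := mem_right_of_nodup (d' := b'.leaves) (e' := t.leaves)
            (by rw [add_comm, he]; abel) hl hlb
          have link : t.last ∈ s.leaves ∧ b'.top ∈ s.leaves := by
            by_contra hne
            rcases hs.connected (fun k => k ∈ t.leaves) (fun c k hk l hl hkt hlt => by
              rw [cross c k hkt l ((ms l hl).resolve_left hlt), if_neg]
              rintro ⟨-, rfl, rfl⟩
              exact hne ⟨hk, hl⟩) hvs with h | h
            · exact dT (h l hls) hl
            · exact h _ hdt (hd_mem t)
          have hbB : ∀ i ∈ b.leaves, i ∈ b'.leaves := by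
            rcases hbt.connected (fun k => k ∈ t.leaves) (fun c k hk l hl hkt hlt => by
              rw [cross c k hkt l ((mb l hl).resolve_left hlt), if_neg]
              rintro ⟨-, rfl, -⟩
              exact dS link.1 hk) hvb with h | h
            · exact absurd hk (dT (h k hkb))
            · exact fun i hi => (mb i hi).resolve_left (h i hi)
          obtain ⟨U, hU⟩ := exists_add_of_subset (Multiset.nodup_add.1 hn').2.1 hbB
          have hsU : s.leaves = t.leaves + U := by
            have : s.leaves + b.leaves = t.leaves + U + b.leaves := by rw [he, hU]; abel
            exact add_right_cancel this
          apply hp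
          rw [hsU, SkewForm.pair_add_left, SkewForm.pair_eq_zero_of_row (right.row hb') hU,
            SkewForm.pair_eq_zero, add_zero]
          intro i hi m hm
          rw [cross 1 i hi m (hbB m hm), if_neg]
          rintro ⟨-, -, rfl⟩
          exact dS link.2 hm

end BiHamTerm

/-! ### Independence of the normal monomials -/

namespace SkewForm

variable {I : Type*} [DecidableEq I] (ω : SkewForm I)

/-- The form `ω` on the letters in `d`, and zero otherwise. -/
def restrict (d : Multiset I) : SkewForm I where
  form c i j := if i ∈ d ∧ j ∈ d then ω.form c i j else 0
  skew c i j := by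
    by_cases h : i ∈ d ∧ j ∈ d
    · rw [if_pos h, if_pos h.symm, ω.skew]
    · rw [if_neg h, if_neg fun h' => h h'.symm, neg_zero]

theorem restrict_form (d : Multiset I) (c : Fin 2) (i j : I) :
    (ω.restrict d).form c i j = if i ∈ d ∧ j ∈ d then ω.form c i j else 0 := rfl

/-- The form with `form c i j = -f c i` for `i ∈ d`, and zero otherwise. -/
def column (d : Multiset I) (j : I) (f : Fin 2 → I → ℚ) : SkewForm I where
  form c i k := (if i = j ∧ k ∈ d then f c k else 0) - if k = j ∧ i ∈ d then f c i else 0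
  skew c i k := by ring

theorem column_form (d : Multiset I) (j : I) (f : Fin 2 → I → ℚ) (c : Fin 2) (i k : I) :
    (column d j f).form c i k
      = (if i = j ∧ k ∈ d then f c k else 0) - if k = j ∧ i ∈ d then f c i else 0 := rfl

end SkewForm

namespace BiHamTerm

/-- The functions `ω ↦ val ω t` on `Ω`, for `t` in `T`, are linearly independent. -/
def Indep {I : Type*} (Ω : Set (SkewForm I)) (T : Set (BiHamTerm I)) : Prop :=
  ∀ (F : Finset (BiHamTerm I)) (a : BiHamTerm I → ℚ), (∀ t ∈ F, t ∈ T) →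
    (∀ ω ∈ Ω, ∑ t ∈ F, a t * val ω t = 0) → ∀ t ∈ F, a t = 0

/-- If `val ω` factors on the monomials `node o s t`, then their independence follows from that of
the factors. -/
theorem Indep.node {I : Type*} {Ω₁ Ω₂ Ω : Set (SkewForm I)} {T₁ T₂ T : Set (BiHamTerm I)}
    (h₁ : Indep Ω₁ T₁) (h₂ : Indep Ω₂ T₂) (o : BiHamOp)
    (hT : ∀ t ∈ T, ∃ t₁ ∈ T₁, ∃ t₂ ∈ T₂, t = node o t₁ t₂)
    (hΩ : ∀ ω₁ ∈ Ω₁, ∀ ω₂ ∈ Ω₂, ∃ ω ∈ Ω, ∀ t₁ ∈ T₁, ∀ t₂ ∈ T₂,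
      val ω (node o t₁ t₂) = val ω₁ t₁ * val ω₂ t₂) : Indep Ω T := by
  classical
  intro F a hF h0
  let l : BiHamTerm I → BiHamTerm I := fun t => match t with
    | leaf i => leaf i
    | .node _ s _ => s
  let r : BiHamTerm I → BiHamTerm I := fun t => match t with
    | leaf i => leaf i
    | .node _ _ s => s
  have hl : ∀ s t, l (BiHamTerm.node o s t) = s := fun s t => rfl
  have hr : ∀ s t, r (BiHamTerm.node o s t) = t := fun s t => rfl
  have hlr : ∀ t ∈ F, l t ∈ T₁ ∧ r t ∈ T₂ ∧ BiHamTerm.node o (l t) (r t) = t := by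
    intro t ht
    obtain ⟨t₁, h1, t₂, h2, rfl⟩ := hT t (hF t ht)
    exact ⟨h1, h2, rfl⟩
  let a' : BiHamTerm I → BiHamTerm I → ℚ := fun s t =>
    if BiHamTerm.node o s t ∈ F then a (BiHamTerm.node o s t) else 0
  have key : ∀ ω₁ ∈ Ω₁, ∀ ω₂ ∈ Ω₂,
      ∑ s ∈ F.image l, (∑ t ∈ F.image r, a' s t * val ω₂ t) * val ω₁ s = 0 := by
    intro ω₁ hω₁ ω₂ hω₂
    obtain ⟨ω, hω, hv⟩ := hΩ ω₁ hω₁ ω₂ hω₂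
    rw [← h0 ω hω]
    simp only [Finset.sum_mul]
    rw [← Finset.sum_product']
    have : ∀ p ∈ F.image l ×ˢ F.image r, a' p.1 p.2 * val ω₂ p.2 * val ω₁ p.1
        = if BiHamTerm.node o p.1 p.2 ∈ F then
          a (BiHamTerm.node o p.1 p.2) * val ω (BiHamTerm.node o p.1 p.2) else 0 := by
      intro p hp
      obtain ⟨hp1, hp2⟩ := Finset.mem_product.1 hp
      obtain ⟨u, hu, hu'⟩ := Finset.mem_image.1 hp1
      obtain ⟨v, hw, hv'⟩ := Finset.mem_image.1 hp2
      by_cases hm : BiHamTerm.node o p.1 p.2 ∈ F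
      · rw [if_pos hm, hv p.1 (hu' ▸ (hlr u hu).1) p.2 (hv' ▸ (hlr v hw).2.1)]
        simp only [a', if_pos hm]
        ring
      · rw [if_neg hm]
        simp only [a', if_neg hm]
        ring
    rw [Finset.sum_congr rfl this, ← Finset.sum_filter]
    refine Finset.sum_bij' (fun p _ => BiHamTerm.node o p.1 p.2) (fun t _ => (l t, r t))
      (fun p hp => (Finset.mem_filter.1 hp).2) (fun t ht => ?_) (fun p hp => rfl)
      (fun t ht => (hlr t ht).2.2) (fun p hp => rfl)
    refine Finset.mem_filter.2 ⟨Finset.mem_product.2 ⟨Finset.mem_image_of_mem l ht,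
      Finset.mem_image_of_mem r ht⟩, ?_⟩
    rwa [(hlr t ht).2.2]
  intro t ht
  have e1 : ∀ ω₂ ∈ Ω₂, ∑ t' ∈ F.image r, a' (l t) t' * val ω₂ t' = 0 := fun ω₂ hω₂ =>
    h₁ (F.image l) (fun s => ∑ t' ∈ F.image r, a' s t' * val ω₂ t') (fun s hs => by
      obtain ⟨u, hu, rfl⟩ := Finset.mem_image.1 hs
      exact (hlr u hu).1) (fun ω₁ hω₁ => key ω₁ hω₁ ω₂ hω₂) (l t) (Finset.mem_image_of_mem l ht)
  have e2 := h₂ (F.image r) (a' (l t)) (fun s hs => by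
      obtain ⟨u, hu, rfl⟩ := Finset.mem_image.1 hs
      exact (hlr u hu).2.1) e1 (r t) (Finset.mem_image_of_mem r ht)
  simp only [a', (hlr t ht).2.2, if_pos ht] at e2
  exact e2

theorem indep_leaf {I : Type*} (i : I) : Indep Set.univ {leaf i} := by
  intro F a hF h0 t ht
  have hF' : F = {leaf i} :=
    Finset.eq_singleton_iff_unique_mem.2 ⟨(hF t ht) ▸ ht, fun s hs => hF s hs⟩
  have := h0 0 trivial
  rw [hF', Finset.sum_singleton, val_leaf, mul_one] at this
  rw [hF t ht, this]

variable {I : Type*} [LinearOrder I]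

theorem Adapted.congr {ω ω' : SkewForm I} {t : BiHamTerm I} (h : Adapted ω t)
    (hω : ∀ c, ∀ i ∈ t.leaves, ∀ j ∈ t.leaves, ω.form c i j = ω'.form c i j) : Adapted ω' t := by
  induction h with
  | leaf i => exact .leaf i
  | ext j t row₁ row₀ val =>
    refine .ext j t (fun i hi => ?_) (fun i hi hne => ?_) ?_
    · rw [← row₁ i hi]
      exact SkewForm.pair_congr _ fun k hk l hl =>
          (hω _ k (Multiset.mem_singleton.1 hk ▸ hi) l hl).symm
    · rw [← row₀ i hi hne]
      exact SkewForm.pair_congr _ fun k hk l hl =>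
        (hω _ k (by rw [Multiset.mem_singleton.1 hk]; simp [hi]) l hl).symm
    · rw [← val]
      exact SkewForm.pair_congr _ fun k hk l hl =>
        (hω _ k (by rw [Multiset.mem_singleton.1 hk]; simp) l (by simp [hl])).symm
  | join t b left right cross iht ihb =>
    refine .join t b (iht fun c i hi j hj => hω c i (by simp [hi]) j (by simp [hj]))
      (ihb fun c i hi j hj => hω c i (by simp [hi]) j (by simp [hj])) fun c i hi k hk => ?_
    rw [← hω c i (by simp [hi]) k (by simp [hk]), cross c i hi k hk]

/-- Every form on the leaves of `t` extends to a form adapted to `{j, t}₁`. -/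
theorem exists_adapted_ext (ω : SkewForm I) {j : I} {t : BiHamTerm I} (hj : j ∉ t.leaves)
    (hn : t.leaves.Nodup) : ∃ ω', Adapted ω' (ext j t) ∧
      ∀ c, ∀ i ∈ t.leaves, ∀ k ∈ t.leaves, ω'.form c i k = ω.form c i k := by
  let f : Fin 2 → I → ℚ := fun c i => ω.pair c {i} t.leaves + if c = 0 ∧ i = t.hd then 1 else 0
  let ω' : SkewForm I := ω.restrict t.leaves + .column t.leaves j f
  have ne : ∀ i ∈ t.leaves, i ≠ j := by rintro i hi rfl; exact hj hi
  have e1 : ∀ c, ∀ i ∈ t.leaves, ∀ k ∈ t.leaves, ω'.form c i k = ω.form c i k := by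
    intro c i hi k hk
    simp [ω', SkewForm.restrict_form, SkewForm.column_form, hi, hk, ne i hi, ne k hk]
  have e2 : ∀ c, ∀ i ∈ t.leaves, ω'.form c i j = -f c i := by
    intro c i hi
    simp [ω', SkewForm.restrict_form, SkewForm.column_form, hi, ne i hi, hj]
  have e3 : ∀ c, ω'.pair c {j} t.leaves = if c = 0 then 1 else 0 := by
    intro c
    have h1 : ω'.pair c {j} t.leaves = (t.leaves.map fun i => f c i).sum := by
      rw [SkewForm.pair_singleton_left]
      refine congrArg _ (Multiset.map_congr rfl fun i hi => ?_)
      rw [ω'.skew, e2 c i hi, neg_neg]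
    rw [h1, Multiset.sum_map_add]
    have h2 : (t.leaves.map fun i => ω.pair c {i} t.leaves).sum = 0 := by
      have := ω.pair_self c t.leaves
      simpa [SkewForm.pair] using this
    rw [h2, zero_add]
    rw [SkewForm.sum_ind, Multiset.count_eq_one_of_mem hn t.hd_mem]
    split_ifs <;> simp
  have e4 : ∀ c, ∀ i ∈ t.leaves, ω'.pair c {i} (ext j t).leaves
      = -if c = 0 ∧ i = t.hd then 1 else 0 := by
    intro c i hi
    rw [leaves_node, leaves_leaf, SkewForm.pair_add_right, SkewForm.pair_singleton, e2 c i hi,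
      SkewForm.pair_congr (ω := ω') (ω' := ω) c fun k hk l hl =>
        e1 c k (Multiset.mem_singleton.1 hk ▸ hi) l hl]
    simp only [f]
    ring
  refine ⟨ω', .ext j t (fun i hi => ?_) (fun i hi hne => ?_) (by simp [e3]), e1⟩
  · rcases Multiset.mem_add.1 hi with h | h
    · obtain rfl : i = j := Multiset.mem_singleton.1 h
      rw [leaves_node, SkewForm.pair_add_right,
        leaves_leaf, SkewForm.pair_self, e3]
      simp
    · rw [e4 1 i h]; simp
  · rw [e4 0 i hi]; simp [hne]

/-- Forms adapted to the two arguments extend to a form adapted to `{t, b}₂`. -/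
theorem exists_adapted_join {ω₁ ω₂ : SkewForm I} {t b : BiHamTerm I}
    (hn : (t.leaves + b.leaves).Nodup) (h₁ : Adapted ω₁ t) (h₂ : Adapted ω₂ b) :
    ∃ ω, Adapted ω (join t b) ∧
      (∀ c, ∀ i ∈ t.leaves, ∀ k ∈ t.leaves, ω.form c i k = ω₁.form c i k) ∧
      ∀ c, ∀ i ∈ b.leaves, ∀ k ∈ b.leaves, ω.form c i k = ω₂.form c i k := by
  have d1 := notMem_of_nodup_add hn
  have d2 : ∀ i ∈ b.leaves, i ∉ t.leaves := fun i h h' => d1 h' h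
  let ω : SkewForm I := ω₁.restrict t.leaves + ω₂.restrict b.leaves + .single 1 1 t.last b.top
  have nt : ∀ i ∈ t.leaves, i ≠ b.top := by rintro i hi rfl; exact d1 hi b.top_mem
  have nb : ∀ i ∈ b.leaves, i ≠ t.last := by rintro i hi rfl; exact d2 _ hi t.last_mem
  have e1 : ∀ c, ∀ i ∈ t.leaves, ∀ k ∈ t.leaves, ω.form c i k = ω₁.form c i k := by
    intro c i hi k hk
    simp [ω, SkewForm.restrict_form, SkewForm.single_form, hi, hk, d1 hi, nt i hi, nt k hk]
  have e2 : ∀ c, ∀ i ∈ b.leaves, ∀ k ∈ b.leaves, ω.form c i k = ω₂.form c i k := by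
    intro c i hi k hk
    simp [ω, SkewForm.restrict_form, SkewForm.single_form, hi, hk, d2 i hi, nb i hi, nb k hk]
  refine ⟨ω, .join t b (h₁.congr fun c i hi k hk => (e1 c i hi k hk).symm)
    (h₂.congr fun c i hi k hk => (e2 c i hi k hk).symm) fun c i hi k hk => ?_, e1, e2⟩
  simp only [ω, SkewForm.restrict_form, SkewForm.single_form, SkewForm.add_form, hi, hk, d1 hi,
    d2 k hk, nt i hi, and_false, false_and, if_false]
  by_cases hc : c = 1 <;> simp [hc]

/-- The normal trees with a given skeleton are separated by the forms adapted to it, provided that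
smaller normal trees are separated by all forms. These enter through the blocks `{j, u}₁`, where
the form on the leaves of `u` is arbitrary. -/
theorem indep_tree_aux (n : ℕ) (ih : ∀ d : Multiset I, d.card < n → d.Nodup →
    Indep Set.univ {t | IsNormalTree t ∧ t.leaves = d}) {t : BiHamTerm I} (ht : IsTree t)
    (hc : t.leaves.card ≤ n) (hn : t.leaves.Nodup) :
    Indep {ω | Adapted ω t} {s | IsTree s ∧ HdMax s ∧ SameSkel s t} := by
  induction ht with
  | leaf i =>
    intro F a hF h0
    refine indep_leaf i F a (fun s hs => ?_) fun ω _ => h0 ω (.leaf i)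
    obtain ⟨-, -, h⟩ := hF s hs
    cases h
    rfl
  | ext j t ht _ =>
    rw [leaves_node, leaves_leaf] at hn hc
    have hj : j ∉ t.leaves := notMem_of_nodup_add hn (Multiset.mem_singleton_self j)
    have hnt := (Multiset.nodup_add.1 hn).2.1
    refine (indep_leaf j).node (ih t.leaves (by simp at hc; omega) hnt) (bracket 0) ?_ ?_
    · rintro s ⟨hs, hm, hk⟩
      cases hk with
      | ext _ s _ h =>
        cases hs with
        | ext _ _ hs => exact ⟨leaf j, rfl, s, ⟨⟨hs, hm.of_ext.1⟩, h⟩, rfl⟩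
    · rintro ω₁ - ω₂ -
      obtain ⟨ω, hA, hω⟩ := exists_adapted_ext ω₂ hj hnt
      refine ⟨ω, hA, ?_⟩
      rintro _ rfl s ⟨-, hs⟩
      cases hA with
      | ext _ _ row₁ row₀ val =>
        rw [val_bracket, leaves_leaf, hs, val, val_leaf, val_leaf, one_mul]
        congr 1
        exact val_congr (by rw [hs]; exact hω)
  | join t b ht hb hbt hbm iht ihb =>
    rw [leaves_node] at hn hc
    rw [Multiset.card_add] at hc
    have ih1 := iht (by omega) (Multiset.nodup_add.1 hn).1
    have ih2 := ihb (by omega) (Multiset.nodup_add.1 hn).2.1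
    refine ih1.node ih2 (bracket 1) ?_ ?_
    · rintro s ⟨hs, hm, hk⟩
      cases hk with
      | join s _ b' _ h h' =>
        cases hs with
        | join _ _ hs hb' hbt' hbm' =>
          exact ⟨s, ⟨hs, hm.of_join.1, h⟩, b', ⟨hbt', hbm', h'⟩, rfl⟩
    · rintro ω₁ h₁ ω₂ h₂
      obtain ⟨ω, hA, e1, e2⟩ := exists_adapted_join hn h₁ h₂
      refine ⟨ω, hA, ?_⟩
      rintro s ⟨-, -, hs⟩ b' ⟨-, -, hb'⟩
      cases hA with
      | join _ _ left right cross =>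
        have hp : ω.pair 1 t.leaves b.leaves = 1 := by
          have : ω.pair 1 t.leaves b.leaves
              = (SkewForm.single 1 1 t.last b.top).pair 1 t.leaves b.leaves := by
            refine SkewForm.pair_congr _ fun i hi k hk => ?_
            rw [cross 1 i hi k hk, SkewForm.single_form]
            have : i ≠ b.top := by rintro rfl; exact notMem_of_nodup_add hn hi b.top_mem
            simp [this]
          rw [this, SkewForm.pair_single]
          have h1 : t.last ∉ b.leaves := notMem_of_nodup_add hn t.last_mem
          simp [Multiset.count_eq_one_of_mem (Multiset.nodup_add.1 hn).1 t.last_mem,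
            Multiset.count_eq_one_of_mem (Multiset.nodup_add.1 hn).2.1 b.top_mem,
            Multiset.count_eq_zero_of_notMem h1]
        rw [val_bracket, hs.leaves_eq, hb'.leaves_eq, hp, one_mul]
        congr 1
        · exact val_congr (by rw [hs.leaves_eq]; exact e1)
        · exact val_congr (by rw [hb'.leaves_eq]; exact e2)

theorem indep_tree {d : Multiset I} (hd : d.Nodup) :
    Indep Set.univ {t | IsNormalTree t ∧ t.leaves = d} := by
  classical
  induction hn : d.card using Nat.strong_induction_on generalizing d with
  | _ n ih =>
  intro F a hF h0
  by_contra hne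
  push Not at hne
  -- a tree with the fewest outer brackets among those with non-zero coefficient
  obtain ⟨t, ht, hmin⟩ := Finset.exists_min_image (F.filter fun t => a t ≠ 0) joins
    (by obtain ⟨t, h1, h2⟩ := hne; exact ⟨t, Finset.mem_filter.2 ⟨h1, h2⟩⟩)
  obtain ⟨htF, hta⟩ := Finset.mem_filter.1 ht
  obtain ⟨⟨htt, htm⟩, rfl⟩ := hF t htF
  refine hta (indep_tree_aux n (fun d hd hd' => ih _ hd hd' rfl) htt hn.le hd
    (F.filter fun s => SameSkel s t) a (fun s hs => ?_) (fun ω hω => ?_) t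
    (Finset.mem_filter.2 ⟨htF, .refl htt⟩))
  · obtain ⟨h1, h2⟩ := Finset.mem_filter.1 hs
    exact ⟨(hF s h1).1.1, (hF s h1).1.2, h2⟩
  · rw [← h0 ω trivial]
    refine Finset.sum_subset (Finset.filter_subset _ _) fun s hs hs' => ?_
    by_contra hz
    have ha := left_ne_zero_of_mul hz
    have hle := (hω.joins_le htt htm).2 s (hF s hs).1.1 (hF s hs).1.2 (hF s hs).2 hd
      (right_ne_zero_of_mul hz)
    exact hs' (Finset.mem_filter.2 ⟨hs, hle.2 (le_antisymm hle.1
      (hmin s (Finset.mem_filter.2 ⟨hs, ha⟩)))⟩)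

/-- The first factor of a product of trees. -/
def first : BiHamTerm I → BiHamTerm I
  | node prod t _ => t
  | t => t

theorem IsTree.first_eq {t : BiHamTerm I} (h : IsTree t) : first t = t := by cases h <;> rfl

theorem IsForest.first_spec {f : BiHamTerm I} (h : IsForest f) :
    IsNormalTree (first f) ∧ (first f).leaves ≤ f.leaves ∧ f.hd ∈ (first f).leaves ∧
      ∀ ω, val ω f ≠ 0 → val ω (first f) ≠ 0 := by
  cases h with
  | tree t h =>
    rw [h.1.first_eq]
    exact ⟨h, le_rfl, hd_mem _, fun _ h => h⟩
  | prod t f ht hf hle =>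
    exact ⟨ht, by simp [first], hd_mem t, fun ω h => by
      rw [val_prod] at h; exact left_ne_zero_of_mul h⟩

/-- The functions `ω ↦ val ω t`, for the normal monomials `t` with leaves `d`, are linearly
independent. -/
theorem indep_forest {d : Multiset I} (hd : d.Nodup) :
    Indep Set.univ {t | IsForest t ∧ t.leaves = d} := by
  classical
  induction hn : d.card using Nat.strong_induction_on generalizing d with
  | _ n ih =>
  intro F a hF h0
  by_contra hne
  push Not at hne
  -- a monomial whose first factor is as small as possible
  obtain ⟨t, ht, hmin⟩ := Finset.exists_min_image (F.filter fun t => a t ≠ 0)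
    (fun t => (first t).leaves.card)
    (by obtain ⟨t, h1, h2⟩ := hne; exact ⟨t, Finset.mem_filter.2 ⟨h1, h2⟩⟩)
  obtain ⟨htF, hta⟩ := Finset.mem_filter.1 ht
  obtain ⟨htf, rfl⟩ := hF t htF
  set D := (first t).leaves with hD
  -- forms without entries between the leaves of the first factor and the other letters
  let Ω : Set (SkewForm I) := {ω | ∀ c, ∀ i ∈ t.leaves, ∀ j ∈ t.leaves, i ∈ D → j ∉ D →
    ω.form c i j = 0}
  have hsum : ∀ ω ∈ Ω, ∑ s ∈ F.filter (fun s => (first s).leaves = D), a s * val ω s = 0 := by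
    intro ω hω
    rw [← h0 ω trivial]
    refine Finset.sum_subset (Finset.filter_subset _ _) fun s hs hs' => ?_
    by_contra hz
    have ha := left_ne_zero_of_mul hz
    obtain ⟨hsf, hsl⟩ := hF s hs
    obtain ⟨h1, h2, h3, h4⟩ := hsf.first_spec
    have hle := hmin s (Finset.mem_filter.2 ⟨hs, ha⟩)
    have hsub : ∀ i ∈ (first s).leaves, i ∈ t.leaves := fun i hi =>
      hsl ▸ Multiset.mem_of_le h2 hi
    refine hs' (Finset.mem_filter.2 ⟨hs, ?_⟩)
    rcases h1.1.connected (fun i => i ∈ D) (fun c i hi j hj => hω c i (hsub i hi) j (hsub j hj))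
      (h4 ω (right_ne_zero_of_mul hz)) with h | h
    · have hnd : (first s).leaves.Nodup := Multiset.nodup_of_le h2 (hsl ▸ hd)
      exact Multiset.eq_of_le_of_card_le ((Multiset.le_iff_subset hnd).2 h) hle
    · refine absurd ?_ (h _ h3)
      rw [hsf.hdMax.hd_eq htf.hdMax hsl]
      exact htf.first_spec.2.2.1
  have hmem : t ∈ F.filter (fun s => (first s).leaves = D) := Finset.mem_filter.2 ⟨htF, rfl⟩
  cases htf with
  | tree t htt =>
    have hDt : D = t.leaves := by rw [hD, htt.1.first_eq]
    refine hta (indep_tree hd _ a (fun s hs => ?_) (fun ω _ => hsum ω ?_) t hmem)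
    · obtain ⟨h1, h2⟩ := Finset.mem_filter.1 hs
      obtain ⟨hsf, hsl⟩ := hF s h1
      refine ⟨?_, hsl⟩
      cases hsf with
      | tree s h => exact h
      | prod u f hu hf hle =>
        exfalso
        simp only [first] at h2
        rw [hDt, ← hsl, leaves_node] at h2
        exact f.leaves_ne_zero (by simpa using h2)
    · intro c i hi j hj hiD hjD
      exact absurd (hDt ▸ hj) hjD
  | prod u f hu hf hle =>
    have hDu : D = u.leaves := rfl
    rw [leaves_node] at hd hn hF
    have hc := u.card_leaves_pos
    have hc' := f.card_leaves_pos
    have i1 := indep_tree (Multiset.nodup_add.1 hd).1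
    have i2 := ih f.leaves.card (by rw [← hn, Multiset.card_add]; omega)
      (Multiset.nodup_add.1 hd).2.1 rfl
    have i3 := i1.node (Ω := Ω) (T := {s | (IsForest s ∧ s.leaves = u.leaves + f.leaves) ∧
      (first s).leaves = D}) i2 prod (by
        rintro s ⟨⟨hsf, hsl⟩, hs⟩
        cases hsf with
        | tree s h =>
          rw [h.1.first_eq, hsl, hDu] at hs
          exact absurd (by simpa using hs) f.leaves_ne_zero
        | prod u' f' hu' hf' hle' =>
          refine ⟨u', ⟨hu', hs⟩, f', ⟨hf', ?_⟩, rfl⟩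
          rw [leaves_node, show u'.leaves = u.leaves from hs] at hsl
          exact add_left_cancel hsl) (by
        rintro ω₁ - ω₂ -
        have d1 := notMem_of_nodup_add hd
        have d2 : ∀ i ∈ f.leaves, i ∉ u.leaves := fun i h h' => d1 h' h
        refine ⟨ω₁.restrict u.leaves + ω₂.restrict f.leaves, fun c i hi j hj hiD hjD => ?_, ?_⟩
        · rw [hDu] at hiD hjD
          simp [SkewForm.restrict_form, hjD, d1 hiD]
        · rintro s ⟨-, hs⟩ g ⟨-, hg⟩
          rw [val_prod]
          congr 1
          · refine val_congr fun c i hi j hj => ?_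
            rw [hs] at hi hj
            simp [SkewForm.restrict_form, hi, hj, d1 hi]
          · refine val_congr fun c i hi j hj => ?_
            rw [hg] at hi hj
            simp [SkewForm.restrict_form, hi, hj, d2 i hi])
    refine hta (i3 _ a (fun s hs => ?_) hsum _ hmem)
    obtain ⟨h1, h2⟩ := Finset.mem_filter.1 hs
    exact ⟨hF s h1, h2⟩

end BiHamTerm

/-! ### Tree monomials -/

/-- Elements `g c i j` of a commutative ring which satisfy the relations of the double even
Orlik–Solomon algebra, where `g c i i = 0`. -/
structure OSFamily (I R : Type*) [CommRing R] where
  /-- The element with label `c` and indices `i`, `j`. -/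
  g : Fin 2 → I → I → R
  skew : ∀ c i j, g c i j = -g c j i
  diag : ∀ c i, g c i i = 0
  square : ∀ c c' i j, g c i j * g c' i j = 0
  three_term : ∀ c i j k, g c i j * g c j k + g c j k * g c k i + g c k i * g c i j = 0
  six_term : ∀ a b i j k, a ≠ b → g a i j * g b j k + g a j k * g b k i + g a k i * g b i j
    + g b i j * g a j k + g b j k * g a k i + g b k i * g a i j = 0

namespace OSFamily

variable {I R : Type*} [CommRing R] (G : OSFamily I R)

/-- The product of the elements `g c u w` along a walk that starts at `u`. -/
def walkProd (u : I) : List (Fin 2 × I) → R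
  | [] => 1
  | (c, w) :: L => G.g c u w * walkProd w L

/-- The end of a walk that starts at `u`. -/
def walkEnd (u : I) : List (Fin 2 × I) → I
  | [] => u
  | (_, w) :: L => walkEnd w L

theorem walkProd_append (u : I) (L L' : List (Fin 2 × I)) :
    G.walkProd u (L ++ L') = G.walkProd u L * G.walkProd (walkEnd u L) L' := by
  induction L generalizing u with
  | nil => simp [walkProd, walkEnd]
  | cons p L ih => simp [walkProd, walkEnd, ih, mul_assoc]

theorem walkEnd_append (u : I) (L L' : List (Fin 2 × I)) :
    walkEnd u (L ++ L') = walkEnd (walkEnd u L) L' := by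
  induction L generalizing u with
  | nil => rfl
  | cons p L ih => simp [walkEnd, ih]

/-- The product along a closed walk vanishes: by the relations for the triangle that consists of the
first two edges and a diagonal, or of the first edge and the last one, it is a combination of
products along shorter closed walks. -/
theorem closed_walk (n : ℕ) : ∀ (L : List (Fin 2 × I)) (u : I) (c : Fin 2), L.length ≤ n →
    G.g c u (walkEnd u L) * G.walkProd u L = 0 := by
  induction n with
  | zero =>
    intro L u c h
    rw [List.length_eq_zero_iff.1 (Nat.le_zero.1 h)]
    simp [walkEnd, G.diag]
  | succ n ih =>
    intro L u B h
    match L, h with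
    | [], _ => simp [walkEnd, G.diag]
    | [(A, v)], _ => simp [walkEnd, walkProd, G.square]
    | (A, v) :: (C, w) :: L, h =>
      simp only [List.length_cons] at h
      have H1 : ∀ c, G.g c v (walkEnd w L) * (G.g C v w * G.walkProd w L) = 0 := fun c =>
        ih ((C, w) :: L) v c (by simp; omega)
      have H2 : ∀ c c', G.g c u (walkEnd w L) * (G.g c' u w * G.walkProd w L) = 0 := fun c c' =>
        ih ((c', w) :: L) u c (by simp; omega)
      simp only [walkEnd, walkProd]
      set b := walkEnd w L
      set S := G.walkProd w L
      by_cases hAB : A = B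
      · subst hAB
        have h3 := G.three_term A u v b
        rw [G.skew A b u] at h3
        linear_combination (-(G.g C v w * S)) * h3 + (G.g A u v - G.g A u b) * H1 A
      by_cases hCA : C = A
      · subst hCA
        have h3 := G.three_term C u v w
        rw [G.skew C w u] at h3
        linear_combination (G.g B u b * S) * h3 + (G.g C v w + G.g C u v) * H2 B C
      · obtain rfl : C = B := by omega
        have h3 := G.three_term C u v w
        have h6 := G.six_term A C u v b hAB
        rw [G.skew C w u] at h3
        rw [G.skew A b u, G.skew C b u] at h6
        linear_combination (-(G.g C v w * S)) * h6 + (G.g A u v - G.g A u b) * H1 C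
          + (G.g C u v - G.g C u b) * H1 A - (G.g A u b * S) * h3
          - (G.g C v w + G.g C u v) * H2 A C

/-- Products of the elements `g c u v` over the edges of a tree with vertices `d`, up to sign. -/
inductive TreeMon : Multiset I → R → Prop
  | single (i : I) : TreeMon {i} 1
  | merge (c : Fin 2) (u v : I) (d e : Multiset I) (m m' : R) : TreeMon d m → TreeMon e m' →
      u ∈ d → v ∈ e → TreeMon (d + e) (G.g c u v * m * m')
  | neg (d : Multiset I) (m : R) : TreeMon d m → TreeMon d (-m)

variable {G}

theorem TreeMon.exists_walk {d : Multiset I} {m : R} (h : G.TreeMon d m) :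
    ∀ u ∈ d, ∀ v ∈ d, ∃ L, walkEnd u L = v ∧ G.walkProd u L ∣ m := by
  induction h with
  | single i =>
    intro u hu v hv
    exact ⟨[], (Multiset.mem_singleton.1 hu).trans (Multiset.mem_singleton.1 hv).symm, one_dvd _⟩
  | neg d m _ ih =>
    intro u hu v hv
    obtain ⟨L, h1, h2⟩ := ih u hu v hv
    exact ⟨L, h1, (dvd_neg).2 h2⟩
  | merge c a b d e m m' _ _ ha hb ih ih' =>
    have cross : ∀ (c : Fin 2) (a b u v : I) (d e : Multiset I) (m m' : R),
        (∀ u ∈ d, ∀ v ∈ d, ∃ L, walkEnd u L = v ∧ G.walkProd u L ∣ m) →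
        (∀ u ∈ e, ∀ v ∈ e, ∃ L, walkEnd u L = v ∧ G.walkProd u L ∣ m') →
        a ∈ d → b ∈ e → u ∈ d → v ∈ e →
        ∃ L, walkEnd u L = v ∧ G.walkProd u L ∣ G.g c a b * m * m' := by
      intro c a b u v d e m m' ih ih' ha hb hu hv
      obtain ⟨L, h1, h2⟩ := ih u hu a ha
      obtain ⟨L', h1', h2'⟩ := ih' b hb v hv
      refine ⟨L ++ (c, b) :: L', by rw [walkEnd_append, walkEnd, h1'], ?_⟩
      rw [walkProd_append, walkProd, h1]
      obtain ⟨k, rfl⟩ := h2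
      obtain ⟨k', rfl⟩ := h2'
      exact ⟨k * k', by ring⟩
    intro u hu v hv
    rcases Multiset.mem_add.1 hu with hu | hu <;> rcases Multiset.mem_add.1 hv with hv | hv
    · obtain ⟨L, h1, h2⟩ := ih u hu v hv
      exact ⟨L, h1, (h2.mul_left _).mul_right _⟩
    · exact cross c a b u v d e m m' ih ih' ha hb hu hv
    · obtain ⟨L, h1, h2⟩ := cross c b a u v e d m' m ih' ih hb ha hu hv
      refine ⟨L, h1, ?_⟩
      rw [G.skew c a b]
      have : -G.g c b a * m * m' = -(G.g c b a * m' * m) := by ring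
      rw [this]
      exact (dvd_neg).2 h2
    · obtain ⟨L, h1, h2⟩ := ih' u hu v hv
      exact ⟨L, h1, h2.mul_left _⟩

/-- Adding an edge to a tree yields zero. -/
theorem TreeMon.mul_eq_zero {d : Multiset I} {m : R} (h : G.TreeMon d m) (c : Fin 2) {u v : I}
    (hu : u ∈ d) (hv : v ∈ d) : G.g c u v * m = 0 := by
  obtain ⟨L, rfl, k, rfl⟩ := h.exists_walk u hu v hv
  rw [← mul_assoc, G.closed_walk _ L u c le_rfl, zero_mul]

theorem TreeMon.ne_zero {d : Multiset I} {m : R} (h : G.TreeMon d m) : d ≠ 0 := by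
  induction h with
  | single i => simp
  | neg _ _ _ ih => exact ih
  | merge c u v d e m m' _ _ _ _ ih _ => exact fun h => ih (add_eq_zero.1 h).1

theorem TreeMon.merge' {c : Fin 2} {u v : I} {d e f : Multiset I} {m m' n : R}
    (h : G.TreeMon d m) (h' : G.TreeMon e m') (hu : u ∈ d) (hv : v ∈ e) (hf : f = d + e)
    (hn : n = G.g c u v * m * m') : G.TreeMon f n := by
  rw [hf, hn]
  exact .merge c u v d e m m' h h' hu hv

/-- A tree with root `r` is `{r}` or has an edge that starts at `r`. -/
theorem TreeMon.reroot {d : Multiset I} {m : R} (h : G.TreeMon d m) {r : I} (hr : r ∈ d) :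
    (d = {r} ∧ (m = 1 ∨ m = -1)) ∨ ∃ (c : Fin 2) (v : I) (d₁ d₂ : Multiset I) (m₁ m₂ : R),
      G.TreeMon d₁ m₁ ∧ G.TreeMon d₂ m₂ ∧ r ∈ d₁ ∧ v ∈ d₂ ∧ d = d₁ + d₂ ∧
        m = G.g c r v * m₁ * m₂ := by
  induction h with
  | single i => exact .inl ⟨by rw [Multiset.mem_singleton.1 hr], .inl rfl⟩
  | neg d m _ ih =>
    rcases ih hr with ⟨h1, h2⟩ | ⟨c, v, d₁, d₂, m₁, m₂, h1, h2, h3, h4, h5, h6⟩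
    · exact .inl ⟨h1, h2.elim (fun h => .inr (by rw [h])) (fun h => .inl (by rw [h, neg_neg]))⟩
    · exact .inr ⟨c, v, d₁, d₂, -m₁, m₂, .neg _ _ h1, h2, h3, h4, h5, by rw [h6]; ring⟩
  | merge c u v d e m m' hd he hu hv ih ih' =>
    have key : ∀ (c : Fin 2) (u v : I) (d e : Multiset I) (m m' : R), G.TreeMon d m →
        G.TreeMon e m' → u ∈ d → v ∈ e →
        ((d = {r} ∧ (m = 1 ∨ m = -1)) ∨ ∃ (c : Fin 2) (v : I) (d₁ d₂ : Multiset I) (m₁ m₂ : R),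
          G.TreeMon d₁ m₁ ∧ G.TreeMon d₂ m₂ ∧ r ∈ d₁ ∧ v ∈ d₂ ∧ d = d₁ + d₂ ∧
          m = G.g c r v * m₁ * m₂) →
        ∃ (c' : Fin 2) (v' : I) (d₁ d₂ : Multiset I) (m₁ m₂ : R),
          G.TreeMon d₁ m₁ ∧ G.TreeMon d₂ m₂ ∧ r ∈ d₁ ∧ v' ∈ d₂ ∧ d + e = d₁ + d₂ ∧
          G.g c u v * m * m' = G.g c' r v' * m₁ * m₂ := by
      intro c u v d e m m' hd he hu hv ih
      rcases ih with ⟨rfl, -⟩ | ⟨c', w, d₁, d₂, m₁, m₂, h1, h2, h3, h4, rfl, rfl⟩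
      · obtain rfl := Multiset.mem_singleton.1 hu
        exact ⟨c, v, _, e, m, m', hd, he, hu, hv, rfl, rfl⟩
      · rcases Multiset.mem_add.1 hu with hu | hu
        · exact ⟨c', w, d₁ + e, d₂, G.g c u v * m₁ * m', m₂, .merge _ _ _ _ _ _ _ h1 he hu hv, h2,
            by simp [h3], h4, by abel, by ring⟩
        · exact ⟨c', w, d₁, d₂ + e, m₁, G.g c u v * m₂ * m', h1, .merge _ _ _ _ _ _ _ h2 he hu hv,
            h3, by simp [h4], by abel, by ring⟩
    rcases Multiset.mem_add.1 hr with hr | hr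
    · exact .inr (key c u v d e m m' hd he hu hv (ih hr))
    · obtain ⟨c', w, d₁, d₂, m₁, m₂, h1, h2, h3, h4, h5, h6⟩ :=
        key c v u e d m' m he hd hv hu (ih' hr)
      refine .inr ⟨c', w, d₁, d₂, -m₁, m₂, .neg _ _ h1, h2, h3, h4, by rw [add_comm, h5], ?_⟩
      rw [G.skew c u v]
      linear_combination -h6

/-- Two trees with one common vertex `r` form a tree. -/
theorem TreeMon.glue {d e : Multiset I} {m m' : R} {r : I} (h : G.TreeMon d m) (hr : r ∈ d)
    (h' : G.TreeMon e m') : ∀ E, e = {r} + E → G.TreeMon (d + E) (m * m') := by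
  induction h' with
  | single i =>
    intro E hE
    have : E = 0 := by
      have := congrArg Multiset.card hE
      simp only [Multiset.card_add, Multiset.card_singleton] at this
      exact Multiset.card_eq_zero.1 (by omega)
    rw [this, add_zero, mul_one]
    exact h
  | neg e m' _ ih =>
    intro E hE
    rw [mul_neg]
    exact .neg _ _ (ih E hE)
  | merge c u v e₁ e₂ m₁ m₂ h1 h2 hu hv ih1 ih2 =>
    intro E hE
    have hm : r ∈ e₁ + e₂ := by rw [hE]; simp
    have mem : ∀ {w E'}, w ∈ {r} + E' → w ∈ d + E' := by
      intro w E' hw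
      rcases Multiset.mem_add.1 hw with hw | hw
      · rw [Multiset.mem_singleton.1 hw]; simp [hr]
      · simp [hw]
    rcases Multiset.mem_add.1 hm with hm | hm
    · obtain ⟨E₁, rfl⟩ := Multiset.exists_cons_of_mem hm
      rw [← Multiset.singleton_add] at hE ih1 hu
      have hE' : E = E₁ + e₂ := by
        rw [add_assoc] at hE
        exact (add_left_cancel hE).symm
      exact (ih1 E₁ rfl).merge' (c := c) h2 (mem hu) hv (by rw [hE']; abel) (by ring)
    · obtain ⟨E₂, rfl⟩ := Multiset.exists_cons_of_mem hm
      rw [← Multiset.singleton_add] at hE ih2 hv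
      have hE' : E = e₁ + E₂ := by
        rw [add_left_comm] at hE
        exact (add_left_cancel hE).symm
      exact h1.merge' (c := c) (ih2 E₂ rfl) hu (mem hv) (by rw [hE']; abel) (by ring)

/-- An equivalence relation that contains the edges of a tree relates all its vertices. -/
theorem TreeMon.rel {d : Multiset I} {m : R} (h : G.TreeMon d m) {S : I → I → Prop}
    (hS : Equivalence S) (hedge : ∀ (c : Fin 2) (u v : I) (d₁ d₂ : Multiset I) (m₁ m₂ : R),
      G.TreeMon d₁ m₁ → G.TreeMon d₂ m₂ → u ∈ d₁ → v ∈ d₂ → d = d₁ + d₂ →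
      m = G.g c u v * m₁ * m₂ → S u v) : ∀ u ∈ d, ∀ v ∈ d, S u v := by
  induction h with
  | single i =>
    intro u hu v hv
    rw [Multiset.mem_singleton.1 hu, Multiset.mem_singleton.1 hv]
    exact hS.refl i
  | neg d m _ ih =>
    exact ih fun c u v d₁ d₂ m₁ m₂ h1 h2 hu hv hd hm =>
      hedge c u v d₁ d₂ (-m₁) m₂ (.neg _ _ h1) h2 hu hv hd (by rw [hm]; ring)
  | merge c u v d e m m' hd he hu hv ih ih' =>
    have huv : S u v := hedge c u v d e m m' hd he hu hv rfl rfl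
    have s1 : ∀ p ∈ d, ∀ q ∈ d, S p q := ih fun c' p q d₁ d₂ m₁ m₂ h1 h2 hp hq hdd hm => by
      subst hdd hm
      rcases Multiset.mem_add.1 hu with hu | hu
      · exact hedge c' p q (d₁ + e) d₂ (G.g c u v * m₁ * m') m₂ (.merge _ _ _ _ _ _ _ h1 he hu hv)
          h2 (by simp [hp]) hq (by abel) (by ring)
      · exact hedge c' p q d₁ (d₂ + e) m₁ (G.g c u v * m₂ * m') h1
          (.merge _ _ _ _ _ _ _ h2 he hu hv)
          hp (by simp [hq]) (by abel) (by ring)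
    have s2 : ∀ p ∈ e, ∀ q ∈ e, S p q := ih' fun c' p q d₁ d₂ m₁ m₂ h1 h2 hp hq hdd hm => by
      subst hdd hm
      rcases Multiset.mem_add.1 hv with hv | hv
      · exact hedge c' p q (d + d₁) d₂ (G.g c u v * m * m₁) m₂ (.merge _ _ _ _ _ _ _ hd h1 hu hv)
          h2 (by simp [hp]) hq (by abel) (by ring)
      · exact hedge c' p q d₁ (d + d₂) m₁ (G.g c u v * m * m₂) h1 (.merge _ _ _ _ _ _ _ hd h2 hu hv)
          hp (by simp [hq]) (by abel) (by ring)
    intro p hp q hq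
    rcases Multiset.mem_add.1 hp with hp | hp <;> rcases Multiset.mem_add.1 hq with hq | hq
    · exact s1 p hp q hq
    · exact hS.trans (s1 p hp u hu) (hS.trans huv (s2 v hv q hq))
    · exact hS.trans (s2 p hp v hv) (hS.trans (hS.symm huv) (s1 u hu q hq))
    · exact s2 p hp q hq

/-- Products of tree monomials with vertex sets that add up to `d`. -/
inductive ForestMon (G : OSFamily I R) : Multiset I → R → Prop
  | tree (d : Multiset I) (m : R) : G.TreeMon d m → ForestMon G d m
  | mul (d e : Multiset I) (m m' : R) : G.TreeMon d m → ForestMon G e m' →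
      ForestMon G (d + e) (m * m')

theorem ForestMon.split {d : Multiset I} {m : R} (h : G.ForestMon d m) {u : I} (hu : u ∈ d) :
    (∃ m', G.TreeMon d m' ∧ m = m') ∨ ∃ d₁ d₂ m₁ m₂, G.TreeMon d₁ m₁ ∧ u ∈ d₁ ∧ G.ForestMon d₂ m₂ ∧
      d = d₁ + d₂ ∧ m = m₁ * m₂ := by
  induction h with
  | tree d m hm => exact .inl ⟨m, hm, rfl⟩
  | mul d e m m' hm hf ih =>
    rcases Multiset.mem_add.1 hu with hu | hu
    · exact .inr ⟨d, e, m, m', hm, hu, hf, rfl, rfl⟩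
    · rcases ih hu with ⟨m'', h, rfl⟩ | ⟨d₁, d₂, m₁, m₂, h1, h2, h3, rfl, rfl⟩
      · exact .inr ⟨e, d, m', m, h, hu, .tree d m hm, add_comm _ _, mul_comm _ _⟩
      · exact .inr ⟨d₁, d + d₂, m₁, m * m₂, h1, h2, .mul _ _ _ _ hm h3, add_left_comm _ _ _,
          mul_left_comm _ _ _⟩

/-- The product of a forest monomial with a generator is zero or a forest monomial. -/
theorem ForestMon.mul_g {d : Multiset I} {m : R} (h : G.ForestMon d m) (c : Fin 2) {u v : I}
    (hu : u ∈ d) (hv : v ∈ d) : G.g c u v * m = 0 ∨ G.ForestMon d (G.g c u v * m) := by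
  rcases h.split hu with ⟨m', hm, rfl⟩ | ⟨d₁, d₂, m₁, m₂, h1, h2, h3, rfl, rfl⟩
  · exact .inl (hm.mul_eq_zero c hu hv)
  · rcases Multiset.mem_add.1 hv with hv | hv
    · exact .inl (by rw [← mul_assoc, h1.mul_eq_zero c h2 hv, zero_mul])
    · refine .inr ?_
      rcases h3.split hv with ⟨m', hm, rfl⟩ | ⟨e₁, e₂, n₁, n₂, k1, k2, k3, rfl, rfl⟩
      · rw [← mul_assoc]
        exact .tree _ _ (.merge _ _ _ _ _ _ _ h1 hm h2 hv)
      · have e : G.g c u v * (m₁ * (n₁ * n₂)) = G.g c u v * m₁ * n₁ * n₂ := by ring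
        rw [e, ← add_assoc]
        exact .mul _ _ _ _ (.merge _ _ _ _ _ _ _ h1 k1 h2 k2) k3

theorem forestMon_one {d : Multiset I} (hd : d ≠ 0) : G.ForestMon d 1 := by
  induction d using Multiset.induction with
  | empty => exact absurd rfl hd
  | cons i d ih =>
    rw [← Multiset.singleton_add]
    by_cases h : d = 0
    · rw [h, add_zero]
      exact .tree _ _ (.single i)
    · have := ForestMon.mul {i} d 1 1 (.single i) (ih h)
      rwa [one_mul] at this

end OSFamily

/-! ### Normal tree monomials span the tree monomials -/

namespace OSFamily

open BiHamTerm

section Mon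

variable {I R : Type*} [CommRing R] (G : OSFamily I R)

/-- The monomial of the forest that is associated with a normal monomial: the bracket `{j, t}₁` adds
an `x`-edge from `top t` to `j`, and `{t, b}₂` adds a `y`-edge from `last t` to `top b`. -/
def mon : BiHamTerm I → R
  | leaf _ => 1
  | node prod s t => mon s * mon t
  | node (bracket c) s t =>
      (if c = 0 then G.g 0 t.top s.top else G.g 1 s.last t.top) * mon s * mon t

@[simp] theorem mon_leaf (i : I) : G.mon (leaf i) = 1 := rfl
@[simp] theorem mon_prod (s t : BiHamTerm I) : G.mon (node prod s t) = G.mon s * G.mon t := rfl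

@[simp] theorem mon_ext (j : I) (t : BiHamTerm I) : G.mon (ext j t) = G.g 0 t.top j * G.mon t := by
  simp [mon, top]

@[simp] theorem mon_join (t b : BiHamTerm I) :
    G.mon (join t b) = G.g 1 t.last b.top * G.mon t * G.mon b := rfl

/-- The product over a `y`-chain that starts at `r`, to which the blocks in a list are attached by
their leftmost letters. -/
def chain (r : I) : List (BiHamTerm I) → R
  | [] => 1
  | b :: L => G.g 1 r b.top * G.mon b * chain b.top L

/-- Products of `y`-chains with the same first vertex are sums over shuffles. -/
theorem chain_mul_chain [Algebra ℚ R] (n : ℕ) : ∀ (r : I) (L L' : List (BiHamTerm I)),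
    L.length + L'.length ≤ n → G.chain r L * G.chain r L' ∈
      Submodule.span ℚ {m | ∃ K : List (BiHamTerm I), K.Perm (L ++ L') ∧ G.chain r K = m} := by
  induction n with
  | zero =>
    intro r L L' h
    rw [List.length_eq_zero_iff.1 (by omega : L.length = 0),
      List.length_eq_zero_iff.1 (by omega : L'.length = 0)]
    exact Submodule.subset_span ⟨[], by simp, by simp [chain]⟩
  | succ n ih =>
    intro r L L' h
    match L, L', h with
    | [], L', _ => exact Submodule.subset_span ⟨L', by simp, by simp [chain]⟩
    | b :: L, [], _ => exact Submodule.subset_span ⟨b :: L, by simp, by simp [chain]⟩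
    | b :: L, b' :: L', h =>
      simp only [List.length_cons] at h
      have h3 := G.three_term 1 b.top r b'.top
      rw [G.skew 1 b.top r, G.skew 1 b'.top b.top] at h3
      have e : G.chain r (b :: L) * G.chain r (b' :: L')
          = G.g 1 r b.top * G.mon b * (G.chain b.top L * G.chain b.top (b' :: L'))
            + G.g 1 r b'.top * G.mon b' * (G.chain b'.top (b :: L) * G.chain b'.top L') := by
        simp only [chain]
        rw [G.skew 1 b'.top b.top]
        linear_combination -(G.mon b * G.mon b' * G.chain b.top L * G.chain b'.top L') * h3
      have step : ∀ (b : BiHamTerm I) (M N : List (BiHamTerm I)) (x : R), x ∈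
          Submodule.span ℚ {m | ∃ K : List (BiHamTerm I), K.Perm M ∧ G.chain b.top K = m} →
          (b :: M).Perm N → G.g 1 r b.top * G.mon b * x ∈
          Submodule.span ℚ {m | ∃ K : List (BiHamTerm I), K.Perm N ∧ G.chain r K = m} := by
        intro b M N x hx hN
        induction hx using Submodule.span_induction with
        | zero => simp
        | add x y _ _ hx hy => rw [mul_add]; exact add_mem hx hy
        | smul c x _ hx => rw [mul_smul_comm]; exact Submodule.smul_mem _ c hx
        | mem x hx =>
          obtain ⟨K, hK, rfl⟩ := hx
          exact Submodule.subset_span ⟨b :: K, (hK.cons b).trans hN, rfl⟩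
      rw [e]
      refine add_mem (step b _ _ _ (ih b.top L (b' :: L') (by simp; omega)) (by simp)) ?_
      refine step b' _ _ _ (ih b'.top (b :: L) L' (by simp; omega)) ?_
      exact (List.perm_middle (a := b') (l₁ := b :: L) (l₂ := L')).symm

theorem mon_foldl (L : List (BiHamTerm I)) (u : BiHamTerm I) :
    G.mon (L.foldl join u) = G.mon u * G.chain u.last L := by
  induction L generalizing u with
  | nil => simp [chain]
  | cons b L ih =>
    rw [List.foldl_cons, ih, chain, mon_join, last_join]
    ring

end Mon

section Star

variable {I R : Type*} [CommRing R] {G : OSFamily I R}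

/-- The tree monomials with an `x`-edge at `r`; here `E` is the set of vertices without `r`. -/
def starSet (G : OSFamily I R) (r : I) (E : Multiset I) : Set R :=
  {m | ∃ (v : I) (C E' : Multiset I) (m₁ m₂ : R), v ∈ C ∧ G.TreeMon C m₁ ∧
    G.TreeMon ({r} + E') m₂ ∧ E = C + E' ∧ G.g 0 r v * m₁ * m₂ = m}

theorem star_mul_mem {r : I} {E E' : Multiset I} {m m' : R} (h : m ∈ G.starSet r E)
    (h' : G.TreeMon ({r} + E') m') : m * m' ∈ G.starSet r (E + E') := by
  obtain ⟨v, C, F, m₁, m₂, hv, h1, h2, rfl, rfl⟩ := h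
  refine ⟨v, C, F + E', m₁, m₂ * m', hv, h1, ?_, by rw [add_assoc], by ring⟩
  rw [← add_assoc]
  exact h2.glue (r := r) (by simp) h' E' rfl

end Star

variable {I R : Type*} [LinearOrder I] [CommRing R] {G : OSFamily I R}

/-- The blocks that are admitted in normal trees. -/
def IsGoodBlock (b : BiHamTerm I) : Prop := IsBlock b ∧ IsTree b ∧ HdMax b

theorem foldl_join {L : List (BiHamTerm I)} (hL : ∀ b ∈ L, IsGoodBlock b) :
    ∀ {u : BiHamTerm I}, IsTree u → IsTree (L.foldl join u) ∧
      (L.foldl join u).leaves = u.leaves + (L.map leaves).sum ∧ (L.foldl join u).hd = u.hd ∧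
      (L.foldl join u).top = u.top := by
  induction L with
  | nil => intro u hu; simp [hu]
  | cons b L ih =>
    intro u hu
    obtain ⟨h1, h2, h3⟩ := hL b (by simp)
    obtain ⟨a1, a2, a3, a4⟩ := ih (fun b hb => hL b (by simp [hb])) (IsTree.join u b hu h1 h2 h3)
    refine ⟨a1, ?_, a3, a4⟩
    rw [List.foldl_cons, a2, leaves_node, List.map_cons, List.sum_cons, add_assoc]

theorem exists_foldl {t : BiHamTerm I} (ht : IsTree t) : ∃ (e : BiHamTerm I)
    (L : List (BiHamTerm I)), IsBlock e ∧ IsTree e ∧ (∀ b ∈ L, IsGoodBlock b) ∧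
      t = L.foldl join e := by
  induction ht with
  | leaf i => exact ⟨leaf i, [], .leaf i, .leaf i, by simp, rfl⟩
  | ext j t ht _ => exact ⟨ext j t, [], .ext j t, .ext j t ht, by simp, rfl⟩
  | join t b ht hb hbt hbm iht _ =>
    obtain ⟨e, L, h1, h2, h3, rfl⟩ := iht
    refine ⟨e, L ++ [b], h1, h2, fun c hc => ?_, by simp⟩
    rcases List.mem_append.1 hc with hc | hc
    · exact h3 c hc
    · rw [List.mem_singleton.1 hc]
      exact ⟨hb, hbt, hbm⟩

theorem _root_.BiHamTerm.IsTree.treeMon {t : BiHamTerm I} (ht : IsTree t) :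
    G.TreeMon t.leaves (G.mon t) := by
  induction ht with
  | leaf i => exact .single i
  | ext j t _ ih =>
    exact ih.merge' (c := 0) (.single j) t.top_mem (Multiset.mem_singleton_self j)
      (by rw [leaves_node, add_comm, leaves_leaf]) (by rw [mon_ext, mul_one])
  | join t b _ _ _ _ iht ihb => exact iht.merge' (c := 1) ihb t.last_mem b.top_mem rfl (mon_join ..)

theorem chain_treeMon {L : List (BiHamTerm I)} (hL : ∀ b ∈ L, IsGoodBlock b) (r : I) :
    G.TreeMon ({r} + (L.map leaves).sum) (G.chain r L) := by
  obtain ⟨h1, h2, -⟩ := foldl_join hL (IsTree.leaf r)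
  have := h1.treeMon (G := G)
  rwa [h2, mon_foldl, mon_leaf, one_mul] at this

/-- A normal tree `u` can be grafted at the head of a tree `t`, by an `x`-edge from `top u` to the
head of `t`. -/
theorem exists_graft (G : OSFamily I R) {t u : BiHamTerm I} (ht : IsTree t) (hu : IsTree u) :
    ∃ t', IsTree t' ∧ t'.hd = u.hd ∧ t'.leaves = t.leaves + u.leaves ∧ t'.top = t.top ∧
      t'.last = t.last ∧ G.mon t' = G.g 0 u.top t.hd * G.mon t * G.mon u := by
  induction ht with
  | leaf v => exact ⟨ext v u, .ext v u hu, rfl, rfl, rfl, rfl, by simp⟩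
  | ext j t _ ih =>
    obtain ⟨t', h1, h2, h3, h4, h5, h6⟩ := ih
    refine ⟨ext j t', .ext j t' h1, h2, by simp [h3], rfl, rfl, ?_⟩
    rw [mon_ext, mon_ext, h4, h6, hd_ext]
    ring
  | join t b _ hb hbt hbm ih _ =>
    obtain ⟨t', h1, h2, h3, h4, h5, h6⟩ := ih
    refine ⟨join t' b, .join t' b h1 hb hbt hbm, h2, by simp [h3, add_right_comm], h4, rfl, ?_⟩
    rw [mon_join, mon_join, h5, h6, hd_join]
    ring

/-- The products of `y`-chains of blocks that start at `r`; here `E` is the set of vertices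
without `r`. -/
def chainSet (G : OSFamily I R) (r : I) (E : Multiset I) : Set R :=
  {m | ∃ L : List (BiHamTerm I), (∀ b ∈ L, IsGoodBlock b) ∧ (L.map leaves).sum = E ∧
    G.chain r L = m}

theorem treeMon_of_mem {r : I} {E : Multiset I} {m : R} (h : m ∈ G.chainSet r E ∪ G.starSet r E) :
    G.TreeMon ({r} + E) m := by
  rcases h with ⟨L, hL, rfl, rfl⟩ | ⟨v, C, E', m₁, m₂, hv, h1, h2, rfl, rfl⟩
  · exact chain_treeMon hL r
  · exact h2.merge' (c := 0) (u := r) h1 (by simp) hv (by abel) (by ring)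

theorem tree_mul_forest {t f : BiHamTerm I} (ht : IsNormalTree t) (hf : IsForest f) :
    ∃ h, IsForest h ∧ h.leaves = t.leaves + f.leaves ∧ G.mon h = G.mon t * G.mon f := by
  induction hf with
  | tree f hf =>
    rcases le_total f.hd t.hd with h | h
    · exact ⟨_, .prod t f ht (.tree f hf) fun x hx => (hf.2 x hx).trans h, rfl, rfl⟩
    · exact ⟨_, .prod f t hf (.tree t ht) fun x hx => (ht.2 x hx).trans h, add_comm _ _,
        mul_comm _ _⟩
  | prod t' f ht' hf hle ih =>
    rcases le_total t'.hd t.hd with h | h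
    · exact ⟨_, .prod t _ ht (.prod t' f ht' hf hle)
        fun x hx => ((IsForest.prod t' f ht' hf hle).hdMax x hx).trans h, rfl, rfl⟩
    · obtain ⟨k, h1, h2, h3⟩ := ih
      refine ⟨_, .prod t' k ht' h1 fun x hx => ?_, ?_, ?_⟩
      · rw [h2] at hx
        rcases Multiset.mem_add.1 hx with hx | hx
        · exact (ht.2 x hx).trans h
        · exact hle x hx
      · rw [leaves_node, leaves_node, h2, add_left_comm]
      · rw [mon_prod, mon_prod, h3, mul_left_comm]

variable [Algebra ℚ R]

/-- The span of the trees with head `r` and leaves `d` which satisfy all conditions of normal trees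
except for the maximality of `r`. -/
def rootedSpan (G : OSFamily I R) (r : I) (d : Multiset I) : Submodule ℚ R :=
  Submodule.span ℚ {m | ∃ t, IsTree t ∧ t.hd = r ∧ t.leaves = d ∧ G.mon t = m}

/-- The span of the `y`-chains at `r` and of the trees with an `x`-edge at `r`. -/
def branchSpan (G : OSFamily I R) (r : I) (E : Multiset I) : Submodule ℚ R :=
  Submodule.span ℚ (G.chainSet r E ∪ G.starSet r E)

theorem branchSpan_mul_mem {r : I} {E E' : Multiset I} {x y : R} (hx : x ∈ G.branchSpan r E)
    (hy : y ∈ G.branchSpan r E') : x * y ∈ G.branchSpan r (E + E') := by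
  refine bilin_mem_of_span (LinearMap.mul ℚ R) ?_ hx hy
  intro s hs t ht
  rw [LinearMap.mul_apply']
  rcases hs with hs | hs
  · rcases ht with ht | ht
    · obtain ⟨L, hL, rfl, rfl⟩ := hs
      obtain ⟨L', hL', rfl, rfl⟩ := ht
      refine Submodule.span_mono ?_ (G.chain_mul_chain _ r L L' le_rfl)
      rintro _ ⟨K, hK, rfl⟩
      refine .inl ⟨K, fun b hb => ?_, ?_, rfl⟩
      · exact (List.mem_append.1 (hK.subset hb)).elim (hL b) (hL' b)
      · rw [(hK.map leaves).sum_eq, List.map_append, List.sum_append]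
    · rw [mul_comm, add_comm]
      exact Submodule.subset_span (.inr (star_mul_mem ht (treeMon_of_mem (.inl hs))))
  · exact Submodule.subset_span (.inr (star_mul_mem hs (treeMon_of_mem ht)))

theorem exists_max (d : Multiset I) (hd : d ≠ 0) : ∃ r ∈ d, ∀ x ∈ d, x ≤ r := by
  obtain ⟨i, hi⟩ := Multiset.exists_mem_of_ne_zero hd
  obtain ⟨r, hr, h⟩ := d.toFinset.exists_max_image id ⟨i, by simpa using hi⟩
  exact ⟨r, by simpa using hr, fun x hx => h x (by simpa using hx)⟩

/-- A `y`-branch at `r`: moving the vertex at which it is attached along an edge changes it by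
trees with an `x`-edge at `r` and by products of smaller `y`-branches. -/
theorem y_branch_mem {n : ℕ} (hP : ∀ (d : Multiset I), d.card < n → ∀ r ∈ d, ∀ m, G.TreeMon d m →
    m ∈ G.rootedSpan r d) (r : I) (k : ℕ) : ∀ (D : Multiset I), D.card ≤ k → D.card < n →
    ∀ w ∈ D, ∀ m, G.TreeMon D m → G.g 1 r w * m ∈ G.branchSpan r D := by
  induction k with
  | zero =>
    intro D hD _ w hw
    rw [Multiset.card_eq_zero.1 (Nat.le_zero.1 hD)] at hw
    simp at hw
  | succ k ih =>
    intro D hD hn w hw m hm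
    -- the vertex of attachment can be moved
    have move : ∀ m, G.TreeMon D m → ∀ u ∈ D, ∀ v ∈ D,
        G.g 1 r u * m - G.g 1 r v * m ∈ G.branchSpan r D := by
      intro m hm
      refine hm.rel (S := fun u v => G.g 1 r u * m - G.g 1 r v * m ∈ G.branchSpan r D)
        ⟨fun u => by simp, fun {u v} h => by simpa using neg_mem h,
          fun {u v w} h h' => by simpa using add_mem h h'⟩ ?_
      intro c u v d₁ d₂ m₁ m₂ h1 h2 hu hv hd hm'
      have p1 := Multiset.card_pos.2 h1.ne_zero
      have p2 := Multiset.card_pos.2 h2.ne_zero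
      have hc := congrArg Multiset.card hd
      rw [Multiset.card_add] at hc
      have b1 := ih d₁ (by omega) (by omega) u hu m₁ h1
      have b2 := ih d₂ (by omega) (by omega) v hv m₂ h2
      by_cases hc0 : c = 0
      · subst hc0
        have h6 := G.six_term 0 1 r u v (by decide)
        rw [G.skew 0 v r, G.skew 1 v r] at h6
        have t1 : G.TreeMon D (G.g 1 u v * m₁ * m₂) := h1.merge' h2 hu hv hd rfl
        have t2 : G.TreeMon ({r} + d₁) (G.g 1 r u * m₁) :=
          (TreeMon.single r).merge' h1 (Multiset.mem_singleton_self r) hu rfl (by ring)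
        have t3 : G.TreeMon ({r} + d₂) (G.g 1 r v * m₂) :=
          (TreeMon.single r).merge' h2 (Multiset.mem_singleton_self r) hv rfl (by ring)
        have s1 : G.g 0 r u * (G.g 1 u v * m₁ * m₂) * 1 ∈ G.starSet r D :=
          ⟨u, D, 0, _, 1, by rw [hd]; simp [hu], t1, by rw [add_zero]; exact .single r, by simp,
            rfl⟩
        have s2 : G.g 0 r v * (G.g 1 u v * m₁ * m₂) * 1 ∈ G.starSet r D :=
          ⟨v, D, 0, _, 1, by rw [hd]; simp [hv], t1, by rw [add_zero]; exact .single r, by simp,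
            rfl⟩
        have s3 : G.g 0 r v * m₂ * (G.g 1 r u * m₁) ∈ G.starSet r D :=
          ⟨v, d₂, d₁, _, _, hv, h2, t2, by rw [hd, add_comm], rfl⟩
        have s4 : G.g 0 r u * m₁ * (G.g 1 r v * m₂) ∈ G.starSet r D :=
          ⟨u, d₁, d₂, _, _, hu, h1, t3, hd, rfl⟩
        have e : G.g 1 r u * m - G.g 1 r v * m = G.g 0 r v * (G.g 1 u v * m₁ * m₂) * 1
            - G.g 0 r u * (G.g 1 u v * m₁ * m₂) * 1 + G.g 0 r v * m₂ * (G.g 1 r u * m₁)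
            + G.g 0 r u * m₁ * (G.g 1 r v * m₂) := by
          rw [hm']
          linear_combination (m₁ * m₂) * h6
        rw [e]
        exact add_mem (add_mem (sub_mem (Submodule.subset_span (.inr s2))
          (Submodule.subset_span (.inr s1))) (Submodule.subset_span (.inr s3)))
          (Submodule.subset_span (.inr s4))
      · obtain rfl : c = 1 := by omega
        have h3 := G.three_term 1 r u v
        rw [G.skew 1 v r] at h3
        have e : G.g 1 r u * m - G.g 1 r v * m = (G.g 1 r u * m₁) * (G.g 1 r v * m₂) := by
          rw [hm']
          linear_combination (m₁ * m₂) * h3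
        rw [e, hd]
        exact branchSpan_mul_mem b1 b2
    -- expanded with its maximum as root, the branch is a `y`-chain if it is attached by its top
    obtain ⟨q, hq, hmax⟩ := exists_max D hm.ne_zero
    have hmr := hP D hn q hq m hm
    clear hm
    induction hmr using Submodule.span_induction with
    | zero => simp
    | add x y _ _ hx hy => rw [mul_add]; exact add_mem hx hy
    | smul c x _ hx => rw [mul_smul_comm]; exact Submodule.smul_mem _ c hx
    | mem x hx =>
      obtain ⟨t, ht, rfl, rfl, rfl⟩ := hx
      have hdiff := move _ ht.treeMon w hw t.top t.top_mem
      refine (sub_add_cancel (G.g 1 r w * G.mon t) (G.g 1 r t.top * G.mon t)) ▸ add_mem hdiff ?_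
      obtain ⟨e, L, h1, h2, h3, rfl⟩ := exists_foldl ht
      obtain ⟨-, a2, a3, a4⟩ := foldl_join h3 h2
      refine Submodule.subset_span (.inl ⟨e :: L, fun b hb => ?_, ?_, ?_⟩)
      · rcases List.mem_cons.1 hb with rfl | hb
        · refine ⟨h1, h2, fun x hx => ?_⟩
          rw [← a3]
          exact hmax x (by rw [a2]; simp [hx])
        · exact h3 b hb
      · rw [a2, List.map_cons, List.sum_cons]
      · have hl : e.last = e.top := by cases h1 <;> rfl
        rw [a4, mon_foldl, chain, hl]
        ring

/-- A tree with an `x`-edge at `r` belongs to `starSet`, and any other tree is a product of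
`y`-branches at `r`. -/
theorem mem_branchSpan {n : ℕ} (hP : ∀ (d : Multiset I), d.card < n → ∀ r ∈ d, ∀ m, G.TreeMon d m →
    m ∈ G.rootedSpan r d) (r : I) (k : ℕ) : ∀ (E : Multiset I) (m : R), E.card ≤ k → E.card < n →
    G.TreeMon ({r} + E) m → m ∈ G.branchSpan r E := by
  have one : (1 : R) ∈ G.branchSpan r 0 :=
    Submodule.subset_span (.inl ⟨[], by simp, by simp, rfl⟩)
  induction k with
  | zero =>
    intro E m hE _ hm
    obtain rfl := Multiset.card_eq_zero.1 (Nat.le_zero.1 hE)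
    rcases hm.reroot (r := r) (by simp) with ⟨-, h⟩ | ⟨c, v, d₁, d₂, m₁, m₂, h1, h2, -, -, h, -⟩
    · exact h.elim (fun h => h ▸ one) (fun h => h ▸ neg_mem one)
    · have p1 := Multiset.card_pos.2 h1.ne_zero
      have p2 := Multiset.card_pos.2 h2.ne_zero
      have := congrArg Multiset.card h
      simp only [Multiset.card_add, Multiset.card_singleton, Multiset.card_zero] at this
      omega
  | succ k ih =>
    intro E m hE hn hm
    rcases hm.reroot (r := r) (by simp) with
      ⟨h0, h⟩ | ⟨c, v, d₁, d₂, m₁, m₂, h1, h2, hr, hv, h, hm'⟩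
    · have : E = 0 := add_eq_left.1 h0
      rw [this]
      exact h.elim (fun h => h ▸ one) (fun h => h ▸ neg_mem one)
    · obtain ⟨E₁, rfl⟩ := Multiset.exists_cons_of_mem hr
      rw [← Multiset.singleton_add] at h h1
      rw [add_assoc] at h
      obtain rfl := add_left_cancel h
      have p2 := Multiset.card_pos.2 h2.ne_zero
      rw [Multiset.card_add] at hE hn
      by_cases hc0 : c = 0
      · subst hc0
        exact Submodule.subset_span (.inr ⟨v, d₂, E₁, m₂, m₁, hv, h2, h1, add_comm _ _,
          by rw [hm']; ring⟩)
      · obtain rfl : c = 1 := by omega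
        have e : m = m₁ * (G.g 1 r v * m₂) := by rw [hm']; ring
        rw [e]
        exact branchSpan_mul_mem (ih E₁ m₁ (by omega) (by omega) h1)
          (y_branch_mem hP r d₂.card d₂ le_rfl (by omega) v hv m₂ h2)

/-- An `x`-branch at `r` times an element of `branchSpan`: the three-term relation replaces several
`x`-edges at `r` by a single one, and then the branch is expanded with root `v`. -/
theorem star_mem_rootedSpan {n : ℕ} (hP : ∀ (d : Multiset I), d.card < n → ∀ r ∈ d, ∀ m,
    G.TreeMon d m → m ∈ G.rootedSpan r d) (r : I) (k : ℕ) : ∀ (v : I) (C E : Multiset I) (m x : R),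
    E.card ≤ k → C.card + E.card < n → v ∈ C → G.TreeMon C m → x ∈ G.branchSpan r E →
    G.g 0 r v * m * x ∈ G.rootedSpan r ({r} + (C + E)) := by
  have hchain : ∀ (v : I) (C E : Multiset I) (m x : R), C.card < n → v ∈ C →
      G.TreeMon C m → x ∈ G.chainSet r E → G.g 0 r v * m * x ∈ G.rootedSpan r ({r} + (C + E)) := by
    rintro v C _ m _ hn hv hm ⟨L, hL, rfl, rfl⟩
    have hmr := hP C hn v hv m hm
    clear hm
    induction hmr using Submodule.span_induction with
    | zero => simp
    | add x y _ _ hx hy => rw [mul_add, add_mul]; exact add_mem hx hy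
    | smul c x _ hx => rw [mul_smul_comm, smul_mul_assoc]; exact Submodule.smul_mem _ c hx
    | mem x hx =>
      obtain ⟨t, ht, rfl, rfl, rfl⟩ := hx
      obtain ⟨a1, a2, a3, a4⟩ := foldl_join hL (IsTree.leaf r)
      obtain ⟨t', b1, b2, b3, -, -, b6⟩ := exists_graft G ht a1
      refine Submodule.subset_span ⟨t', b1, by rw [b2, a3]; rfl, ?_, ?_⟩
      · rw [b3, a2, leaves_leaf]; abel
      · rw [b6, mon_foldl, a4, mon_leaf, one_mul]; rfl
  induction k with
  | zero =>
    intro v C E m x hE hn hv hm hx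
    obtain rfl := Multiset.card_eq_zero.1 (Nat.le_zero.1 hE)
    induction hx using Submodule.span_induction with
    | zero => simp
    | add x y _ _ hx hy => rw [mul_add]; exact add_mem hx hy
    | smul c x _ hx => rw [mul_smul_comm]; exact Submodule.smul_mem _ c hx
    | mem x hx =>
      rcases hx with hx | ⟨v', C', E', m₁, m₂, hv', h1, h2, h, -⟩
      · exact hchain v C 0 m x (by simpa using hn) hv hm hx
      · exact absurd (add_eq_zero.1 h.symm).1 h1.ne_zero
  | succ k ih =>
    intro v C E m x hE hn hv hm hx
    induction hx using Submodule.span_induction with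
    | zero => simp
    | add x y _ _ hx hy => rw [mul_add]; exact add_mem hx hy
    | smul c x _ hx => rw [mul_smul_comm]; exact Submodule.smul_mem _ c hx
    | mem x hx =>
      rcases hx with hx | ⟨v', C', E', m₁, m₂, hv', h1, h2, rfl, rfl⟩
      · exact hchain v C E m x (by omega) hv hm hx
      · -- two `x`-edges at `r` are replaced by one
        rw [Multiset.card_add] at hE hn
        have p1 := Multiset.card_pos.2 h1.ne_zero
        have hb := mem_branchSpan hP r E'.card E' m₂ le_rfl (by omega) h2
        have t1 : G.TreeMon (C + C') (G.g 0 v v' * m * m₁) := .merge _ _ _ _ _ _ _ hm h1 hv hv'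
        have i1 := ih v (C + C') E' _ m₂ (by omega) (by rw [Multiset.card_add]; omega)
          (by simp [hv]) t1 hb
        have i2 := ih v' (C + C') E' _ m₂ (by omega) (by rw [Multiset.card_add]; omega)
          (by simp [hv']) t1 hb
        have h3 := G.three_term 0 r v v'
        rw [G.skew 0 v' r] at h3
        have e : G.g 0 r v * m * (G.g 0 r v' * m₁ * m₂)
            = G.g 0 r v * (G.g 0 v v' * m * m₁) * m₂ - G.g 0 r v' * (G.g 0 v v' * m * m₁) * m₂ := by
          linear_combination -(m * m₁ * m₂) * h3
        rw [e, ← add_assoc C C' E']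
        exact sub_mem i1 i2

/-- Every tree monomial is a combination of the monomials of the trees in `rootedSpan`, for any
choice of the root. -/
theorem mem_rootedSpan (n : ℕ) : ∀ (d : Multiset I), d.card < n → ∀ r ∈ d, ∀ m, G.TreeMon d m →
    m ∈ G.rootedSpan r d := by
  induction n with
  | zero => intro d hd; omega
  | succ n ih =>
    intro d hd r hr m hm
    obtain ⟨E, rfl⟩ := Multiset.exists_cons_of_mem hr
    rw [← Multiset.singleton_add] at hm hd ⊢
    rw [Multiset.card_add, Multiset.card_singleton] at hd
    have hb := mem_branchSpan ih r E.card E m le_rfl (by omega) hm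
    clear hm
    induction hb using Submodule.span_induction with
    | zero => simp
    | add x y _ _ hx hy => exact add_mem hx hy
    | smul c x _ hx => exact Submodule.smul_mem _ c hx
    | mem x hx =>
      rcases hx with ⟨L, hL, rfl, rfl⟩ | ⟨v, C, E', m₁, m₂, hv, h1, h2, rfl, rfl⟩
      · obtain ⟨a1, a2, a3, -⟩ := foldl_join hL (IsTree.leaf r)
        exact Submodule.subset_span ⟨_, a1, a3, a2, by rw [mon_foldl, mon_leaf, one_mul]; rfl⟩
      · rw [Multiset.card_add] at hd
        have p1 := Multiset.card_pos.2 h1.ne_zero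
        exact star_mem_rootedSpan ih r E'.card v C E' m₁ m₂ le_rfl (by omega) hv h1
          (mem_branchSpan ih r E'.card E' m₂ le_rfl (by omega) h2)

/-- The span of the monomials associated with the normal monomials with leaves `d`. -/
def forestSpan (G : OSFamily I R) (d : Multiset I) : Submodule ℚ R :=
  Submodule.span ℚ {m | ∃ t, IsForest t ∧ t.leaves = d ∧ G.mon t = m}

theorem TreeMon.mul_mem_forestSpan {d e : Multiset I} {m x : R} (hm : G.TreeMon d m)
    (hx : x ∈ G.forestSpan e) : m * x ∈ G.forestSpan (d + e) := by
  obtain ⟨r, hr, hmax⟩ := exists_max d hm.ne_zero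
  refine bilin_mem_of_span (LinearMap.mul ℚ R) ?_
    (mem_rootedSpan _ d (Nat.lt_succ_self _) r hr m hm) hx
  rintro _ ⟨t, ht, rfl, rfl, rfl⟩ _ ⟨f, hf, rfl, rfl⟩
  obtain ⟨h, h1, h2, h3⟩ := tree_mul_forest (G := G) ⟨ht, hmax⟩ hf
  exact Submodule.subset_span ⟨h, h1, h2, h3⟩

theorem ForestMon.mem_forestSpan {d : Multiset I} {m : R} (h : G.ForestMon d m) :
    m ∈ G.forestSpan d := by
  induction h with
  | tree d m hm =>
    obtain ⟨r, hr, hmax⟩ := exists_max d hm.ne_zero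
    refine Submodule.span_mono ?_ (mem_rootedSpan _ d (Nat.lt_succ_self _) r hr m hm)
    rintro _ ⟨t, ht, rfl, rfl, rfl⟩
    exact ⟨t, .tree t ⟨ht, hmax⟩, rfl, rfl⟩
  | mul d e m m' hm _ ih => exact hm.mul_mem_forestSpan ih

end OSFamily

/-! ### Normal monomials span the double even Orlik–Solomon algebra -/

namespace DoubleOS

open OSFamily

variable {I : Type*}

open Classical in
/-- The generators of the double even Orlik–Solomon algebra, extended by zero to the diagonal. -/
def genOrZero (c : Fin 2) (i j : I) : DoubleOS I :=
  if h : i ≠ j then Ideal.Quotient.mk _ (var c i j h) else 0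

theorem genOrZero_of_ne (c : Fin 2) {i j : I} (h : i ≠ j) :
    genOrZero c i j = Ideal.Quotient.mk _ (var c i j h) := dif_pos h

theorem genOrZero_self (c : Fin 2) (i : I) : genOrZero c i i = 0 := dif_neg (by simp)

theorem mk_eq_zero_of_rel {p : MvPolynomial (Gen I) ℚ} (h : Rel I p) :
    (Ideal.Quotient.mk (Ideal.span {r | Rel I r}) p : DoubleOS I) = 0 :=
  Ideal.Quotient.eq_zero_iff_mem.2 (Ideal.subset_span h)

theorem genOrZero_skew (c : Fin 2) (i j : I) : genOrZero c i j = -genOrZero c j i := by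
  by_cases h : i = j
  · rw [h, genOrZero_self, neg_zero]
  · have := mk_eq_zero_of_rel (.skew c i j h)
    rw [map_add, ← genOrZero_of_ne, ← genOrZero_of_ne] at this
    exact eq_neg_of_add_eq_zero_left this

theorem genOrZero_square (c c' : Fin 2) (i j : I) : genOrZero c i j * genOrZero c' i j = 0 := by
  by_cases h : i = j
  · rw [h, genOrZero_self, zero_mul]
  · have := mk_eq_zero_of_rel (.square c c' i j h)
    rwa [map_mul, ← genOrZero_of_ne, ← genOrZero_of_ne] at this

theorem genOrZero_three_term (c : Fin 2) (i j k : I) :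
    genOrZero c i j * genOrZero c j k + genOrZero c j k * genOrZero c k i
      + genOrZero c k i * genOrZero c i j = 0 := by
  have key : ∀ i j : I, genOrZero c i j * genOrZero c j i = 0 := fun i j => by
    rw [genOrZero_skew c j i]; linear_combination -genOrZero_square c c i j
  by_cases hij : i = j
  · subst hij
    simp [genOrZero_self, key]
  by_cases hjk : j = k
  · subst hjk
    simp [genOrZero_self, key]
  by_cases hki : k = i
  · subst hki
    simp [genOrZero_self, key]
  have := mk_eq_zero_of_rel (.three_term c i j k hij hjk hki)
  simp only [map_add, map_mul, ← genOrZero_of_ne] at this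
  exact this

theorem genOrZero_six_term (i j k : I) :
    genOrZero 0 i j * genOrZero 1 j k + genOrZero 0 j k * genOrZero 1 k i
      + genOrZero 0 k i * genOrZero 1 i j + genOrZero 1 i j * genOrZero 0 j k
      + genOrZero 1 j k * genOrZero 0 k i + genOrZero 1 k i * genOrZero 0 i j = 0 := by
  have key : ∀ (c c' : Fin 2) (i j : I), genOrZero c i j * genOrZero c' j i = 0 :=
    fun c c' i j => by rw [genOrZero_skew c' j i]; linear_combination -genOrZero_square c c' i j
  by_cases hij : i = j
  · subst hij
    simp [genOrZero_self, key]
  by_cases hjk : j = k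
  · subst hjk
    simp [genOrZero_self, key]
  by_cases hki : k = i
  · subst hki
    simp [genOrZero_self, key]
  have := mk_eq_zero_of_rel (.six_term i j k hij hjk hki)
  simp only [map_add, map_mul, ← genOrZero_of_ne] at this
  exact this

/-- The generators of the double even Orlik–Solomon algebra. -/
def family (I : Type*) : OSFamily I (DoubleOS I) where
  g := genOrZero
  skew := genOrZero_skew
  diag := genOrZero_self
  square := genOrZero_square
  three_term := genOrZero_three_term
  six_term a b i j k h := by
    have h6 := genOrZero_six_term i j k
    obtain ⟨rfl, rfl⟩ | ⟨rfl, rfl⟩ : (a = 0 ∧ b = 1) ∨ (a = 1 ∧ b = 0) := by omega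
    · exact h6
    · linear_combination h6

/-- The monomials associated with the normal monomials with leaves `I` span the double even
Orlik–Solomon algebra. -/
theorem forestSpan_eq_top (I : Type*) [LinearOrder I] [Fintype I] [Nonempty I] :
    (family I).forestSpan (Finset.univ.val : Multiset I) = ⊤ := by
  set G := family I
  set d : Multiset I := Finset.univ.val
  have hd : d ≠ 0 := fun h => by
    have := Finset.mem_univ (Classical.arbitrary I)
    rw [← Finset.mem_val] at this
    change _ ∈ d at this
    simp [h] at this
  set P : Submodule ℚ (DoubleOS I) := Submodule.span ℚ {m | G.ForestMon d m} with hP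
  have hPle : P ≤ G.forestSpan d := Submodule.span_le.2 fun m hm => ForestMon.mem_forestSpan hm
  have hmul : ∀ (g : Gen I) (x : DoubleOS I), x ∈ P →
      x * Ideal.Quotient.mk _ (MvPolynomial.X g) ∈ P := by
    rintro ⟨c, ⟨i, j⟩, h⟩ x hx
    have hg : (Ideal.Quotient.mk _ (MvPolynomial.X (c, ⟨(i, j), h⟩)) : DoubleOS I) = G.g c i j :=
      (genOrZero_of_ne c h).symm
    rw [hg]
    induction hx using Submodule.span_induction with
    | zero => simp
    | add x y _ _ hx hy => rw [add_mul]; exact add_mem hx hy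
    | smul r x _ hx => rw [smul_mul_assoc]; exact Submodule.smul_mem _ r hx
    | mem x hx =>
      rw [mul_comm]
      rcases ForestMon.mul_g hx c (Finset.mem_univ_val i) (Finset.mem_univ_val j) with h | h
      · rw [h]; exact zero_mem _
      · exact Submodule.subset_span h
  refine eq_top_iff.2 fun x _ => hPle ?_
  obtain ⟨p, rfl⟩ := Ideal.Quotient.mk_surjective x
  induction p using MvPolynomial.induction_on with
  | C r =>
    have : (Ideal.Quotient.mk _ (MvPolynomial.C r) : DoubleOS I) = r • (1 : DoubleOS I) := by
      rw [MvPolynomial.C_eq_smul_one]; rfl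
    rw [this]
    exact Submodule.smul_mem _ r (Submodule.subset_span (forestMon_one hd))
  | add p q hp hq => rw [map_add]; exact add_mem (hp trivial) (hq trivial)
  | mul_X p g hp => rw [map_mul]; exact hmul g _ (hp trivial)

end DoubleOS

/-! ### Abel's identity -/

section Abel

open Polynomial

/-- The number `x (x + k) ^ (k - 1)`, which is `1` for `k = 0`. -/
def abelCoeff (x : ℚ) : ℕ → ℚ
  | 0 => 1
  | k + 1 => x * (x + (k + 1)) ^ k

/-- The case of Abel's identity in which both sides vanish: a higher difference of a power. -/
theorem sum_abelCoeff_eq_zero (x : ℚ) (m : ℕ) :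
    ∑ k ∈ Finset.range (m + 2), ((m + 1).choose k * abelCoeff x k) *
      (-x - k) ^ (m + 1 - k) = 0 := by
  have h := congrFun (fwdDiff_iter_pow_eq_zero_of_lt (R := ℚ) (Nat.lt_succ_self m)) x
  rw [fwdDiff_iter_eq_sum_shift] at h
  rw [← mul_zero x, ← Pi.zero_apply (M := fun _ : ℚ => ℚ) x, ← h, Finset.mul_sum]
  refine Finset.sum_congr rfl fun k hk => ?_
  have hk' : k ≤ m + 1 := Nat.lt_succ_iff.1 (Finset.mem_range.1 hk)
  have e : (-x - k) ^ (m + 1 - k) = (-1) ^ (m + 1 - k) * (x + k) ^ (m + 1 - k) := by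
    rw [← mul_pow]; congr 1; ring
  rw [e, zsmul_eq_mul, nsmul_eq_mul, mul_one]
  push_cast
  cases k with
  | zero => simp [abelCoeff]; ring
  | succ k =>
    have : (x + (k + 1)) ^ m = (x + (k + 1)) ^ k * (x + (k + 1)) ^ (m + 1 - (k + 1)) := by
      rw [← pow_add]; congr 1; omega
    simp only [abelCoeff, Nat.cast_add, Nat.cast_one, Nat.succ_eq_add_one]
    rw [this]
    ring

/-- Abel's identity: the derivatives of both sides agree by induction. -/
theorem abel_identity_poly (x : ℚ) (m : ℕ) :
    ∑ k ∈ Finset.range (m + 1), C (m.choose k * abelCoeff x k) *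
      (X + C ((m - k : ℕ) : ℚ)) ^ (m - k) = (X + C (x + m)) ^ m := by
  induction m with
  | zero => simp [abelCoeff]
  | succ m ih =>
    rw [← sub_eq_zero]
    set P := ∑ k ∈ Finset.range (m + 1 + 1), C ((m + 1).choose k * abelCoeff x k) *
      (X + C ((m + 1 - k : ℕ) : ℚ)) ^ (m + 1 - k) - (X + C (x + (m + 1 : ℕ))) ^ (m + 1) with hP
    have hd : derivative P = 0 := by
      have ih' := congrArg (fun p => C ((m : ℚ) + 1) * p.comp (X + C 1)) ih
      simp only [sum_comp, mul_comp, C_comp, pow_comp, add_comp, X_comp] at ih'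
      rw [hP, derivative_sub, derivative_sum, derivative_X_add_C_pow, sub_eq_zero,
        Finset.sum_range_succ]
      have h0 : derivative (C (((m + 1).choose (m + 1) : ℚ) * abelCoeff x (m + 1)) *
          (X + C ((m + 1 - (m + 1) : ℕ) : ℚ)) ^ (m + 1 - (m + 1))) = 0 := by simp
      rw [h0, add_zero]
      have e1 : C ((m + 1 : ℕ) : ℚ) * (X + C (x + (m + 1 : ℕ))) ^ (m + 1 - 1)
          = C ((m : ℚ) + 1) * (X + C 1 + C (x + m)) ^ m := by
        rw [add_assoc X, ← C_add]
        push_cast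
        congr 4
        ring
      rw [e1, ← ih', Finset.mul_sum]
      refine Finset.sum_congr rfl fun k hk => ?_
      have hk' : k ≤ m := Nat.lt_succ_iff.1 (Finset.mem_range.1 hk)
      obtain ⟨l, rfl⟩ := Nat.exists_eq_add_of_le hk'
      have a1 : k + l + 1 - k = l + 1 := by omega
      have a2 : k + l - k = l := by omega
      rw [a1, a2, derivative_C_mul, derivative_X_add_C_pow, Nat.add_sub_cancel]
      have hch : ((k + l + 1).choose k : ℚ) * (l + 1) = ((k + l : ℕ) + 1) * (k + l).choose k := by
        have := Nat.add_one_mul_choose_eq (k + l) l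
        rw [Nat.choose_symm_of_eq_add (show k + l + 1 = k + (l + 1) by omega),
          Nat.choose_symm_add]
        exact_mod_cast this.symm
      have e2 : (X : ℚ[X]) + C 1 + C (l : ℚ) = X + C ((l + 1 : ℕ) : ℚ) := by
        rw [add_assoc, ← C_add]; push_cast; rw [add_comm (1 : ℚ)]
      rw [e2, ← mul_assoc, ← mul_assoc, ← C_mul, ← C_mul]
      congr 2
      push_cast at hch ⊢
      linear_combination (abelCoeff x k) * hch
    -- the constant is determined at the zero of the right-hand side
    have hc := eq_C_of_derivative_eq_zero hd
    have he : P.eval (-x - (m + 1 : ℕ)) = 0 := by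
      rw [hP]
      simp only [eval_sub, eval_finsetSum, eval_mul, eval_C, eval_pow, eval_add, eval_X]
      have : -x - ((m + 1 : ℕ) : ℚ) + (x + (m + 1 : ℕ)) = 0 := by ring
      rw [this, zero_pow (by omega), sub_zero, ← sum_abelCoeff_eq_zero x m]
      refine Finset.sum_congr rfl fun k hk => ?_
      have hk' : k ≤ m + 1 := Nat.lt_succ_iff.1 (Finset.mem_range.1 hk)
      rw [Nat.cast_sub hk']
      congr 2
      ring
    rw [hc, eval_C] at he
    rw [hc, he, C_0]

theorem abel_identity (x y : ℚ) (m : ℕ) :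
    ∑ k ∈ Finset.range (m + 1), (m.choose k * abelCoeff x k) *
      (y + (m - k : ℕ)) ^ (m - k) = (y + (x + m)) ^ m := by
  have := congrArg (eval y) (abel_identity_poly x m)
  simpa only [eval_finsetSum, eval_mul, eval_C, eval_pow, eval_add, eval_X] using this

/-- The recursion for the number `n ^ (n - 1)` of normal trees; `k` is the number of leaves of the
last block. -/
theorem tree_count_identity (m : ℕ) : m ^ m + ∑ k ∈ Finset.range m,
    m.choose (k + 1) * ((m - (k + 1) + 1) ^ (m - (k + 1)) * k ^ k) = (m + 1) ^ m := by
  have h := abel_identity (-1) 1 m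
  rw [Finset.sum_range_succ'] at h
  have : ((m ^ m + ∑ k ∈ Finset.range m,
    m.choose (k + 1) * ((m - (k + 1) + 1) ^ (m - (k + 1)) * k ^ k) : ℕ) : ℚ)
      = ((m + 1) ^ m : ℕ) := by
    push_cast
    simp only [Nat.choose_zero_right, abelCoeff, Nat.cast_one, one_mul, Nat.sub_zero] at h
    rw [show (1 : ℚ) + (-1 + m) = m by ring] at h
    rw [← h, add_right_comm, ← Finset.sum_add_distrib, Finset.sum_eq_zero, zero_add, add_comm]
    intro k _
    rw [show (-1 : ℚ) + (k + 1) = k by ring, add_comm (1 : ℚ)]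
    ring
  exact_mod_cast this

/-- The recursion for the number `(n + 1) ^ (n - 1)` of normal monomials; `k` is the number of
leaves that do not belong to the first tree. -/
theorem forest_count_identity (m : ℕ) : (m + 1) ^ m + ∑ k ∈ Finset.range m,
    m.choose (k + 1) * ((m - (k + 1) + 1) ^ (m - (k + 1)) * (k + 2) ^ k) = (m + 2) ^ m := by
  have h := abel_identity 1 1 m
  rw [Finset.sum_range_succ'] at h
  have : (((m + 1) ^ m + ∑ k ∈ Finset.range m,
    m.choose (k + 1) * ((m - (k + 1) + 1) ^ (m - (k + 1)) * (k + 2) ^ k) : ℕ) : ℚ)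
      = ((m + 2) ^ m : ℕ) := by
    push_cast
    simp only [Nat.choose_zero_right, abelCoeff, Nat.cast_one, one_mul, Nat.sub_zero] at h
    rw [show (1 : ℚ) + (1 + m) = m + 2 by ring] at h
    rw [← h, add_comm, add_comm (1 : ℚ) m]
    congr 1
    refine Finset.sum_congr rfl fun k _ => ?_
    rw [show (1 : ℚ) + (k + 1) = k + 2 by ring, add_comm (1 : ℚ)]
    ring
  exact_mod_cast this

end Abel

/-! ### The number of normal monomials -/

namespace BiHamTerm

theorem card_nodes {I β : Type*} [DecidableEq (BiHamTerm I)] (P : Finset β)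
    (X Y : β → Finset (BiHamTerm I)) (o : BiHamOp)
    (h : ∀ b ∈ P, ∀ b' ∈ P, ∀ u ∈ X b, u ∈ X b' → b = b') :
    (P.biUnion fun b => Finset.image₂ (node o) (X b) (Y b)).card =
      ∑ b ∈ P, (X b).card * (Y b).card := by
  have inj : Function.Injective2 (node o : BiHamTerm I → BiHamTerm I → BiHamTerm I) := by
    intro s s' t t' h
    injection h with _ h1 h2
    exact ⟨h1, h2⟩
  rw [Finset.card_biUnion]
  · exact Finset.sum_congr rfl fun b _ => Finset.card_image₂ inj _ _
  · intro b hb b' hb' hne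
    refine Finset.disjoint_left.2 fun t ht ht' => hne ?_
    obtain ⟨u, hu, v, hv, rfl⟩ := Finset.mem_image₂.1 ht
    obtain ⟨u', hu', v', hv', e⟩ := Finset.mem_image₂.1 ht'
    obtain ⟨rfl, rfl⟩ := inj e
    exact h b hb b' hb' _ hu hu'

variable {I : Type*} [LinearOrder I]

theorem leaves_split {u v : BiHamTerm I} {s : Finset I} (h : u.leaves + v.leaves = s.val) :
    ∃ B, B ⊆ s ∧ B.Nonempty ∧ v.leaves = B.val ∧ u.leaves = (s \ B).val := by
  have hn : (u.leaves + v.leaves).Nodup := h ▸ s.nodup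
  refine ⟨⟨v.leaves, (Multiset.nodup_add.1 hn).2.1⟩, fun i hi => ?_, ⟨v.hd, v.hd_mem⟩, rfl, ?_⟩
  · rw [← Finset.mem_val, ← h]
    exact Multiset.mem_add.2 (.inr hi)
  · rw [Finset.sdiff_val, ← h]
    exact (add_tsub_cancel_right _ _).symm

theorem sdiff_val_add {s B : Finset I} (h : B ⊆ s) : (s \ B).val + B.val = s.val := by
  rw [Finset.sdiff_val]
  exact tsub_add_cancel_of_le (Finset.val_le_iff.2 h)

/-- Sums over the non-empty subsets that do not contain a given element. -/
theorem sum_subsets (s : Finset I) {r : I} (hr : r ∈ s) (f : ℕ → ℕ) (m : ℕ) (hm : s.card = m + 1) :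
    ∑ B ∈ (s.erase r).powerset.erase ∅, f B.card
      = ∑ k ∈ Finset.range m, m.choose (k + 1) * f (k + 1) := by
  have hc : (s.erase r).card = m := by rw [Finset.card_erase_of_mem hr, hm]; rfl
  have h := Finset.sum_powerset_apply_card f (x := s.erase r)
  rw [hc, Finset.sum_range_succ', ← Finset.sum_erase_add _ _ (Finset.empty_mem_powerset _)] at h
  simpa using h

theorem mem_erase_powerset {s B : Finset I} {r : I} :
    B ∈ (s.erase r).powerset.erase ∅ ↔ B ⊆ s ∧ r ∉ B ∧ B.Nonempty := by
  rw [Finset.mem_erase, Finset.mem_powerset, Finset.subset_erase, Finset.nonempty_iff_ne_empty]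
  tauto

/-- There are `n ^ (n - 1)` normal trees with `n` given leaves: a normal tree is a block or arises
from a smaller one by attaching a last block, and the numbers are summed by Abel's identity. -/
theorem exists_normalTrees (n : ℕ) : ∀ s : Finset I, s.card = n + 1 →
    ∃ F : Finset (BiHamTerm I), (∀ t, t ∈ F ↔ IsNormalTree t ∧ t.leaves = s.val) ∧
      F.card = (n + 1) ^ n := by
  classical
  induction n using Nat.strong_induction_on with
  | _ m ih =>
  intro s hs
  have hne : s.Nonempty := Finset.card_pos.1 (by omega)
  set r := s.max' hne with hrdef
  have hr : r ∈ s := s.max'_mem hne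
  have hmax : ∀ x ∈ s, x ≤ r := fun x hx => s.le_max' x hx
  have ex : ∀ B : Finset I, ∃ F : Finset (BiHamTerm I), B.Nonempty → B.card < m + 1 →
      (∀ t, t ∈ F ↔ IsNormalTree t ∧ t.leaves = B.val) ∧ F.card = B.card ^ (B.card - 1) := by
    intro B
    by_cases hB : B.Nonempty ∧ B.card < m + 1
    · have := Finset.card_pos.2 hB.1
      obtain ⟨F, h1, h2⟩ := ih (B.card - 1) (by omega) B (by omega)
      refine ⟨F, fun _ _ => ⟨h1, ?_⟩⟩
      rw [h2]
      congr 1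
      omega
    · exact ⟨∅, fun h1 h2 => absurd ⟨h1, h2⟩ hB⟩
  choose T hT using ex
  have hd_eq : ∀ {t : BiHamTerm I}, HdMax t → ∀ B : Finset I, t.leaves = B.val → B ⊆ s → r ∈ B →
      t.hd = r := by
    intro t ht B hB hBs hrB
    refine le_antisymm (hmax _ (hBs ?_)) (ht r ?_)
    · rw [← Finset.mem_val, ← hB]; exact t.hd_mem
    · rw [hB]; exact hrB
  -- the normal blocks with leaves `B`: a single letter, or `{j, t}₁` where `j` is any letter but the
  -- largest one
  have blocks : ∀ B : Finset I, B.Nonempty → B ⊆ s → ∃ F : Finset (BiHamTerm I),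
      (∀ t, t ∈ F ↔ IsNormalTree t ∧ IsBlock t ∧ t.leaves = B.val) ∧
        F.card = (B.card - 1) ^ (B.card - 1) := by
    intro B hB hBs
    by_cases h1 : B.card = 1
    · obtain ⟨i, rfl⟩ := Finset.card_eq_one.1 h1
      refine ⟨{leaf i}, fun t => ⟨fun h => ?_, ?_⟩, by simp⟩
      · rw [Finset.mem_singleton.1 h]
        exact ⟨⟨.leaf i, fun x hx => (Multiset.mem_singleton.1 hx).le⟩, .leaf i, rfl⟩
      · rintro ⟨-, hb, hl⟩
        cases hb with
        | leaf j =>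
          rw [leaves_leaf, Finset.singleton_val, Multiset.singleton_inj] at hl
          rw [hl, Finset.mem_singleton]
        | ext j t =>
          have hc := congrArg Multiset.card hl
          have := t.card_leaves_pos
          simp only [leaves_node, Multiset.card_add, leaves_leaf, Multiset.card_singleton,
            Finset.singleton_val] at hc
          omega
    · have hB' := Finset.card_pos.2 hB
      have hBm : B.card ≤ m + 1 := hs ▸ Finset.card_le_card hBs
      set q := B.max' hB with hq
      have hqB : q ∈ B := B.max'_mem hB
      have sub : ∀ j ∈ B, (∀ t, t ∈ T (B \ {j}) ↔ IsNormalTree t ∧ t.leaves = (B \ {j}).val) ∧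
          (T (B \ {j})).card = (B.card - 1) ^ (B.card - 1 - 1) := by
        intro j hj
        have hc : (B \ {j}).card = B.card - 1 := by
          rw [Finset.card_sdiff_of_subset (by simpa using hj), Finset.card_singleton]
        have := hT (B \ {j}) (Finset.card_pos.1 (by omega)) (by omega)
        rwa [hc] at this
      refine ⟨(B.erase q).biUnion fun j => Finset.image₂ (node (bracket 0)) {leaf j} (T (B \ {j})),
        fun t => ?_, ?_⟩
      · simp only [Finset.mem_biUnion, Finset.mem_image₂, Finset.mem_singleton, Finset.mem_erase]
        constructor
        · rintro ⟨j, ⟨hjq, hj⟩, _, rfl, t, ht, rfl⟩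
          obtain ⟨⟨h1, h2⟩, h3⟩ := ((sub j hj).1 t).1 ht
          have hqt : q ∈ t.leaves := by
            rw [h3, Finset.mem_val, Finset.mem_sdiff, Finset.mem_singleton]
            exact ⟨hqB, Ne.symm hjq⟩
          have hleaves : (ext j t).leaves = B.val := by
            rw [leaves_node, leaves_leaf, h3, add_comm]
            exact sdiff_val_add (B := {j}) (by simpa using hj)
          refine ⟨⟨.ext j t h1, fun x hx => ?_⟩, .ext j t, hleaves⟩
          rw [hleaves] at hx
          exact (B.le_max' x hx).trans (h2 q hqt)
        · rintro ⟨⟨h1, h2⟩, hb, h3⟩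
          cases hb with
          | leaf j =>
            have := congrArg Multiset.card h3
            simp at this
            omega
          | ext j t =>
            cases h1 with
            | ext _ _ ht =>
              have h3' : t.leaves + (leaf j).leaves = B.val := by rw [← h3, add_comm]; rfl
              obtain ⟨C, hC, -, hj, hl⟩ := leaves_split h3'
              obtain rfl : C = {j} := Finset.val_injective hj.symm
              refine ⟨j, ⟨fun hjq => ?_, by simpa using hC⟩, leaf j, rfl, t,
                ((sub j (by simpa using hC)).1 t).2 ⟨⟨ht, h2.of_ext.1⟩, hl⟩, rfl⟩
              have m1 : t.hd ∈ B \ {j} := by rw [← Finset.mem_val, ← hl]; exact t.hd_mem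
              rw [Finset.mem_sdiff, Finset.mem_singleton] at m1
              refine m1.2 (le_antisymm ?_ h2.of_ext.2)
              rw [hjq]
              exact B.le_max' _ m1.1
      · rw [card_nodes _ _ _ _ fun b _ b' _ u hu hu' => by
          rw [Finset.mem_singleton] at hu hu'
          rw [hu] at hu'
          injection hu']
        rw [Finset.sum_congr rfl fun j hj => by
          rw [(sub j (Finset.mem_of_mem_erase hj)).2, Finset.card_singleton, one_mul]]
        rw [Finset.sum_const, Finset.card_erase_of_mem hqB, smul_eq_mul, ← pow_succ']
        congr 1
        omega
  have exb : ∀ B : Finset I, ∃ F : Finset (BiHamTerm I), B.Nonempty → B ⊆ s →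
      (∀ t, t ∈ F ↔ IsNormalTree t ∧ IsBlock t ∧ t.leaves = B.val) ∧
        F.card = (B.card - 1) ^ (B.card - 1) := by
    intro B
    by_cases hB : B.Nonempty ∧ B ⊆ s
    · obtain ⟨F, h⟩ := blocks B hB.1 hB.2
      exact ⟨F, fun _ _ => h⟩
    · exact ⟨∅, fun h1 h2 => absurd ⟨h1, h2⟩ hB⟩
  choose Bl hBl using exb
  have small : ∀ B ∈ (s.erase r).powerset.erase ∅,
      (∀ t, t ∈ T (s \ B) ↔ IsNormalTree t ∧ t.leaves = (s \ B).val) ∧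
        (T (s \ B)).card = (m - B.card + 1) ^ (m - B.card) := by
    intro B hB
    obtain ⟨h1, h2, h3⟩ := mem_erase_powerset.1 hB
    have hc := Finset.card_sdiff_of_subset h1
    have hp := Finset.card_pos.2 h3
    have hle := Finset.card_le_card h1
    have hlt : B.card < s.card :=
      Finset.card_lt_card ⟨h1, fun h => h2 (h hr)⟩
    have := hT (s \ B) (Finset.card_pos.1 (by omega)) (by omega)
    rw [hc, hs] at this
    rwa [show m + 1 - B.card = m - B.card + 1 by omega, Nat.add_sub_cancel] at this
  refine ⟨Bl s ∪ ((s.erase r).powerset.erase ∅).biUnion fun B =>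
    Finset.image₂ (node (bracket 1)) (T (s \ B)) (Bl B), fun t => ?_, ?_⟩
  · simp only [Finset.mem_union, (hBl s hne subset_rfl).1, Finset.mem_biUnion, Finset.mem_image₂]
    constructor
    · rintro (⟨h1, -, h2⟩ | ⟨B, hB, u, hu, b, hb, rfl⟩)
      · exact ⟨h1, h2⟩
      · obtain ⟨h1, h2, h3⟩ := mem_erase_powerset.1 hB
        obtain ⟨hu1, hu2⟩ := ((small B hB).1 u).1 hu
        obtain ⟨hb1, hb2, hb3⟩ := ((hBl B h3 h1).1 b).1 hb
        have hl : (join u b).leaves = s.val := by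
          rw [leaves_node, hu2, hb3]; exact sdiff_val_add h1
        refine ⟨⟨.join u b hu1.1 hb2 hb1.1 hb1.2, fun x hx => ?_⟩, hl⟩
        rw [hl] at hx
        rw [hd_join, hd_eq hu1.2 (s \ B) hu2 Finset.sdiff_subset (by simp [hr, h2])]
        exact hmax x hx
    · rintro ⟨⟨h1, h2⟩, h3⟩
      cases h1 with
      | leaf i => exact .inl ⟨⟨.leaf i, h2⟩, .leaf i, h3⟩
      | ext j t ht => exact .inl ⟨⟨.ext j t ht, h2⟩, .ext j t, h3⟩
      | join u b hu hb hbt hbm =>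
        obtain ⟨B, hBs, hBn, hbl, hul⟩ := leaves_split h3
        have hrB : r ∉ B := fun hrB => by
          have hx := hd_eq h2 s h3 subset_rfl hr
          have hu' : u.hd ∈ s \ B := by rw [← Finset.mem_val, ← hul]; exact u.hd_mem
          rw [hd_join] at hx
          exact (Finset.mem_sdiff.1 hu').2 (hx ▸ hrB)
        have hB : B ∈ (s.erase r).powerset.erase ∅ := mem_erase_powerset.2 ⟨hBs, hrB, hBn⟩
        exact .inr ⟨B, hB, u, ((small B hB).1 u).2 ⟨⟨hu, h2.of_join.1⟩, hul⟩, b,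
          ((hBl B hBn hBs).1 b).2 ⟨⟨hbt, hbm⟩, hb, hbl⟩, rfl⟩
  · rw [Finset.card_union_of_disjoint, (hBl s hne subset_rfl).2, card_nodes]
    · rw [Finset.sum_congr rfl (g := fun B : Finset I =>
        (m - B.card + 1) ^ (m - B.card) * (B.card - 1) ^ (B.card - 1)) fun B hB => by
          obtain ⟨h1, -, h3⟩ := mem_erase_powerset.1 hB
          rw [(small B hB).2, (hBl B h3 h1).2]]
      rw [sum_subsets s hr (fun k => (m - k + 1) ^ (m - k) * (k - 1) ^ (k - 1)) m hs, hs,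
        ← tree_count_identity m]
      simp
    · intro B hB B' hB' u hu hu'
      have e := (((small B hB).1 u).1 hu).2.symm.trans (((small B' hB').1 u).1 hu').2
      have e' := Finset.val_injective e
      rw [← Finset.sdiff_sdiff_eq_self (mem_erase_powerset.1 hB).1, e',
        Finset.sdiff_sdiff_eq_self (mem_erase_powerset.1 hB').1]
    · refine Finset.disjoint_left.2 fun t ht ht' => ?_
      obtain ⟨B, hB, ht'⟩ := Finset.mem_biUnion.1 ht'
      obtain ⟨u, hu, b, hb, rfl⟩ := Finset.mem_image₂.1 ht'
      have := (((hBl s hne subset_rfl).1 _).1 ht).2.1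
      cases this

/-- There are `(n + 1) ^ (n - 1)` normal monomials with `n` given leaves. -/
theorem exists_normalForests (n : ℕ) : ∀ s : Finset I, s.card = n + 1 →
    ∃ F : Finset (BiHamTerm I), (∀ t, t ∈ F ↔ IsForest t ∧ t.leaves = s.val) ∧
      F.card = (n + 2) ^ n := by
  classical
  induction n using Nat.strong_induction_on with
  | _ m ih =>
  intro s hs
  have hne : s.Nonempty := Finset.card_pos.1 (by omega)
  set r := s.max' hne with hrdef
  have hr : r ∈ s := s.max'_mem hne
  have hmax : ∀ x ∈ s, x ≤ r := fun x hx => s.le_max' x hx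
  have ex : ∀ B : Finset I, ∃ F : Finset (BiHamTerm I), B.Nonempty → B.card < m + 1 →
      (∀ t, t ∈ F ↔ IsForest t ∧ t.leaves = B.val) ∧ F.card = (B.card + 1) ^ (B.card - 1) := by
    intro B
    by_cases hB : B.Nonempty ∧ B.card < m + 1
    · have := Finset.card_pos.2 hB.1
      obtain ⟨F, h1, h2⟩ := ih (B.card - 1) (by omega) B (by omega)
      refine ⟨F, fun _ _ => ⟨h1, ?_⟩⟩
      rw [h2]
      congr 1
      omega
    · exact ⟨∅, fun h1 h2 => absurd ⟨h1, h2⟩ hB⟩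
  choose Fo hFo using ex
  have ext : ∀ B : Finset I, ∃ F : Finset (BiHamTerm I), B.Nonempty →
      (∀ t, t ∈ F ↔ IsNormalTree t ∧ t.leaves = B.val) ∧ F.card = B.card ^ (B.card - 1) := by
    intro B
    by_cases hB : B.Nonempty
    · have := Finset.card_pos.2 hB
      obtain ⟨F, h1, h2⟩ := exists_normalTrees (B.card - 1) B (by omega)
      refine ⟨F, fun _ => ⟨h1, ?_⟩⟩
      rw [h2]
      congr 1
      omega
    · exact ⟨∅, fun h1 => absurd h1 hB⟩
  choose T hT using ext
  have large : ∀ B ∈ (s.erase r).powerset.erase ∅,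
      (∀ t, t ∈ T (s \ B) ↔ IsNormalTree t ∧ t.leaves = (s \ B).val) ∧
        (T (s \ B)).card = (m - B.card + 1) ^ (m - B.card) := by
    intro B hB
    obtain ⟨h1, h2, h3⟩ := mem_erase_powerset.1 hB
    have hc := Finset.card_sdiff_of_subset h1
    have hlt : B.card < s.card :=
      Finset.card_lt_card ⟨h1, fun h => h2 (h hr)⟩
    have := hT (s \ B) (Finset.card_pos.1 (by omega))
    rw [hc, hs] at this
    rwa [show m + 1 - B.card = m - B.card + 1 by omega, Nat.add_sub_cancel] at this
  have small : ∀ B ∈ (s.erase r).powerset.erase ∅,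
      (∀ t, t ∈ Fo B ↔ IsForest t ∧ t.leaves = B.val) ∧
        (Fo B).card = (B.card + 1) ^ (B.card - 1) := by
    intro B hB
    obtain ⟨h1, h2, h3⟩ := mem_erase_powerset.1 hB
    have hlt : B.card < s.card :=
      Finset.card_lt_card ⟨h1, fun h => h2 (h hr)⟩
    exact hFo B h3 (by omega)
  refine ⟨T s ∪ ((s.erase r).powerset.erase ∅).biUnion fun B =>
    Finset.image₂ (node prod) (T (s \ B)) (Fo B), fun t => ?_, ?_⟩
  · simp only [Finset.mem_union, (hT s hne).1, Finset.mem_biUnion, Finset.mem_image₂]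
    constructor
    · rintro (⟨h1, h2⟩ | ⟨B, hB, u, hu, f, hf, rfl⟩)
      · exact ⟨.tree t h1, h2⟩
      · obtain ⟨h1, h2, h3⟩ := mem_erase_powerset.1 hB
        obtain ⟨hu1, hu2⟩ := ((large B hB).1 u).1 hu
        obtain ⟨hf1, hf2⟩ := ((small B hB).1 f).1 hf
        refine ⟨.prod u f hu1 hf1 fun x hx => ?_, ?_⟩
        · have hrB : r ∈ u.leaves := by rw [hu2, Finset.mem_val, Finset.mem_sdiff]; exact ⟨hr, h2⟩
          rw [hf2] at hx
          exact (hmax x (h1 hx)).trans (hu1.2 r hrB)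
        · rw [leaves_node, hu2, hf2]; exact sdiff_val_add h1
    · rintro ⟨h1, h3⟩
      cases h1 with
      | tree t ht => exact .inl ⟨ht, h3⟩
      | prod u f hu hf hle =>
        obtain ⟨B, hBs, hBn, hfl, hul⟩ := leaves_split h3
        have hrB : r ∉ B := fun hrB => by
          have hu' : u.hd ∈ s \ B := by rw [← Finset.mem_val, ← hul]; exact u.hd_mem
          have : u.hd = r := le_antisymm (hmax _ (Finset.mem_sdiff.1 hu').1)
            (hle r (by rw [hfl]; exact hrB))
          exact (Finset.mem_sdiff.1 hu').2 (this ▸ hrB)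
        have hB : B ∈ (s.erase r).powerset.erase ∅ := mem_erase_powerset.2 ⟨hBs, hrB, hBn⟩
        exact .inr ⟨B, hB, u, ((large B hB).1 u).2 ⟨hu, hul⟩, f,
          ((small B hB).1 f).2 ⟨hf, hfl⟩, rfl⟩
  · rw [Finset.card_union_of_disjoint, (hT s hne).2, card_nodes]
    · rw [Finset.sum_congr rfl (g := fun B : Finset I =>
        (m - B.card + 1) ^ (m - B.card) * (B.card + 1) ^ (B.card - 1)) fun B hB => by
          rw [(large B hB).2, (small B hB).2]]
      rw [sum_subsets s hr (fun k => (m - k + 1) ^ (m - k) * (k + 1) ^ (k - 1)) m hs, hs,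
        ← forest_count_identity m]
      simp
    · intro B hB B' hB' u hu hu'
      have e := (((large B hB).1 u).1 hu).2.symm.trans (((large B' hB').1 u).1 hu').2
      have e' := Finset.val_injective e
      rw [← Finset.sdiff_sdiff_eq_self (mem_erase_powerset.1 hB).1, e',
        Finset.sdiff_sdiff_eq_self (mem_erase_powerset.1 hB').1]
    · refine Finset.disjoint_left.2 fun t ht ht' => ?_
      obtain ⟨B, hB, ht'⟩ := Finset.mem_biUnion.1 ht'
      obtain ⟨u, hu, b, hb, rfl⟩ := Finset.mem_image₂.1 ht'
      have := (((hT s hne).1 _).1 ht).1.1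
      cases this

end BiHamTerm

/-! ### The isomorphism -/

namespace BiHamOperad

open BiHamTerm

variable {I : Type*}

theorem eval_mono (t : BiHamTerm I) :
    t.eval (fun i => FreeBiHam.mono (leaf i)) = FreeBiHam.mono t := by
  induction t with
  | leaf i => rfl
  | node o s t hs ht => rw [FreeBiHam.mono_node, ← hs, ← ht]; rfl

variable [LinearOrder I] [Fintype I]

theorem span_normal : Submodule.span ℚ {x : BiHamOperad I | ∃ t h, IsForest t ∧ mono t h = x}
    = ⊤ := by
  rw [← top_le_iff, ← span_mono, Submodule.span_le]
  rintro _ ⟨t, h, rfl⟩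
  have h1 := BiHamAlgebra.eval_mem_span_forest (fun i => FreeBiHam.mono (leaf i))
    (nodup_of_leaves h)
  rw [eval_mono, h] at h1
  have h2 : BiHamAlgebra.forestSpan (fun i => FreeBiHam.mono (leaf i)) Finset.univ.val
      ≤ Submodule.map (incl I)
        (Submodule.span ℚ {x : BiHamOperad I | ∃ t h, IsForest t ∧ mono t h = x}) := by
    rw [BiHamAlgebra.forestSpan, Submodule.span_le]
    rintro _ ⟨s, hs, hl, rfl⟩
    exact ⟨mono s hl, Submodule.subset_span ⟨s, hl, hs, rfl⟩, (eval_mono s).symm⟩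
  obtain ⟨x, hx, hxe⟩ := h2 h1
  have : x = mono t h := incl_injective I hxe
  exact this ▸ hx

/-- The normal monomials that contain each generator exactly once form a basis. -/
theorem exists_basis {F : Finset (BiHamTerm I)}
    (hF : ∀ t, t ∈ F ↔ IsForest t ∧ t.leaves = Finset.univ.val) :
    ∃ b : Module.Basis F ℚ (BiHamOperad I), ∀ t, b t = mono t.1 ((hF t.1).1 t.2).2 := by
  classical
  have li : LinearIndependent ℚ fun t : F => mono t.1 ((hF t.1).1 t.2).2 := by
    rw [Fintype.linearIndependent_iff]
    intro a ha
    have key := indep_forest (Finset.univ : Finset I).nodup F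
      (fun t => if h : t ∈ F then a ⟨t, h⟩ else 0) (fun t ht => (hF t).1 ht) (fun ω _ => by
        rw [← Finset.sum_attach]
        have := congrArg (valConv ω).ofConv ha
        rw [map_sum, map_zero] at this
        rw [← this]
        refine Finset.sum_congr rfl fun t _ => ?_
        rw [map_smul, valConv_mono, smul_eq_mul, dif_pos t.2])
    intro t
    have := key t.1 t.2
    rwa [dif_pos t.2] at this
  refine ⟨Module.Basis.mk li ?_, fun t => Module.Basis.mk_apply ..⟩
  rw [top_le_iff, ← span_normal]
  congr 1
  ext x
  constructor
  · rintro ⟨t, rfl⟩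
    exact ⟨t.1, _, ((hF t.1).1 t.2).1, rfl⟩
  · rintro ⟨t, h, ht, rfl⟩
    exact ⟨⟨t, (hF t).2 ⟨ht, h⟩⟩, rfl⟩

variable (I) [Nonempty I]

theorem exists_basis_card : ∃ F : Finset (BiHamTerm I),
    (∀ t, t ∈ F ↔ IsForest t ∧ t.leaves = Finset.univ.val) ∧
    F.card = (Fintype.card I + 1) ^ (Fintype.card I - 1) := by
  have hc : 0 < Fintype.card I := Fintype.card_pos
  obtain ⟨F, h1, h2⟩ := exists_normalForests (Fintype.card I - 1) (Finset.univ : Finset I)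
    (by rw [Finset.card_univ]; omega)
  exact ⟨F, h1, by rw [h2]; congr 1; omega⟩

theorem finrank_eq : Module.Finite ℚ (BiHamOperad I) ∧
    Module.finrank ℚ (BiHamOperad I) = (Fintype.card I + 1) ^ (Fintype.card I - 1) := by
  obtain ⟨F, hF, hc⟩ := exists_basis_card I
  obtain ⟨b, -⟩ := exists_basis hF
  exact ⟨.of_basis b, by rw [Module.finrank_eq_card_basis b, Fintype.card_coe, hc]⟩

/-- The homomorphism to the dual algebra is surjective: its image contains the functionals
`valConv ω`, which have no common zero. -/
theorem ofDoubleOS_surjective : Function.Surjective (ofDoubleOS I) := by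
  classical
  have := (finrank_eq I).1
  let ψ : DoubleOS I →ₗ[ℚ] Module.Dual ℚ (BiHamOperad I) :=
    (WithConv.linearEquiv ℚ (BiHamOperad I →ₗ[ℚ] ℚ)).toLinearMap ∘ₗ (ofDoubleOS I).toLinearMap
  have hbot : (LinearMap.range ψ).dualCoannihilator = ⊥ := by
    rw [Submodule.eq_bot_iff]
    intro x hx
    rw [Submodule.mem_dualCoannihilator] at hx
    obtain ⟨F, hF, hc⟩ := exists_basis_card I
    obtain ⟨b, hb⟩ := exists_basis hF
    have hval : ∀ ω : SkewForm I, (valConv ω).ofConv x = 0 := by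
      intro ω
      obtain ⟨z, hz⟩ := valConv_mem_range ω
      rw [← hx (ψ z) ⟨z, rfl⟩, ← hz]
      rfl
    have key := indep_forest (Finset.univ : Finset I).nodup F
      (fun t => if h : t ∈ F then b.repr x ⟨t, h⟩ else 0) (fun t ht => (hF t).1 ht) (fun ω _ => by
        rw [← Finset.sum_attach, ← hval ω]
        conv_rhs => rw [← b.sum_repr x, map_sum]
        refine Finset.sum_congr rfl fun t _ => ?_
        rw [map_smul, hb, valConv_mono, smul_eq_mul, dif_pos t.2])
    refine b.ext_elem fun t => ?_
    have := key t.1 t.2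
    rw [dif_pos t.2] at this
    rw [map_zero]
    exact this
  have hrank := Subspace.finrank_add_finrank_dualCoannihilator_eq (LinearMap.range ψ)
  rw [hbot, finrank_bot, add_zero] at hrank
  have htop : LinearMap.range ψ = ⊤ :=
    Submodule.eq_top_of_finrank_eq (hrank.trans Subspace.dual_finrank_eq.symm)
  intro f
  obtain ⟨z, hz⟩ := LinearMap.range_eq_top.1 htop f.ofConv
  exact ⟨z, WithConv.ofConv_injective hz⟩

theorem finite_doubleOS : Module.Finite ℚ (DoubleOS I) ∧
    Module.finrank ℚ (DoubleOS I) ≤ (Fintype.card I + 1) ^ (Fintype.card I - 1) := by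
  classical
  obtain ⟨F, hF, hc⟩ := exists_basis_card I
  have hspan := DoubleOS.forestSpan_eq_top I
  have : {m | ∃ t, IsForest t ∧ t.leaves = Finset.univ.val ∧ (DoubleOS.family I).mon t = m}
      = (F.image (DoubleOS.family I).mon : Set (DoubleOS I)) := by
    ext m
    simp [hF, and_assoc]
  rw [OSFamily.forestSpan, this] at hspan
  refine ⟨⟨⟨_, hspan⟩⟩, ?_⟩
  have h1 := finrank_span_finset_le_card (R := ℚ) (F.image (DoubleOS.family I).mon)
  rw [Set.finrank, hspan, finrank_top] at h1
  exact h1.trans (Finset.card_image_le.trans hc.le)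

theorem finrank_doubleOS : Module.finrank ℚ (DoubleOS I)
    = (Fintype.card I + 1) ^ (Fintype.card I - 1) ∧ Function.Injective (ofDoubleOS I) := by
  obtain ⟨hfin, hle⟩ := finite_doubleOS I
  obtain ⟨hfin', hr⟩ := finrank_eq I
  have hsurj := ofDoubleOS_surjective I
  have e : Module.finrank ℚ (DualAlgebra I) = (Fintype.card I + 1) ^ (Fintype.card I - 1) := by
    rw [LinearEquiv.finrank_eq (WithConv.linearEquiv ℚ (BiHamOperad I →ₗ[ℚ] ℚ)), ← hr]
    exact Subspace.dual_finrank_eq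
  have hfd : Module.Finite ℚ (DualAlgebra I) :=
    Module.Finite.equiv (WithConv.linearEquiv ℚ (BiHamOperad I →ₗ[ℚ] ℚ)).symm
  have hge := LinearMap.finrank_le_finrank_of_surjective (f := (ofDoubleOS I).toLinearMap) hsurj
  rw [e] at hge
  have heq := le_antisymm hle hge
  exact ⟨heq, (LinearMap.injective_iff_surjective_of_finrank_eq_finrank
    (f := (ofDoubleOS I).toLinearMap) (by rw [heq, e])).2 hsurj⟩

end BiHamOperad

/-! ### Rooted trees as oriented relations -/

open Relation

namespace LabelledGraph

variable {I : Type*}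

/-- The labelled graph that underlies an oriented labelled graph, where `O c u v` says that there is
an edge with label `c` from `u` to `v`. -/
def ofRel (O : Fin 2 → I → I → Prop) : LabelledGraph I := fun c => SimpleGraph.fromRel (O c)

theorem adj_total {T : LabelledGraph I} {u v : I} : T.total.Adj u v ↔ ∃ c, (T c).Adj u v := by
  simp [total, Fin.exists_fin_two]

theorem disjoint_zero_one {T : LabelledGraph I} :
    Disjoint (T 0) (T 1) ↔ ∀ u v, (T 0).Adj u v → ¬ (T 1).Adj u v := by
  rw [SimpleGraph.disjoint_left]

theorem IsForest.eq_label {T : LabelledGraph I} (h : T.IsForest) {c c' : Fin 2} {u v : I}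
    (h1 : (T c).Adj u v) (h2 : (T c').Adj u v) : c = c' := by
  have h0 := disjoint_zero_one.1 h.1 u v
  fin_cases c <;> fin_cases c' <;> simp_all

/-- The oriented labelled graph `O` is an arborescence with root `r` and vertex set `A`: a tree
whose edges are oriented away from the root. -/
structure IsArborescence (O : Fin 2 → I → I → Prop) (r : I) (A : Set I) : Prop where
  root_mem : r ∈ A
  mem : ∀ {c u v}, O c u v → u ∈ A ∧ v ∈ A
  parent : ∀ {c c' u u' v}, O c u v → O c' u' v → c = c' ∧ u = u'
  depth : ∃ d : I → ℕ, d r = 0 ∧ ∀ c u v, O c u v → d v = d u + 1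
  reach : ∀ {v}, v ∈ A → ReflTransGen (fun u v => ∃ c, O c u v) r v

/-- An oriented labelled graph with a depth function and with unique parents is a forest: an edge
`u → v` separates the descendants of `v` from `u`. -/
theorem isForest_ofRel {O : Fin 2 → I → I → Prop}
    (parent : ∀ {c c' u u' v}, O c u v → O c' u' v → c = c' ∧ u = u')
    (depth : ∃ d : I → ℕ, ∀ c u v, O c u v → d v = d u + 1) : (ofRel O).IsForest := by
  obtain ⟨d, hd⟩ := depth
  refine ⟨disjoint_zero_one.2 ?_, SimpleGraph.isAcyclic_iff_forall_adj_isBridge.2 ?_⟩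
  · rintro u v ⟨-, h | h⟩ ⟨-, h' | h'⟩
    · simpa using (parent h h').1
    · have := hd _ _ _ h; have := hd _ _ _ h'; omega
    · have := hd _ _ _ h; have := hd _ _ _ h'; omega
    · simpa using (parent h h').1
  · have key : ∀ c u v, O c u v → (ofRel O).total.IsBridge s(u, v) := by
      intro c u v huv
      rw [SimpleGraph.isBridge_iff]
      intro hr
      have hD : ∀ w, ((ofRel O).total.deleteEdges {s(u, v)}).Reachable v w →
          ReflTransGen (fun u v => ∃ c, O c u v) v w := by
        intro w hw
        rw [SimpleGraph.reachable_iff_reflTransGen] at hw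
        induction hw with
        | refl => exact .refl
        | @tail w z _ hwz ih =>
          rw [SimpleGraph.deleteEdges_adj, adj_total] at hwz
          obtain ⟨⟨c', -, h | h⟩, hne⟩ := hwz
          · exact ih.tail ⟨c', h⟩
          · rcases ReflTransGen.cases_tail ih with rfl | ⟨p, hp, c'', hpw⟩
            · obtain ⟨-, rfl⟩ := parent h huv
              exact absurd (by simp [Sym2.eq_swap]) hne
            · obtain ⟨-, rfl⟩ := parent h hpw
              exact hp
      have hle : ∀ w, ReflTransGen (fun u v => ∃ c, O c u v) v w → d v ≤ d w := by
        intro w hw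
        induction hw with
        | refl => exact le_rfl
        | tail _ h ih =>
          obtain ⟨c', h⟩ := h
          have := hd _ _ _ h
          omega
      have h1 := hle u (hD u hr.symm)
      have h2 := hd _ _ _ huv
      omega
    intro u v huv
    obtain ⟨c, -, h | h⟩ := adj_total.1 huv
    · exact key c u v h
    · rw [Sym2.eq_swap]
      exact key c v u h

namespace IsArborescence

variable {O O' : Fin 2 → I → I → Prop} {r s : I} {A B : Set I}

theorem ne (h : IsArborescence O r A) {c : Fin 2} {u v : I} (huv : O c u v) : u ≠ v := by
  obtain ⟨d, -, hd⟩ := h.depth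
  rintro rfl
  have := hd _ _ _ huv
  omega

theorem asymm (h : IsArborescence O r A) {c c' : Fin 2} {u v : I} (huv : O c u v) :
    ¬ O c' v u := by
  obtain ⟨d, -, hd⟩ := h.depth
  intro hvu
  have := hd _ _ _ huv
  have := hd _ _ _ hvu
  omega

theorem not_to_root (h : IsArborescence O r A) {c : Fin 2} {u : I} : ¬ O c u r := by
  obtain ⟨d, h0, hd⟩ := h.depth
  intro hu
  have := hd _ _ _ hu
  omega

theorem adj_iff (h : IsArborescence O r A) {c : Fin 2} {u v : I} :
    (ofRel O c).Adj u v ↔ O c u v ∨ O c v u := by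
  refine ⟨fun h' => h'.2, fun h' => ⟨?_, h'⟩⟩
  rcases h' with h' | h'
  · exact h.ne h'
  · exact (h.ne h').symm

theorem isForest (h : IsArborescence O r A) : (ofRel O).IsForest := by
  obtain ⟨d, -, hd⟩ := h.depth
  exact isForest_ofRel h.parent ⟨d, hd⟩

theorem reachable (h : IsArborescence O r A) {v : I} (hv : v ∈ A) :
    (ofRel O).total.Reachable r v := by
  rw [SimpleGraph.reachable_iff_reflTransGen]
  refine ReflTransGen.mono ?_ _ _ (h.reach hv)
  rintro u v ⟨c, huv⟩
  exact adj_total.2 ⟨c, h.adj_iff.2 (.inl huv)⟩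

theorem isTreeOn (h : IsArborescence O r A) : (ofRel O).IsTreeOn A := by
  refine ⟨h.isForest, fun u v huv => ?_, ⟨r, h.root_mem⟩,
    fun u hu v hv => (h.reachable hu).symm.trans (h.reachable hv)⟩
  obtain ⟨c, -, h' | h'⟩ := adj_total.1 huv
  · exact h.mem h'
  · exact (h.mem h').symm

/-- In the graph that underlies an arborescence, the edges that lead away from the root are the
edges of the arborescence. -/
theorem out_iff (h : IsArborescence O r A) {c : Fin 2} {u v : I} :
    (ofRel O).Out r c u v ↔ O c u v := by
  obtain ⟨d, h0, hd⟩ := h.depth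
  have hadj : ∀ u v, (ofRel O).total.Adj u v → d v ≤ d u + 1 := by
    intro u v huv
    obtain ⟨c, -, h' | h'⟩ := adj_total.1 huv <;> have := hd _ _ _ h' <;> omega
  have hwalk : ∀ u v (p : (ofRel O).total.Walk u v), d v ≤ d u + p.length := by
    intro u v p
    induction p with
    | nil => simp
    | cons h p ih =>
      have := hadj _ _ h
      rw [SimpleGraph.Walk.length_cons]
      omega
  have hle : ∀ v, ReflTransGen (fun u v => ∃ c, O c u v) r v →
      ∃ p : (ofRel O).total.Walk r v, p.length = d v := by
    intro v hv
    induction hv with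
    | refl => exact ⟨.nil, by simp [h0]⟩
    | @tail u v _ huv ih =>
      obtain ⟨p, hp⟩ := ih
      obtain ⟨c, huv⟩ := huv
      refine ⟨p.concat (adj_total.2 ⟨c, h.adj_iff.2 (.inl huv)⟩), ?_⟩
      rw [SimpleGraph.Walk.length_concat, hp, hd _ _ _ huv]
  have hdist : ∀ v ∈ A, (ofRel O).total.dist r v = d v := by
    intro v hv
    obtain ⟨p, hp⟩ := hle v (h.reach hv)
    obtain ⟨q, hq⟩ := (h.reachable hv).exists_walk_length_eq_dist
    have h1 := SimpleGraph.dist_le p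
    have h2 := hwalk _ _ q
    omega
  constructor
  · rintro ⟨⟨-, h1 | h1⟩, h2⟩
    · exact h1
    · obtain ⟨hv, hu⟩ := h.mem h1
      rw [hdist v hv, hdist u hu, hd _ _ _ h1] at h2
      omega
  · intro huv
    obtain ⟨hu, hv⟩ := h.mem huv
    exact ⟨h.adj_iff.2 (.inl huv), by rw [hdist v hv, hdist u hu, hd _ _ _ huv]⟩

/-- The arborescence obtained by adding an edge from a vertex of an arborescence to the root of
another one. -/
theorem graft (h : IsArborescence O r A) (h' : IsArborescence O' s B)
    (hAB : ∀ x ∈ A, x ∉ B) {u : I} (hu : u ∈ A) (c₀ : Fin 2) :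
    IsArborescence (fun c x y => O c x y ∨ O' c x y ∨ (c = c₀ ∧ x = u ∧ y = s)) r (A ∪ B) where
  root_mem := .inl h.root_mem
  mem := by
    rintro c x y (hxy | hxy | ⟨-, rfl, rfl⟩)
    · exact ⟨.inl (h.mem hxy).1, .inl (h.mem hxy).2⟩
    · exact ⟨.inr (h'.mem hxy).1, .inr (h'.mem hxy).2⟩
    · exact ⟨.inl hu, .inr h'.root_mem⟩
  parent := by
    rintro c c' x x' y (h1 | h1 | ⟨rfl, rfl, rfl⟩) (h2 | h2 | ⟨rfl, rfl, e⟩)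
    · exact h.parent h1 h2
    · exact absurd (h'.mem h2).2 (hAB _ (h.mem h1).2)
    · exact absurd (e ▸ h'.root_mem) (hAB _ (h.mem h1).2)
    · exact absurd (h'.mem h1).2 (hAB _ (h.mem h2).2)
    · exact h'.parent h1 h2
    · exact absurd (e ▸ h1) h'.not_to_root
    · exact absurd h'.root_mem (hAB _ (h.mem h2).2)
    · exact absurd h2 h'.not_to_root
    · exact ⟨rfl, rfl⟩
  depth := by
    classical
    obtain ⟨d, h0, hd⟩ := h.depth
    obtain ⟨d', h0', hd'⟩ := h'.depth
    refine ⟨fun x => if x ∈ A then d x else d' x + d u + 1, by simp [h.root_mem, h0], ?_⟩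
    rintro c x y (h1 | h1 | ⟨rfl, rfl, rfl⟩)
    · simp [h.mem h1, hd _ _ _ h1]
    · obtain ⟨hx, hy⟩ := h'.mem h1
      dsimp only
      rw [if_neg fun h => hAB _ h hx, if_neg fun h => hAB _ h hy, hd' _ _ _ h1]
      omega
    · dsimp only
      rw [if_neg fun h => hAB _ h h'.root_mem, if_pos hu, h0']
      omega
  reach := by
    have l : ∀ {v}, v ∈ A → ReflTransGen
        (fun x y => ∃ c, O c x y ∨ O' c x y ∨ (c = c₀ ∧ x = u ∧ y = s)) r v := fun hv =>
      ReflTransGen.mono (fun x y ⟨c, hc⟩ => ⟨c, .inl hc⟩) _ _ (h.reach hv)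
    rintro v (hv | hv)
    · exact l hv
    · exact ((l hu).tail ⟨c₀, .inr (.inr ⟨rfl, rfl, rfl⟩)⟩).trans
        (ReflTransGen.mono (fun x y ⟨c, hc⟩ => ⟨c, .inr (.inl hc)⟩) _ _ (h'.reach hv))

theorem single (r : I) : IsArborescence (fun _ _ _ => False) r {r} where
  root_mem := rfl
  mem := False.elim
  parent := False.elim
  depth := ⟨fun _ => 0, rfl, fun _ _ _ => False.elim⟩
  reach := by
    rintro v rfl
    exact .refl

end IsArborescence

/-- Two neighbouring vertices of a tree have different distances from the root. -/
theorem IsTreeOn.out_or_out {T : LabelledGraph I} {A : Set I} (h : T.IsTreeOn A) {r : I}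
    (hr : r ∈ A) {c : Fin 2} {u v : I} (huv : (T c).Adj u v) : T.Out r c u v ∨ T.Out r c v u := by
  have hadj : T.total.Adj u v := adj_total.2 ⟨c, huv⟩
  have hu := h.2.2.2 r hr u (h.2.1 u v hadj).1
  have hv := h.2.2.2 r hr v (h.2.1 u v hadj).2
  have h1 := hadj.diff_dist_adj (u := r)
  have h1' := hadj.symm.diff_dist_adj (u := r)
  have h2 := h.1.2.dist_ne_of_adj hadj hu
  by_cases h3 : T.total.dist r v = T.total.dist r u + 1
  · exact .inl ⟨huv, h3⟩
  · refine .inr ⟨huv.symm, ?_⟩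
    omega

theorem IsTreeOn.isArborescence {T : LabelledGraph I} {A : Set I} (h : T.IsTreeOn A) {r : I}
    (hr : r ∈ A) : IsArborescence (T.Out r) r A := by
  have parent : ∀ {c c' u u' v}, T.Out r c u v → T.Out r c' u' v → c = c' ∧ u = u' := by
    intro c c' u u' v h1 h2
    have a1 : T.total.Adj u v := adj_total.2 ⟨c, h1.1⟩
    have a2 : T.total.Adj u' v := adj_total.2 ⟨c', h2.1⟩
    obtain ⟨p, hp⟩ := (h.2.2.2 r hr u (h.2.1 _ _ a1).1).exists_walk_length_eq_dist
    obtain ⟨q, hq⟩ := (h.2.2.2 r hr u' (h.2.1 _ _ a2).1).exists_walk_length_eq_dist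
    have hp' := (p.concat a1).isPath_of_length_eq_dist
      (by rw [SimpleGraph.Walk.length_concat, hp, h1.2])
    have hq' := (q.concat a2).isPath_of_length_eq_dist
      (by rw [SimpleGraph.Walk.length_concat, hq, h2.2])
    have e := congrArg Subtype.val ((h.1.2.subsingleton_path r v).elim ⟨_, hp'⟩ ⟨_, hq'⟩)
    have e' := congrArg SimpleGraph.Walk.penultimate e
    simp only [SimpleGraph.Walk.penultimate_concat] at e'
    subst e'
    exact ⟨h.1.eq_label h1.1 h2.1, rfl⟩
  refine ⟨hr, fun {c u v} huv => h.2.1 u v (adj_total.2 ⟨c, huv.1⟩), parent,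
    ⟨T.total.dist r, by simp, fun c u v huv => huv.2⟩, fun {v} hv => ?_⟩
  have hrv := h.2.2.2 r hr v hv
  rw [SimpleGraph.reachable_iff_reflTransGen] at hrv
  clear hv
  induction hrv with
  | refl => exact .refl
  | @tail u v _ huv ih =>
    obtain ⟨c, huv⟩ := adj_total.1 huv
    rcases h.out_or_out hr huv with h' | h'
    · exact ih.tail ⟨c, h'⟩
    · rcases ReflTransGen.cases_tail ih with rfl | ⟨p, hp, c', hpu⟩
      · have := h'.2
        simp at this
      · obtain ⟨-, rfl⟩ := parent h' hpu
        exact hp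

end LabelledGraph

/-! ### The tree of a normal monomial -/

open Relation

namespace BiHamTerm

variable {I : Type*}

/-- The set of letters of a monomial. -/
def support (t : BiHamTerm I) : Set I := {i | i ∈ t.leaves}

@[simp] theorem mem_support {t : BiHamTerm I} {i : I} : i ∈ t.support ↔ i ∈ t.leaves := Iff.rfl

theorem support_ext (j : I) (t : BiHamTerm I) : (ext j t).support = {j} ∪ t.support := by
  ext i; simp

theorem support_join (t b : BiHamTerm I) : (join t b).support = t.support ∪ b.support := by
  ext i; simp

theorem nodup_ext {j : I} {t : BiHamTerm I} (h : (ext j t).leaves.Nodup) :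
    t.leaves.Nodup ∧ j ∉ t.leaves := by
  simp only [leaves_node, leaves_leaf, Multiset.singleton_add, Multiset.nodup_cons] at h
  exact h.symm

theorem nodup_join {t b : BiHamTerm I} (h : (join t b).leaves.Nodup) :
    t.leaves.Nodup ∧ b.leaves.Nodup ∧ ∀ x ∈ t.leaves, x ∉ b.leaves :=
  ⟨(Multiset.nodup_add.1 h).1, (Multiset.nodup_add.1 h).2.1, notMem_of_nodup_add h⟩

/-- The oriented edges of the forest of a normal monomial. The factor `{j, t}₁` contributes an
`x`-edge between `j` and the top of `t`, and the factor `{t, b}₂` contributes a `y`-edge between the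
last vertex of `t` and the top of `b`. For `k = true`, the trees are rooted at their heads, and for
`k = false` they are rooted at their tops; in both cases the block `b` hangs from its top. -/
def orient (k : Bool) : BiHamTerm I → Fin 2 → I → I → Prop
  | leaf _ => fun _ _ _ => False
  | node prod s t => fun c u v => orient k s c u v ∨ orient k t c u v
  | node (bracket i) s t => fun c u v =>
      if i = 0 then orient k t c u v ∨
        (c = 0 ∧ if k then u = t.top ∧ v = s.top else u = s.top ∧ v = t.top)
      else orient k s c u v ∨ orient false t c u v ∨ (c = 1 ∧ u = s.last ∧ v = t.top)

@[simp] theorem orient_leaf (k : Bool) (i : I) (c : Fin 2) (u v : I) :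
    orient k (leaf i) c u v ↔ False := Iff.rfl

@[simp] theorem orient_prod (k : Bool) (s t : BiHamTerm I) (c : Fin 2) (u v : I) :
    orient k (node prod s t) c u v ↔ orient k s c u v ∨ orient k t c u v := Iff.rfl

@[simp] theorem orient_true_ext (j : I) (t : BiHamTerm I) (c : Fin 2) (u v : I) :
    orient true (ext j t) c u v ↔ orient true t c u v ∨ (c = 0 ∧ u = t.top ∧ v = j) := by
  simp [orient]

@[simp] theorem orient_false_ext (j : I) (t : BiHamTerm I) (c : Fin 2) (u v : I) :
    orient false (ext j t) c u v ↔ orient false t c u v ∨ (c = 0 ∧ u = j ∧ v = t.top) := by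
  simp [orient]

@[simp] theorem orient_join (k : Bool) (t b : BiHamTerm I) (c : Fin 2) (u v : I) :
    orient k (join t b) c u v ↔
      orient k t c u v ∨ orient false b c u v ∨ (c = 1 ∧ u = t.last ∧ v = b.top) := by
  simp [orient]

/-- The labelled forest of a normal monomial. -/
def graph (t : BiHamTerm I) : LabelledGraph I := LabelledGraph.ofRel (orient true t)

/-- The vertices of the maximal `x`-chain that starts at the head. -/
def xs : BiHamTerm I → Set I
  | leaf i => {i}
  | node prod s _ => xs s
  | node (bracket c) s t => if c = 0 then insert s.top (xs t) else xs s

@[simp] theorem xs_leaf (i : I) : xs (leaf i) = {i} := rfl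
@[simp] theorem xs_ext (j : I) (t : BiHamTerm I) : xs (ext j t) = insert j (xs t) := rfl
@[simp] theorem xs_join (t b : BiHamTerm I) : xs (join t b) = xs t := rfl

/-- The blocks `b` that occur in the factors `{ · , b}₂` of a normal monomial without products. -/
def blocks : BiHamTerm I → Set (BiHamTerm I)
  | leaf _ => ∅
  | node prod s _ => blocks s
  | node (bracket c) s t => if c = 0 then blocks t else insert t (blocks s)

@[simp] theorem blocks_leaf (i : I) : blocks (leaf i) = ∅ := rfl
@[simp] theorem blocks_ext (j : I) (t : BiHamTerm I) : blocks (ext j t) = blocks t := rfl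
@[simp] theorem blocks_join (t b : BiHamTerm I) : blocks (join t b) = insert b (blocks t) := rfl

/-- The edges of the maximal `x`-chain that starts at the head and of the maximal `y`-chains that
start at the vertices of this `x`-chain. -/
def spine : BiHamTerm I → Fin 2 → I → I → Prop
  | leaf _ => fun _ _ _ => False
  | node prod s _ => spine s
  | node (bracket i) s t => fun c u v =>
      if i = 0 then spine t c u v ∨ (c = 0 ∧ u = t.top ∧ v = s.top)
      else spine s c u v ∨ (c = 1 ∧ u = s.last ∧ v = t.top)

@[simp] theorem spine_leaf (i : I) (c : Fin 2) (u v : I) : spine (leaf i) c u v ↔ False := Iff.rfl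

@[simp] theorem spine_ext (j : I) (t : BiHamTerm I) (c : Fin 2) (u v : I) :
    spine (ext j t) c u v ↔ spine t c u v ∨ (c = 0 ∧ u = t.top ∧ v = j) := by
  simp [spine]

@[simp] theorem spine_join (t b : BiHamTerm I) (c : Fin 2) (u v : I) :
    spine (join t b) c u v ↔ spine t c u v ∨ (c = 1 ∧ u = t.last ∧ v = b.top) := by
  simp [spine]

theorem orient_mem {k : Bool} {t : BiHamTerm I} {c : Fin 2} {u v : I} (h : orient k t c u v) :
    u ∈ t.leaves ∧ v ∈ t.leaves := by
  induction t generalizing k with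
  | leaf i => exact h.elim
  | node o s t hs ht =>
    simp only [leaves_node, Multiset.mem_add]
    rcases o with _ | i
    · rcases h with h | h
      · exact ⟨.inl (hs h).1, .inl (hs h).2⟩
      · exact ⟨.inr (ht h).1, .inr (ht h).2⟩
    · by_cases hi : i = 0
      · simp only [orient, hi, if_true] at h
        rcases h with h | ⟨-, h⟩
        · exact ⟨.inr (ht h).1, .inr (ht h).2⟩
        · cases k
          · obtain ⟨rfl, rfl⟩ : u = s.top ∧ v = t.top := by simpa using h
            exact ⟨.inl s.top_mem, .inr t.top_mem⟩
          · obtain ⟨rfl, rfl⟩ : u = t.top ∧ v = s.top := by simpa using h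
            exact ⟨.inr t.top_mem, .inl s.top_mem⟩
      · simp only [orient, hi, if_false] at h
        rcases h with h | h | ⟨-, rfl, rfl⟩
        · exact ⟨.inl (hs h).1, .inl (hs h).2⟩
        · exact ⟨.inr (ht h).1, .inr (ht h).2⟩
        · exact ⟨.inl s.last_mem, .inr t.top_mem⟩

theorem graph_adj_mem {t : BiHamTerm I} {c : Fin 2} {u v : I} (h : (t.graph c).Adj u v) :
    u ∈ t.leaves ∧ v ∈ t.leaves := by
  obtain ⟨-, h | h⟩ := h
  · exact orient_mem h
  · exact (orient_mem h).symm

theorem IsBlock.top_eq_last {b : BiHamTerm I} (hb : IsBlock b) : b.top = b.last := by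
  cases hb <;> rfl

/-- The root of the tree with the orientation `orient k`. -/
def root (k : Bool) (t : BiHamTerm I) : I := if k then t.hd else t.top

variable [LinearOrder I]

theorem IsTree.isArborescence {t : BiHamTerm I} (ht : IsTree t) (hn : t.leaves.Nodup) (k : Bool) :
    LabelledGraph.IsArborescence (orient k t) (t.root k) t.support := by
  induction ht generalizing k with
  | leaf i =>
    have e : support (BiHamTerm.leaf i) = {i} := by ext x; simp
    rw [e, show root k (BiHamTerm.leaf i) = i by simp [root]]
    exact .single i
  | ext j t ht ih =>
    obtain ⟨hn1, hj⟩ := nodup_ext hn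
    rw [support_ext]
    cases k with
    | false =>
      have := (LabelledGraph.IsArborescence.single j).graft (ih hn1 false)
        (by rintro x rfl; exact hj) rfl 0
      convert this using 1
      ext c u v
      simp [root]
      rfl
    | true =>
      have := (ih hn1 true).graft (.single j) (u := t.top)
        (by rintro x hx rfl; exact hj hx) t.top_mem 0
      rw [Set.union_comm] at this
      convert this using 1
      ext c u v
      simp
      rfl
  | join t b ht hb hbt hbm iht ihb =>
    obtain ⟨hn1, hn2, hd⟩ := nodup_join hn
    rw [support_join]
    have := (iht hn1 k).graft (ihb hn2 false) hd t.last_mem 1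
    convert this using 1
    · ext c u v
      simp [root]
    · cases k <;> rfl

theorem orient_true_or {t : BiHamTerm I} (ht : IsTree t) (c : Fin 2) (u v : I) :
    (orient true t c u v ∨ orient true t c v u) ↔
      (orient false t c u v ∨ orient false t c v u) := by
  induction ht with
  | leaf i => simp
  | ext j t ht ih =>
    simp only [orient_true_ext, orient_false_ext]
    grind
  | join t b ht hb hbt hbm iht ihb =>
    simp only [orient_join]
    grind

theorem IsTree.graph_eq {t : BiHamTerm I} (ht : IsTree t) (k : Bool) :
    t.graph = LabelledGraph.ofRel (orient k t) := by
  cases k with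
  | true => rfl
  | false =>
    funext c
    ext u v
    exact and_congr_right fun _ => orient_true_or ht c u v

theorem IsTree.adj_graph {t : BiHamTerm I} (ht : IsTree t) (hn : t.leaves.Nodup) (k : Bool)
    {c : Fin 2} {u v : I} : (t.graph c).Adj u v ↔ orient k t c u v ∨ orient k t c v u := by
  rw [ht.graph_eq k]
  exact (ht.isArborescence hn k).adj_iff

/-- The last vertex has no outgoing `y`-edge. -/
theorem IsTree.last_out {t : BiHamTerm I} (ht : IsTree t) (hn : t.leaves.Nodup) (k : Bool)
    {v : I} : ¬ orient k t 1 t.last v := by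
  induction ht generalizing k v with
  | leaf i => simp
  | ext j t ht ih =>
    obtain ⟨hn1, hj⟩ := nodup_ext hn
    cases k <;> simpa using fun h => hj (orient_mem h).1
  | join t b ht hb hbt hbm iht ihb =>
    obtain ⟨hn1, hn2, hd⟩ := nodup_join hn
    simp only [orient_join, last_join]
    rintro (h | h | ⟨-, h, -⟩)
    · exact hd _ (orient_mem h).1 b.top_mem
    · refine ihb hn2 false (v := v) ?_
      cases hb with
      | leaf i => exact h
      | ext j t => exact h
    · exact hd _ (h ▸ t.last_mem) b.top_mem

/-- The end of the `x`-chain of the head has no outgoing `x`-edge. -/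
theorem IsTree.top_out {t : BiHamTerm I} (ht : IsTree t) (hn : t.leaves.Nodup)
    {v : I} : ¬ orient true t 0 t.top v := by
  induction ht generalizing v with
  | leaf i => simp
  | ext j t ht ih =>
    obtain ⟨hn1, hj⟩ := nodup_ext hn
    simp only [orient_true_ext, top_node, top_leaf]
    rintro (h | ⟨-, h, -⟩)
    · exact hj (orient_mem h).1
    · exact hj (h ▸ t.top_mem)
  | join t b ht hb hbt hbm iht ihb =>
    obtain ⟨hn1, hn2, hd⟩ := nodup_join hn
    simp only [orient_join, top_node]
    rintro (h | h | ⟨h, -⟩)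
    · exact iht hn1 h
    · exact hd _ t.top_mem (orient_mem h).1
    · simp at h

theorem IsTree.star {t : BiHamTerm I} (ht : IsTree t) (hn : t.leaves.Nodup) (k : Bool)
    {c : Fin 2} {u v w : I} (hv : orient k t c u v) (hw : orient k t c u w) : v = w := by
  induction ht generalizing k with
  | leaf i => exact hv.elim
  | ext j t ht ih =>
    obtain ⟨hn1, hj⟩ := nodup_ext hn
    cases k with
    | false =>
      simp only [orient_false_ext] at hv hw
      rcases hv with hv | ⟨-, rfl, rfl⟩ <;> rcases hw with hw | ⟨-, h, rfl⟩
      · exact ih hn1 false hv hw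
      · exact absurd (h ▸ (orient_mem hv).1) hj
      · exact absurd (orient_mem hw).1 hj
      · rfl
    | true =>
      simp only [orient_true_ext] at hv hw
      rcases hv with hv | ⟨rfl, rfl, rfl⟩ <;> rcases hw with hw | ⟨h0, h, rfl⟩
      · exact ih hn1 true hv hw
      · subst h h0
        exact absurd hv (ht.top_out hn1)
      · exact absurd hw (ht.top_out hn1)
      · rfl
  | join t b ht hb hbt hbm iht ihb =>
    obtain ⟨hn1, hn2, hd⟩ := nodup_join hn
    simp only [orient_join] at hv hw
    rcases hv with hv | hv | ⟨rfl, rfl, rfl⟩ <;> rcases hw with hw | hw | ⟨h0, h, rfl⟩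
    · exact iht hn1 k hv hw
    · exact absurd (orient_mem hw).1 (hd _ (orient_mem hv).1)
    · subst h h0
      exact absurd hv (ht.last_out hn1 k)
    · exact absurd (orient_mem hv).1 (hd _ (orient_mem hw).1)
    · exact ihb hn2 false hv hw
    · exact absurd (h ▸ (orient_mem hv).1) (hd _ t.last_mem)
    · exact absurd hw (ht.last_out hn1 k)
    · exact absurd (orient_mem hw).1 (hd _ t.last_mem)
    · rfl

theorem IsTree.xs_subset {t : BiHamTerm I} (ht : IsTree t) {x : I} (hx : x ∈ t.xs) :
    x ∈ t.leaves := by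
  induction ht with
  | leaf i => simpa using hx
  | ext j t ht ih =>
    rcases hx with rfl | hx
    · simp
    · simp [ih hx]
  | join t b ht hb hbt hbm iht ihb => simp [iht hx]

theorem IsTree.hd_mem_xs {t : BiHamTerm I} (ht : IsTree t) : t.hd ∈ t.xs := by
  induction ht with
  | leaf i => simp
  | ext j t ht ih => exact .inr ih
  | join t b ht hb hbt hbm iht ihb => exact iht

theorem IsTree.top_mem_xs {t : BiHamTerm I} (ht : IsTree t) : t.top ∈ t.xs := by
  induction ht with
  | leaf i => simp
  | ext j t ht ih => exact .inl rfl
  | join t b ht hb hbt hbm iht ihb => exact iht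

theorem IsTree.xs_closed {t : BiHamTerm I} (ht : IsTree t) (hn : t.leaves.Nodup) (k : Bool)
    {u v : I} (h : orient k t 0 u v) : u ∈ t.xs ↔ v ∈ t.xs := by
  induction ht generalizing k with
  | leaf i => exact h.elim
  | ext j t ht ih =>
    obtain ⟨hn1, hj⟩ := nodup_ext hn
    have key : ∀ k, orient k t 0 u v →
        (u ∈ (BiHamTerm.ext j t).xs ↔ v ∈ (BiHamTerm.ext j t).xs) := by
      intro k h
      have hu : u ≠ j := fun e => hj (e ▸ (orient_mem h).1)
      have hv : v ≠ j := fun e => hj (e ▸ (orient_mem h).2)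
      simp [hu, hv, ih hn1 k h]
    cases k with
    | false =>
      simp only [orient_false_ext] at h
      rcases h with h | ⟨-, rfl, rfl⟩
      · exact key _ h
      · simp [ht.top_mem_xs]
    | true =>
      simp only [orient_true_ext] at h
      rcases h with h | ⟨-, rfl, rfl⟩
      · exact key _ h
      · simp [ht.top_mem_xs]
  | join t b ht hb hbt hbm iht ihb =>
    obtain ⟨hn1, hn2, hd⟩ := nodup_join hn
    simp only [orient_join] at h
    rcases h with h | h | ⟨h, -⟩
    · exact iht hn1 k h
    · exact ⟨fun hu => absurd (orient_mem h).1 (hd _ (ht.xs_subset hu)),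
        fun hu => absurd (orient_mem h).2 (hd _ (ht.xs_subset hu))⟩
    · simp at h

theorem IsTree.exists_out {t : BiHamTerm I} (ht : IsTree t) {x : I} (hx : x ∈ t.xs)
    (hne : x ≠ t.top) : ∃ z, orient true t 0 x z := by
  induction ht with
  | leaf i => exact absurd hx hne
  | ext j t ht ih =>
    simp only [orient_true_ext]
    rcases hx with rfl | hx
    · exact absurd rfl hne
    · by_cases h : x = t.top
      · exact ⟨j, .inr ⟨trivial, h, rfl⟩⟩
      · obtain ⟨z, hz⟩ := ih hx h
        exact ⟨z, .inl hz⟩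
  | join t b ht hb hbt hbm iht ihb =>
    obtain ⟨z, hz⟩ := iht hx hne
    exact ⟨z, by simp [hz]⟩

theorem IsTree.exists_in {t : BiHamTerm I} (ht : IsTree t) {x : I} (hx : x ∈ t.xs)
    (hne : x ≠ t.hd) : ∃ z, orient true t 0 z x := by
  induction ht with
  | leaf i => exact absurd hx hne
  | ext j t ht ih =>
    simp only [orient_true_ext]
    rcases hx with rfl | hx
    · exact ⟨t.top, .inr ⟨trivial, rfl, rfl⟩⟩
    · obtain ⟨z, hz⟩ := ih hx hne
      exact ⟨z, .inl hz⟩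
  | join t b ht hb hbt hbm iht ihb =>
    obtain ⟨z, hz⟩ := iht hx hne
    exact ⟨z, by simp [hz]⟩

/-- Seen from the top, the `x`-chain ends at the head. -/
theorem IsTree.exists_out' {t : BiHamTerm I} (ht : IsTree t) {x : I} (hx : x ∈ t.xs)
    (hne : x ≠ t.hd) : ∃ z, orient false t 0 x z := by
  induction ht with
  | leaf i => exact absurd hx hne
  | ext j t ht ih =>
    simp only [orient_false_ext]
    rcases hx with rfl | hx
    · exact ⟨t.top, .inr ⟨trivial, rfl, rfl⟩⟩
    · obtain ⟨z, hz⟩ := ih hx hne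
      exact ⟨z, .inl hz⟩
  | join t b ht hb hbt hbm iht ihb =>
    obtain ⟨z, hz⟩ := iht hx hne
    exact ⟨z, by simp [hz]⟩

theorem IsTree.isBlock_or {t : BiHamTerm I} (ht : IsTree t) :
    IsBlock t ∨ ∃ z, orient true t 1 t.top z := by
  induction ht with
  | leaf i => exact .inl (.leaf i)
  | ext j t ht ih => exact .inl (.ext j t)
  | join t b ht hb hbt hbm iht ihb =>
    right
    rcases iht with h | ⟨z, h⟩
    · exact ⟨b.top, by simp [h.top_eq_last]⟩
    · exact ⟨z, by simp [h]⟩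

/-! ### Spines and blocks -/

theorem IsTree.orient_iff {t : BiHamTerm I} (ht : IsTree t) {c : Fin 2} {u v : I} :
    orient true t c u v ↔ spine t c u v ∨ ∃ b ∈ t.blocks, orient false b c u v := by
  induction ht with
  | leaf i => simp
  | ext j t ht ih =>
    rw [orient_true_ext, spine_ext, blocks_ext, ih, or_right_comm]
  | join t b ht hb hbt hbm iht ihb =>
    simp only [orient_join, spine_join, blocks_join, iht, Set.exists_mem_insert]
    grind

theorem IsTree.of_mem_blocks {t : BiHamTerm I} (ht : IsTree t) {b : BiHamTerm I}
    (hb : b ∈ t.blocks) : IsTree b ∧ IsBlock b ∧ HdMax b := by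
  induction ht with
  | leaf i => exact hb.elim
  | ext j t ht ih => exact ih hb
  | join t b' ht hb' hbt hbm iht ihb =>
    rcases hb with rfl | hb
    · exact ⟨hbt, hb', hbm⟩
    · exact iht hb

theorem IsTree.leaves_le_of_mem_blocks {t : BiHamTerm I} (ht : IsTree t) {b : BiHamTerm I}
    (hb : b ∈ t.blocks) : b.leaves ≤ t.leaves := by
  induction ht with
  | leaf i => exact hb.elim
  | ext j t ht ih => exact (ih hb).trans (Multiset.le_add_left _ _)
  | join t b' ht hb' hbt hbm iht ihb =>
    rcases hb with rfl | hb
    · exact Multiset.le_add_left _ _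
    · exact (iht hb).trans (Multiset.le_add_right _ _)

theorem IsTree.blocks_disjoint {t : BiHamTerm I} (ht : IsTree t) (hn : t.leaves.Nodup)
    {b b' : BiHamTerm I} (hb : b ∈ t.blocks) (hb' : b' ∈ t.blocks) {x : I} (hx : x ∈ b.leaves)
    (hx' : x ∈ b'.leaves) : b = b' := by
  induction ht with
  | leaf i => exact hb.elim
  | ext j t ht ih => exact ih (nodup_ext hn).1 hb hb'
  | join t b₀ ht _ hbt hbm iht ihb =>
    obtain ⟨hn1, hn2, hd⟩ := nodup_join hn
    rcases hb with rfl | hb <;> rcases hb' with rfl | hb'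
    · rfl
    · exact absurd hx (hd _ (Multiset.mem_of_le (ht.leaves_le_of_mem_blocks hb') hx'))
    · exact absurd hx' (hd _ (Multiset.mem_of_le (ht.leaves_le_of_mem_blocks hb) hx))
    · exact iht hn1 hb hb'

theorem IsTree.xs_disjoint {t : BiHamTerm I} (ht : IsTree t) (hn : t.leaves.Nodup)
    {b : BiHamTerm I} (hb : b ∈ t.blocks) {x : I} (hx : x ∈ t.xs) : x ∉ b.leaves := by
  induction ht with
  | leaf i => exact hb.elim
  | ext j t ht ih =>
    obtain ⟨hn1, hj⟩ := nodup_ext hn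
    rcases hx with rfl | hx
    · exact fun h => hj (Multiset.mem_of_le (ht.leaves_le_of_mem_blocks hb) h)
    · exact ih hn1 hb hx
  | join t b₀ ht _ hbt hbm iht ihb =>
    obtain ⟨hn1, hn2, hd⟩ := nodup_join hn
    rcases hb with rfl | hb
    · exact hd _ (ht.xs_subset hx)
    · exact iht hn1 hb hx

/-- The vertices other than the starting points on the `y`-chains that start on the `x`-chain of
the head are the tops of the blocks. -/
def ys (t : BiHamTerm I) : Set I := {v | ∃ b ∈ t.blocks, v = b.top}

theorem IsTree.last_mem_spine {t : BiHamTerm I} (ht : IsTree t) : t.last ∈ t.xs ∪ t.ys := by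
  cases ht with
  | leaf i => exact .inl rfl
  | ext j t ht => exact .inl (.inl rfl)
  | join t b ht hb hbt hbm => exact .inr ⟨b, .inl rfl, rfl⟩

theorem IsTree.spine_mem {t : BiHamTerm I} (ht : IsTree t) {c : Fin 2} {u v : I}
    (h : spine t c u v) :
    (c = 0 ∧ u ∈ t.xs ∧ v ∈ t.xs) ∨ (c = 1 ∧ u ∈ t.xs ∪ t.ys ∧ v ∈ t.ys) := by
  induction ht with
  | leaf i => exact h.elim
  | ext j t ht ih =>
    rw [spine_ext] at h
    rcases h with h | ⟨rfl, rfl, rfl⟩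
    · rcases ih h with ⟨h0, h1, h2⟩ | ⟨h0, h1, h2⟩
      · exact .inl ⟨h0, .inr h1, .inr h2⟩
      · exact .inr ⟨h0, h1.imp .inr id, h2⟩
    · exact .inl ⟨rfl, .inr ht.top_mem_xs, .inl rfl⟩
  | join t b ht hb hbt hbm iht ihb =>
    have hys : t.ys ⊆ (BiHamTerm.join t b).ys := fun x ⟨b', hb', e⟩ => ⟨b', .inr hb', e⟩
    rw [spine_join] at h
    rcases h with h | ⟨rfl, rfl, rfl⟩
    · rcases iht h with ⟨h0, h1, h2⟩ | ⟨h0, h1, h2⟩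
      · exact .inl ⟨h0, h1, h2⟩
      · exact .inr ⟨h0, h1.imp id (fun h => hys h), hys h2⟩
    · exact .inr ⟨rfl, ht.last_mem_spine.imp id (fun h => hys h), b, .inl rfl, rfl⟩

theorem IsTree.xs_reach {t : BiHamTerm I} (ht : IsTree t) {x : I} (hx : x ∈ t.xs) :
    ReflTransGen (spine t 0) t.hd x := by
  induction ht generalizing x with
  | leaf i => rw [show x = i from hx]; exact .refl
  | ext j t ht ih =>
    have h : ∀ {x}, x ∈ t.xs → ReflTransGen (spine (BiHamTerm.ext j t) 0) t.hd x := fun hx =>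
      ReflTransGen.mono (fun u v h => by simp [h]) _ _ (ih hx)
    rcases hx with rfl | hx
    · exact (h ht.top_mem_xs).tail (by simp)
    · exact h hx
  | join t b ht hb hbt hbm iht ihb =>
    exact ReflTransGen.mono (fun u v h => by simp [h]) _ _ (iht hx)

theorem IsTree.ys_reach {t : BiHamTerm I} (ht : IsTree t) {x : I} (hx : x ∈ t.ys) :
    ∃ j ∈ t.xs, TransGen (spine t 1) j x := by
  induction ht generalizing x with
  | leaf i => obtain ⟨b, hb, -⟩ := hx; exact hb.elim
  | ext j t ht ih =>
    obtain ⟨i, hi, h⟩ := ih hx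
    exact ⟨i, .inr hi, TransGen.mono (fun u v h => by simp [h]) _ _ h⟩
  | join t b ht hb hbt hbm iht ihb =>
    have h : ∀ {x}, x ∈ t.ys →
        ∃ j ∈ t.xs, TransGen (spine (BiHamTerm.join t b) 1) j x := fun hx => by
      obtain ⟨i, hi, h⟩ := iht hx
      exact ⟨i, hi, TransGen.mono (fun u v h => by simp [h]) _ _ h⟩
    obtain ⟨b', rfl | hb', rfl⟩ := hx
    · rcases ht.last_mem_spine with hl | hl
      · exact ⟨t.last, hl, .single (by simp)⟩
      · obtain ⟨i, hi, h⟩ := h hl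
        exact ⟨i, hi, h.tail (by simp)⟩
    · exact h ⟨b', hb', rfl⟩

end BiHamTerm

/-! ### The forests of normal monomials are basis forests -/

open Relation

namespace LabelledGraph

variable {I : Type*}

/-- A set that is closed under adjacency and in which all vertices are reachable from `v` is the
connected component of `v`. -/
theorem setOf_reachable_eq {G : SimpleGraph I} {S : Set I} {v : I} (hv : v ∈ S)
    (hcl : ∀ x y, x ∈ S → G.Adj x y → y ∈ S) (hr : ∀ x ∈ S, G.Reachable v x) :
    {w | G.Reachable v w} = S := by
  ext w
  refine ⟨fun h => ?_, fun h => hr w h⟩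
  rw [Set.mem_ofPred_eq, SimpleGraph.reachable_iff_reflTransGen] at h
  induction h with
  | refl => exact hv
  | tail _ h ih => exact hcl _ _ ih h

theorem restrict_adj {T : LabelledGraph I} {S : Set I} {c : Fin 2} {u v : I} :
    (T.restrict S c).Adj u v ↔ (T c).Adj u v ∧ u ∈ S ∧ v ∈ S := Iff.rfl

theorem total_mono {T T' : LabelledGraph I} (h : ∀ c u v, (T c).Adj u v → (T' c).Adj u v) :
    T.total ≤ T'.total := by
  intro u v huv
  obtain ⟨c, huv⟩ := adj_total.1 huv
  exact adj_total.2 ⟨c, h c u v huv⟩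

theorem ext_adj {T T' : LabelledGraph I} (h : ∀ c u v, (T c).Adj u v ↔ (T' c).Adj u v) :
    T = T' := by
  funext c
  ext u v
  exact h c u v

theorem remainder_adj {T : LabelledGraph I} {r : I} {c : Fin 2} {u v : I} :
    (T.remainder r c).Adj u v ↔ (T c).Adj u v ∧
      ∀ x y, T.Out r c x y → ((x = u ∧ y = v) ∨ (x = v ∧ y = u)) →
        ¬ ((c = 0 ∧ x ∈ T.chain r 0 r) ∨ (c = 1 ∧ ∃ j ∈ T.chain r 0 r, x ∈ T.chain r 1 j)) := by
  rw [remainder, SimpleGraph.deleteEdges_adj]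
  refine and_congr_right fun _ => ⟨fun h x y hxy he hc => h ⟨x, y, ?_, hxy, hc⟩, ?_⟩
  · rcases he with ⟨rfl, rfl⟩ | ⟨rfl, rfl⟩
    · rfl
    · exact Sym2.eq_swap
  · rintro h ⟨x, y, he, hxy, hc⟩
    refine h x y hxy ?_ hc
    rw [Sym2.eq_iff] at he
    rcases he with ⟨rfl, rfl⟩ | ⟨rfl, rfl⟩
    · exact .inl ⟨rfl, rfl⟩
    · exact .inr ⟨rfl, rfl⟩

end LabelledGraph

namespace BiHamTerm

open LabelledGraph

variable {I : Type*}

theorem graph_prod_adj {s t : BiHamTerm I} {c : Fin 2} {u v : I} :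
    ((node prod s t).graph c).Adj u v ↔ (s.graph c).Adj u v ∨ (t.graph c).Adj u v := by
  simp only [graph, ofRel, SimpleGraph.fromRel_adj, orient_prod]
  tauto

variable [LinearOrder I]

section

variable {t : BiHamTerm I} (ht : IsTree t) (hn : t.leaves.Nodup)
include ht hn

theorem IsTree.nodup_block {b : BiHamTerm I} (hb : b ∈ t.blocks) : b.leaves.Nodup :=
  Multiset.nodup_of_le (ht.leaves_le_of_mem_blocks hb) hn

theorem IsTree.out_graph {c : Fin 2} {u v : I} :
    t.graph.Out t.hd c u v ↔ orient true t c u v :=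
  (ht.isArborescence hn true).out_iff

theorem IsTree.chain_graph : t.graph.chain t.hd 0 t.hd = t.xs := by
  ext x
  constructor
  · intro h
    induction h with
    | refl => exact ht.hd_mem_xs
    | tail _ h ih => exact (ht.xs_closed hn true ((ht.out_graph hn).1 h)).1 ih
  · intro h
    refine ReflTransGen.mono (fun u v h => ?_) _ _ (ht.xs_reach h)
    exact (ht.out_graph hn).2 (ht.orient_iff.2 (.inl h))

theorem IsTree.block_top_out {b : BiHamTerm I} (hb : b ∈ t.blocks) {v : I} :
    ¬ orient false b 1 b.top v := by
  obtain ⟨h1, h2, -⟩ := ht.of_mem_blocks hb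
  rw [h2.top_eq_last]
  exact h1.last_out (ht.nodup_block hn hb) false

/-- Edges of the blocks do not lie on the spine. -/
theorem IsTree.not_spine_of_block {b : BiHamTerm I} (hb : b ∈ t.blocks) {c : Fin 2} {u v : I}
    (h : orient false b c u v) : ¬ ((c = 0 ∧ u ∈ t.xs) ∨ (c = 1 ∧ u ∈ t.xs ∪ t.ys)) := by
  have hu := (orient_mem h).1
  rintro (⟨rfl, hx⟩ | ⟨rfl, hx | ⟨b', hb', rfl⟩⟩)
  · exact ht.xs_disjoint hn hb hx hu
  · exact ht.xs_disjoint hn hb hx hu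
  · obtain rfl := ht.blocks_disjoint hn hb hb' hu b'.top_mem
    exact ht.block_top_out hn hb h

theorem IsTree.spine_iff {c : Fin 2} {u v : I} : spine t c u v ↔
    orient true t c u v ∧ ((c = 0 ∧ u ∈ t.xs) ∨ (c = 1 ∧ u ∈ t.xs ∪ t.ys)) := by
  rw [ht.orient_iff]
  constructor
  · intro h
    refine ⟨.inl h, ?_⟩
    rcases ht.spine_mem h with ⟨h0, h1, -⟩ | ⟨h0, h1, -⟩
    · exact .inl ⟨h0, h1⟩
    · exact .inr ⟨h0, h1⟩
  · rintro ⟨h | ⟨b, hb, h⟩, hc⟩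
    · exact h
    · exact absurd hc (ht.not_spine_of_block hn hb h)

theorem IsTree.mem_ychain {j v : I} (hj : j ∈ t.xs) (h : v ∈ t.graph.chain t.hd 1 j) :
    v ∈ t.xs ∪ t.ys := by
  induction h with
  | refl => exact .inl hj
  | tail _ h ih =>
    rcases ht.spine_mem ((ht.spine_iff hn).2 ⟨(ht.out_graph hn).1 h, .inr ⟨rfl, ih⟩⟩) with
      ⟨h, -⟩ | ⟨-, -, h⟩
    · simp at h
    · exact .inr h

theorem IsTree.exists_ychain {v : I} (hv : v ∈ t.xs ∪ t.ys) :
    ∃ j ∈ t.xs, v ∈ t.graph.chain t.hd 1 j := by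
  rcases hv with hv | hv
  · exact ⟨v, hv, .refl⟩
  · obtain ⟨j, hj, h⟩ := ht.ys_reach hv
    exact ⟨j, hj, ReflTransGen.mono (fun u v h => (ht.out_graph hn).2 (ht.orient_iff.2 (.inl h)))
      _ _ h.to_reflTransGen⟩

theorem IsTree.mem_ys_of_isSpine {v : I} (h : t.graph.IsSpine t.hd v) : v ∈ t.ys := by
  obtain ⟨j, hj, h⟩ := h
  rw [ht.chain_graph hn] at hj
  obtain ⟨u, hu, h⟩ := TransGen.tail'_iff.1 h
  have hu' := ht.mem_ychain hn hj hu
  rcases ht.spine_mem ((ht.spine_iff hn).2 ⟨(ht.out_graph hn).1 h, .inr ⟨rfl, hu'⟩⟩) with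
      ⟨h, -⟩ | ⟨-, -, h⟩
  · simp at h
  · exact h

theorem IsTree.remainder_graph_adj {c : Fin 2} {u v : I} :
    (t.graph.remainder t.hd c).Adj u v ↔ ∃ b ∈ t.blocks, (b.graph c).Adj u v := by
  have hcond : ∀ x : I, (((c = 0 ∧ x ∈ t.graph.chain t.hd 0 t.hd) ∨
      (c = 1 ∧ ∃ j ∈ t.graph.chain t.hd 0 t.hd, x ∈ t.graph.chain t.hd 1 j)) ↔
      ((c = 0 ∧ x ∈ t.xs) ∨ (c = 1 ∧ x ∈ t.xs ∪ t.ys))) := by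
    intro x
    rw [ht.chain_graph hn]
    refine or_congr_right (and_congr_right fun _ => ⟨fun ⟨j, hj, h⟩ => ht.mem_ychain hn hj h,
      fun h => ht.exists_ychain hn h⟩)
  have hadj : ∀ b ∈ t.blocks, ((b.graph c).Adj u v ↔ orient false b c u v ∨ orient false b c v u) :=
    fun b hb => (ht.of_mem_blocks hb).1.adj_graph (ht.nodup_block hn hb) false
  have hA := ht.isArborescence hn true
  simp only [remainder_adj, hcond, ht.out_graph hn]
  constructor
  · rintro ⟨h, hs⟩
    rcases (ht.adj_graph hn true).1 h with h | h
    · rcases ht.orient_iff.1 h with h' | ⟨b, hb, h'⟩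
      · exact absurd ((ht.spine_iff hn).1 h').2 (hs u v h (.inl ⟨rfl, rfl⟩))
      · exact ⟨b, hb, (hadj b hb).2 (.inl h')⟩
    · rcases ht.orient_iff.1 h with h' | ⟨b, hb, h'⟩
      · exact absurd ((ht.spine_iff hn).1 h').2 (hs v u h (.inr ⟨rfl, rfl⟩))
      · exact ⟨b, hb, (hadj b hb).2 (.inr h')⟩
  · rintro ⟨b, hb, h⟩
    have key : ∀ x y, orient false b c x y → ∀ x' y', orient true t c x' y' →
        ((x' = x ∧ y' = y) ∨ (x' = y ∧ y' = x)) →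
        ¬ ((c = 0 ∧ x' ∈ t.xs) ∨ (c = 1 ∧ x' ∈ t.xs ∪ t.ys)) := by
      rintro x y h x' y' h' (⟨rfl, rfl⟩ | ⟨rfl, rfl⟩)
      · exact ht.not_spine_of_block hn hb h
      · exact absurd h' (hA.asymm (ht.orient_iff.2 (.inr ⟨b, hb, h⟩)))
    rcases (hadj b hb).1 h with h | h
    · exact ⟨(ht.adj_graph hn true).2 (.inl (ht.orient_iff.2 (.inr ⟨b, hb, h⟩))),
        fun x y hxy he => key u v h x y hxy he⟩
    · exact ⟨(ht.adj_graph hn true).2 (.inr (ht.orient_iff.2 (.inr ⟨b, hb, h⟩))),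
        fun x y hxy he => key v u h x y hxy he.symm⟩

theorem IsTree.remainder_adj_block {b : BiHamTerm I} (hb : b ∈ t.blocks) {c : Fin 2} {u v : I}
    (hu : u ∈ b.leaves) : (t.graph.remainder t.hd c).Adj u v ↔ (b.graph c).Adj u v := by
  rw [ht.remainder_graph_adj hn]
  refine ⟨?_, fun h => ⟨b, hb, h⟩⟩
  rintro ⟨b', hb', h⟩
  obtain rfl := ht.blocks_disjoint hn hb hb' hu (graph_adj_mem h).1
  exact h

theorem IsTree.part_graph {b : BiHamTerm I} (hb : b ∈ t.blocks) :
    t.graph.part t.hd b.top = b.support := by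
  refine setOf_reachable_eq b.top_mem (fun x y hx hxy => ?_) (fun x hx => ?_)
  · obtain ⟨c, h⟩ := adj_total.1 hxy
    exact (graph_adj_mem ((ht.remainder_adj_block hn hb hx).1 h)).2
  · have h1 := (ht.of_mem_blocks hb).1
    have h2 := (h1.isArborescence (ht.nodup_block hn hb) false).reachable hx
    rw [← h1.graph_eq] at h2
    exact h2.mono (total_mono fun c u v h => (ht.remainder_graph_adj hn).2 ⟨b, hb, h⟩)

theorem IsTree.restrict_remainder {b : BiHamTerm I} (hb : b ∈ t.blocks) :
    (t.graph.remainder t.hd).restrict b.support = b.graph := by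
  refine ext_adj fun c u v => ?_
  rw [restrict_adj]
  constructor
  · rintro ⟨h, hu, -⟩
    exact (ht.remainder_adj_block hn hb hu).1 h
  · intro h
    obtain ⟨hu, hv⟩ := graph_adj_mem h
    exact ⟨(ht.remainder_adj_block hn hb hu).2 h, hu, hv⟩

theorem IsTree.chainEnd_block {b : BiHamTerm I} (hb : b ∈ t.blocks) {w : I}
    (h : t.graph.IsChainEnd t.hd 0 b.top w) : w = b.hd := by
  obtain ⟨h1, h2⟩ := h
  have hbt := (ht.of_mem_blocks hb).1
  have hw : w ∈ b.xs := by
    clear h2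
    induction h1 with
    | refl => exact hbt.top_mem_xs
    | @tail x y _ h ih =>
      rcases ht.orient_iff.1 ((ht.out_graph hn).1 h) with h | ⟨b', hb', h⟩
      · rcases ht.spine_mem h with ⟨-, hx, -⟩ | ⟨h, -⟩
        · exact absurd (hbt.xs_subset ih) (ht.xs_disjoint hn hb hx)
        · simp at h
      · obtain rfl := ht.blocks_disjoint hn hb hb' (hbt.xs_subset ih) (orient_mem h).1
        exact (hbt.xs_closed (ht.nodup_block hn hb) false h).1 ih
  by_contra hne
  obtain ⟨z, hz⟩ := hbt.exists_out' hw hne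
  exact h2 z ((ht.out_graph hn).2 (ht.orient_iff.2 (.inr ⟨b, hb, hz⟩)))

theorem IsTree.isBasisTree_of_blocks (hm : HdMax t)
    (ih : ∀ b ∈ t.blocks, IsBasisTree b.support b.graph) : IsBasisTree t.support t.graph := by
  refine .intro t.support t.graph t.hd (ht.isArborescence hn true).isTreeOn
    ⟨t.hd_mem, hm⟩ (fun c u v w h1 h2 => ht.star hn true ((ht.out_graph hn).1 h1)
      ((ht.out_graph hn).1 h2)) (fun v hv w hw => ?_) (fun v hv => ?_)
  · obtain ⟨b, hb, rfl⟩ := ht.mem_ys_of_isSpine hn hv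
    rw [ht.part_graph hn hb, ht.chainEnd_block hn hb hw]
    exact ⟨b.hd_mem, (ht.of_mem_blocks hb).2.2⟩
  · obtain ⟨b, hb, rfl⟩ := ht.mem_ys_of_isSpine hn hv
    rw [ht.part_graph hn hb, ht.restrict_remainder hn hb]
    exact ih b hb

/-- The tree of a normal monomial belongs to `𝔗`, and so do the trees of its blocks, by induction on
the monomial. For the monomial itself, `r` is the head, the chains at the root are made of the
letters in `xs` and `ys`, and the components that remain are the blocks. -/
theorem IsTree.isBasisTree : (HdMax t → IsBasisTree t.support t.graph) ∧
    ∀ b ∈ t.blocks, IsBasisTree b.support b.graph := by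
  suffices h : ∀ b ∈ t.blocks, IsBasisTree b.support b.graph from
    ⟨fun hm => ht.isBasisTree_of_blocks hn hm h, h⟩
  induction ht with
  | leaf i => exact fun b hb => hb.elim
  | ext j t ht ih => exact ih (nodup_ext hn).1
  | join t b₀ ht hb hbt hbm iht ihb =>
    obtain ⟨hn1, hn2, hd⟩ := nodup_join hn
    rintro b (rfl | hb)
    · exact hbt.isBasisTree_of_blocks hn2 hbm (ihb hn2)
    · exact iht hn1 b hb

end

theorem IsForest.isForest_graph {f : BiHamTerm I} (hf : IsForest f) (hn : f.leaves.Nodup) :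
    f.graph.IsForest := by
  have h : (∀ {c c' u u' v}, orient true f c u v → orient true f c' u' v → c = c' ∧ u = u') ∧
      ∃ d : I → ℕ, ∀ c u v, orient true f c u v → d v = d u + 1 := by
    induction hf with
    | tree t ht =>
      have := ht.1.isArborescence hn true
      exact ⟨this.parent, this.depth.imp fun d h => h.2⟩
    | prod t f ht _ _ ih =>
      have hd := notMem_of_nodup_add (d := t.leaves) (e := f.leaves) hn
      replace hn : (t.leaves + f.leaves).Nodup := hn
      rw [Multiset.nodup_add] at hn
      obtain ⟨hp, d, h⟩ := ih hn.2.1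
      have hA := ht.1.isArborescence hn.1 true
      obtain ⟨d', -, h'⟩ := hA.depth
      refine ⟨?_, ?_⟩
      · rintro c c' u u' v (h1 | h1) (h2 | h2)
        · exact hA.parent h1 h2
        · exact absurd (orient_mem h2).2 (hd (orient_mem h1).2)
        · exact absurd (orient_mem h1).2 (hd (orient_mem h2).2)
        · exact hp h1 h2
      · classical
        refine ⟨fun i => if i ∈ t.leaves then d' i else d i, ?_⟩
        rintro c u v (h1 | h1)
        · simp [orient_mem h1, h' c u v h1]
        · obtain ⟨hu, hv⟩ := orient_mem h1
          dsimp only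
          rw [if_neg fun h => hd h hu, if_neg fun h => hd h hv, h c u v h1]
  exact isForest_ofRel h.1 h.2

/-- The trees of a normal monomial are the connected components of its forest. -/
theorem IsForest.exists_tree {f : BiHamTerm I} (hf : IsForest f) (hn : f.leaves.Nodup) {i : I}
    (hi : i ∈ f.leaves) : ∃ t, IsNormalTree t ∧ t.leaves.Nodup ∧ i ∈ t.leaves ∧
      (∀ x ∈ t.leaves, x ∈ f.leaves) ∧
      (∀ c u v, (t.graph c).Adj u v → (f.graph c).Adj u v) ∧
      ∀ c u v, u ∈ t.leaves → (f.graph c).Adj u v → (t.graph c).Adj u v := by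
  induction hf with
  | tree t ht => exact ⟨t, ht, hn, hi, fun _ h => h, fun _ _ _ h => h, fun _ _ _ _ h => h⟩
  | prod t f ht _ _ ih =>
    have hd := notMem_of_nodup_add (d := t.leaves) (e := f.leaves) hn
    replace hn : (t.leaves + f.leaves).Nodup := hn
    rw [Multiset.nodup_add] at hn
    simp only [graph_prod_adj]
    rcases Multiset.mem_add.1 hi with hi | hi
    · exact ⟨t, ht, hn.1, hi, fun _ h => Multiset.mem_add.2 (.inl h), fun _ _ _ h => .inl h,
        fun c u v hu h =>
        h.resolve_right fun h => hd hu (graph_adj_mem h).1⟩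
    · obtain ⟨s, h1, h2, h3, h6, h4, h5⟩ := ih hn.2.1 hi
      refine ⟨s, h1, h2, h3, fun x hx => Multiset.mem_add.2 (.inr (h6 x hx)),
        fun c u v h => .inr (h4 c u v h), fun c u v hu h => ?_⟩
      refine h5 c u v hu (h.resolve_left fun h => ?_)
      exact hd (graph_adj_mem h).1 (h6 u hu)

theorem IsForest.graph_mem_basisForests {f : BiHamTerm I} (hf : IsForest f) (hn : f.leaves.Nodup)
    (hu : ∀ i, i ∈ f.leaves) : f.graph ∈ basisForests I := by
  refine ⟨hf.isForest_graph hn, fun C => ?_⟩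
  induction C using SimpleGraph.ConnectedComponent.ind with
  | h i =>
    obtain ⟨t, ht, hnt, hi, -, h1, h2⟩ := hf.exists_tree hn (hu i)
    have hA := ht.1.isArborescence hnt true
    have hs : (f.graph.total.connectedComponentMk i).supp = t.support := by
      have : (f.graph.total.connectedComponentMk i).supp = {w | f.graph.total.Reachable i w} := by
        ext w
        rw [SimpleGraph.ConnectedComponent.mem_supp_iff, SimpleGraph.ConnectedComponent.eq]
        exact ⟨fun h => h.symm, fun h => h.symm⟩
      rw [this]
      refine setOf_reachable_eq hi (fun x y hx hxy => ?_) (fun x hx => ?_)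
      · obtain ⟨c, h⟩ := adj_total.1 hxy
        exact (graph_adj_mem (h2 c x y hx h)).2
      · exact (((hA.reachable hi).symm.trans (hA.reachable hx)).mono (total_mono h1))
    have hr : f.graph.restrict t.support = t.graph := by
      refine ext_adj fun c u v => ⟨fun h => h2 c u v h.2.1 h.1, fun h => ?_⟩
      exact ⟨h1 c u v h, graph_adj_mem h⟩
    rw [hs, hr]
    exact (ht.1.isBasisTree hnt).1 ht.2

end BiHamTerm

/-! ### Basis forests come from normal monomials -/

open Relation

namespace LabelledGraph

variable {I : Type*} {T : LabelledGraph I} {r : I} {A : Set I}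

/-- The oriented edges of the remainder. -/
def RemainderOut (T : LabelledGraph I) (r : I) (c : Fin 2) (u v : I) : Prop :=
  T.Out r c u v ∧
    ¬ ((c = 0 ∧ u ∈ T.chain r 0 r) ∨ (c = 1 ∧ ∃ j ∈ T.chain r 0 r, u ∈ T.chain r 1 j))

section

variable (hT : T.IsTreeOn A) (hr : r ∈ A)
include hT hr

theorem IsTreeOn.remainder_adj_iff {c : Fin 2} {u v : I} :
    (T.remainder r c).Adj u v ↔ T.RemainderOut r c u v ∨ T.RemainderOut r c v u := by
  have hO := hT.isArborescence hr
  rw [remainder_adj]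
  constructor
  · rintro ⟨h, hs⟩
    rcases hT.out_or_out hr h with h | h
    · exact .inl ⟨h, hs u v h (.inl ⟨rfl, rfl⟩)⟩
    · exact .inr ⟨h, hs v u h (.inr ⟨rfl, rfl⟩)⟩
  · rintro (⟨h, hs⟩ | ⟨h, hs⟩)
    · refine ⟨h.1, ?_⟩
      rintro x y hxy (⟨rfl, rfl⟩ | ⟨rfl, rfl⟩)
      · exact hs
      · exact absurd hxy (hO.asymm h)
    · refine ⟨h.1.symm, ?_⟩
      rintro x y hxy (⟨rfl, rfl⟩ | ⟨rfl, rfl⟩)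
      · exact absurd hxy (hO.asymm h)
      · exact hs

theorem IsTreeOn.notMem_chain_of_remainderOut {c : Fin 2} {u v : I}
    (h : T.RemainderOut r c u v) : v ∉ T.chain r 0 r := by
  have hO := hT.isArborescence hr
  intro hv
  rcases ReflTransGen.cases_tail hv with rfl | ⟨p, hp, hpv⟩
  · exact hO.not_to_root h.1
  · obtain ⟨rfl, rfl⟩ := hO.parent h.1 hpv
    exact h.2 (.inl ⟨rfl, hp⟩)

theorem IsTreeOn.not_isSpine_of_remainderOut {c : Fin 2} {u v : I}
    (h : T.RemainderOut r c u v) : ¬ T.IsSpine r v := by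
  have hO := hT.isArborescence hr
  rintro ⟨j, hj, hv⟩
  obtain ⟨p, hp, hpv⟩ := TransGen.tail'_iff.1 hv
  obtain ⟨rfl, rfl⟩ := hO.parent h.1 hpv
  exact h.2 (.inr ⟨rfl, j, hj, hp⟩)

theorem IsTreeOn.notMem_chain_of_isSpine {v : I} (h : T.IsSpine r v) : v ∉ T.chain r 0 r := by
  have hO := hT.isArborescence hr
  obtain ⟨j, hj, hv⟩ := h
  obtain ⟨p, hp, hpv⟩ := TransGen.tail'_iff.1 hv
  intro hv
  rcases ReflTransGen.cases_tail hv with rfl | ⟨q, hq, hqv⟩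
  · exact hO.not_to_root hpv
  · simpa using (hO.parent hpv hqv).1

/-- The part of a spine vertex consists of its descendants in the remainder. -/
theorem IsTreeOn.reach_of_mem_part {v w : I} (hv : T.IsSpine r v) (hw : w ∈ T.part r v) :
    ReflTransGen (fun x y => ∃ c, T.RemainderOut r c x y) v w := by
  have hO := hT.isArborescence hr
  rw [part, Set.mem_ofPred_eq, SimpleGraph.reachable_iff_reflTransGen] at hw
  induction hw with
  | refl => exact .refl
  | @tail w z _ hwz ih =>
    obtain ⟨c, hwz⟩ := adj_total.1 hwz
    rcases (hT.remainder_adj_iff hr).1 hwz with h | h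
    · exact ih.tail ⟨c, h⟩
    · rcases ReflTransGen.cases_tail ih with rfl | ⟨p, hp, c', hpw⟩
      · exact absurd hv (hT.not_isSpine_of_remainderOut hr h)
      · obtain ⟨-, rfl⟩ := hO.parent h.1 hpw.1
        exact hp

theorem IsTreeOn.notMem_chain_of_mem_part {v w : I} (hv : T.IsSpine r v) (hw : w ∈ T.part r v) :
    w ∉ T.chain r 0 r := by
  rcases ReflTransGen.cases_tail (hT.reach_of_mem_part hr hv hw) with rfl | ⟨p, -, c, h⟩
  · exact hT.notMem_chain_of_isSpine hr hv
  · exact hT.notMem_chain_of_remainderOut hr h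

theorem IsTreeOn.eq_of_mem_part {v w : I} (hv : T.IsSpine r v) (hw : w ∈ T.part r v)
    (hw' : T.IsSpine r w) : w = v := by
  rcases ReflTransGen.cases_tail (hT.reach_of_mem_part hr hv hw) with rfl | ⟨p, -, c, h⟩
  · rfl
  · exact absurd hw' (hT.not_isSpine_of_remainderOut hr h)

/-- The edges that start in the part of a spine vertex `v` belong to the remainder, except for the
`y`-edge that starts at `v`. -/
theorem IsTreeOn.remainderOut_of_mem_part {v w z : I} {c : Fin 2} (hv : T.IsSpine r v)
    (hw : w ∈ T.part r v) (h : T.Out r c w z) (hc : c = 1 → w ≠ v) :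
    T.RemainderOut r c w z := by
  refine ⟨h, ?_⟩
  rintro (⟨-, h⟩ | ⟨rfl, j, hj, h⟩)
  · exact hT.notMem_chain_of_mem_part hr hv hw h
  · rcases Relation.reflTransGen_iff_eq_or_transGen.1 h with rfl | h
    · exact hT.notMem_chain_of_mem_part hr hv hw hj
    · exact hc rfl (hT.eq_of_mem_part hr hv hw ⟨j, hj, h⟩)

theorem IsTreeOn.mem_part_of_remainderOut {v w z : I} {c : Fin 2} (hw : w ∈ T.part r v)
    (h : T.RemainderOut r c w z) : z ∈ T.part r v :=
  SimpleGraph.Reachable.trans hw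
    (adj_total.2 ⟨c, (hT.remainder_adj_iff hr).2 (.inl h)⟩ :
      (T.remainder r).total.Adj w z).reachable

theorem IsTreeOn.exists_isChainEnd [Finite I] (v : I) : ∃ w, T.IsChainEnd r 0 v w := by
  obtain ⟨d, -, hd⟩ := (hT.isArborescence hr).depth
  obtain ⟨w, hw, hmax⟩ := Set.exists_max_image (T.chain r 0 v) d (Set.toFinite _) ⟨v, .refl⟩
  refine ⟨w, hw, fun u hu => ?_⟩
  have h1 := hmax u (ReflTransGen.tail hw hu)
  have h2 := hd _ _ _ hu
  omega

end

end LabelledGraph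

namespace BiHamTerm

open LabelledGraph

variable {I : Type*} [LinearOrder I] {T : LabelledGraph I} {r : I} {A : Set I}

/-- If the part of a spine vertex `v` is the tree of a normal monomial `s` and if the `x`-chain of
`v` ends at the maximum of this part, then `s` is a block with top `v`: otherwise `v` would have a
`y`-edge or two `x`-edges in its part. -/
theorem isBlock_of_part [Finite I] (hT : T.IsTreeOn A) (hr : r ∈ A) (hstar : T.Star r) {v : I}
    (hv : T.IsSpine r v) (hmax : ∀ w, T.IsChainEnd r 0 v w → IsGreatest (T.part r v) w)
    {s : BiHamTerm I} (hs : IsNormalTree s) (hn : s.leaves.Nodup) (hsupp : s.support = T.part r v)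
    (hg : s.graph = (T.remainder r).restrict (T.part r v)) : IsBlock s ∧ s.top = v := by
  have hO := hT.isArborescence hr
  have hA := hs.1.isArborescence hn true
  have hvp : v ∈ T.part r v := SimpleGraph.Reachable.refl v
  have hgraph : ∀ {c x y}, (s.graph c).Adj x y →
      T.RemainderOut r c x y ∨ T.RemainderOut r c y x := by
    intro c x y h
    rw [hg] at h
    exact (hT.remainder_adj_iff hr).1 h.1
  have hout : ∀ {c x y}, x ∈ T.part r v → T.RemainderOut r c x y → (s.graph c).Adj x y := by
    intro c x y hx h
    rw [hg]
    exact ⟨(hT.remainder_adj_iff hr).2 (.inl h), hx, hT.mem_part_of_remainderOut hr hx h⟩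
  have hv_out : ∀ {c z}, (s.graph c).Adj v z → T.RemainderOut r c v z := fun h =>
    (hgraph h).resolve_right fun h => hT.not_isSpine_of_remainderOut hr h hv
  obtain ⟨w, hw⟩ := hT.exists_isChainEnd hr v
  have hwhd : w = s.hd := by
    have h1 := hmax w hw
    rw [← hsupp] at h1
    exact le_antisymm (hs.2 w h1.1) (h1.2 s.hd_mem)
  -- the `x`-chain from `v` to its end lies in the part of `v` and in the `x`-chain of `s`
  have hpart : ∀ x ∈ T.chain r 0 v, x ∈ T.part r v := by
    intro x hx
    induction hx with
    | refl => exact hvp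
    | tail _ h ih =>
      exact hT.mem_part_of_remainderOut hr ih (hT.remainderOut_of_mem_part hr hv ih h (by simp))
  have hvx : v ∈ s.xs := by
    have : ∀ x, ReflTransGen (T.Out r 0) v x → x ∈ s.xs → v ∈ s.xs := by
      intro x hx
      induction hx with
      | refl => exact id
      | @tail x y hx h ih =>
        intro hy
        have hxp := hpart x hx
        have h2 := hout hxp (hT.remainderOut_of_mem_part hr hv hxp h (by simp))
        rcases (hs.1.adj_graph hn true).1 h2 with h3 | h3
        · exact ih ((hs.1.xs_closed hn true h3).2 hy)
        · exact ih ((hs.1.xs_closed hn true h3).1 hy)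
    exact this w hw.1 (hwhd ▸ hs.1.hd_mem_xs)
  -- otherwise `v` has an `x`-edge in `s` towards the top; by the choice of `v` it is the edge of `T`
  -- that starts at `v`, and then so is the edge towards the head
  have htop : s.top = v := by
    by_contra hne
    obtain ⟨q, hq⟩ := hs.1.exists_out hvx (Ne.symm hne)
    have hq' := hv_out ((hs.1.adj_graph hn true).2 (.inl hq))
    by_cases hvhd : v = s.hd
    · have hvw : v = w := hvhd.trans hwhd.symm
      exact hw.2 q (hvw ▸ hq'.1)
    · obtain ⟨p, hp⟩ := hs.1.exists_in hvx hvhd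
      have hp' := hv_out ((hs.1.adj_graph hn true).2 (.inr hp))
      have : p = q := hstar _ _ _ _ hp'.1 hq'.1
      subst this
      exact hA.asymm hp hq
  -- `s` is a block, since the `y`-edges at a spine vertex belong to the spine
  refine ⟨hs.1.isBlock_or.resolve_right ?_, htop⟩
  rintro ⟨z, hz⟩
  rw [htop] at hz
  have h := hv_out ((hs.1.adj_graph hn true).2 (.inl hz))
  obtain ⟨j, hj, hjv⟩ := hv
  exact h.2 (.inr ⟨rfl, j, hj, hjv.to_reflTransGen⟩)

/-- The tree of the normal monomial `t` is an initial part of the tree `T` with root `r`: every edge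
of `T` that leaves it starts at the last vertex with label `y` or at the top with label `x`. -/
structure IsInitial (T : LabelledGraph I) (r : I) (t : BiHamTerm I) : Prop where
  tree : IsTree t
  nodup : t.leaves.Nodup
  hd_eq : t.hd = r
  adj : ∀ {c u v}, (t.graph c).Adj u v → (T c).Adj u v
  top_mem : t.top ∈ T.chain r 0 r
  last_mem : t.last ∈ T.chain r 1 t.top
  closed : ∀ {c u v}, T.Out r c u v → u ∈ t.leaves →
    v ∈ t.leaves ∨ (c = 1 ∧ u = t.last) ∨ (c = 0 ∧ u = t.top)
  parent : ∀ {c u v}, T.Out r c u v → v ∈ t.leaves → u ∈ t.leaves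
  last_out : ∀ {v}, T.Out r 1 t.last v → v ∉ t.leaves
  top_out : ∀ {v}, T.Out r 0 t.top v → v ∉ t.leaves

theorem isInitial_leaf (hT : T.IsTreeOn A) (hr : r ∈ A) : IsInitial T r (leaf r) := by
  have hO := hT.isArborescence hr
  refine ⟨.leaf r, by simp, rfl, ?_, .refl, .refl, ?_, ?_, ?_, ?_⟩
  · rintro c u v ⟨-, h | h⟩ <;> exact h.elim
  · intro c u v h hu
    rw [leaves_leaf, Multiset.mem_singleton] at hu
    fin_cases c
    · exact .inr (.inr ⟨rfl, hu⟩)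
    · exact .inr (.inl ⟨rfl, hu⟩)
  · intro c u v h hv
    rw [leaves_leaf, Multiset.mem_singleton] at hv
    exact absurd (hv ▸ h) hO.not_to_root
  · intro v h hv
    rw [leaves_leaf, Multiset.mem_singleton] at hv
    exact absurd (hv ▸ h) hO.not_to_root
  · intro v h hv
    rw [leaves_leaf, Multiset.mem_singleton] at hv
    exact absurd (hv ▸ h) hO.not_to_root

theorem IsInitial.ext {t : BiHamTerm I} (h : IsInitial T r t) (hT : T.IsTreeOn A) (hr : r ∈ A)
    (hstar : T.Star r) (hlast : ∀ v, ¬ T.Out r 1 t.last v) {j : I} (hj : T.Out r 0 t.top j) :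
    IsInitial T r (BiHamTerm.ext j t) := by
  have hO := hT.isArborescence hr
  have hjt : j ∉ t.leaves := h.top_out hj
  have hmem : ∀ {x}, x ∈ (BiHamTerm.ext j t).leaves ↔ x = j ∨ x ∈ t.leaves := by simp
  have hout : ∀ {c v}, T.Out r c j v → v ∉ (BiHamTerm.ext j t).leaves := by
    intro c v hv hvl
    rcases hmem.1 hvl with rfl | hvl
    · exact hO.ne hv rfl
    · exact hjt (h.parent hv hvl)
  refine ⟨.ext j t h.tree, ?_, h.hd_eq, ?_, ReflTransGen.tail h.top_mem hj, .refl, ?_, ?_, hout,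
    hout⟩
  · simpa using ⟨hjt, h.nodup⟩
  · have key : ∀ {c u v}, orient true (BiHamTerm.ext j t) c u v → (T c).Adj u v := by
      intro c u v huv
      rw [orient_true_ext] at huv
      rcases huv with huv | ⟨rfl, rfl, rfl⟩
      · exact h.adj ((h.tree.adj_graph h.nodup true).2 (.inl huv))
      · exact hj.1
    rintro c u v ⟨-, huv | huv⟩
    · exact key huv
    · exact (key huv).symm
  · intro c u v huv hu
    rcases hmem.1 hu with rfl | hu
    · fin_cases c
      · exact .inr (.inr ⟨rfl, rfl⟩)
      · exact .inr (.inl ⟨rfl, rfl⟩)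
    · rcases h.closed huv hu with hv | ⟨rfl, rfl⟩ | ⟨rfl, rfl⟩
      · exact .inl (hmem.2 (.inr hv))
      · exact absurd huv (hlast v)
      · exact .inl (hmem.2 (.inl (hstar _ _ _ _ huv hj)))
  · intro c u v huv hv
    rcases hmem.1 hv with rfl | hv
    · exact hmem.2 (.inr ((hO.parent huv hj).2 ▸ t.top_mem))
    · exact hmem.2 (.inr (h.parent huv hv))

theorem IsInitial.join {t b : BiHamTerm I} (h : IsInitial T r t) (hT : T.IsTreeOn A) (hr : r ∈ A)
    (hstar : T.Star r) (hb : T.Out r 1 t.last b.top) (hbn : b.leaves.Nodup) (hbt : IsNormalTree b)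
    (hbb : IsBlock b) (hbs : b.support = T.part r b.top)
    (hbg : b.graph = (T.remainder r).restrict (T.part r b.top)) :
    IsInitial T r (BiHamTerm.join t b) := by
  have hO := hT.isArborescence hr
  have hspine : T.IsSpine r b.top := ⟨t.top, h.top_mem, TransGen.tail' h.last_mem hb⟩
  have hbl : ∀ {x}, x ∈ b.leaves ↔ x ∈ T.part r b.top := fun {x} => by rw [← hbs, mem_support]
  have hmem : ∀ {x}, x ∈ (BiHamTerm.join t b).leaves ↔ x ∈ t.leaves ∨ x ∈ b.leaves := by simp
  have hdisj : ∀ x ∈ t.leaves, x ∉ b.leaves := by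
    intro x hx hxb
    have hreach := hT.reach_of_mem_part hr hspine (hbl.1 hxb)
    have : ∀ y, ReflTransGen (fun x y => ∃ c, T.RemainderOut r c x y) b.top y → y ∈ t.leaves →
        b.top ∈ t.leaves := by
      intro y hy
      induction hy with
      | refl => exact id
      | tail _ hyz ih =>
        obtain ⟨c, hyz⟩ := hyz
        exact fun hz => ih (h.parent hyz.1 hz)
    exact h.last_out hb (this x hreach hx)
  refine ⟨.join t b h.tree hbb hbt.1 hbt.2, ?_, h.hd_eq, ?_, h.top_mem,
    ReflTransGen.tail h.last_mem hb, ?_, ?_, ?_, ?_⟩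
  · exact Multiset.nodup_add.2 ⟨h.nodup, hbn, Multiset.disjoint_left.2 fun {x} => hdisj x⟩
  · have key : ∀ {c u v}, orient true (BiHamTerm.join t b) c u v → (T c).Adj u v := by
      intro c u v huv
      rw [orient_join] at huv
      rcases huv with huv | huv | ⟨rfl, rfl, rfl⟩
      · exact h.adj ((h.tree.adj_graph h.nodup true).2 (.inl huv))
      · have := (hbt.1.adj_graph hbn false).2 (.inl huv)
        rw [hbg] at this
        exact (remainder_adj.1 this.1).1
      · exact hb.1
    rintro c u v ⟨-, huv | huv⟩
    · exact key huv
    · exact (key huv).symm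
  · intro c u v huv hu
    rcases hmem.1 hu with hu | hu
    · rcases h.closed huv hu with hv | ⟨rfl, rfl⟩ | ⟨rfl, rfl⟩
      · exact .inl (hmem.2 (.inl hv))
      · exact .inl (hmem.2 (.inr (hstar _ _ _ _ hb huv ▸ b.top_mem)))
      · exact .inr (.inr ⟨rfl, rfl⟩)
    · by_cases hc : c = 1 ∧ u = b.top
      · exact .inr (.inl hc)
      · refine .inl (hmem.2 (.inr (hbl.2 ?_)))
        have hup := hbl.1 hu
        exact hT.mem_part_of_remainderOut hr hup
          (hT.remainderOut_of_mem_part hr hspine hup huv fun h1 h2 => hc ⟨h1, h2⟩)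
  · intro c u v huv hv
    rcases hmem.1 hv with hv | hv
    · exact hmem.2 (.inl (h.parent huv hv))
    · rcases ReflTransGen.cases_tail (hT.reach_of_mem_part hr hspine (hbl.1 hv)) with
        rfl | ⟨p, hp, c', hpv⟩
      · exact hmem.2 (.inl ((hO.parent huv hb).2 ▸ t.last_mem))
      · obtain ⟨-, rfl⟩ := hO.parent huv hpv.1
        refine hmem.2 (.inr (hbl.2 ?_))
        have : ∀ y, ReflTransGen (fun x y => ∃ c, T.RemainderOut r c x y) b.top y →
            y ∈ T.part r b.top := by
          intro y hy
          induction hy with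
          | refl => exact SimpleGraph.Reachable.refl _
          | tail _ hyz ih =>
            obtain ⟨c, hyz⟩ := hyz
            exact hT.mem_part_of_remainderOut hr ih hyz
        exact this _ hp
  · intro v hv hvl
    have hv' : T.Out r 1 b.top v := hv
    rcases hmem.1 hvl with hvl | hvl
    · exact hdisj _ (h.parent hv' hvl) b.top_mem
    · have : v = b.top := hT.eq_of_mem_part hr hspine (hbl.1 hvl)
        ⟨t.top, h.top_mem, (TransGen.tail' h.last_mem hb).tail hv'⟩
      exact hO.ne hv' this.symm
  · intro v hv hvl
    have hv' : T.Out r 0 t.top v := hv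
    rcases hmem.1 hvl with hvl | hvl
    · exact h.top_out hv' hvl
    · exact hT.notMem_chain_of_mem_part hr hspine (hbl.1 hvl) (ReflTransGen.tail h.top_mem hv')

/-- An initial part without outgoing edges is everything. -/
theorem IsInitial.eq {t : BiHamTerm I} (h : IsInitial T r t) (hT : T.IsTreeOn A) (hr : r ∈ A)
    (hlast : ∀ v, ¬ T.Out r 1 t.last v) (htop : ∀ v, ¬ T.Out r 0 t.top v) :
    t.support = A ∧ t.graph = T := by
  have hO := hT.isArborescence hr
  have hA := h.tree.isArborescence h.nodup true
  have hsupp : t.support = A := by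
    ext x
    constructor
    · intro hx
      rcases ReflTransGen.cases_tail (hA.reach hx) with rfl | ⟨p, -, c, hpx⟩
      · exact (show t.root true = r from h.hd_eq) ▸ hr
      · exact (hT.2.1 p x (adj_total.2
          ⟨c, h.adj ((h.tree.adj_graph h.nodup true).2 (.inl hpx))⟩)).2
    · intro hx
      have hreach := hO.reach hx
      clear hx
      induction hreach with
      | refl => exact h.hd_eq ▸ t.hd_mem
      | tail _ huv ih =>
        obtain ⟨c, huv⟩ := huv
        rcases h.closed huv ih with hv | ⟨rfl, rfl⟩ | ⟨rfl, rfl⟩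
        · exact hv
        · exact absurd huv (hlast _)
        · exact absurd huv (htop _)
  refine ⟨hsupp, ext_adj fun c u v => ⟨h.adj, fun huv => ?_⟩⟩
  have hadj : T.total.Adj u v := adj_total.2 ⟨c, huv⟩
  obtain ⟨hu, hv⟩ := hT.2.1 u v hadj
  rw [← hsupp] at hu hv
  have hb := SimpleGraph.isAcyclic_iff_forall_adj_isBridge.1 hT.1.2 hadj
  rw [SimpleGraph.isBridge_iff] at hb
  -- an edge of `T` is a bridge, so a connected spanning subgraph contains it
  have hg : t.graph.total.Adj u v := by
    by_contra hne
    refine hb (((hA.reachable hu).symm.trans (hA.reachable hv)).mono ?_)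
    intro x y hxy
    rw [SimpleGraph.deleteEdges_adj]
    refine ⟨total_mono (fun c u v h' => h.adj h') hxy, fun he => hne ?_⟩
    rw [Set.mem_singleton_iff, Sym2.eq_iff] at he
    rcases he with ⟨rfl, rfl⟩ | ⟨rfl, rfl⟩
    · exact hxy
    · exact hxy.symm
  obtain ⟨c', hc'⟩ := adj_total.1 hg
  rwa [hT.1.eq_label huv (h.adj hc')]

/-- Every tree in `𝔗` is the tree of a normal monomial. The monomial is built from the root: as long
as the last vertex has an outgoing `y`-edge, the block of the component at its end is attached by
`{·, b}₂`; otherwise the next vertex `j` of the `x`-chain of the root is added by `{j, ·}₁`. -/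
theorem exists_of_isBasisTree [Fintype I] (h : IsBasisTree A T) :
    ∃ t, IsNormalTree t ∧ t.leaves.Nodup ∧ t.support = A ∧ t.graph = T := by
  induction h with
  | intro A T r hT root hstar hmax _ ih =>
    have hr := root.1
    have main : ∀ n (t : BiHamTerm I), IsInitial T r t → Fintype.card I ≤ t.leaves.card + n →
        ∃ t, IsInitial T r t ∧ (∀ v, ¬ T.Out r 1 t.last v) ∧ ∀ v, ¬ T.Out r 0 t.top v := by
      intro n
      induction n with
      | zero =>
        intro t ht hc
        have hall : ∀ x, x ∈ t.leaves := by
          intro x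
          have h1 : (⟨t.leaves, ht.nodup⟩ : Finset I) = Finset.univ :=
            Finset.eq_univ_of_card _ (le_antisymm (Finset.card_le_univ _) hc)
          have h2 := Finset.mem_univ x
          rw [← h1] at h2
          exact h2
        exact ⟨t, ht, fun v hv => ht.last_out hv (hall v), fun v hv => ht.top_out hv (hall v)⟩
      | succ n ihn =>
        intro t ht hc
        by_cases hlast : ∃ v, T.Out r 1 t.last v
        · obtain ⟨v, hv⟩ := hlast
          have hspine : T.IsSpine r v := ⟨t.top, ht.top_mem, TransGen.tail' ht.last_mem hv⟩
          obtain ⟨b, hb, hbn, hbs, hbg⟩ := ih v hspine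
          obtain ⟨hbb, rfl⟩ :=
            isBlock_of_part hT hr hstar hspine (hmax v hspine) hb hbn hbs hbg
          refine ihn _ (ht.join hT hr hstar hv hbn hb hbb hbs hbg) ?_
          have := b.card_leaves_pos
          simp only [leaves_node, Multiset.card_add]
          omega
        · by_cases htop : ∃ v, T.Out r 0 t.top v
          · obtain ⟨j, hj⟩ := htop
            refine ihn _ (ht.ext hT hr hstar (not_exists.1 hlast) hj) ?_
            simp only [leaves_node, leaves_leaf, Multiset.card_add, Multiset.card_singleton]
            omega
          · exact ⟨t, ht, not_exists.1 hlast, not_exists.1 htop⟩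
    obtain ⟨t, ht, h1, h2⟩ := main (Fintype.card I) _ (isInitial_leaf hT hr) (by omega)
    obtain ⟨h3, h4⟩ := ht.eq hT hr h1 h2
    refine ⟨t, ⟨ht.tree, fun x hx => ?_⟩, ht.nodup, h3, h4⟩
    rw [ht.hd_eq]
    exact root.2 (h3 ▸ hx : x ∈ A)

/-- Every forest in `𝔉` is the forest of a normal monomial, whose factors are the components, that of
the largest vertex first. -/
theorem exists_of_mem_basisForests [Fintype I] [Nonempty I] {F : LabelledGraph I}
    (hF : F ∈ basisForests I) :
    ∃ f, IsForest f ∧ f.leaves = Finset.univ.val ∧ f.graph = F := by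
  classical
  have main : ∀ n (A : Set I), A.ncard ≤ n → A.Nonempty →
      (∀ u v, F.total.Adj u v → u ∈ A → v ∈ A) →
      ∃ f, IsForest f ∧ f.leaves.Nodup ∧ f.support = A ∧ f.graph = F.restrict A := by
    intro n
    induction n with
    | zero =>
      intro A hA hne
      exact absurd ((Set.ncard_eq_zero).1 (Nat.le_zero.1 hA)) hne.ne_empty
    | succ n ih =>
      intro A hA hne hcl
      obtain ⟨m, hm, hmax⟩ := Set.exists_max_image A id (Set.toFinite _) hne
      set C := F.total.connectedComponentMk m with hC
      have hCA : C.supp ⊆ A := by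
        intro x hx
        rw [SimpleGraph.ConnectedComponent.mem_supp_iff, hC,
          SimpleGraph.ConnectedComponent.eq] at hx
        replace hx := hx.symm
        rw [SimpleGraph.reachable_iff_reflTransGen] at hx
        induction hx with
        | refl => exact hm
        | tail _ h ih => exact hcl _ _ h ih
      have hmC : m ∈ C.supp := rfl
      have hCadj : ∀ u v, F.total.Adj u v → (u ∈ C.supp ↔ v ∈ C.supp) := fun u v h =>
        SimpleGraph.ConnectedComponent.mem_supp_congr_adj C h
      obtain ⟨t, ht, htn, hts, htg⟩ := exists_of_isBasisTree (hF.2 C)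
      have hmem : ∀ x, x ∈ t.leaves ↔ x ∈ C.supp := fun x => by rw [← hts, mem_support]
      by_cases hAC : A ⊆ C.supp
      · have hCeq := hCA.antisymm hAC
        exact ⟨t, .tree t ht, htn, hts.trans hCeq, hCeq ▸ htg⟩
      · obtain ⟨f, hf, hfn, hfs, hfg⟩ := ih (A \ C.supp) (by
          have := Set.ncard_lt_ncard
            ((Set.ssubset_iff_of_subset fun x (hx : x ∈ A \ C.supp) => hx.1).2
            ⟨m, hm, fun h => h.2 hmC⟩) (Set.toFinite _)
          omega) (Set.sdiff_nonempty.2 hAC) fun u v h hu =>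
            ⟨hcl u v h hu.1, fun hv => hu.2 ((hCadj u v h).2 hv)⟩
        have hmem' : ∀ x, x ∈ f.leaves ↔ x ∈ A \ C.supp := fun x => by rw [← hfs, mem_support]
        refine ⟨node prod t f, .prod t f ht hf fun x hx => ?_, ?_, ?_, ?_⟩
        · exact (hmax x ((hmem' x).1 hx).1).trans (ht.2 m ((hmem m).2 hmC))
        · exact Multiset.nodup_add.2 ⟨htn, hfn, Multiset.disjoint_left.2 fun {x} hx hx' =>
            ((hmem' x).1 hx').2 ((hmem x).1 hx)⟩
        · ext x
          rw [mem_support, leaves_node, Multiset.mem_add, hmem, hmem']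
          by_cases hx : x ∈ C.supp
          · simp [hx, hCA hx]
          · simp [hx]
        · refine ext_adj fun c u v => ?_
          rw [graph_prod_adj, htg, hfg, restrict_adj, restrict_adj, restrict_adj]
          constructor
          · rintro (⟨h, hu, hv⟩ | ⟨h, hu, hv⟩)
            · exact ⟨h, hCA hu, hCA hv⟩
            · exact ⟨h, hu.1, hv.1⟩
          · rintro ⟨h, hu, hv⟩
            have := hCadj u v (adj_total.2 ⟨c, h⟩)
            by_cases hu' : u ∈ C.supp
            · exact .inl ⟨h, hu', this.1 hu'⟩
            · exact .inr ⟨h, ⟨hu, hu'⟩, hv, fun h => hu' (this.2 h)⟩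
  obtain ⟨f, hf, hfn, hfs, hfg⟩ := main _ Set.univ le_rfl Set.univ_nonempty
    fun _ _ _ _ => Set.mem_univ _
  refine ⟨f, hf, ?_, ?_⟩
  · refine (Multiset.Nodup.ext hfn Finset.univ.nodup).2 fun x => ?_
    have : x ∈ f.support := hfs ▸ Set.mem_univ x
    exact ⟨fun _ => Finset.mem_univ x, fun _ => this⟩
  · rw [hfg]
    exact ext_adj fun c u v => ⟨fun h => h.1, fun h => ⟨h, Set.mem_univ _, Set.mem_univ _⟩⟩

end BiHamTerm

/-! ### The monomials of the basis forests -/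

namespace LabelledGraph

variable {I : Type*}

/-- The graph with a single edge, labelled `c`, between `u` and `v`. -/
def edge (c : Fin 2) (u v : I) : LabelledGraph I :=
  ofRel fun c' x y => c' = c ∧ x = u ∧ y = v

theorem edge_adj {c c' : Fin 2} {x y u v : I} (huv : u ≠ v) :
    (edge c u v c').Adj x y ↔ c' = c ∧ ((x = u ∧ y = v) ∨ (x = v ∧ y = u)) := by
  simp only [edge, ofRel, SimpleGraph.fromRel_adj]
  constructor
  · rintro ⟨-, ⟨rfl, rfl, rfl⟩ | ⟨rfl, rfl, rfl⟩⟩ <;> simp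
  · rintro ⟨rfl, ⟨rfl, rfl⟩ | ⟨rfl, rfl⟩⟩
    · simp [huv]
    · simp [huv.symm]

variable [LinearOrder I] [Fintype I]

theorem monomial_of_no_adj {F : LabelledGraph I} (h : ∀ c u v, ¬ (F c).Adj u v) :
    F.monomial = 1 := by
  classical
  rw [monomial, Finset.filter_false_of_mem fun g _ hg => h _ _ _ hg.2, Finset.prod_empty]

theorem monomial_union {F F₁ F₂ : LabelledGraph I}
    (h : ∀ c u v, (F c).Adj u v ↔ (F₁ c).Adj u v ∨ (F₂ c).Adj u v)
    (hd : ∀ c u v, (F₁ c).Adj u v → ¬ (F₂ c).Adj u v) :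
    F.monomial = F₁.monomial * F₂.monomial := by
  classical
  simp only [monomial]
  rw [← Finset.prod_union]
  · refine Finset.prod_congr ?_ fun _ _ => rfl
    ext g
    simp only [Finset.mem_filter, Finset.mem_union, Finset.mem_univ, true_and, h]
    tauto
  · refine Finset.disjoint_filter.2 fun g _ h1 h2 => hd _ _ _ h1.2 h2.2

theorem monomial_edge (c : Fin 2) {u v : I} (huv : u ≠ v) :
    (edge c u v).monomial = DoubleOS.genOrZero c u v ∨
      (edge c u v).monomial = -DoubleOS.genOrZero c u v := by
  classical
  have key : ∀ (x y : I) (hxy : x ≠ y), x < y → ((x = u ∧ y = v) ∨ (x = v ∧ y = u)) →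
      (edge c u v).monomial = DoubleOS.genOrZero c x y := by
    intro x y hxy hlt he
    rw [DoubleOS.genOrZero_of_ne c hxy, monomial,
      show Finset.univ.filter (fun g : DoubleOS.Gen I =>
        g.2.1.1 < g.2.1.2 ∧ (edge c u v g.1).Adj g.2.1.1 g.2.1.2) = {(c, ⟨(x, y), hxy⟩)} from ?_,
      Finset.prod_singleton]
    · rfl
    · ext ⟨c', ⟨a, b⟩, hab⟩
      simp only [Finset.mem_filter, Finset.mem_univ, true_and, Finset.mem_singleton, Prod.mk.injEq,
        Subtype.mk.injEq, edge, ofRel, SimpleGraph.fromRel_adj]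
      constructor
      · rintro ⟨h1, -, ⟨rfl, rfl, rfl⟩ | ⟨rfl, rfl, rfl⟩⟩
        · rcases he with ⟨rfl, rfl⟩ | ⟨rfl, rfl⟩
          · exact ⟨rfl, rfl, rfl⟩
          · exact absurd h1 hlt.asymm
        · rcases he with ⟨rfl, rfl⟩ | ⟨rfl, rfl⟩
          · exact absurd h1 hlt.asymm
          · exact ⟨rfl, rfl, rfl⟩
      · rintro ⟨rfl, rfl, rfl⟩
        refine ⟨hlt, hxy, ?_⟩
        rcases he with ⟨rfl, rfl⟩ | ⟨rfl, rfl⟩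
        · exact .inl ⟨rfl, rfl, rfl⟩
        · exact .inr ⟨rfl, rfl, rfl⟩
  rcases lt_or_gt_of_ne huv with h | h
  · exact .inl (key u v huv h (.inl ⟨rfl, rfl⟩))
  · right
    rw [key v u huv.symm h (.inr ⟨rfl, rfl⟩), DoubleOS.genOrZero_skew]

end LabelledGraph

theorem mul_eq_or_neg {R : Type*} [CommRing R] {a b a' b' : R} (h : a = a' ∨ a = -a')
    (h' : b = b' ∨ b = -b') : a * b = a' * b' ∨ a * b = -(a' * b') := by
  rcases h with rfl | rfl <;> rcases h' with rfl | rfl <;> simp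

namespace BiHamTerm

open LabelledGraph

variable {I : Type*} [LinearOrder I] [Fintype I]

theorem IsTree.monomial_graph {t : BiHamTerm I} (ht : IsTree t) (hn : t.leaves.Nodup) :
    t.graph.monomial = (DoubleOS.family I).mon t ∨
      t.graph.monomial = -(DoubleOS.family I).mon t := by
  induction ht with
  | leaf i =>
    left
    rw [OSFamily.mon_leaf]
    exact monomial_of_no_adj fun c u v h => by rcases h.2 with h | h <;> exact h
  | ext j t ht ih =>
    obtain ⟨hn1, hj⟩ := nodup_ext hn
    have hne : t.top ≠ j := fun h => hj (h ▸ t.top_mem)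
    rw [OSFamily.mon_ext, monomial_union (F₁ := edge 0 t.top j) (F₂ := t.graph)]
    · exact mul_eq_or_neg (monomial_edge 0 hne) (ih hn1)
    · intro c u v
      rw [(IsTree.ext j t ht).adj_graph hn true, ht.adj_graph hn1 true, edge_adj hne]
      simp only [orient_true_ext]
      grind
    · intro c u v h h'
      rw [edge_adj hne] at h
      rcases h with ⟨-, ⟨-, rfl⟩ | ⟨rfl, -⟩⟩
      · exact hj (graph_adj_mem h').2
      · exact hj (graph_adj_mem h').1
  | join t b ht hb hbt hbm iht ihb =>
    obtain ⟨hn1, hn2, hd⟩ := nodup_join hn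
    have hne : t.last ≠ b.top := fun h => hd _ t.last_mem (h ▸ b.top_mem)
    have hdd : ∀ c u v, (t.graph c).Adj u v → ¬ (b.graph c).Adj u v := fun c u v h h' =>
      hd _ (graph_adj_mem h).1 (graph_adj_mem h').1
    let F₁ : LabelledGraph I := fun c => edge 1 t.last b.top c ⊔ t.graph c
    have h1 : F₁.monomial = (edge 1 t.last b.top).monomial * t.graph.monomial := by
      refine monomial_union (fun c u v => Iff.rfl) fun c u v h h' => ?_
      rw [edge_adj hne] at h
      rcases h with ⟨-, ⟨-, rfl⟩ | ⟨rfl, -⟩⟩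
      · exact hd _ (graph_adj_mem h').2 b.top_mem
      · exact hd _ (graph_adj_mem h').1 b.top_mem
    rw [OSFamily.mon_join, monomial_union (F₁ := F₁) (F₂ := b.graph), h1]
    · exact mul_eq_or_neg (mul_eq_or_neg (monomial_edge 1 hne) (iht hn1)) (ihb hn2)
    · intro c u v
      have hF : (F₁ c).Adj u v ↔ (edge 1 t.last b.top c).Adj u v ∨ (t.graph c).Adj u v := Iff.rfl
      rw [hF, (IsTree.join t b ht hb hbt hbm).adj_graph hn true, ht.adj_graph hn1 true,
        hbt.adj_graph hn2 false, edge_adj hne]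
      simp only [orient_join]
      grind
    · intro c u v h h'
      rcases h with h | h
      · rw [edge_adj hne] at h
        rcases h with ⟨-, ⟨rfl, -⟩ | ⟨-, rfl⟩⟩
        · exact hd _ t.last_mem (graph_adj_mem h').1
        · exact hd _ t.last_mem (graph_adj_mem h').2
      · exact hdd c u v h h'

/-- Up to sign, the monomial of the forest of `f` is the monomial attached to `f`. -/
theorem IsForest.monomial_graph {f : BiHamTerm I} (hf : IsForest f) (hn : f.leaves.Nodup) :
    f.graph.monomial = (DoubleOS.family I).mon f ∨
      f.graph.monomial = -(DoubleOS.family I).mon f := by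
  induction hf with
  | tree t ht => exact ht.1.monomial_graph hn
  | prod t f ht _ _ ih =>
    have hd := notMem_of_nodup_add (d := t.leaves) (e := f.leaves) hn
    replace hn : (t.leaves + f.leaves).Nodup := hn
    rw [Multiset.nodup_add] at hn
    rw [OSFamily.mon_prod, monomial_union (fun c u v => graph_prod_adj) fun c u v h h' =>
      hd (graph_adj_mem h).1 (graph_adj_mem h').1]
    exact mul_eq_or_neg (ht.1.monomial_graph hn.1) (ih hn.2.1)

end BiHamTerm

namespace LabelledGraph

open BiHamTerm

variable (I : Type*) [LinearOrder I] [Fintype I] [Nonempty I]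

theorem span_monomial_basisForests :
    ⊤ ≤ Submodule.span ℚ (Set.range fun F : basisForests I => (F : LabelledGraph I).monomial) := by
  rw [← DoubleOS.forestSpan_eq_top I, OSFamily.forestSpan, Submodule.span_le]
  rintro _ ⟨f, hf, hl, rfl⟩
  have hn : f.leaves.Nodup := hl ▸ Finset.univ.nodup
  have hF : f.graph ∈ basisForests I := hf.graph_mem_basisForests hn fun i => by
    rw [hl]; exact Finset.mem_univ i
  have hmem : f.graph.monomial ∈
      Submodule.span ℚ (Set.range fun F : basisForests I => (F : LabelledGraph I).monomial) :=
    Submodule.subset_span ⟨⟨_, hF⟩, rfl⟩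
  rcases hf.monomial_graph hn with h | h
  · rwa [h] at hmem
  · rw [h] at hmem
    simpa using Submodule.neg_mem _ hmem

/-- The monomials of the basis forests are a basis: they span, and there are not more of them than
normal monomials, whose number is the dimension. -/
theorem exists_basis_monomial : ∃ b : Module.Basis (basisForests I) ℚ (DoubleOS I),
    ∀ F, b F = (F : LabelledGraph I).monomial := by
  classical
  obtain ⟨S, hS, hc⟩ := BiHamOperad.exists_basis_card I
  choose φ hφ using fun F : basisForests I => exists_of_mem_basisForests F.2
  have hinj : Function.Injective fun F => (⟨φ F, (hS _).2 ⟨(hφ F).1, (hφ F).2.1⟩⟩ : S) := by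
    intro F F' h
    have h1 : φ F = φ F' := congrArg Subtype.val h
    have h2 := (hφ F).2.2
    rw [h1, (hφ F').2.2] at h2
    exact Subtype.ext h2.symm
  have : Finite (basisForests I) := Finite.of_injective _ hinj
  have : Fintype (basisForests I) := Fintype.ofFinite _
  have hcard : Fintype.card (basisForests I) ≤ Module.finrank ℚ (DoubleOS I) := by
    rw [(BiHamOperad.finrank_doubleOS I).1, ← hc, ← Fintype.card_coe S]
    exact Fintype.card_le_of_injective _ hinj
  have hspan := span_monomial_basisForests I
  exact ⟨.mk (linearIndependent_of_top_le_span_of_card_le_finrank hspan hcard) hspan,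
    fun F => Module.Basis.mk_apply _ _ _⟩

end LabelledGraph

end

theorem mainTheorem2 (n : ℕ) (hn : 1 ≤ n) :
    Nonempty (DoubleOS (Fin n) ≃ₐ[ℚ] BiHamOperad.DualAlgebra (Fin n)) ∧
    Module.finrank ℚ (DoubleOS (Fin n)) = (n + 1) ^ (n - 1) ∧
    ∃ b : Module.Basis (LabelledGraph.basisForests (Fin n)) ℚ (DoubleOS (Fin n)),
      ∀ F, b F = LabelledGraph.monomial (F : LabelledGraph (Fin n)) := by
  have : Nonempty (Fin n) := ⟨⟨0, hn⟩⟩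
  obtain ⟨hdim, hinj⟩ := BiHamOperad.finrank_doubleOS (Fin n)
  refine ⟨⟨AlgEquiv.ofBijective (BiHamOperad.ofDoubleOS (Fin n))
    ⟨hinj, BiHamOperad.ofDoubleOS_surjective (Fin n)⟩⟩, ?_,
    LabelledGraph.exists_basis_monomial (Fin n)⟩
  rw [hdim, Fintype.card_fin]
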